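/- **Setting.** Let $d\in\{2,3\}$ and let $\mathcal O\subset\mathbb R^d$ be a nonempty bounded convex polygonal/polyhedral domain with boundary $\Gamma$. Let $F,G\in C^2(\mathbb R)$ be bounded from below by a positive constant, with $c(1+|z|^4)\le F(z)\le C(1+|z|^4)$, $|F'(z)|\le C(1+|z|^3)$, $|F''(z)|\le C(1+|z|^2)$ for some $c,C>0$, and $F=F_1+F_2$ with $F_1\in C^{2,\nu}(\mathbb R)$, $\nu\in(0,1)$, $F_2\in C^3(\mathbb R)$, $|F_2'''(z)|\le C(1+|z|^2)$; the same is assumed for $G$. Let $\varrho:\mathbb R\to\mathbb R$ be bounded and Lipschitz continuous, and let $\phi_0\in H^2(\mathcal O)$, identified with its continuous representative on $\overline{\mathcal O}$. Let $T>0$. **Discretization.** Let $\tau=T/N<1$, $N\in\mathbb N$, and let $\mathcal T_h$ be a conforming triangulation of $\overline{\mathcal O}$ into simplices of diameter at most $h$, each containing a ball of diameter $\kappa h$, with $\kappa>0$ fixed (quasiuniformity). The edges/faces of elements lying in $\Gamma$ form a triangulation of $\Gamma$, and each of them equals $\overline K\cap\Gamma$ for exactly one element $K$. Let $U_h^{\mathcal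 O}$ be the continuous, elementwise affine functions, $U_h^\Gamma$ their traces, $\mathcal I_h,\mathcal I_h^\Gamma$ the nodal interpolation operators, and $$E_h^{\mathcal O}(\zeta)=\int_{\mathcal O}\mathcal I_h\{F(\zeta)\}\,dx,\qquad E_h^\Gamma(\zeta)=\int_\Gamma\mathcal I_h^\Gamma\{G(\zeta)\}\,d\Gamma .$$ **Noise.** Let $(\mathfrak g_k)_{k\in\mathbb Z}$ be an orthonormal basis of $L^2(\mathcal O)$ and $\lambda_k\in\mathbb R$ with $\sum_k\lambda_k^2\|\mathfrak g_k\|_{W^{2,\infty}(\mathcal O)}^2\le\widetilde C$. On a probability space with a filtration $(\mathcal F_{t^n})_{n=0,\dots,N}$, $t^n=n\tau$, let $\xi^n=\sqrt\tau\sum_k\lambda_k\mathfrak g_k\xi_k^n$, $n=1,\dots,N$, be $\mathcal F_{t^n}$-measurable and independent of $\mathcal F_{t^m}$ for $m\le n-1$, where the $\xi^n_k$ are mutually independent symmetric real random variables with $\mathbb E\,\xi_k^n=0$, $\mathbb E|\xi_k^n|^2=1$ and $\mathbb E|\xi_k^n|^q\le C_q$ for all integers $q\ge2$. For a finite set $\mathbb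 Z_h\subset\mathbb Z$ put $\Phi_h(\zeta)f=\sum_{k\in\mathbb Z_h}\mathcal I_h\{\varrho(\zeta)(f,\mathfrak g_k)_{L^2(\mathcal O)}\mathfrak g_k\}$. **Scheme.** Let $\phi_h^0=\mathcal I_h\phi_0$, $r_h^0=\sqrt{E_h^{\mathcal O}(\phi_h^0)}$, $s_h^0=\sqrt{E_h^\Gamma(\phi_h^0)}$. A discrete solution consists of random variables $\phi_h^n,\mu_h^n\in U_h^{\mathcal O}$, $\theta_h^n\in U_h^\Gamma$, $r_h^n,s_h^n\in\mathbb R$, $\mathcal F_{t^n}$-measurable, $n=1,\dots,N$, such that almost surely, with $\phi'=\phi_h^{n-1}$, $X=\Phi_h(\phi_h^{n-1})\xi^n$, $E=E_h^{\mathcal O}(\phi')$, $E_\Gamma=E_h^\Gamma(\phi')$, $\delta=\phi_h^n-\phi_h^{n-1}$, for all $\psi,\eta\in U_h^{\mathcal O}$ and $\hat\psi\in U_h^\Gamma$ (traces on $\Gamma$ are not written) $$\int_{\mathcal O}\mathcal I_h\{\delta\psi\}\,dx+\tau\int_{\mathcal O}\nabla\mu_h^n\cdot\nabla\psi\,dx=\int_{\mathcal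 O}\mathcal I_h\{X\psi\}\,dx,$$ $$\int_\Gamma\mathcal I_h^\Gamma\{\delta\hat\psi\}\,d\Gamma+\tau\int_\Gamma\mathcal I_h^\Gamma\{\theta_h^n\hat\psi\}\,d\Gamma=\int_\Gamma\mathcal I_h^\Gamma\{X\hat\psi\}\,d\Gamma,$$ $$\int_{\mathcal O}\mathcal I_h\{\mu_h^n\eta\}\,dx+\int_\Gamma\mathcal I_h^\Gamma\{\theta_h^n\eta\}\,d\Gamma=\int_{\mathcal O}\nabla\phi_h^n\cdot\nabla\eta\,dx+\int_\Gamma\nabla_\Gamma\phi_h^n\cdot\nabla_\Gamma\eta\,d\Gamma+2r_h^nA_n(\eta)+2s_h^nB_n(\eta),$$ $$r_h^n-r_h^{n-1}=A_n(\delta),\qquad s_h^n-s_h^{n-1}=B_n(\delta),$$ where $$A_n(\eta)=\frac{1}{2\sqrt E}\int_{\mathcal O}\mathcal I_h\{F'(\phi')\eta\}\,dx-\frac1{8E^{3/2}}\int_{\mathcal O}\mathcal I_h\{F'(\phi')X\}\,dx\int_{\mathcal O}\mathcal I_h\{F'(\phi')\eta\}\,dx+\frac1{4\sqrt E}\int_{\mathcal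 O}\mathcal I_h\{F''(\phi')X\eta\}\,dx,$$ $$B_n(\eta)=\frac{1}{2\sqrt{E_\Gamma}}\int_\Gamma\mathcal I_h^\Gamma\{G'(\phi')\eta\}\,d\Gamma-\frac1{8E_\Gamma^{3/2}}\int_\Gamma\mathcal I_h^\Gamma\{G'(\phi')X\}\,d\Gamma\int_\Gamma\mathcal I_h^\Gamma\{G'(\phi')\eta\}\,d\Gamma+\frac1{4\sqrt{E_\Gamma}}\int_\Gamma\mathcal I_h^\Gamma\{G''(\phi')X\eta\}\,d\Gamma .$$ **Lemma.** For every real $p\ge1$ there is a constant $C>0$ that depends only on $p$, $T$, $\mathcal O$, $F$, $G$, $\varrho$, $\phi_0$, $\kappa$, $\widetilde C$ and $(C_q)_{q\ge2}$, in particular not on $h$, $\tau$, the triangulation or $\mathbb Z_h$, such that every discrete solution satisfies $$\begin{aligned} &\mathbb E\Big[\max_{0\le m\le N}\|\phi_h^m\|_{H^1(\mathcal O)}^{2p}\Big]+\mathbb E\Big[\max_{0\le m\le N}\|\phi_h^m\|_{H^1(\Gamma)}^{2p}\Big]+\mathbb E\Big[\max_{0\le m\le N}|r_h^m|^{2p}\Big]+\mathbb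 E\Big[\max_{0\le m\le N}|s_h^m|^{2p}\Big]\\ &+\mathbb E\Big[\Big(\sum_{n=1}^N\|\phi_h^n-\phi_h^{n-1}\|_{H^1(\mathcal O)}^2\Big)^p\Big]+\mathbb E\Big[\Big(\sum_{n=1}^N\|\phi_h^n-\phi_h^{n-1}\|_{H^1(\Gamma)}^2\Big)^p\Big]\\ &+\mathbb E\Big[\Big(\sum_{n=1}^N|r_h^n-r_h^{n-1}|^2\Big)^p\Big]+\mathbb E\Big[\Big(\sum_{n=1}^N|s_h^n-s_h^{n-1}|^2\Big)^p\Big]\\ &+\mathbb E\Big[\Big(\sum_{n=1}^N\tau\|\nabla\mu_h^n\|_{L^2(\mathcal O)}^2\Big)^p\Big]+\mathbb E\Big[\Big(\sum_{n=1}^N\tau\|\theta_h^n\|_{L^2(\Gamma)}^2\Big)^p\Big]\le C . \end{aligned}$$ -/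

import Mathlib

open MeasureTheory ProbabilityTheory
open scoped ENNReal

noncomputable section

namespace SAV

/-- Points of `ℝ^d` with the Euclidean norm. -/
abbrev Pt (d : ℕ) : Type := EuclideanSpace ℝ (Fin d)

/-! ### Domain and Sobolev regularity -/

/-- A nonempty, bounded, convex, open set whose closure is a polygon or polyhedron, that is, the
convex hull of finitely many points (so boundedness is part of it). -/
def IsConvexPolyhedralDomain {d : ℕ} (O : Set (Pt d)) : Prop :=
  IsOpen O ∧ O.Nonempty ∧ Convex ℝ O ∧ ∃ V : Finset (Pt d), closure O = convexHull ℝ (V : Set (Pt d))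

/-- `g` is the weak partial derivative `∂ᵢ f` on the open set `O`. -/
def HasWeakPartial {d : ℕ} (O : Set (Pt d)) (i : Fin d) (f g : Pt d → ℝ) : Prop :=
  LocallyIntegrableOn f O volume ∧ LocallyIntegrableOn g O volume ∧
    ∀ ψ : Pt d → ℝ, ContDiff ℝ (⊤ : ℕ∞) ψ → HasCompactSupport ψ → tsupport ψ ⊆ O →
      ∫ x in O, f x * fderiv ℝ ψ x (EuclideanSpace.single i (1 : ℝ)) = -∫ x in O, g x * ψ x

/-- `f ∈ H²(O)`: `f` and its weak derivatives up to order two are square integrable. -/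
def MemH2 {d : ℕ} (O : Set (Pt d)) (f : Pt d → ℝ) : Prop :=
  MemLp f 2 (volume.restrict O) ∧
    ∃ (Df : Fin d → Pt d → ℝ) (DDf : Fin d → Fin d → Pt d → ℝ),
      (∀ i, HasWeakPartial O i f (Df i) ∧ MemLp (Df i) 2 (volume.restrict O)) ∧
      ∀ i j, HasWeakPartial O j (Df i) (DDf i j) ∧ MemLp (DDf i j) 2 (volume.restrict O)

/-- The norm of `W^{2,∞}(O)` with values in `[0,∞]`: the sum of the `L^∞`-norms of all weak
derivatives up to order two, and `∞` if one of these does not exist. (Weak derivatives are unique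
almost everywhere, so the infimum is over equal values.) -/
def w2InfNorm {d : ℕ} (O : Set (Pt d)) (f : Pt d → ℝ) : ℝ≥0∞ :=
  ⨅ (Df : Fin d → Pt d → ℝ) (DDf : Fin d → Fin d → Pt d → ℝ)
    (_ : (∀ i, HasWeakPartial O i f (Df i)) ∧ ∀ i j, HasWeakPartial O j (Df i) (DDf i j)),
    eLpNorm f ∞ (volume.restrict O) + ∑ i, eLpNorm (Df i) ∞ (volume.restrict O)
      + ∑ i, ∑ j, eLpNorm (DDf i j) ∞ (volume.restrict O)

/-! ### Data -/

/-- The assumptions on a potential: `C²`, bounded from below by a positive constant, quartic growth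
together with the corresponding bounds for the first two derivatives, and the decomposition into
a `C^{2,ν}` part and a `C³` part with quadratically growing third derivative. -/
def IsPotential (F : ℝ → ℝ) : Prop :=
  ContDiff ℝ 2 F ∧
  (∃ γ > 0, ∀ z, γ ≤ F z) ∧
  (∃ c > 0, ∀ z, c * (1 + |z| ^ 4) ≤ F z) ∧
  (∃ C, ∀ z, F z ≤ C * (1 + |z| ^ 4) ∧ |deriv F z| ≤ C * (1 + |z| ^ 3) ∧
    |deriv (deriv F) z| ≤ C * (1 + |z| ^ 2)) ∧
  ∃ F₁ F₂ : ℝ → ℝ, (∀ z, F z = F₁ z + F₂ z) ∧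
    (ContDiff ℝ 2 F₁ ∧ ∃ ν : NNReal, 0 < ν ∧ ν < 1 ∧
      ∃ K : NNReal, HolderWith K ν (deriv (deriv F₁))) ∧
    (ContDiff ℝ 3 F₂ ∧ ∃ C, ∀ z, |deriv (deriv (deriv F₂)) z| ≤ C * (1 + |z| ^ 2))

/-- The noise coefficient is bounded and Lipschitz continuous. -/
def IsNoiseCoefficient (ϱ : ℝ → ℝ) : Prop :=
  (∃ B, ∀ z, |ϱ z| ≤ B) ∧ ∃ L : NNReal, LipschitzWith L ϱ

/-- `φ₀ ∈ H²(O)`, represented by its continuous version on the closure of `O`. -/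
def IsInitialDatum {d : ℕ} (O : Set (Pt d)) (φ₀ : Pt d → ℝ) : Prop :=
  ContinuousOn φ₀ (closure O) ∧ MemH2 O φ₀

/-! ### Triangulations and finite element spaces -/

/-- A conforming triangulation of `closure O`: a finite simplicial complex with underlying space
`closure O`, each of whose faces is a face of a `d`-dimensional simplex. -/
structure Mesh {d : ℕ} (O : Set (Pt d)) where
  cplx : Geometry.SimplicialComplex ℝ (Pt d)
  finite_faces : cplx.faces.Finite
  pure : ∀ s ∈ cplx.faces, ∃ t ∈ cplx.faces, s ⊆ t ∧ t.card = d + 1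
  space_eq : cplx.space = closure O

namespace Mesh

variable {d : ℕ} {O : Set (Pt d)} (M : Mesh O)

/-- The elements `K` of the triangulation, given by their `d + 1` vertices. -/
def elements : Finset (Finset (Pt d)) :=
  M.finite_faces.toFinset.filter (fun s => s.card = d + 1)

open Classical in
/-- The elements of the boundary triangulation of `Γ = ∂O`, given by their `d` vertices: the edges
(faces) of the elements that lie in `Γ`. -/
def bdryElements : Finset (Finset (Pt d)) :=
  M.finite_faces.toFinset.filter
    (fun s => s.card = d ∧ convexHull ℝ (s : Set (Pt d)) ⊆ frontier O)

open Classical in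
/-- The vertices of the triangulation. -/
def nodes : Finset (Pt d) := M.finite_faces.toFinset.biUnion id

open Classical in
/-- The vertices of the boundary triangulation. -/
def bdryNodes : Finset (Pt d) := M.nodes.filter (fun v => v ∈ frontier O)

/-- Quasiuniformity (Brenner, Scott) with parameter `κ`: every element has diameter at most `h` and
contains a ball of diameter `κ h`. -/
def IsQuasiuniform (κ h : ℝ) : Prop :=
  ∀ s ∈ M.elements, Metric.diam (convexHull ℝ (s : Set (Pt d))) ≤ h ∧
    ∃ c : Pt d, Metric.ball c (κ * h / 2) ⊆ convexHull ℝ (s : Set (Pt d))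

/-- The boundary elements cover `Γ`, and each of them is the intersection of `Γ` with exactly one
element. (Diameter bound and quasiuniformity of the boundary elements are
inherited from the elements.) -/
def IsBdryCompatible : Prop :=
  frontier O = (⋃ s ∈ M.bdryElements, convexHull ℝ (s : Set (Pt d))) ∧
    ∀ s ∈ M.bdryElements, ∃! t, t ∈ M.elements ∧
      convexHull ℝ (s : Set (Pt d)) = convexHull ℝ (t : Set (Pt d)) ∩ frontier O

/-- `w` are the barycentric coordinates of `x` in some simplex of the complex (extended by zero to
points that are not vertices of that simplex). They do not depend on the simplex. -/
def IsBary (x : Pt d) (w : Pt d → ℝ) : Prop :=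
  ∃ s ∈ M.cplx.faces, (∀ y, 0 ≤ w y) ∧ (∀ y, y ∉ s → w y = 0) ∧
    ∑ y ∈ s, w y = 1 ∧ ∑ y ∈ s, w y • y = x

open Classical in
/-- The nodal basis function of the vertex `v`: its value at `x` is the barycentric coordinate of
`x` with respect to `v`. -/
def hat (v x : Pt d) : ℝ := if hx : ∃ w, M.IsBary x w then hx.choose v else 0

/-- The nodal interpolation operator `I_h`. -/
def interp (a : Pt d → ℝ) : Pt d → ℝ := fun x => ∑ v ∈ M.nodes, a v * M.hat v x

/-- The nodal interpolation operator `I_h^Γ` on the boundary. -/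
def interpBdry (a : Pt d → ℝ) : Pt d → ℝ := fun x => ∑ v ∈ M.bdryNodes, a v * M.hat v x

/-- `u ∈ U_h^O`: continuous on the closure of `O` and affine on every element. Only the values on
the closure of `O` matter. -/
def MemU (u : Pt d → ℝ) : Prop :=
  ContinuousOn u (closure O) ∧
    ∀ s ∈ M.elements, ∃ A : Pt d →ᵃ[ℝ] ℝ, Set.EqOn u A (convexHull ℝ (s : Set (Pt d)))

/-- `v ∈ U_h^Γ`: `v` is on `Γ` the trace of a function of `U_h^O`. -/
def MemUBdry (v : Pt d → ℝ) : Prop := ∃ u, M.MemU u ∧ Set.EqOn v u (frontier O)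

end Mesh

/-! ### Integrals, gradients, norms -/

/-- The surface measure on `Γ = ∂O`. -/
def surf {d : ℕ} (O : Set (Pt d)) : Measure (Pt d) :=
  (Measure.euclideanHausdorffMeasure (d - 1)).restrict (frontier O)

/-- `∫_O ∇u · ∇v dx`; piecewise affine continuous functions are differentiable almost everywhere,
and their gradient is their weak gradient. -/
def dirichlet {d : ℕ} (O : Set (Pt d)) (u v : Pt d → ℝ) : ℝ :=
  ∫ x in O, inner ℝ (gradient u x) (gradient v x)

open Classical in
/-- The tangential gradient on the flat boundary piece spanned by `s` of a function `u` that is affine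
there: the vector `q` parallel to the piece with `u y - u x = q · (y - x)`. -/
def tangentialGrad {d : ℕ} (s : Finset (Pt d)) (u : Pt d → ℝ) : Pt d :=
  if hq : ∃ q ∈ vectorSpan ℝ (s : Set (Pt d)),
      ∀ x ∈ convexHull ℝ (s : Set (Pt d)), ∀ y ∈ convexHull ℝ (s : Set (Pt d)),
        u y - u x = inner ℝ q (y - x)
  then hq.choose else 0

/-- `‖u‖_{H¹(O)}`. -/
def normH1 {d : ℕ} (O : Set (Pt d)) (u : Pt d → ℝ) : ℝ :=
  Real.sqrt ((∫ x in O, u x ^ 2) + dirichlet O u u)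

namespace Mesh

variable {d : ℕ} {O : Set (Pt d)} (M : Mesh O)

/-- `∫_O I_h{a} dx`. -/
def intI (a : Pt d → ℝ) : ℝ := ∫ x in O, M.interp a x

/-- `∫_Γ I_h^Γ{a} dΓ`. -/
def intIBdry (a : Pt d → ℝ) : ℝ := ∫ x, M.interpBdry a x ∂(surf O)

/-- `∫_Γ ∇_Γ u · ∇_Γ v dΓ` for `u, v` in the finite element space, as the sum of the integrals over
the boundary elements. -/
def dirichletBdry (u v : Pt d → ℝ) : ℝ :=
  ∑ s ∈ M.bdryElements, ∫ _x in convexHull ℝ (s : Set (Pt d)),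
    inner ℝ (tangentialGrad s u) (tangentialGrad s v) ∂(surf O)

/-- `‖u‖_{H¹(Γ)}` of the trace of a finite element function `u`. -/
def normH1Bdry (u : Pt d → ℝ) : ℝ :=
  Real.sqrt ((∫ x, u x ^ 2 ∂(surf O)) + M.dirichletBdry u u)

/-- The discrete bulk energy `∫_O I_h{F(ζ)} dx`. -/
def energy (F : ℝ → ℝ) (ζ : Pt d → ℝ) : ℝ := M.intI (fun x => F (ζ x))

/-- The discrete surface energy `∫_Γ I_h^Γ{G(ζ)} dΓ`. -/
def energyBdry (G : ℝ → ℝ) (ζ : Pt d → ℝ) : ℝ := M.intIBdry (fun x => G (ζ x))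

/-- The discrete noise operator
`Φ_h(ζ) f = ∑_{k ∈ Z} I_h{ϱ(ζ) (f, g_k)_{L²(O)} g_k}`; the `L²` functions `e k` are the basis
vectors, and `g k` are the representatives that enter the nodal values. -/
def noiseOp (ϱ : ℝ → ℝ) (e : HilbertBasis ℤ ℝ (Lp ℝ 2 (volume.restrict O))) (g : ℤ → Pt d → ℝ)
    (Z : Finset ℤ) (ζ : Pt d → ℝ) (f : Lp ℝ 2 (volume.restrict O)) : Pt d → ℝ :=
  fun x => ∑ k ∈ Z, M.interp (fun y => ϱ (ζ y) * inner ℝ f (e k) * g k y) x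

/-- One step of the augmented SAV scheme: from the old values `φ', r', s'` and the noise term
`X = Φ_h(φ') ξ` to the new values `φ, μ, θ, r, s`. -/
structure SchemeStep (F G : ℝ → ℝ) (τ : ℝ) (φ' : Pt d → ℝ) (r' s' : ℝ) (X : Pt d → ℝ)
    (φ μ θ : Pt d → ℝ) (r s : ℝ) : Prop where
  eq_phi : ∀ ψ, M.MemU ψ →
    M.intI (fun x => (φ x - φ' x) * ψ x) + τ * dirichlet O μ ψ = M.intI (fun x => X x * ψ x)
  eq_phi_bdry : ∀ ψ, M.MemUBdry ψ →
    M.intIBdry (fun x => (φ x - φ' x) * ψ x) + τ * M.intIBdry (fun x => θ x * ψ x)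
      = M.intIBdry (fun x => X x * ψ x)
  eq_pot : ∀ η, M.MemU η →
    M.intI (fun x => μ x * η x) + M.intIBdry (fun x => θ x * η x)
      = dirichlet O φ η + M.dirichletBdry φ η
        + (r / Real.sqrt (M.energy F φ') * M.intI (fun x => deriv F (φ' x) * η x)
          - r / (4 * M.energy F φ' ^ (3 / 2 : ℝ)) * M.intI (fun x => deriv F (φ' x) * X x)
              * M.intI (fun x => deriv F (φ' x) * η x)
          + r / (2 * Real.sqrt (M.energy F φ'))
              * M.intI (fun x => deriv (deriv F) (φ' x) * X x * η x))
        + (s / Real.sqrt (M.energyBdry G φ') * M.intIBdry (fun x => deriv G (φ' x) * η x)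
          - s / (4 * M.energyBdry G φ' ^ (3 / 2 : ℝ)) * M.intIBdry (fun x => deriv G (φ' x) * X x)
              * M.intIBdry (fun x => deriv G (φ' x) * η x)
          + s / (2 * Real.sqrt (M.energyBdry G φ'))
              * M.intIBdry (fun x => deriv (deriv G) (φ' x) * X x * η x))
  eq_r : r - r' =
    1 / (2 * Real.sqrt (M.energy F φ')) * M.intI (fun x => deriv F (φ' x) * (φ x - φ' x))
      - 1 / (8 * M.energy F φ' ^ (3 / 2 : ℝ)) * M.intI (fun x => deriv F (φ' x) * X x)
          * M.intI (fun x => deriv F (φ' x) * (φ x - φ' x))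
      + 1 / (4 * Real.sqrt (M.energy F φ'))
          * M.intI (fun x => deriv (deriv F) (φ' x) * X x * (φ x - φ' x))
  eq_s : s - s' =
    1 / (2 * Real.sqrt (M.energyBdry G φ')) * M.intIBdry (fun x => deriv G (φ' x) * (φ x - φ' x))
      - 1 / (8 * M.energyBdry G φ' ^ (3 / 2 : ℝ)) * M.intIBdry (fun x => deriv G (φ' x) * X x)
          * M.intIBdry (fun x => deriv G (φ' x) * (φ x - φ' x))
      + 1 / (4 * Real.sqrt (M.energyBdry G φ'))
          * M.intIBdry (fun x => deriv (deriv G) (φ' x) * X x * (φ x - φ' x))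

end Mesh

/-! ### Noise and discrete solutions -/

/-- The colored basis: `g k` represents the orthonormal basis vector `e k` of `L²(O)`, is the
continuous representative on the closure of `O` whenever the mode `k` is active, and
`∑ λ_k² ‖g_k‖²_{W^{2,∞}(O)} ≤ C`. -/
structure IsColored {d : ℕ} (O : Set (Pt d)) (C : ℝ)
    (e : HilbertBasis ℤ ℝ (Lp ℝ 2 (volume.restrict O))) (g : ℤ → Pt d → ℝ) (lam : ℤ → ℝ) :
    Prop where
  repr : ∀ k, (e k : Pt d → ℝ) =ᵐ[volume.restrict O] g k
  cont : ∀ k, lam k ≠ 0 → ContinuousOn (g k) (closure O)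
  color : ∑' k, ENNReal.ofReal (lam k ^ 2) * w2InfNorm O (g k) ^ 2 ≤ ENNReal.ofReal C

/-- The `L²(O)`-valued increments `ξ 1, …, ξ N`: `ξ n` is measurable with respect to `𝓕 n`,
independent of `𝓕 m` for `m ≤ n - 1`, and equal to `√τ ∑_k λ_k g_k b n k` with mutually independent
symmetric random variables `b n k` of mean zero and variance one whose `q`-th absolute moments are
at most `Cmom q`. The time `n τ` corresponds to the index `n` of the filtration. -/
structure IsNoise {d : ℕ} {O : Set (Pt d)} {Ω : Type*} [mΩ : MeasurableSpace Ω] (P : Measure Ω)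
    (e : HilbertBasis ℤ ℝ (Lp ℝ 2 (volume.restrict O))) (lam : ℤ → ℝ) (Cmom : ℕ → ℝ)
    (τ : ℝ) (N : ℕ) (𝓕 : Filtration ℕ mΩ) (ξ : ℕ → Ω → Lp ℝ 2 (volume.restrict O)) : Prop where
  adapted : ∀ n, 1 ≤ n → n ≤ N → StronglyMeasurable[𝓕 n] (ξ n)
  indep : ∀ n, 1 ≤ n → n ≤ N → ∀ m, m ≤ n - 1 →
    Indep (MeasurableSpace.comap (ξ n) (borel _)) (𝓕 m) P
  expansion : ∃ b : ℕ → ℤ → Ω → ℝ,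
    (∀ n k, Measurable (b n k)) ∧
    iIndepFun (fun (q : {n : ℕ // 1 ≤ n ∧ n ≤ N} × ℤ) => b q.1 q.2) P ∧
    (∀ n, 1 ≤ n → n ≤ N → ∀ k,
      IdentDistrib (b n k) (fun ω => -b n k ω) P P ∧
      ∫ ω, b n k ω ∂P = 0 ∧ ∫ ω, b n k ω ^ 2 ∂P = 1 ∧
      ∀ q : ℕ, 2 ≤ q → Integrable (fun ω => |b n k ω| ^ q) P ∧
        ∫ ω, |b n k ω| ^ q ∂P ≤ Cmom q) ∧
    ∀ n, 1 ≤ n → n ≤ N → ∀ᵐ ω ∂P,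
      HasSum (fun k => (Real.sqrt τ * lam k * b n k ω) • e k) (ξ n ω)

/-- A solution of the discrete scheme with initial data `I_h{φ₀}`: adapted random variables with
values in the finite element spaces that satisfy, pathwise, the scheme in each of the `N` steps. -/
structure IsDiscreteSolution {d : ℕ} {O : Set (Pt d)} (M : Mesh O) {Ω : Type*}
    [mΩ : MeasurableSpace Ω] (P : Measure Ω) (F G ϱ : ℝ → ℝ) (φ₀ : Pt d → ℝ)
    (e : HilbertBasis ℤ ℝ (Lp ℝ 2 (volume.restrict O))) (g : ℤ → Pt d → ℝ) (Z : Finset ℤ)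
    (τ : ℝ) (N : ℕ) (𝓕 : Filtration ℕ mΩ) (ξ : ℕ → Ω → Lp ℝ 2 (volume.restrict O))
    (φ μ θ : ℕ → Ω → Pt d → ℝ) (r s : ℕ → Ω → ℝ) : Prop where
  mem_phi : ∀ n, n ≤ N → ∀ ω, M.MemU (φ n ω)
  mem_mu : ∀ n, 1 ≤ n → n ≤ N → ∀ ω, M.MemU (μ n ω)
  mem_theta : ∀ n, 1 ≤ n → n ≤ N → ∀ ω, M.MemUBdry (θ n ω)
  meas_phi : ∀ n, n ≤ N → ∀ x ∈ closure O, Measurable[𝓕 n] (fun ω => φ n ω x)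
  meas_mu : ∀ n, 1 ≤ n → n ≤ N → ∀ x ∈ closure O, Measurable[𝓕 n] (fun ω => μ n ω x)
  meas_theta : ∀ n, 1 ≤ n → n ≤ N → ∀ x ∈ frontier O, Measurable[𝓕 n] (fun ω => θ n ω x)
  meas_r : ∀ n, n ≤ N → Measurable[𝓕 n] (r n)
  meas_s : ∀ n, n ≤ N → Measurable[𝓕 n] (s n)
  init_phi : ∀ ω, Set.EqOn (φ 0 ω) (M.interp φ₀) (closure O)
  init_r : ∀ ω, r 0 ω = Real.sqrt (M.energy F (φ 0 ω))
  init_s : ∀ ω, s 0 ω = Real.sqrt (M.energyBdry G (φ 0 ω))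
  step : ∀ n, n < N → ∀ᵐ ω ∂P,
    M.SchemeStep F G τ (φ n ω) (r n ω) (s n ω) (M.noiseOp ϱ e g Z (φ n ω) (ξ (n + 1) ω))
      (φ (n + 1) ω) (μ (n + 1) ω) (θ (n + 1) ω) (r (n + 1) ω) (s (n + 1) ω)

end SAV

end

/-! ### Barycentric coordinates and nodal interpolation on the mesh. -/

namespace SAV

namespace Mesh

variable {d : ℕ} {O : Set (Pt d)} (M : Mesh O)

/-! The core is a pathwise energy inequality. The evolution equations are tested with the potentials
`μ`, `θ` and, with weight 1/4, with `φ`; the potential equation is tested with the increment and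
with the noise `X`. Since the linear form in the update of `r` also occurs in the potential
equation, testing with the increment produces exactly `2 r (r - r')`, and similarly for `s`. This
gives (`Mesh.SchemeStep.energy_le`): new energy plus dissipation is at most `(1 + τ)` times the old
energy, plus a part `ell` that is linear in `X` with coefficients from the past, plus a remainder
`rem` made of squares of linear forms in `X` and of `τ⁻¹` times fourth powers of such forms. The
correction terms in the scheme are quadratic in `X` when evaluated at `X`. Young's inequality with
weight `τ` turns them into the quartic part of `rem`, which is of order `τ` because `X` is of order
`√τ`. The growth conditions on the potentials are rewritten as bounds by the potential itself
(`IsPotential.bounds`), so that every negative power of the discrete energy cancels.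

Let `V n` be the energy after `n` steps, enlarged by 1 and by all the dissipation so far
(`Mesh.pathEnergy`). The noise modes have nodal values and gradients controlled by their `W^{2,∞}`
norms (`exists_mode_bound`). Hence the linear part has mean zero and variance of order `τ V n ^ 2`,
and the remainder has `j`-th moments of order `(τ V n) ^ j`, by Khinchine's inequality and
Minkowski's inequality, uniformly in the number of nodes and modes. Expanding an even power then
gives, on every event of the past, that the moment of `V (n + 1) ^ q` is at most `1 + ρ τ` times
that of `V n ^ q` (`lintegral_step_le`). Independence enters through the product law: the past is
frozen and the noise is integrated out, with no conditional expectation.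

Such a sequence satisfies a weak maximal inequality with factor `(1 + ρ τ) ^ N ≤ exp (ρ T)`
(`mul_measure_exists_le`). Applied to the exponent `2 q` it yields an integrable tail for the
maximum of `V ^ q`, so a strong maximal inequality or a Burkholder estimate is not needed. All ten
quantities are bounded by the maximum of `V` up to powers and a factor 32.

It remains to bound the initial energy uniformly in the mesh, that is, the Dirichlet energies of the
interpolated `H²` datum in the domain and on the boundary (`exists_initial_dirichlet_le`). The datum
is contracted towards an interior point and mollified. For the smooth approximation, nodal
differences on an element are estimated by a Taylor formula averaged over the element; this uses `d
≤ 3`. On the boundary an estimate of the gradient in a layer of width `h` plays the role of the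
trace theorem. -/

lemma mem_elements {s : Finset (Pt d)} :
    s ∈ M.elements ↔ s ∈ M.cplx.faces ∧ s.card = d + 1 := by
  simp [elements]

lemma mem_bdryElements {s : Finset (Pt d)} :
    s ∈ M.bdryElements ↔
      s ∈ M.cplx.faces ∧ s.card = d ∧ convexHull ℝ (s : Set (Pt d)) ⊆ frontier O := by
  simp [bdryElements]

lemma mem_nodes {v : Pt d} : v ∈ M.nodes ↔ ∃ s ∈ M.cplx.faces, v ∈ s := by
  simp [nodes]

lemma mem_bdryNodes {v : Pt d} : v ∈ M.bdryNodes ↔ v ∈ M.nodes ∧ v ∈ frontier O := by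
  simp [bdryNodes]

lemma convexHull_subset_closure {s : Finset (Pt d)} (hs : s ∈ M.cplx.faces) :
    convexHull ℝ (s : Set (Pt d)) ⊆ closure O := by
  rw [← M.space_eq]; exact Geometry.SimplicialComplex.convexHull_subset_space hs

lemma exists_element_superset {s : Finset (Pt d)} (hs : s ∈ M.cplx.faces) :
    ∃ t ∈ M.elements, s ⊆ t := by
  obtain ⟨t, ht, hst, hc⟩ := M.pure s hs
  exact ⟨t, M.mem_elements.2 ⟨ht, hc⟩, hst⟩

lemma exists_element_of_mem {x : Pt d} (hx : x ∈ closure O) :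
    ∃ t ∈ M.elements, x ∈ convexHull ℝ (t : Set (Pt d)) := by
  rw [← M.space_eq, Geometry.SimplicialComplex.mem_space_iff] at hx
  obtain ⟨s, hs, hx⟩ := hx
  obtain ⟨t, ht, hst⟩ := M.exists_element_superset hs
  exact ⟨t, ht, convexHull_mono (by exact_mod_cast hst) hx⟩

lemma mem_closure_of_mem_nodes {v : Pt d} (hv : v ∈ M.nodes) : v ∈ closure O := by
  obtain ⟨s, hs, hv⟩ := M.mem_nodes.1 hv
  exact M.convexHull_subset_closure hs (subset_convexHull ℝ _ (by exact_mod_cast hv))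

lemma subset_nodes {s : Finset (Pt d)} (hs : s ∈ M.cplx.faces) : s ⊆ M.nodes :=
  fun _ hv => M.mem_nodes.2 ⟨s, hs, hv⟩

lemma closure_eq_iUnion :
    closure O = ⋃ t ∈ M.elements, convexHull ℝ (t : Set (Pt d)) := by
  ext x
  simp only [Set.mem_iUnion, exists_prop]
  refine ⟨fun hx => M.exists_element_of_mem hx, ?_⟩
  rintro ⟨t, ht, hx⟩
  exact M.convexHull_subset_closure (M.mem_elements.1 ht).1 hx

end Mesh

lemma affineIndependent_weights_unique {d : ℕ} {s : Finset (Pt d)}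
    (hs : AffineIndependent ℝ ((↑) : s → Pt d)) {w w' : Pt d → ℝ}
    (h1 : ∑ y ∈ s, w y = ∑ y ∈ s, w' y) (h2 : ∑ y ∈ s, w y • y = ∑ y ∈ s, w' y • y) :
    ∀ y ∈ s, w y = w' y := by
  intro y hy
  have := (affineIndependent_iff.1 hs) Finset.univ (fun i => w i - w' i) ?_ ?_ ⟨y, hy⟩
    (Finset.mem_univ _)
  · exact sub_eq_zero.1 this
  · rw [Finset.sum_coe_sort s (fun i => w i - w' i), Finset.sum_sub_distrib, h1, sub_self]
  · rw [Finset.sum_coe_sort s (fun i => (w i - w' i) • i)]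
    simp only [sub_smul, Finset.sum_sub_distrib, h2, sub_self]

namespace Mesh

variable {d : ℕ} {O : Set (Pt d)} (M : Mesh O)

lemma exists_isBary_of_mem_convexHull {s : Finset (Pt d)} (hs : s ∈ M.cplx.faces) {x : Pt d}
    (hx : x ∈ convexHull ℝ (s : Set (Pt d))) :
    ∃ w, M.IsBary x w ∧ (∀ y, y ∉ s → w y = 0) ∧ ∑ y ∈ s, w y = 1 ∧ ∑ y ∈ s, w y • y = x := by
  classical
  obtain ⟨w, hw0, hw1, hw2⟩ := Finset.mem_convexHull'.1 hx
  have e1 : ∑ y ∈ s, (if y ∈ s then w y else 0) = 1 := by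
    rw [← hw1]; exact Finset.sum_congr rfl fun y hy => by simp [hy]
  have e2 : ∑ y ∈ s, (if y ∈ s then w y else 0) • y = x := by
    rw [← hw2]; exact Finset.sum_congr rfl fun y hy => by simp [hy]
  refine ⟨fun y => if y ∈ s then w y else 0, ⟨s, hs, ?_, ?_, e1, e2⟩, ?_, e1, e2⟩
  · intro y; dsimp only; split_ifs with h
    · exact hw0 y h
    · exact le_rfl
  · intro y hy; simp [hy]
  · intro y hy; simp [hy]

lemma IsBary.mem_convexHull {x : Pt d} {s : Finset (Pt d)} {w : Pt d → ℝ} (h0 : ∀ y, 0 ≤ w y)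
    (h1 : ∑ y ∈ s, w y = 1) (h2 : ∑ y ∈ s, w y • y = x) :
    x ∈ convexHull ℝ (s : Set (Pt d)) :=
  Finset.mem_convexHull'.2 ⟨w, fun y _ => h0 y, h1, h2⟩

variable {M} in
-- Two simplices meet in the hull of their common vertices. Weights on those common vertices are
-- admissible for both simplices, and affine independence forces both given systems to agree with
-- them.
lemma IsBary.unique {x : Pt d} {w w' : Pt d → ℝ} (h : M.IsBary x w) (h' : M.IsBary x w') :
    w = w' := by
  classical
  obtain ⟨s, hs, h0, hz, h1, h2⟩ := h
  obtain ⟨s', hs', h0', hz', h1', h2'⟩ := h'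
  have hx : x ∈ convexHull ℝ ((s ∩ s' : Finset (Pt d)) : Set (Pt d)) := by
    have := M.cplx.inter_subset_convexHull hs hs'
      ⟨IsBary.mem_convexHull h0 h1 h2, IsBary.mem_convexHull h0' h1' h2'⟩
    simpa using this
  obtain ⟨w₂, hw0, hw1, hw2⟩ := Finset.mem_convexHull'.1 hx
  set u : Pt d → ℝ := fun y => if y ∈ s ∩ s' then w₂ y else 0 with hu
  have key : ∀ t : Finset (Pt d), s ∩ s' ⊆ t →
      (∑ y ∈ t, u y = 1 ∧ ∑ y ∈ t, u y • y = x) := by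
    intro t ht
    constructor
    · rw [← Finset.sum_subset ht, ← hw1]
      · exact Finset.sum_congr rfl fun y hy => by simp only [hu, hy, if_true]
      · intro y _ hy; simp only [hu, hy, if_false]
    · rw [← Finset.sum_subset ht, ← hw2]
      · exact Finset.sum_congr rfl fun y hy => by simp only [hu, hy, if_true]
      · intro y _ hy; simp only [hu, hy, if_false, zero_smul]
  obtain ⟨a1, a2⟩ := key s Finset.inter_subset_left
  obtain ⟨b1, b2⟩ := key s' Finset.inter_subset_right
  have A := affineIndependent_weights_unique (M.cplx.indep hs) (h1.trans a1.symm) (h2.trans a2.symm)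
  have B := affineIndependent_weights_unique (M.cplx.indep hs') (h1'.trans b1.symm)
    (h2'.trans b2.symm)
  have A' : w = u := by
    funext y
    by_cases hy : y ∈ s
    · exact A y hy
    · rw [hz y hy]; simp [hu, hy]
  have B' : w' = u := by
    funext y
    by_cases hy : y ∈ s'
    · exact B y hy
    · rw [hz' y hy]; simp [hu, hy]
  rw [A', B']

/-- By uniqueness the choice in the definition of `hat` is immaterial. -/
lemma hat_eq_of_isBary {x : Pt d} {w : Pt d → ℝ} (h : M.IsBary x w) (v : Pt d) :
    M.hat v x = w v := by
  have hx : ∃ w, M.IsBary x w := ⟨w, h⟩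
  simp only [hat, hx, dif_pos]
  rw [hx.choose_spec.unique h]

lemma hat_nonneg (v x : Pt d) : 0 ≤ M.hat v x := by
  by_cases hx : ∃ w, M.IsBary x w
  · obtain ⟨w, hw⟩ := hx
    rw [M.hat_eq_of_isBary hw]
    obtain ⟨s, hs, h0, -⟩ := hw
    exact h0 v
  · simp [hat, hx]

/-- On a face, interpolation only involves the vertices of this face. -/
lemma hat_face {s : Finset (Pt d)} (hs : s ∈ M.cplx.faces) {x : Pt d}
    (hx : x ∈ convexHull ℝ (s : Set (Pt d))) :
    (∀ v, v ∉ s → M.hat v x = 0) ∧ ∑ v ∈ s, M.hat v x = 1 ∧ ∑ v ∈ s, M.hat v x • v = x := by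
  obtain ⟨w, hw, h0, h1, h2⟩ := M.exists_isBary_of_mem_convexHull hs hx
  have : (fun v => M.hat v x) = w := funext fun v => M.hat_eq_of_isBary hw v
  refine ⟨fun v hv => by rw [M.hat_eq_of_isBary hw, h0 v hv], ?_, ?_⟩
  · simpa only [M.hat_eq_of_isBary hw] using h1
  · simpa only [M.hat_eq_of_isBary hw] using h2

lemma interp_face {s : Finset (Pt d)} (hs : s ∈ M.cplx.faces) {x : Pt d}
    (hx : x ∈ convexHull ℝ (s : Set (Pt d))) (a : Pt d → ℝ) :
    M.interp a x = ∑ v ∈ s, a v * M.hat v x := by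
  unfold interp
  rw [← Finset.sum_subset (M.subset_nodes hs)]
  intro v _ hv
  rw [(M.hat_face hs hx).1 v hv, mul_zero]

lemma hat_node {v w : Pt d} (hw : w ∈ M.nodes) [Decidable (v = w)] :
    M.hat v w = if v = w then 1 else 0 := by
  classical
  obtain ⟨s, hs, hws⟩ := M.mem_nodes.1 hw
  have : M.IsBary w (fun y => if y = w then 1 else 0) := by
    refine ⟨s, hs, fun y => ?_, fun y hy => ?_, ?_, ?_⟩
    · dsimp only; split_ifs <;> norm_num
    · have : y ≠ w := fun h => hy (h ▸ hws)
      simp [this]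
    · simp [hws]
    · simp [hws]
  rw [M.hat_eq_of_isBary this]
  congr

lemma interp_node (a : Pt d → ℝ) {w : Pt d} (hw : w ∈ M.nodes) : M.interp a w = a w := by
  classical
  simp [interp, M.hat_node hw, hw]

lemma sum_hat {x : Pt d} (hx : x ∈ closure O) : ∑ v ∈ M.nodes, M.hat v x = 1 := by
  obtain ⟨t, ht, hxt⟩ := M.exists_element_of_mem hx
  have := M.interp_face (M.mem_elements.1 ht).1 hxt (fun _ => 1)
  simp only [interp, one_mul] at this
  rw [this, (M.hat_face (M.mem_elements.1 ht).1 hxt).2.1]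

/-- A boundary point lies on a boundary element, all of whose vertices are boundary nodes; only
these have nonzero barycentric coordinates there. -/
lemma sum_hat_bdry (hM : M.IsBdryCompatible) {x : Pt d} (hx : x ∈ frontier O) :
    (∀ v, v ∈ M.nodes → v ∉ M.bdryNodes → M.hat v x = 0) ∧ ∑ v ∈ M.bdryNodes, M.hat v x = 1 := by
  have hx' := hx
  rw [hM.1] at hx'
  simp only [Set.mem_iUnion, exists_prop] at hx'
  obtain ⟨s, hs, hxs⟩ := hx'
  obtain ⟨hsf, -, hsb⟩ := M.mem_bdryElements.1 hs
  have h0 : ∀ v, v ∈ M.nodes → v ∉ M.bdryNodes → M.hat v x = 0 := by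
    intro v hv hvb
    refine (M.hat_face hsf hxs).1 v fun hvs => hvb (M.mem_bdryNodes.2 ⟨hv, ?_⟩)
    exact hsb (subset_convexHull ℝ _ (by exact_mod_cast hvs))
  refine ⟨h0, ?_⟩
  rw [← M.sum_hat (frontier_subset_closure hx)]
  refine Finset.sum_subset (fun v hv => (M.mem_bdryNodes.1 hv).1) fun v hv hvb => h0 v hv hvb

lemma interpBdry_eq (hM : M.IsBdryCompatible) (a : Pt d → ℝ) {x : Pt d} (hx : x ∈ frontier O) :
    M.interpBdry a x = M.interp a x := by
  unfold interp interpBdry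
  refine Finset.sum_subset (fun v hv => (M.mem_bdryNodes.1 hv).1) fun v hv hvb => ?_
  rw [(M.sum_hat_bdry hM hx).1 v hv hvb, mul_zero]

/-- The affine basis of the vertices of an element. -/
lemma element_affineSpan {t : Finset (Pt d)} (ht : t ∈ M.elements) :
    affineSpan ℝ (Set.range ((↑) : t → Pt d)) = ⊤ := by
  obtain ⟨hf, hc⟩ := M.mem_elements.1 ht
  rw [(M.cplx.indep hf).affineSpan_eq_top_iff_card_eq_finrank_add_one]
  simp [hc]

/-- On an element, the interpolant agrees with an affine map. -/
lemma exists_affine_interp {t : Finset (Pt d)} (ht : t ∈ M.elements) (a : Pt d → ℝ) :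
    ∃ A : Pt d →ᵃ[ℝ] ℝ, (∀ v ∈ t, A v = a v) ∧
      Set.EqOn (M.interp a) A (convexHull ℝ (t : Set (Pt d))) := by
  obtain ⟨hf, hc⟩ := M.mem_elements.1 ht
  let b : AffineBasis t ℝ (Pt d) := ⟨(↑), M.cplx.indep hf, M.element_affineSpan ht⟩
  let A : Pt d →ᵃ[ℝ] ℝ := ∑ v : t, a v • b.coord v
  have hA : ∀ x, A x = ∑ v : t, a v * b.coord v x := by
    intro x
    have : ∀ s : Finset t, (∑ v ∈ s, a v • b.coord v : Pt d →ᵃ[ℝ] ℝ) x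
        = ∑ v ∈ s, a v * b.coord v x := by
      classical
      intro s
      induction s using Finset.induction_on with
      | empty => simp
      | insert i s hi ih => rw [Finset.sum_insert hi, Finset.sum_insert hi, ← ih]; simp
    exact this _
  have hv : ∀ v ∈ t, A v = a v := by
    classical
    intro v hv
    rw [hA]
    have : v = b ⟨v, hv⟩ := rfl
    rw [this]
    simp only [AffineBasis.coord_apply]
    simp [b]
    rfl
  refine ⟨A, hv, fun x hx => ?_⟩
  obtain ⟨h0, h1, h2⟩ := M.hat_face hf hx
  rw [M.interp_face hf hx]
  have hx2 : x = t.affineCombination ℝ id (fun v => M.hat v x) := by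
    rw [Finset.affineCombination_eq_linear_combination _ _ _ h1]; exact h2.symm
  conv_rhs => rw [hx2, Finset.map_affineCombination _ _ _ h1,
    Finset.affineCombination_eq_linear_combination _ _ _ h1]
  refine Finset.sum_congr rfl fun v hv' => ?_
  simp [hv v hv', mul_comm]

/-- Gluing over a finite closed cover. No compatibility has to be checked, because `interp` is one
globally defined function that is affine on every element. -/
lemma continuousOn_interp (a : Pt d → ℝ) : ContinuousOn (M.interp a) (closure O) := by
  rw [M.closure_eq_iUnion]
  have : ⋃ t ∈ M.elements, convexHull ℝ (t : Set (Pt d))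
      = ⋃ t : M.elements, convexHull ℝ ((t : Finset (Pt d)) : Set (Pt d)) := by
    ext; simp
  rw [this]
  refine (locallyFinite_of_finite _).continuousOn_iUnion ?_ ?_
  · intro t
    exact (t.1.finite_toSet.isCompact_convexHull ℝ).isClosed
  · rintro ⟨t, ht⟩
    obtain ⟨A, -, hA⟩ := M.exists_affine_interp ht a
    exact (A.continuous_of_finiteDimensional.continuousOn).congr hA

lemma memU_interp (a : Pt d → ℝ) : M.MemU (M.interp a) := by
  refine ⟨M.continuousOn_interp a, fun t ht => ?_⟩
  obtain ⟨A, -, hA⟩ := M.exists_affine_interp ht a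
  exact ⟨A, hA⟩

variable {M} in
lemma MemU.eq_interp {u : Pt d → ℝ} (hu : M.MemU u) : Set.EqOn u (M.interp u) (closure O) := by
  intro x hx
  obtain ⟨t, ht, hxt⟩ := M.exists_element_of_mem hx
  obtain ⟨hf, hc⟩ := M.mem_elements.1 ht
  obtain ⟨A, hA⟩ := hu.2 t ht
  obtain ⟨h0, h1, h2⟩ := M.hat_face hf hxt
  rw [M.interp_face hf hxt, hA hxt]
  have hx2 : x = t.affineCombination ℝ id (fun v => M.hat v x) := by
    rw [Finset.affineCombination_eq_linear_combination _ _ _ h1]; exact h2.symm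
  conv_lhs => rw [hx2, Finset.map_affineCombination _ _ _ h1,
    Finset.affineCombination_eq_linear_combination _ _ _ h1]
  refine Finset.sum_congr rfl fun v hv' => ?_
  simp [hA (subset_convexHull ℝ _ (by exact_mod_cast hv') : v ∈ _), mul_comm]

variable {M} in
lemma MemU.add {u v : Pt d → ℝ} (hu : M.MemU u) (hv : M.MemU v) :
    M.MemU (fun x => u x + v x) := by
  refine ⟨hu.1.add hv.1, fun t ht => ?_⟩
  obtain ⟨A, hA⟩ := hu.2 t ht
  obtain ⟨B, hB⟩ := hv.2 t ht
  exact ⟨A + B, fun x hx => by simp [hA hx, hB hx]⟩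

variable {M} in
lemma MemU.smul {u : Pt d → ℝ} (c : ℝ) (hu : M.MemU u) : M.MemU (fun x => c * u x) := by
  refine ⟨continuousOn_const.mul hu.1, fun t ht => ?_⟩
  obtain ⟨A, hA⟩ := hu.2 t ht
  exact ⟨c • A, fun x hx => by simp [hA hx]⟩

variable {M} in
lemma MemU.sub {u v : Pt d → ℝ} (hu : M.MemU u) (hv : M.MemU v) :
    M.MemU (fun x => u x - v x) := by
  have := hu.add (hv.smul (-1))
  simpa [sub_eq_add_neg] using this

lemma memU_sum {ι : Type*} (s : Finset ι) (f : ι → Pt d → ℝ) (hf : ∀ i ∈ s, M.MemU (f i)) :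
    M.MemU (fun x => ∑ i ∈ s, f i x) := by
  classical
  induction s using Finset.induction_on with
  | empty =>
    refine ⟨by simpa using continuousOn_const, fun t ht => ⟨0, fun x _ => by simp⟩⟩
  | insert i s hi ih =>
    simp only [Finset.sum_insert hi]
    exact (hf i (by simp)).add (ih fun j hj => hf j (by simp [hj]))

end Mesh
end SAV

/-! ### Tangential gradients of functions that are affine on a simplex. -/

namespace SAV

/-- `u` is affine on the simplex spanned by `s`. -/
def AffOn {d : ℕ} (s : Finset (Pt d)) (u : Pt d → ℝ) : Prop :=
  ∃ A : Pt d →ᵃ[ℝ] ℝ, Set.EqOn u A (convexHull ℝ (s : Set (Pt d)))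

section TangentialGrad

variable {d : ℕ} {s : Finset (Pt d)} {u v : Pt d → ℝ}

lemma AffOn.add (hu : AffOn s u) (hv : AffOn s v) : AffOn s (fun x => u x + v x) := by
  obtain ⟨A, hA⟩ := hu
  obtain ⟨B, hB⟩ := hv
  exact ⟨A + B, fun x hx => by simp [hA hx, hB hx]⟩

lemma AffOn.smul (c : ℝ) (hu : AffOn s u) : AffOn s (fun x => c * u x) := by
  obtain ⟨A, hA⟩ := hu
  exact ⟨c • A, fun x hx => by simp [hA hx]⟩

/-- The Riesz representative of the linear part, projected orthogonally to the direction space of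
the simplex. -/
lemma AffOn.exists_grad (hu : AffOn s u) : ∃ q ∈ vectorSpan ℝ (s : Set (Pt d)),
    ∀ x ∈ convexHull ℝ (s : Set (Pt d)), ∀ y ∈ convexHull ℝ (s : Set (Pt d)),
      u y - u x = inner ℝ q (y - x) := by
  obtain ⟨A, hA⟩ := hu
  let g : Pt d := (InnerProductSpace.toDual ℝ (Pt d)).symm (LinearMap.toContinuousLinearMap A.linear)
  have hg : ∀ w, inner ℝ g w = A.linear w := fun w => by
    simp only [g, InnerProductSpace.toDual_symm_apply]; rfl
  refine ⟨(vectorSpan ℝ (s : Set (Pt d))).starProjection g, Submodule.coe_mem _, ?_⟩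
  intro x hx y hy
  have hyx : y - x ∈ vectorSpan ℝ (s : Set (Pt d)) := by
    have h1 := convexHull_subset_affineSpan (𝕜 := ℝ) (s : Set (Pt d)) hx
    have h2 := convexHull_subset_affineSpan (𝕜 := ℝ) (s : Set (Pt d)) hy
    have := AffineSubspace.vsub_mem_direction h2 h1
    rwa [direction_affineSpan] at this
  rw [Submodule.inner_starProjection_left_eq_right,
    Submodule.starProjection_eq_self_iff.2 hyx, hg, hA hx, hA hy]
  exact (A.linearMap_vsub y x).symm

lemma AffOn.tangentialGrad_spec (hu : AffOn s u) :
    tangentialGrad s u ∈ vectorSpan ℝ (s : Set (Pt d)) ∧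
    ∀ x ∈ convexHull ℝ (s : Set (Pt d)), ∀ y ∈ convexHull ℝ (s : Set (Pt d)),
      u y - u x = inner ℝ (tangentialGrad s u) (y - x) := by
  have h := hu.exists_grad
  simp only [tangentialGrad, h, dif_pos]
  exact h.choose_spec

/-- Uniqueness: vertex differences span the direction space, so the difference of two candidates
lies in that space and is orthogonal to it. Checking vertices only is what makes the linearity rules
below easy. -/
lemma AffOn.tangentialGrad_eq (hu : AffOn s u) {q : Pt d}
    (hq : q ∈ vectorSpan ℝ (s : Set (Pt d)))
    (h : ∀ x ∈ s, ∀ y ∈ s, u y - u x = inner ℝ q (y - x)) : tangentialGrad s u = q := by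
  obtain ⟨h1, h2⟩ := hu.tangentialGrad_spec
  have hz : tangentialGrad s u - q ∈ vectorSpan ℝ (s : Set (Pt d)) := Submodule.sub_mem _ h1 hq
  have key : ∀ w ∈ vectorSpan ℝ (s : Set (Pt d)), inner ℝ (tangentialGrad s u - q) w = 0 := by
    intro w hw
    rw [vectorSpan_def] at hw
    induction hw using Submodule.span_induction with
    | mem w hw =>
      obtain ⟨y, hy, x, hx, rfl⟩ := hw
      have hx' := subset_convexHull ℝ (s : Set (Pt d)) hx
      have hy' := subset_convexHull ℝ (s : Set (Pt d)) hy
      simp only [vsub_eq_sub]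
      rw [inner_sub_left, ← h2 x hx' y hy', ← h x (by exact_mod_cast hx) y (by exact_mod_cast hy),
        sub_self]
    | zero => simp
    | add w w' _ _ h h' => rw [inner_add_right, h, h', add_zero]
    | smul c w _ h => rw [inner_smul_right, h, mul_zero]
  exact sub_eq_zero.1 (inner_self_eq_zero.1 (key _ hz))

lemma tangentialGrad_add (hu : AffOn s u) (hv : AffOn s v) :
    tangentialGrad s (fun x => u x + v x) = tangentialGrad s u + tangentialGrad s v := by
  obtain ⟨h1, h2⟩ := hu.tangentialGrad_spec
  obtain ⟨h3, h4⟩ := hv.tangentialGrad_spec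
  refine (hu.add hv).tangentialGrad_eq (Submodule.add_mem _ h1 h3) fun x hx y hy => ?_
  have hx' := subset_convexHull ℝ (s : Set (Pt d)) hx
  have hy' := subset_convexHull ℝ (s : Set (Pt d)) hy
  rw [inner_add_left, ← h2 x hx' y hy', ← h4 x hx' y hy']
  ring

lemma tangentialGrad_smul (c : ℝ) (hu : AffOn s u) :
    tangentialGrad s (fun x => c * u x) = c • tangentialGrad s u := by
  obtain ⟨h1, h2⟩ := hu.tangentialGrad_spec
  refine (hu.smul c).tangentialGrad_eq (Submodule.smul_mem _ _ h1) fun x hx y hy => ?_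
  have hx' := subset_convexHull ℝ (s : Set (Pt d)) hx
  have hy' := subset_convexHull ℝ (s : Set (Pt d)) hy
  rw [inner_smul_left, ← h2 x hx' y hy']
  simp; ring

lemma affOn_zero : AffOn s (fun _ => (0 : ℝ)) := ⟨0, fun x _ => by simp⟩

lemma tangentialGrad_zero : tangentialGrad s (fun _ => (0 : ℝ)) = 0 :=
  affOn_zero.tangentialGrad_eq (Submodule.zero_mem _) fun x _ y _ => by simp

lemma affOn_sum {ι : Type*} (I : Finset ι) (c : ι → ℝ) (f : ι → Pt d → ℝ)
    (hf : ∀ i ∈ I, AffOn s (f i)) : AffOn s (fun x => ∑ i ∈ I, c i * f i x) ∧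
    tangentialGrad s (fun x => ∑ i ∈ I, c i * f i x) = ∑ i ∈ I, c i • tangentialGrad s (f i) := by
  classical
  induction I using Finset.induction_on with
  | empty => simpa using ⟨affOn_zero, tangentialGrad_zero⟩
  | insert i I hi ih =>
    obtain ⟨h1, h2⟩ := ih fun j hj => hf j (by simp [hj])
    have h3 := hf i (by simp)
    simp only [Finset.sum_insert hi]
    refine ⟨(h3.smul (c i)).add h1, ?_⟩
    rw [tangentialGrad_add (h3.smul (c i)) h1, h2, tangentialGrad_smul _ h3]

lemma AffOn.tangentialGrad_congr (hu : AffOn s u) (hv : AffOn s v) (h : ∀ x ∈ s, u x = v x) :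
    tangentialGrad s u = tangentialGrad s v := by
  obtain ⟨h1, h2⟩ := hv.tangentialGrad_spec
  refine hu.tangentialGrad_eq h1 fun x hx y hy => ?_
  rw [h x hx, h y hy]
  exact h2 x (subset_convexHull ℝ _ hx) y (subset_convexHull ℝ _ hy)

/-- The gradient of an affine function on a face of a simplex that contains a ball is bounded by
the oscillation of the function over the vertices of the face. -/
lemma AffOn.norm_tangentialGrad_le {s t : Finset (Pt d)} (hst : s ⊆ t) (hs : s.Nonempty)
    (hu : AffOn s u)
    (hext : ∀ a : Pt d → ℝ, ∃ A : Pt d →ᵃ[ℝ] ℝ, ∀ v ∈ t, A v = a v)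
    {c : Pt d} {ρ : ℝ} (hρ : 0 < ρ) (hball : Metric.ball c ρ ⊆ convexHull ℝ (t : Set (Pt d)))
    {a : ℝ} (ha : ∀ x ∈ s, ∀ y ∈ s, |u x - u y| ≤ a) :
    ‖tangentialGrad s u‖ * (2 * ρ) ≤ a := by
  classical
  obtain ⟨v₀, hv₀⟩ := hs
  have ha0 : 0 ≤ a := (abs_nonneg _).trans (ha v₀ hv₀ v₀ hv₀)
  -- Giving the remaining vertices the value at `v₀` does not increase the oscillation. Thus the
  -- ball inside the full simplex `t` can be used although `s` may be lower-dimensional.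
  obtain ⟨A, hA⟩ := hext (fun v => if v ∈ s then u v else u v₀)
  have hosc : ∀ x ∈ convexHull ℝ (t : Set (Pt d)), ∀ y ∈ convexHull ℝ (t : Set (Pt d)),
      A x - A y ≤ a := by
    have h0 : ∀ x ∈ t, ∀ y ∈ t, A x - A y ≤ a := by
      intro x hx y hy
      rw [hA x hx, hA y hy]
      split_ifs with h h' h'
      · exact (le_abs_self _).trans (ha _ h _ h')
      · exact (le_abs_self _).trans (ha _ h _ hv₀)
      · exact (le_abs_self _).trans (ha _ hv₀ _ h')
      · simpa using ha0
    have h1 : ∀ y ∈ t, ∀ x ∈ convexHull ℝ (t : Set (Pt d)), A x - A y ≤ a := by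
      intro y hy x hx
      have hc : Convex ℝ {x | A x - A y ≤ a} := by
        have e : {x | A x - A y ≤ a} = A ⁻¹' Set.Iic (a + A y) := by ext z; simp
        rw [e]
        exact (convex_Iic (a + A y)).affine_preimage A
      exact convexHull_min (fun x hx => h0 x (by exact_mod_cast hx) y hy) hc hx
    intro x hx y hy
    have hc : Convex ℝ {y | A x - A y ≤ a} := by
      have e : {y | A x - A y ≤ a} = A ⁻¹' Set.Ici (A x - a) := by
        ext z; simp only [Set.mem_ofPred_eq, Set.mem_preimage, Set.mem_Ici]
        constructor <;> intro h <;> linarith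
      rw [e]
      exact (convex_Ici (A x - a)).affine_preimage A
    exact convexHull_min (fun y hy => h1 y (by exact_mod_cast hy) x hx) hc hy
  obtain ⟨h1, h2⟩ := hu.tangentialGrad_spec
  set q := tangentialGrad s u with hq
  have hlin : ∀ w ∈ vectorSpan ℝ (s : Set (Pt d)), A.linear w = inner ℝ q w := by
    intro w hw
    rw [vectorSpan_def] at hw
    induction hw using Submodule.span_induction with
    | mem w hw =>
      obtain ⟨y, hy, x, hx, rfl⟩ := hw
      have hx' := subset_convexHull ℝ (s : Set (Pt d)) hx
      have hy' := subset_convexHull ℝ (s : Set (Pt d)) hy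
      have hx2 : x ∈ s := hx
      have hy2 : y ∈ s := hy
      simp only []
      rw [A.linearMap_vsub, vsub_eq_sub, vsub_eq_sub, ← h2 x hx' y hy', hA x (hst hx2),
        hA y (hst hy2)]
      simp [hx2, hy2]
    | zero => simp
    | add w w' _ _ h h' => rw [inner_add_right, map_add, h, h']
    | smul c w _ h => rw [inner_smul_right, map_smul, h, smul_eq_mul]
  rcases eq_or_ne q 0 with h0 | h0
  · simp [h0, ha0]
  have hqn : 0 < ‖q‖ := norm_pos_iff.2 h0
  by_contra! hlt
  have hB : 0 < ‖q‖ * (2 * ρ) := by positivity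
  -- The ball is open, so its radius is shrunk by a factor `r < 1` that still leaves `a < r * (‖q‖ *
  -- (2 * ρ))`. The points at distance `r * ρ` from the centre in the directions `± q` give the
  -- contradiction.
  obtain ⟨r, har, hr1⟩ := exists_between ((div_lt_one hB).2 hlt)
  have hr : 0 ≤ r := (div_nonneg ha0 hB.le).trans har.le
  rw [div_lt_iff₀ hB] at har
  have hmem : ∀ ε : ℝ, |ε| ≤ 1 → c + (ε * r * ρ / ‖q‖) • q ∈ convexHull ℝ (t : Set (Pt d)) := by
    intro ε hε
    refine hball ?_
    rw [Metric.mem_ball, dist_eq_norm, add_sub_cancel_left, norm_smul, Real.norm_eq_abs, abs_div,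
      abs_mul, abs_mul, abs_of_pos hqn, div_mul_cancel₀ _ hqn.ne', abs_of_pos hρ]
    have : |ε| * |r| < 1 := by
      rw [abs_of_nonneg hr]
      nlinarith [abs_nonneg ε]
    nlinarith
  have key := hosc _ (hmem 1 (by simp)) _ (hmem (-1) (by simp))
  have e : A (c + (1 * r * ρ / ‖q‖) • q) - A (c + (-1 * r * ρ / ‖q‖) • q)
      = A.linear ((2 * r * ρ / ‖q‖) • q) := by
    rw [← vsub_eq_sub, ← A.linearMap_vsub, vsub_eq_sub]
    congr 1
    rw [add_sub_add_left_eq_sub, ← sub_smul]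
    congr 1; ring
  rw [e, map_smul, hlin q h1, real_inner_self_eq_norm_sq, smul_eq_mul] at key
  have e2 : r * (‖q‖ * (2 * ρ)) = 2 * r * ρ / ‖q‖ * ‖q‖ ^ 2 := by field_simp
  linarith

end TangentialGrad
end SAV

/-! ### Integrals over the domain as sums over elements. -/

namespace SAV

/-- Near an interior point the function coincides with an affine one, whose slope is the chosen
tangential gradient. -/
lemma gradient_eq_tangentialGrad {d : ℕ} {t : Finset (Pt d)} {u : Pt d → ℝ} (hu : AffOn t u)
    {x : Pt d} (hx : x ∈ interior (convexHull ℝ (t : Set (Pt d)))) :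
    gradient u x = tangentialGrad t u := by
  obtain ⟨-, h2⟩ := hu.tangentialGrad_spec
  have hx' := interior_subset hx
  have : HasGradientAt u (tangentialGrad t u) x := by
    rw [hasGradientAt_iff_hasFDerivAt]
    have h3 : HasFDerivAt (fun y => u x + (InnerProductSpace.toDual ℝ (Pt d) (tangentialGrad t u))
        (y - x)) (InnerProductSpace.toDual ℝ (Pt d) (tangentialGrad t u)) x := by
      have h4 : HasFDerivAt (fun y : Pt d => y - x) (ContinuousLinearMap.id ℝ (Pt d)) x :=
        (hasFDerivAt_id x).sub_const x
      exact (((InnerProductSpace.toDual ℝ (Pt d) (tangentialGrad t u)).hasFDerivAt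
        (x := x - x)).comp (f := fun y : Pt d => y - x) x h4).const_add (u x)
    refine h3.congr_of_eventuallyEq ?_
    filter_upwards [mem_interior_iff_mem_nhds.1 hx] with y hy
    rw [InnerProductSpace.toDual_apply_apply, ← h2 x hx' y hy]
    ring
  exact this.gradient

namespace Mesh

variable {d : ℕ} {O : Set (Pt d)} (M : Mesh O)

variable {M} in
lemma MemU.affOn {u : Pt d → ℝ} (hu : M.MemU u) {s : Finset (Pt d)} (hs : s ∈ M.cplx.faces) :
    AffOn s u := by
  obtain ⟨t, ht, hst⟩ := M.exists_element_superset hs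
  obtain ⟨A, hA⟩ := hu.2 t ht
  exact ⟨A, hA.mono (convexHull_mono (by exact_mod_cast hst))⟩

lemma element_face {t : Finset (Pt d)} (ht : t ∈ M.elements) : t ∈ M.cplx.faces :=
  (M.mem_elements.1 ht).1

lemma bdryElement_face {t : Finset (Pt d)} (ht : t ∈ M.bdryElements) : t ∈ M.cplx.faces :=
  (M.mem_bdryElements.1 ht).1

lemma isCompact_simplex (s : Finset (Pt d)) : IsCompact (convexHull ℝ (s : Set (Pt d))) :=
  s.finite_toSet.isCompact_convexHull ℝ

lemma measurableSet_simplex (s : Finset (Pt d)) :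
    MeasurableSet (convexHull ℝ (s : Set (Pt d))) :=
  (isCompact_simplex s).isClosed.measurableSet

/-- Distinct elements overlap in a null set only. -/
lemma volume_inter_elements {s t : Finset (Pt d)} (hs : s ∈ M.elements) (ht : t ∈ M.elements)
    (hst : s ≠ t) :
    volume (convexHull ℝ (s : Set (Pt d)) ∩ convexHull ℝ (t : Set (Pt d))) = 0 := by
  classical
  have h1 : convexHull ℝ (s : Set (Pt d)) ∩ convexHull ℝ (t : Set (Pt d))
      ⊆ affineSpan ℝ ((s ∩ t : Finset (Pt d)) : Set (Pt d)) := by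
    refine (M.cplx.inter_subset_convexHull (M.element_face hs) (M.element_face ht)).trans ?_
    rw [Finset.coe_inter]
    exact convexHull_subset_affineSpan _
  -- If the common vertices spanned the whole space there would be `d + 1` of them, and the two
  -- elements would be equal.
  refine measure_mono_null h1 (Measure.addHaar_affineSubspace _ _ fun htop => ?_)
  have hind : AffineIndependent ℝ ((↑) : (s ∩ t : Finset (Pt d)) → Pt d) :=
    (M.cplx.indep (M.element_face hs)).mono (by
      intro x hx; exact Finset.mem_of_mem_inter_left hx)
  have h2 : affineSpan ℝ (Set.range ((↑) : (s ∩ t : Finset (Pt d)) → Pt d)) = ⊤ := by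
    rw [← htop]; congr 1; ext x; simp
  rw [hind.affineSpan_eq_top_iff_card_eq_finrank_add_one] at h2
  simp only [Fintype.card_coe, finrank_euclideanSpace, Fintype.card_fin] at h2
  have hcs := (M.mem_elements.1 hs).2
  have hct := (M.mem_elements.1 ht).2
  have e1 : s ∩ t = s := Finset.eq_of_subset_of_card_le Finset.inter_subset_left (by omega)
  have e2 : s ∩ t = t := Finset.eq_of_subset_of_card_le Finset.inter_subset_right (by omega)
  exact hst (e1.symm.trans e2)

lemma aedisjoint_elements :
    Pairwise (Function.onFun (AEDisjoint (volume : Measure (Pt d)))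
      fun t : M.elements => convexHull ℝ ((t : Finset (Pt d)) : Set (Pt d))) := by
  intro s t hst
  exact M.volume_inter_elements s.2 t.2 fun h => hst (Subtype.ext h)

/-- The frontier of a convex set is Lebesgue null. The mesh covers the closure, the integrals are
over the open set. -/
lemma restrict_closure (hO : IsConvexPolyhedralDomain O) :
    (volume : Measure (Pt d)).restrict O = volume.restrict (closure O) := by
  refine Measure.restrict_congr_set ?_
  have h := hO.2.2.1.addHaar_frontier (volume : Measure (Pt d))
  rw [hO.1.frontier_eq] at h
  exact (ae_eq_set.2 ⟨by rw [Set.sdiff_eq_empty.2 subset_closure]; simp, h⟩)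

lemma _root_.SAV.setIntegral_iUnion_fintype {d : ℕ} {ι : Type*} [Fintype ι] {K : ι → Set (Pt d)}
    {μ : Measure (Pt d)}
    (hK : ∀ i, MeasurableSet (K i)) (hd : Pairwise (Function.onFun (AEDisjoint μ) K))
    {f : Pt d → ℝ} (hf : ∀ i, IntegrableOn f (K i) μ) :
    ∫ x in ⋃ i, K i, f x ∂μ = ∑ i, ∫ x in K i, f x ∂μ := by
  rw [integral_iUnion_ae (fun i => (hK i).nullMeasurableSet) hd, tsum_fintype]
  have := (integrableOn_finset_iUnion (s := Finset.univ) (t := K) (f := f) (μ := μ)).2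
    (fun i _ => hf i)
  simpa using this

/-- An integral over the domain is a sum over the elements. -/
lemma setIntegral_eq_sum (hO : IsConvexPolyhedralDomain O) {f : Pt d → ℝ}
    (hf : ∀ t ∈ M.elements, IntegrableOn f (convexHull ℝ (t : Set (Pt d)))) :
    ∫ x in O, f x = ∑ t ∈ M.elements, ∫ x in convexHull ℝ (t : Set (Pt d)), f x := by
  have e : closure O = ⋃ t : M.elements, convexHull ℝ ((t : Finset (Pt d)) : Set (Pt d)) := by
    rw [M.closure_eq_iUnion]; ext; simp
  have h1 := setIntegral_iUnion_fintype (μ := volume) (f := f)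
    (K := fun t : M.elements => convexHull ℝ ((t : Finset (Pt d)) : Set (Pt d)))
    (fun t => measurableSet_simplex t.1) M.aedisjoint_elements (fun t => hf t.1 t.2)
  rw [restrict_closure hO, e, h1]
  exact Finset.sum_coe_sort M.elements (fun t => ∫ x in convexHull ℝ (t : Set (Pt d)), f x)

/-- The volume of an element. -/
noncomputable def vol (t : Finset (Pt d)) : ℝ :=
  (volume : Measure (Pt d)).real (convexHull ℝ (t : Set (Pt d)))

/-- The area of a boundary element. -/
noncomputable def area (O : Set (Pt d)) (s : Finset (Pt d)) : ℝ :=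
  (surf O).real (convexHull ℝ (s : Set (Pt d)))

lemma vol_nonneg (t : Finset (Pt d)) : 0 ≤ vol t := measureReal_nonneg

lemma area_nonneg (t : Finset (Pt d)) : 0 ≤ area O t := measureReal_nonneg

lemma sum_vol (hO : IsConvexPolyhedralDomain O) :
    ∑ t ∈ M.elements, vol t = (volume : Measure (Pt d)).real O := by
  have := M.setIntegral_eq_sum hO (f := fun _ => 1) fun t _ =>
    integrableOn_const ((isCompact_simplex t).measure_lt_top.ne)
  simp at this
  exact this.symm

lemma ae_gradient_eq {t : Finset (Pt d)} {u : Pt d → ℝ} (hu : AffOn t u) :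
    ∀ᵐ x ∂(volume.restrict (convexHull ℝ (t : Set (Pt d)))), gradient u x = tangentialGrad t u := by
  have h := (convex_convexHull ℝ (t : Set (Pt d))).addHaar_frontier (volume : Measure (Pt d))
  rw [ae_restrict_iff' (measurableSet_simplex t)]
  have h2 : ∀ᵐ x ∂(volume : Measure (Pt d)), x ∉ frontier (convexHull ℝ (t : Set (Pt d))) :=
    measure_eq_zero_iff_ae_notMem.1 h
  filter_upwards [h2] with x hx hxt
  refine gradient_eq_tangentialGrad hu ?_
  by_contra hni
  exact hx ⟨subset_closure hxt, hni⟩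

/-- The Dirichlet form as a sum over the elements. -/
lemma dirichlet_eq (hO : IsConvexPolyhedralDomain O) {u v : Pt d → ℝ} (hu : M.MemU u)
    (hv : M.MemU v) :
    dirichlet O u v = ∑ t ∈ M.elements, vol t * inner ℝ (tangentialGrad t u) (tangentialGrad t v) := by
  have key : ∀ t ∈ M.elements, (fun x => (inner ℝ (gradient u x) (gradient v x) : ℝ))
      =ᵐ[volume.restrict (convexHull ℝ (t : Set (Pt d)))]
      fun _ => inner ℝ (tangentialGrad t u) (tangentialGrad t v) := by
    intro t ht
    filter_upwards [ae_gradient_eq (hu.affOn (M.element_face ht)),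
      ae_gradient_eq (hv.affOn (M.element_face ht))] with x h1 h2
    rw [h1, h2]
  unfold dirichlet
  rw [M.setIntegral_eq_sum hO]
  · refine Finset.sum_congr rfl fun t ht => ?_
    rw [integral_congr_ae (key t ht)]
    simp [vol]
  · intro t ht
    refine Integrable.congr ?_ (key t ht).symm
    exact integrableOn_const ((isCompact_simplex t).measure_lt_top.ne)

lemma dirichletBdry_eq (u v : Pt d → ℝ) :
    M.dirichletBdry u v
      = ∑ s ∈ M.bdryElements, area O s * inner ℝ (tangentialGrad s u) (tangentialGrad s v) := by
  unfold dirichletBdry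
  refine Finset.sum_congr rfl fun s _ => ?_
  rw [setIntegral_const, smul_eq_mul, area]

end Mesh
end SAV

/-! ### Hausdorff measure of simplices and the area of the boundary. -/

namespace SAV

/-- The Euclidean Hausdorff measure is controlled under Lipschitz maps. -/
lemma euclideanHausdorffMeasure_image_le {X Y : Type*} [MetricSpace X] [MeasurableSpace X]
    [BorelSpace X] [MetricSpace Y] [MeasurableSpace Y] [BorelSpace Y] {f : X → Y} {K : NNReal}
    (hf : LipschitzWith K f) (n : ℕ) (s : Set X) :
    Measure.euclideanHausdorffMeasure n (f '' s)
      ≤ (K : ℝ≥0∞) ^ n * Measure.euclideanHausdorffMeasure n s := by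
  simp only [Measure.euclideanHausdorffMeasure_def, Measure.smul_apply]
  have h := hf.hausdorffMeasure_image_le (d := (n : ℝ)) (by positivity) s
  rw [ENNReal.rpow_natCast] at h
  simp only [ENNReal.smul_def, smul_eq_mul]
  calc _ ≤ _ := mul_le_mul_right h _
    _ = _ := by ring

/-- The volume of a ball that contains the standard simplex. -/
noncomputable def simplexConst (n : ℕ) : ℝ≥0∞ :=
  ((n + 1 : ℕ) : ℝ≥0∞) ^ n * volume (Metric.closedBall (0 : EuclideanSpace ℝ (Fin n)) (n + 1))

lemma simplexConst_lt_top (n : ℕ) : simplexConst n < ∞ := by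
  refine ENNReal.mul_lt_top ?_ (measure_closedBall_lt_top)
  exact ENNReal.pow_lt_top (ENNReal.natCast_lt_top _)

/-- The `n`-dimensional measure of a simplex with `n + 1` vertices. -/
lemma euclideanHausdorffMeasure_simplex_le {d n : ℕ} (s : Finset (Pt d)) (hs : s.card = n + 1)
    (h : NNReal) (hd : ∀ x ∈ s, ∀ y ∈ s, dist x y ≤ h) :
    Measure.euclideanHausdorffMeasure n (convexHull ℝ (s : Set (Pt d)))
      ≤ simplexConst n * (h : ℝ≥0∞) ^ n := by
  let e : Fin (n + 1) ≃ s := (s.equivFinOfCardEq hs).symm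
  let v : Fin (n + 1) → Pt d := fun i => e i
  -- Parametrization by the barycentric coordinates of all vertices but `v 0`. Each coordinate adds
  -- at most `h` to the Lipschitz constant. On the simplex the coordinates lie in the unit interval,
  -- so a ball of radius `n + 1` contains all parameters.
  let f : EuclideanSpace ℝ (Fin n) → Pt d := fun l => v 0 + ∑ i : Fin n, l i • (v i.succ - v 0)
  have hf : LipschitzWith (((n + 1 : ℕ) : NNReal) * h) f := by
    refine LipschitzWith.of_dist_le_mul fun l l' => ?_
    simp only [f, dist_eq_norm, add_sub_add_left_eq_sub, ← Finset.sum_sub_distrib, ← sub_smul]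
    calc ‖∑ i : Fin n, (l i - l' i) • (v i.succ - v 0)‖
        ≤ ∑ i : Fin n, ‖l - l'‖ * h := by
          refine (norm_sum_le _ _).trans (Finset.sum_le_sum fun i _ => ?_)
          rw [norm_smul]
          refine mul_le_mul ?_ ?_ (norm_nonneg _) (norm_nonneg _)
          · exact (PiLp.norm_apply_le (l - l') i)
          · rw [← dist_eq_norm]; exact hd _ (e _).2 _ (e _).2
      _ = n * (‖l - l'‖ * h) := by simp
      _ ≤ _ := by
          push_cast
          nlinarith [mul_nonneg (norm_nonneg (l - l')) h.coe_nonneg]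
  have hsub : convexHull ℝ (s : Set (Pt d)) ⊆ f '' Metric.closedBall 0 (n + 1) := by
    intro x hx
    obtain ⟨w, hw0, hw1, hw2⟩ := Finset.mem_convexHull'.1 hx
    have s1 : ∑ i : Fin (n + 1), w (v i) = 1 := by
      rw [← hw1, ← Finset.sum_coe_sort s w]
      exact Equiv.sum_comp e (fun y : s => w y)
    have s2 : ∑ i : Fin (n + 1), w (v i) • v i = x := by
      rw [← hw2, ← Finset.sum_coe_sort s (fun y => w y • y)]
      exact Equiv.sum_comp e (fun y : s => w y • (y : Pt d))
    have hwv : ∀ i, 0 ≤ w (v i) := fun i => hw0 _ (e i).2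
    have hwle : ∀ i, w (v i) ≤ 1 := fun i => by
      rw [← s1]; exact Finset.single_le_sum (fun j _ => hwv j) (Finset.mem_univ i)
    refine ⟨WithLp.toLp 2 fun i => w (v i.succ), ?_, ?_⟩
    · rw [mem_closedBall_zero_iff, EuclideanSpace.norm_eq]
      have : ∑ i : Fin n, ‖w (v i.succ)‖ ^ 2 ≤ (n + 1 : ℝ) ^ 2 := by
        calc ∑ i : Fin n, ‖w (v i.succ)‖ ^ 2 ≤ ∑ i : Fin n, (1 : ℝ) := by
              refine Finset.sum_le_sum fun i _ => ?_
              rw [Real.norm_eq_abs, abs_of_nonneg (hwv _)]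
              exact pow_le_one₀ (hwv _) (hwle _)
          _ = n := by simp
          _ ≤ _ := by nlinarith [(Nat.cast_nonneg n : (0 : ℝ) ≤ n)]
      exact Real.sqrt_le_iff.2 ⟨by positivity, this⟩
    · simp only [f, smul_sub, Finset.sum_sub_distrib, ← Finset.sum_smul]
      rw [Fin.sum_univ_succ] at s1 s2
      rw [← s2]
      have : ∑ i : Fin n, w (v i.succ) = 1 - w (v 0) := by linarith
      rw [this, sub_smul, one_smul]
      abel
  calc _ ≤ _ := measure_mono hsub
    _ ≤ _ := euclideanHausdorffMeasure_image_le hf n _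
    _ = simplexConst n * (h : ℝ≥0∞) ^ n := by
      rw [EuclideanSpace.euclideanHausdorffMeasure_eq_volume, simplexConst]
      push_cast
      rw [mul_pow]
      ring

lemma euclideanHausdorffMeasure_simplex_lt_top {d n : ℕ} (s : Finset (Pt d))
    (hs : s.card = n + 1) :
    Measure.euclideanHausdorffMeasure n (convexHull ℝ (s : Set (Pt d))) < ∞ := by
  refine (euclideanHausdorffMeasure_simplex_le s hs
    ⟨Metric.diam (s : Set (Pt d)), Metric.diam_nonneg⟩ fun x hx y hy => ?_).trans_lt ?_
  · exact Metric.dist_le_diam_of_mem s.finite_toSet.isBounded (by exact_mod_cast hx)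
      (by exact_mod_cast hy)
  · exact ENNReal.mul_lt_top (simplexConst_lt_top n) (ENNReal.pow_lt_top ENNReal.coe_lt_top)

/-- A simplex with `j + 1 ≤ n` vertices has finite `j`-dimensional measure, and such sets are null
in every higher dimension. -/
lemma euclideanHausdorffMeasure_simplex_eq_zero {d n : ℕ} (s : Finset (Pt d))
    (hs : s.card ≤ n) :
    Measure.euclideanHausdorffMeasure n (convexHull ℝ (s : Set (Pt d))) = 0 := by
  rcases Nat.eq_zero_or_pos s.card with h0 | h0
  · rw [Finset.card_eq_zero.1 h0]; simp
  obtain ⟨j, hj⟩ : ∃ j, s.card = j + 1 := ⟨s.card - 1, by omega⟩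
  rcases Measure.euclideanHausdorffMeasure_zero_or_top (d₁ := j) (d₂ := n) (by omega)
    (convexHull ℝ (s : Set (Pt d))) with h | h
  · exact h
  · exact absurd h (euclideanHausdorffMeasure_simplex_lt_top s hj).ne

namespace Mesh

variable {d : ℕ} {O : Set (Pt d)} (M : Mesh O)

lemma surf_simplex {s : Finset (Pt d)} (hs : s ∈ M.bdryElements) :
    surf O (convexHull ℝ (s : Set (Pt d)))
      = Measure.euclideanHausdorffMeasure (d - 1) (convexHull ℝ (s : Set (Pt d))) := by
  rw [surf, Measure.restrict_apply (measurableSet_simplex s),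
    Set.inter_eq_left.2 (M.mem_bdryElements.1 hs).2.2]

lemma surf_simplex_lt_top (hd : 1 ≤ d) {s : Finset (Pt d)} (hs : s ∈ M.bdryElements) :
    surf O (convexHull ℝ (s : Set (Pt d))) < ∞ := by
  rw [M.surf_simplex hs]
  exact euclideanHausdorffMeasure_simplex_lt_top s (by rw [(M.mem_bdryElements.1 hs).2.1]; omega)

/-- Two distinct boundary elements share at most `d - 1` vertices, so their overlap has no area. -/
lemma surf_univ_eq (hd : 1 ≤ d) (hM : M.IsBdryCompatible) :
    surf O Set.univ = ∑ s ∈ M.bdryElements, surf O (convexHull ℝ (s : Set (Pt d))) := by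
  classical
  have e : surf O Set.univ = surf O (⋃ s ∈ M.bdryElements, convexHull ℝ (s : Set (Pt d))) := by
    rw [← hM.1, surf, Measure.restrict_apply_self]
    simp
  rw [e, measure_biUnion_finset₀]
  · intro s hs t ht hst
    show surf O (convexHull ℝ (s : Set (Pt d)) ∩ convexHull ℝ (t : Set (Pt d))) = 0
    have hs' := M.mem_bdryElements.1 (Finset.mem_coe.1 hs)
    have ht' := M.mem_bdryElements.1 (Finset.mem_coe.1 ht)
    have h1 := M.cplx.inter_subset_convexHull hs'.1 ht'.1
    refine le_antisymm ((Measure.restrict_apply_le _ _).trans ?_) bot_le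
    rw [← Finset.coe_inter] at h1
    refine (measure_mono h1).trans (le_of_eq ?_)
    refine euclideanHausdorffMeasure_simplex_eq_zero _ ?_
    have c1 := Finset.card_le_card (Finset.inter_subset_left (s₁ := s) (s₂ := t))
    by_contra hlt
    have e1 : s ∩ t = s := Finset.eq_of_subset_of_card_le Finset.inter_subset_left (by omega)
    have e2 : s ∩ t = t := Finset.eq_of_subset_of_card_le Finset.inter_subset_right (by omega)
    exact hst (e1.symm.trans e2)
  · exact fun s _ => (measurableSet_simplex s).nullMeasurableSet

lemma surf_univ_lt_top (hd : 1 ≤ d) (hM : M.IsBdryCompatible) : surf O Set.univ < ∞ := by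
  rw [M.surf_univ_eq hd hM]
  exact ENNReal.sum_lt_top.2 fun s hs => M.surf_simplex_lt_top hd hs

lemma sum_area (hd : 1 ≤ d) (hM : M.IsBdryCompatible) :
    ∑ s ∈ M.bdryElements, area O s = (surf O).real Set.univ := by
  rw [measureReal_def, M.surf_univ_eq hd hM, ENNReal.toReal_sum]
  · rfl
  · exact fun s hs => (M.surf_simplex_lt_top hd hs).ne

lemma area_le (hd : 1 ≤ d) {s : Finset (Pt d)} (hs : s ∈ M.bdryElements) {h : ℝ} (hh : 0 ≤ h)
    (hdist : ∀ x ∈ s, ∀ y ∈ s, dist x y ≤ h) :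
    area O s ≤ (simplexConst (d - 1)).toReal * h ^ (d - 1) := by
  have h1 := euclideanHausdorffMeasure_simplex_le (n := d - 1) s
    (by rw [(M.mem_bdryElements.1 hs).2.1]; omega) ⟨h, hh⟩ hdist
  rw [← M.surf_simplex hs] at h1
  have h2 := ENNReal.toReal_mono (ENNReal.mul_lt_top (simplexConst_lt_top _)
    (ENNReal.pow_lt_top ENNReal.coe_lt_top)).ne h1
  rw [ENNReal.toReal_mul, ENNReal.toReal_pow] at h2
  exact h2

/-! ### Lumped integrals -/

lemma hat_eq_interp {v : Pt d} (hv : v ∈ M.nodes) :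
    ∃ a : Pt d → ℝ, ∀ x, M.hat v x = M.interp a x := by
  classical
  exact ⟨fun y => if y = v then 1 else 0, fun x => by simp [interp, hv]⟩

lemma continuousOn_hat {v : Pt d} (hv : v ∈ M.nodes) : ContinuousOn (M.hat v) (closure O) := by
  obtain ⟨a, ha⟩ := M.hat_eq_interp hv
  rw [funext ha]
  exact M.continuousOn_interp a

lemma memU_hat {v : Pt d} (hv : v ∈ M.nodes) : M.MemU (M.hat v) := by
  obtain ⟨a, ha⟩ := M.hat_eq_interp hv
  rw [funext ha]
  exact M.memU_interp a

lemma isCompact_closure (hO : IsConvexPolyhedralDomain O) : IsCompact (closure O) := by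
  obtain ⟨V, hV⟩ := hO.2.2.2
  rw [hV]
  exact V.finite_toSet.isCompact_convexHull ℝ

lemma integrableOn_of_continuousOn (hO : IsConvexPolyhedralDomain O) {f : Pt d → ℝ}
    (hf : ContinuousOn f (closure O)) : IntegrableOn f O volume :=
  (hf.integrableOn_compact (isCompact_closure hO)).mono_set subset_closure

lemma integrable_surf_of_continuousOn (hO : IsConvexPolyhedralDomain O) (hd : 1 ≤ d)
    (hM : M.IsBdryCompatible) {f : Pt d → ℝ}
    (hf : ContinuousOn f (closure O)) : Integrable f (surf O) := by
  have hfin : IsFiniteMeasure (surf O) := ⟨M.surf_univ_lt_top hd hM⟩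
  have hc : IsCompact (frontier O) :=
    (isCompact_closure hO).of_isClosed_subset isClosed_frontier frontier_subset_closure
  have h1 : IntegrableOn f (frontier O) (surf O) :=
    (hf.mono frontier_subset_closure).integrableOn_compact hc
  have h2 : (surf O).restrict (frontier O) = surf O := by
    rw [surf, Measure.restrict_restrict isClosed_frontier.measurableSet, Set.inter_self]
  rwa [IntegrableOn, h2] at h1

/-- The weights of the lumped integral over the domain. -/
noncomputable def mass (v : Pt d) : ℝ := ∫ x in O, M.hat v x

/-- The weights of the lumped integral over the boundary. -/
noncomputable def massBdry (v : Pt d) : ℝ := ∫ x, M.hat v x ∂(surf O)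

lemma mass_nonneg (v : Pt d) : 0 ≤ M.mass v := integral_nonneg fun x => M.hat_nonneg v x

lemma massBdry_nonneg (v : Pt d) : 0 ≤ M.massBdry v := integral_nonneg fun x => M.hat_nonneg v x

/-- Mass lumping makes the integral a quadrature with nonnegative weights at the nodes. From here
on, nonlinear terms are handled by weighted Cauchy–Schwarz inequalities over nodes. -/
lemma intI_eq (hO : IsConvexPolyhedralDomain O) (a : Pt d → ℝ) :
    M.intI a = ∑ v ∈ M.nodes, a v * M.mass v := by
  unfold intI interp
  rw [integral_finsetSum]
  · simp only [integral_const_mul, mass]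
  · exact fun v hv => (integrableOn_of_continuousOn hO (M.continuousOn_hat hv)).const_mul _

lemma intIBdry_eq (hO : IsConvexPolyhedralDomain O) (hd : 1 ≤ d) (hM : M.IsBdryCompatible)
    (a : Pt d → ℝ) : M.intIBdry a = ∑ v ∈ M.bdryNodes, a v * M.massBdry v := by
  unfold intIBdry interpBdry
  rw [integral_finsetSum]
  · simp only [integral_const_mul, massBdry]
  · exact fun v hv => (M.integrable_surf_of_continuousOn hO hd hM
      (M.continuousOn_hat (M.mem_bdryNodes.1 hv).1)).const_mul _

lemma sum_mass (hO : IsConvexPolyhedralDomain O) :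
    ∑ v ∈ M.nodes, M.mass v = (volume : Measure (Pt d)).real O := by
  have h := M.intI_eq hO (fun _ => 1)
  simp only [one_mul] at h
  rw [← h, intI, setIntegral_congr_fun hO.1.measurableSet (g := fun _ => (1 : ℝ))]
  · simp
  · intro x hx
    simp only [interp, one_mul]
    exact M.sum_hat (subset_closure hx)

lemma ae_surf {p : Pt d → Prop} (h : ∀ x ∈ frontier O, p x) : ∀ᵐ x ∂(surf O), p x := by
  rw [surf, ae_restrict_iff' isClosed_frontier.measurableSet]
  exact Filter.Eventually.of_forall h

lemma sum_massBdry (hO : IsConvexPolyhedralDomain O) (hd : 1 ≤ d) (hM : M.IsBdryCompatible) :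
    ∑ v ∈ M.bdryNodes, M.massBdry v = (surf O).real Set.univ := by
  have h := M.intIBdry_eq hO hd hM (fun _ => 1)
  simp only [one_mul] at h
  rw [← h, intIBdry, integral_congr_ae (g := fun _ => (1 : ℝ))]
  · simp
  · refine ae_surf fun x hx => ?_
    simp only [interpBdry, one_mul]
    exact (M.sum_hat_bdry hM hx).2

lemma sq_sum_le {ι : Type*} (s : Finset ι) (w a : ι → ℝ) (hw : ∀ i ∈ s, 0 ≤ w i)
    (h1 : ∑ i ∈ s, w i = 1) : (∑ i ∈ s, a i * w i) ^ 2 ≤ ∑ i ∈ s, a i ^ 2 * w i := by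
  have := Finset.sum_mul_sq_le_sq_mul_sq s (fun i => a i * Real.sqrt (w i))
    (fun i => Real.sqrt (w i))
  have e1 : ∑ i ∈ s, a i * Real.sqrt (w i) * Real.sqrt (w i) = ∑ i ∈ s, a i * w i :=
    Finset.sum_congr rfl fun i hi => by rw [mul_assoc, Real.mul_self_sqrt (hw i hi)]
  have e2 : ∑ i ∈ s, (a i * Real.sqrt (w i)) ^ 2 = ∑ i ∈ s, a i ^ 2 * w i :=
    Finset.sum_congr rfl fun i hi => by rw [mul_pow, Real.sq_sqrt (hw i hi)]
  have e3 : ∑ i ∈ s, Real.sqrt (w i) ^ 2 = 1 := by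
    rw [← h1]; exact Finset.sum_congr rfl fun i hi => Real.sq_sqrt (hw i hi)
  rw [e1, e2, e3, mul_one] at this
  exact this

variable {M} in
-- Pointwise convexity of the square in the nodal weights: the lumped `L²` norm dominates the true
-- one. The energy argument therefore only ever has to control lumped norms.
lemma MemU.integral_sq_le (hO : IsConvexPolyhedralDomain O) {u : Pt d → ℝ} (hu : M.MemU u) :
    ∫ x in O, u x ^ 2 ≤ M.intI (fun x => u x ^ 2) := by
  refine setIntegral_mono_on (integrableOn_of_continuousOn hO (hu.1.pow 2))
    (integrableOn_of_continuousOn hO (M.continuousOn_interp _)) hO.1.measurableSet fun x hx => ?_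
  rw [hu.eq_interp (subset_closure hx)]
  exact sq_sum_le _ _ _ (fun v _ => M.hat_nonneg v x) (M.sum_hat (subset_closure hx))

lemma integral_surf_sq_le (hO : IsConvexPolyhedralDomain O) (hd : 1 ≤ d)
    (hM : M.IsBdryCompatible) {v : Pt d → ℝ} (hv : M.MemUBdry v) :
    ∫ x, v x ^ 2 ∂(surf O) ≤ M.intIBdry (fun x => v x ^ 2) := by
  obtain ⟨u, hu, huv⟩ := hv
  have e : ∀ x ∈ frontier O, v x = M.interpBdry v x := by
    intro x hx
    rw [huv hx, hu.eq_interp (frontier_subset_closure hx), ← M.interpBdry_eq hM u hx]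
    exact Finset.sum_congr rfl fun y hy => by rw [huv (M.mem_bdryNodes.1 hy).2]
  refine integral_mono_ae ?_ ?_ (ae_surf fun x hx => ?_)
  · refine (M.integrable_surf_of_continuousOn hO hd hM (hu.1.pow 2)).congr (ae_surf fun x hx => ?_)
    simp [huv hx]
  · refine (M.integrable_surf_of_continuousOn hO hd hM
      (M.continuousOn_interp (fun x => v x ^ 2))).congr (ae_surf fun x hx => ?_)
    exact (M.interpBdry_eq hM _ hx).symm
  · simp only
    rw [e x hx]
    exact sq_sum_le _ _ _ (fun v _ => M.hat_nonneg v x) (M.sum_hat_bdry hM hx).2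

variable {M} in
lemma MemU.memUBdry {u : Pt d → ℝ} (hu : M.MemU u) : M.MemUBdry u := ⟨u, hu, fun _ _ => rfl⟩

end Mesh
end SAV

/-! ### Mollification on the domain. -/

namespace SAV

section Mollify

variable {d : ℕ} {O : Set (Pt d)}

/-- Mollification of the restriction of `f` to `O`. -/
noncomputable def moll (η : ContDiffBump (0 : Pt d)) (O : Set (Pt d)) (f : Pt d → ℝ) (z : Pt d) :
    ℝ := ∫ y in O, η.normed volume (z - y) * f y

open scoped Convolution in
lemma moll_eq_convolution (η : ContDiffBump (0 : Pt d)) (hO : MeasurableSet O) (f : Pt d → ℝ) :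
    moll η O f = (η.normed volume ⋆[ContinuousLinearMap.lsmul ℝ ℝ, volume] (O.indicator f)) := by
  funext z
  rw [convolution_lsmul_swap, moll, ← integral_indicator hO]
  congr 1
  funext y
  by_cases hy : y ∈ O <;> simp [hy]

lemma contDiff_moll (η : ContDiffBump (0 : Pt d)) (hO : MeasurableSet O) {f : Pt d → ℝ}
    (hf : IntegrableOn f O) : ContDiff ℝ (⊤ : ℕ∞) (moll η O f) := by
  rw [moll_eq_convolution η hO]
  exact η.hasCompactSupport_normed.contDiff_convolution_left _ η.contDiff_normed
    ((integrable_indicator_iff hO).2 hf).locallyIntegrable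

lemma fderiv_moll_apply (η : ContDiffBump (0 : Pt d)) (hO : MeasurableSet O) {f : Pt d → ℝ}
    (hf : IntegrableOn f O) (z w : Pt d) :
    fderiv ℝ (moll η O f) z w = ∫ y in O, fderiv ℝ (η.normed volume) (z - y) w * f y := by
  rw [moll_eq_convolution η hO]
  have hloc := ((integrable_indicator_iff hO).2 hf).locallyIntegrable
  have h := (η.hasCompactSupport_normed (μ := volume)).hasFDerivAt_convolution_left
    (ContinuousLinearMap.lsmul ℝ ℝ) (μ := volume) (g := O.indicator f)
    (η.contDiff_normed (n := 1)) hloc z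
  rw [h.fderiv, convolution_eq_swap, ContinuousLinearMap.integral_apply]
  · rw [← integral_indicator hO]
    congr 1
    funext y
    by_cases hy : y ∈ O <;> simp [hy, ContinuousLinearMap.precompL_apply]
  · have hc : ConvolutionExistsAt (fderiv ℝ (η.normed volume)) (O.indicator f) z
        ((ContinuousLinearMap.lsmul ℝ ℝ).precompL (Pt d)) volume :=
      (((η.hasCompactSupport_normed (μ := volume)).fderiv ℝ).convolutionExists_left _
        ((η.contDiff_normed (μ := volume) (n := 1)).continuous_fderiv one_ne_zero) hloc) z
    exact hc.integrable_swap

/-- The weak derivative is tested with the reflected and translated bump, which is admissible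
because its support stays in the closed ball around `z`. The sign from the reflection cancels the
one from integration by parts. -/
lemma fderiv_moll_of_hasWeakPartial (η : ContDiffBump (0 : Pt d)) (hO : MeasurableSet O)
    {i : Fin d} {f g : Pt d → ℝ} (hf : IntegrableOn f O) (hfg : HasWeakPartial O i f g) {z : Pt d}
    (hz : Metric.closedBall z η.rOut ⊆ O) :
    fderiv ℝ (moll η O f) z (EuclideanSpace.single i (1 : ℝ)) = moll η O g z := by
  rw [fderiv_moll_apply η hO hf, moll]
  have hcd : ContDiff ℝ (⊤ : ℕ∞) (fun y => η.normed volume (z - y)) :=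
    η.contDiff_normed.comp (contDiff_const.sub contDiff_id)
  have hts : tsupport (fun y => η.normed volume (z - y)) ⊆ Metric.closedBall z η.rOut := by
    refine closure_minimal (fun y hy => ?_) Metric.isClosed_closedBall
    have : z - y ∈ Function.support (η.normed volume) := hy
    rw [η.support_normed_eq, mem_ball_zero_iff] at this
    rw [Metric.mem_closedBall, dist_comm, dist_eq_norm]
    exact this.le
  have h := hfg.2.2 (fun y => η.normed volume (z - y)) hcd
    (HasCompactSupport.of_support_subset_isCompact (isCompact_closedBall z η.rOut)
      (subset_closure.trans hts)) (hts.trans hz)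
  have e : ∀ y, fderiv ℝ (fun y => η.normed volume (z - y)) y (EuclideanSpace.single i (1 : ℝ))
      = -fderiv ℝ (η.normed volume) (z - y) (EuclideanSpace.single i (1 : ℝ)) := by
    intro y
    have h1 : HasFDerivAt (fun y : Pt d => z - y) (-ContinuousLinearMap.id ℝ (Pt d)) y :=
      (hasFDerivAt_id y).const_sub z
    have h2 : HasFDerivAt (η.normed volume) (fderiv ℝ (η.normed volume) (z - y)) (z - y) :=
      ((η.contDiff_normed (n := 1)).differentiable one_ne_zero _).hasFDerivAt
    have h3 := HasFDerivAt.comp (f := fun y : Pt d => z - y) y h2 h1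
    have h4 := h3.fderiv
    simp only [Function.comp_def] at h4
    rw [h4]
    simp
  simp only [e, mul_neg, integral_neg, neg_inj] at h
  simp only [mul_comm (fderiv ℝ _ _ _), mul_comm (η.normed volume _)]
  exact h

lemma sq_lintegral_mul_le {α : Type*} [MeasurableSpace α] (μ : Measure α) {w f : α → ℝ≥0∞}
    (hw : AEMeasurable w μ) (hf : AEMeasurable f μ) :
    (∫⁻ a, w a * f a ∂μ) ^ 2 ≤ (∫⁻ a, w a ^ 2 ∂μ) * ∫⁻ a, f a ^ 2 ∂μ := by
  have h := ENNReal.lintegral_mul_le_Lp_mul_Lq μ Real.HolderConjugate.two_two hw hf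
  simp only [Pi.mul_apply] at h
  have h2 := ENNReal.rpow_le_rpow h (z := 2) (by norm_num)
  rw [ENNReal.mul_rpow_of_nonneg _ _ (by norm_num), ← ENNReal.rpow_mul, ← ENNReal.rpow_mul] at h2
  norm_num at h2
  exact h2

/-- Cauchy–Schwarz after splitting the weight into two square roots. -/
lemma sq_lintegral_weight_le {α : Type*} [MeasurableSpace α] (μ : Measure α) {w f : α → ℝ≥0∞}
    (hw : AEMeasurable w μ) (hf : AEMeasurable f μ) :
    (∫⁻ a, w a * f a ∂μ) ^ 2 ≤ (∫⁻ a, w a ∂μ) * ∫⁻ a, w a * f a ^ 2 ∂μ := by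
  have h := sq_lintegral_mul_le μ (w := fun a => w a ^ (1 / 2 : ℝ))
    (f := fun a => w a ^ (1 / 2 : ℝ) * f a) (hw.pow_const _) ((hw.pow_const _).mul hf)
  have e : ∀ a, w a ^ (1 / 2 : ℝ) * w a ^ (1 / 2 : ℝ) = w a := fun a => by
    rw [← ENNReal.rpow_add_of_nonneg _ _ (by norm_num) (by norm_num)]; norm_num
  have e1 : ∀ a, w a ^ (1 / 2 : ℝ) * (w a ^ (1 / 2 : ℝ) * f a) = w a * f a := fun a => by
    rw [← mul_assoc, e]
  have e2 : ∀ a, (w a ^ (1 / 2 : ℝ)) ^ 2 = w a := fun a => by rw [pow_two, e]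
  simpa only [e1, mul_pow, e2] using h

lemma lintegral_bump (η : ContDiffBump (0 : Pt d)) (z : Pt d) :
    ∫⁻ y, ENNReal.ofReal (η.normed volume (z - y)) = 1 ∧
    ∫⁻ y, ENNReal.ofReal (η.normed volume (y - z)) = 1 := by
  have h : ∫⁻ y, ENNReal.ofReal (η.normed volume y) = 1 := by
    rw [← ofReal_integral_eq_lintegral_ofReal η.integrable_normed
      (Filter.Eventually.of_forall η.nonneg_normed), η.integral_normed, ENNReal.ofReal_one]
  constructor
  · rw [lintegral_sub_left_eq_self (fun y => ENNReal.ofReal (η.normed volume y)) z, h]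
  · rw [lintegral_sub_right_eq_self (fun y => ENNReal.ofReal (η.normed volume y)) z, h]

lemma enorm_moll_sq_le (η : ContDiffBump (0 : Pt d)) {g : Pt d → ℝ}
    (hg : AEStronglyMeasurable g (volume.restrict O)) (z : Pt d) :
    ‖moll η O g z‖ₑ ^ 2
      ≤ ∫⁻ y in O, ENNReal.ofReal (η.normed volume (z - y)) * ‖g y‖ₑ ^ 2 := by
  have hw : Measurable fun y => ENNReal.ofReal (η.normed volume (z - y)) :=
    (η.continuous_normed.comp (continuous_const.sub continuous_id)).measurable.ennreal_ofReal
  calc ‖moll η O g z‖ₑ ^ 2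
      ≤ (∫⁻ y in O, ENNReal.ofReal (η.normed volume (z - y)) * ‖g y‖ₑ) ^ 2 := by
        gcongr
        refine (enorm_integral_le_lintegral_enorm _).trans (le_of_eq ?_)
        refine lintegral_congr fun y => ?_
        rw [enorm_mul, Real.enorm_of_nonneg (η.nonneg_normed _)]
    _ ≤ (∫⁻ y in O, ENNReal.ofReal (η.normed volume (z - y))) * _ :=
        sq_lintegral_weight_le _ hw.aemeasurable hg.enorm
    _ ≤ 1 * _ := by
        gcongr
        exact (setLIntegral_le_lintegral _ _).trans (lintegral_bump η z).1.le
    _ = _ := one_mul _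

/-- Young's convolution inequality in `L²`: Jensen's inequality for a kernel of mass at most one on
`O`, then Tonelli. -/
lemma lintegral_moll_sq_le (η : ContDiffBump (0 : Pt d)) {g : Pt d → ℝ}
    (hg : AEStronglyMeasurable g (volume.restrict O)) :
    ∫⁻ z, ‖moll η O g z‖ₑ ^ 2 ≤ ∫⁻ y in O, ‖g y‖ₑ ^ 2 := by
  calc ∫⁻ z, ‖moll η O g z‖ₑ ^ 2
      ≤ ∫⁻ z, ∫⁻ y in O, ENNReal.ofReal (η.normed volume (z - y)) * ‖g y‖ₑ ^ 2 :=
        lintegral_mono fun z => enorm_moll_sq_le η hg z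
    _ = ∫⁻ y in O, ∫⁻ z, ENNReal.ofReal (η.normed volume (z - y)) * ‖g y‖ₑ ^ 2 := by
        rw [lintegral_lintegral_swap]
        refine AEMeasurable.mul (f := fun p : Pt d × Pt d =>
          ENNReal.ofReal (η.normed volume (p.1 - p.2))) ?_ ?_
        · have : Continuous fun p : Pt d × Pt d => η.normed volume (p.1 - p.2) :=
            η.continuous_normed.comp (continuous_fst.sub continuous_snd)
          exact this.measurable.ennreal_ofReal.aemeasurable
        · exact AEMeasurable.comp_quasiMeasurePreserving (f := Prod.snd)
            (g := fun y => ‖g y‖ₑ ^ 2) (hg.enorm.pow_const 2)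
            Measure.quasiMeasurePreserving_snd
    _ = ∫⁻ y in O, ‖g y‖ₑ ^ 2 := by
        refine lintegral_congr fun y => ?_
        rw [lintegral_mul_const', (lintegral_bump η y).2, one_mul]
        simp

lemma abs_moll_le (η : ContDiffBump (0 : Pt d)) {g : Pt d → ℝ} {b : ℝ} (hb : 0 ≤ b)
    (hg : ∀ᵐ y ∂(volume.restrict O), |g y| ≤ b) (z : Pt d) : |moll η O g z| ≤ b := by
  have hi : Integrable (fun y => η.normed volume (z - y)) volume :=
    (integrable_comp_sub_left (η.normed volume) z).2 η.integrable_normed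
  rw [← Real.norm_eq_abs]
  calc ‖moll η O g z‖ ≤ ∫ y in O, η.normed volume (z - y) * b := by
        refine norm_integral_le_of_norm_le ((hi.mul_const b).integrableOn) ?_
        filter_upwards [hg] with y hy
        rw [norm_mul, Real.norm_of_nonneg (η.nonneg_normed _)]
        exact mul_le_mul_of_nonneg_left hy (η.nonneg_normed _)
    _ = (∫ y in O, η.normed volume (z - y)) * b := integral_mul_const _ _
    _ ≤ 1 * b := by
        gcongr
        refine (setIntegral_le_integral hi (Filter.Eventually.of_forall fun y =>
          η.nonneg_normed _)).trans ?_
        rw [integral_sub_left_eq_self (η.normed volume) volume z, η.integral_normed]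
    _ = b := one_mul b

lemma abs_moll_sub_le (η : ContDiffBump (0 : Pt d)) (hO : MeasurableSet O) {f : Pt d → ℝ}
    (hf : IntegrableOn f O) {z : Pt d} (hz : Metric.ball z η.rOut ⊆ O) {ε : ℝ}
    (hε : ∀ y ∈ Metric.ball z η.rOut, |f y - f z| ≤ ε) : |moll η O f z - f z| ≤ ε := by
  have hzO : z ∈ O := hz (Metric.mem_ball_self η.rOut_pos)
  have h := ContDiffBump.dist_normed_convolution_le (φ := η) (μ := volume) (g := O.indicator f)
    (x₀ := z) (ε := ε) ((integrable_indicator_iff hO).2 hf).1 (fun y hy => by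
      rw [Set.indicator_of_mem (hz hy), Set.indicator_of_mem hzO, Real.dist_eq]
      exact hε y hy)
  rw [← moll_eq_convolution η hO, Set.indicator_of_mem hzO, Real.dist_eq] at h
  exact h

end Mollify

end SAV

/-! ### Smooth approximation by contraction and mollification. -/

namespace SAV

section Approximation

variable {d : ℕ} {O : Set (Pt d)}

lemma norm_le_sum_single {F : Type*} [NormedAddCommGroup F] [NormedSpace ℝ F]
    (L : Pt d →L[ℝ] F) : ‖L‖ ≤ ∑ i, ‖L (EuclideanSpace.single i (1 : ℝ))‖ := by
  refine L.opNorm_le_bound (Finset.sum_nonneg fun i _ => norm_nonneg _) fun v => ?_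
  have hv : v = ∑ i, v i • EuclideanSpace.single i (1 : ℝ) := by
    ext j
    simp [Pi.single_apply]
  conv_lhs => rw [hv, map_sum]
  rw [Finset.sum_mul]
  refine (norm_sum_le _ _).trans (Finset.sum_le_sum fun i _ => ?_)
  rw [map_smul, norm_smul, mul_comm]
  exact mul_le_mul_of_nonneg_left (PiLp.norm_apply_le v i) (norm_nonneg _)

/-- Every point of the small ball is `s x + (1 - s) b` with `b` in the given ball, hence interior by
convexity. The contraction makes room for mollification up to the boundary. -/
lemma ball_contract_subset (hO : IsConvexPolyhedralDomain O) {c : Pt d} {R : ℝ}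
    (hball : Metric.ball c R ⊆ O) {s : ℝ} (hs0 : 0 ≤ s) (hs1 : s < 1) {x : Pt d}
    (hx : x ∈ closure O) : Metric.ball (c + s • (x - c)) ((1 - s) * R) ⊆ O := by
  intro z hz
  have h1s : 0 < 1 - s := by linarith
  set b := c + (1 - s)⁻¹ • (z - (c + s • (x - c))) with hb
  have hbO : b ∈ interior O := by
    rw [hO.1.interior_eq]
    refine hball ?_
    rw [Metric.mem_ball, dist_eq_norm, hb, add_sub_cancel_left, norm_smul, Real.norm_eq_abs,
      abs_of_pos (inv_pos.2 h1s), inv_mul_lt_iff₀ h1s, ← dist_eq_norm]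
    exact hz
  have := hO.2.2.1.combo_closure_interior_mem_interior hx hbO hs0 h1s (by ring)
  rw [hO.1.interior_eq] at this
  convert this using 1
  rw [hb, smul_add, smul_smul, mul_inv_cancel₀ h1s.ne', one_smul, sub_smul, smul_sub, one_smul]
  abel

lemma exists_ball_subset (hO : IsConvexPolyhedralDomain O) :
    ∃ c : Pt d, ∃ R, 0 < R ∧ Metric.ball c R ⊆ O := by
  obtain ⟨c, hc⟩ := hO.2.1
  obtain ⟨R, hR, h⟩ := Metric.isOpen_iff.1 hO.1 c hc
  exact ⟨c, R, hR, h⟩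

lemma isBounded_closure (hO : IsConvexPolyhedralDomain O) : Bornology.IsBounded (closure O) :=
  (Mesh.isCompact_closure hO).isBounded

/-- Contraction followed by mollification approximates a continuous function. -/
lemma exists_moll_close (hO : IsConvexPolyhedralDomain O) {f : Pt d → ℝ}
    (hf : ContinuousOn f (closure O)) {δ : ℝ} (hδ : 0 < δ) {c : Pt d} {R : ℝ} (hR : 0 < R)
    (hball : Metric.ball c R ⊆ O) :
    ∃ s : ℝ, 1 / 2 ≤ s ∧ s < 1 ∧ ∃ η : ContDiffBump (0 : Pt d), ∃ r, η.rOut < r ∧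
      ∀ x ∈ closure O, Metric.ball (c + s • (x - c)) r ⊆ O ∧
        |moll η O f (c + s • (x - c)) - f x| ≤ δ := by
  have huc := (Mesh.isCompact_closure hO).uniformContinuousOn_of_continuous hf
  obtain ⟨ρ, hρ, hclose⟩ := Metric.uniformContinuousOn_iff.1 huc (δ / 2) (by positivity)
  set D := Metric.diam (closure O) with hD
  have hD0 : 0 ≤ D := Metric.diam_nonneg
  -- Points move by at most `(1 - s) * D < ρ`; the summand 1 covers `D = 0`. The cap 1/2 keeps `s`
  -- away from zero, so that later Jacobians are at most `2 ^ d`.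
  set s : ℝ := 1 - min (1 / 2) (ρ / (2 * (D + 1))) with hs
  have hm0 : 0 < min (1 / 2) (ρ / (2 * (D + 1))) := by positivity
  have hs1 : s < 1 := by linarith
  have hs2 : 1 / 2 ≤ s := by have := min_le_left (1 / 2) (ρ / (2 * (D + 1))); linarith
  have hsD : (1 - s) * D < ρ := by
    have h1 : 1 - s ≤ ρ / (2 * (D + 1)) := by
      have := min_le_right (1 / 2) (ρ / (2 * (D + 1))); linarith
    have h2 : ρ / (2 * (D + 1)) * D < ρ := by
      rw [div_mul_eq_mul_div, div_lt_iff₀ (by positivity)]; nlinarith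
    nlinarith
  have hr : 0 < min ρ ((1 - s) * R) := lt_min hρ (mul_pos (by linarith) hR)
  set r := min ρ ((1 - s) * R) with hrdef
  refine ⟨s, hs2, hs1, ⟨r / 4, r / 2, by positivity, by linarith⟩, r, by
    show r / 2 < r; linarith, fun x hx => ?_⟩
  have hb : Metric.ball (c + s • (x - c)) r ⊆ O :=
    (Metric.ball_subset_ball (min_le_right _ _)).trans
      (ball_contract_subset hO hball (by linarith) hs1 hx)
  refine ⟨hb, ?_⟩
  have hxs : c + s • (x - c) ∈ closure O := subset_closure (hb (Metric.mem_ball_self hr))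
  have hcO : c ∈ closure O := subset_closure (hball (Metric.mem_ball_self hR))
  have h1 := abs_moll_sub_le (O := O) (⟨r / 4, r / 2, by positivity, by linarith⟩ :
      ContDiffBump (0 : Pt d)) hO.1.measurableSet (Mesh.integrableOn_of_continuousOn hO hf)
    (z := c + s • (x - c)) (ε := δ / 2)
    ((Metric.ball_subset_ball (by show r / 2 ≤ r; linarith)).trans hb) (fun y hy => by
      have hy' : dist y (c + s • (x - c)) < r / 2 := hy
      have hyb : y ∈ Metric.ball (c + s • (x - c)) r :=
        Metric.mem_ball.2 (hy'.trans (by linarith))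
      have := hclose y (subset_closure (hb hyb)) _ hxs
        ((Metric.mem_ball.1 hyb).trans_le (min_le_left _ _))
      rw [Real.dist_eq] at this
      exact this.le)
  have h2 : dist (f (c + s • (x - c))) (f x) < δ / 2 := by
    refine hclose _ hxs _ hx ?_
    have e : ∀ t : ℝ, c + t • (x - c) - x = (-(1 - t)) • (x - c) := fun t => by module
    rw [dist_eq_norm, e, norm_smul, norm_neg, Real.norm_eq_abs, abs_of_pos (by linarith)]
    refine lt_of_le_of_lt (mul_le_mul_of_nonneg_left ?_ (by linarith)) hsD
    rw [← dist_eq_norm]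
    exact Metric.dist_le_diam_of_mem (isBounded_closure hO) hx hcO
  rw [Real.dist_eq] at h2
  have := abs_sub_le (moll (⟨r / 4, r / 2, by positivity, by linarith⟩ :
      ContDiffBump (0 : Pt d)) O f (c + s • (x - c))) (f (c + s • (x - c))) (f x)
  linarith

/-- A continuous function with bounded weak derivatives on a convex domain is Lipschitz. -/
lemma abs_sub_le_of_hasWeakPartial (hO : IsConvexPolyhedralDomain O) {f : Pt d → ℝ}
    (hf : ContinuousOn f (closure O)) {Df : Fin d → Pt d → ℝ}
    (hD : ∀ i, HasWeakPartial O i f (Df i)) {b : Fin d → ℝ} (hb0 : ∀ i, 0 ≤ b i)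
    (hb : ∀ i, ∀ᵐ y ∂(volume.restrict O), |Df i y| ≤ b i) {x y : Pt d} (hx : x ∈ closure O)
    (hy : y ∈ closure O) : |f x - f y| ≤ (∑ i, b i) * dist x y := by
  obtain ⟨c, R, hR, hball⟩ := exists_ball_subset hO
  refine le_of_forall_pos_le_add fun δ hδ => ?_
  -- On the contracted copy of the closure, which is convex, the partial derivatives of the
  -- mollification are mollified weak derivatives and obey the same bounds. The mean value
  -- inequality applies there, the contraction only shortens distances, and each endpoint costs `δ /
  -- 2`.
  obtain ⟨s, hs2, hs1, η, r, hr, hs⟩ := exists_moll_close hO hf (half_pos hδ) hR hball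
  have hfi := Mesh.integrableOn_of_continuousOn hO hf
  have hL0 : 0 ≤ ∑ i, b i := Finset.sum_nonneg fun i _ => hb0 i
  have hcont := contDiff_moll η hO.1.measurableSet hfi
  set S := (fun x : Pt d => c + s • (x - c)) '' closure O with hS
  have hSc : Convex ℝ S := by
    have : S = (AffineMap.homothety c s : Pt d →ᵃ[ℝ] Pt d) '' closure O := by
      refine Set.image_congr fun x _ => ?_
      simp [AffineMap.homothety_apply, add_comm]
    rw [this]
    exact hO.2.2.1.closure.affine_image _
  have hder : ∀ z ∈ S, ‖fderiv ℝ (moll η O f) z‖ ≤ ∑ i, b i := by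
    rintro z ⟨x, hx, rfl⟩
    refine (norm_le_sum_single _).trans (Finset.sum_le_sum fun i _ => ?_)
    rw [fderiv_moll_of_hasWeakPartial η hO.1.measurableSet hfi (hD i)
      ((Metric.closedBall_subset_ball hr).trans (hs x hx).1)]
    exact abs_moll_le η (hb0 i) (hb i) _
  have key := hSc.norm_image_sub_le_of_norm_fderiv_le
    (fun z _ => (hcont.differentiable (by simp)) z) hder (x := c + s • (y - c))
    (y := c + s • (x - c)) ⟨y, hy, rfl⟩ ⟨x, hx, rfl⟩
  rw [add_sub_add_left_eq_sub, ← smul_sub, norm_smul, Real.norm_eq_abs, Real.norm_eq_abs,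
    abs_of_nonneg (by linarith : (0 : ℝ) ≤ s), sub_sub_sub_cancel_right, ← dist_eq_norm] at key
  have h1 := (hs x hx).2
  have h2 := (hs y hy).2
  have h3 : (∑ i, b i) * (s * dist x y) ≤ (∑ i, b i) * dist x y := by
    refine mul_le_mul_of_nonneg_left ?_ hL0
    nlinarith [dist_nonneg (x := x) (y := y)]
  rw [abs_le] at *
  constructor <;> linarith [h1.1, h1.2, h2.1, h2.2, key.1, key.2]

/-- Change of variables for the homothety with centre `c`; its Jacobian is `s ^ d`. -/
lemma lintegral_comp_contract (c : Pt d) {s : ℝ} (hs : 0 < s) (F : Pt d → ℝ≥0∞) :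
    ∫⁻ x, F (c + s • (x - c)) = ENNReal.ofReal ((s ^ d)⁻¹) * ∫⁻ x, F x := by
  have e1 : ∀ x, F (c + s • (x - c)) = (fun y => F ((c - s • c) + y)) (s • x) := fun x => by
    simp only; congr 1; rw [smul_sub]; abel
  simp only [e1]
  have hm : MeasurableEmbedding (fun x : Pt d => s • x) :=
    (Homeomorph.smulOfNeZero s hs.ne').measurableEmbedding
  rw [← hm.lintegral_map (fun y => F ((c - s • c) + y)), Measure.map_addHaar_smul _ hs.ne',
    lintegral_smul_measure, lintegral_add_left_eq_self F, finrank_euclideanSpace,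
    Fintype.card_fin, abs_of_pos (by positivity), smul_eq_mul]

lemma setLIntegral_comp_contract_le (hO : IsConvexPolyhedralDomain O) {c : Pt d} (hc : c ∈ O)
    {s : ℝ} (hs : 0 < s) (hs1 : s ≤ 1) (F : Pt d → ℝ≥0∞) :
    ∫⁻ x in O, F (c + s • (x - c)) ≤ ENNReal.ofReal ((s ^ d)⁻¹) * ∫⁻ x in O, F x := by
  rw [← lintegral_indicator hO.1.measurableSet, ← lintegral_indicator hO.1.measurableSet,
    ← lintegral_comp_contract c hs]
  refine lintegral_mono fun x => ?_
  by_cases hx : x ∈ O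
  · have : c + s • (x - c) ∈ O := by
      have := hO.2.2.1 hc hx (by linarith : 0 ≤ 1 - s) hs.le (by ring)
      convert this using 1
      rw [sub_smul, one_smul, smul_sub]; abel
    simp [hx, this]
  · simp [hx]

lemma lintegral_sq_lt_top {g : Pt d → ℝ} (hg : MemLp g 2 (volume.restrict O)) :
    ∫⁻ x in O, ‖g x‖ₑ ^ 2 < ∞ := by
  have := (eLpNorm_lt_top_iff_lintegral_rpow_enorm_lt_top (p := 2) (by norm_num) (by norm_num)).1
    hg.2
  simpa using this

lemma ENNReal_sq_sum_le {ι : Type*} (s : Finset ι) (a : ι → ℝ≥0∞) :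
    (∑ i ∈ s, a i) ^ 2 ≤ s.card * ∑ i ∈ s, a i ^ 2 := by
  have := ENNReal.inner_le_Lp_mul_Lq s (fun _ => 1) a Real.HolderConjugate.two_two
  have h2 := ENNReal.rpow_le_rpow this (z := 2) (by norm_num)
  rw [ENNReal.mul_rpow_of_nonneg _ _ (by norm_num), ← ENNReal.rpow_mul, ← ENNReal.rpow_mul] at h2
  norm_num at h2
  exact h2

lemma enorm_smul_sq_le {F : Type*} [NormedAddCommGroup F] [NormedSpace ℝ F] {s : ℝ} (hs : 0 ≤ s)
    (hs1 : s ≤ 1) (L : F) : ‖s • L‖ₑ ≤ ‖L‖ₑ := by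
  rw [← ofReal_norm, ← ofReal_norm, norm_smul, Real.norm_of_nonneg hs]
  exact ENNReal.ofReal_le_ofReal (mul_le_of_le_one_left (norm_nonneg _) hs1)

lemma enorm_sq_le_sum_single {F : Type*} [NormedAddCommGroup F] [NormedSpace ℝ F]
    (L : Pt d →L[ℝ] F) : ‖L‖ₑ ^ 2 ≤ d * ∑ i, ‖L (EuclideanSpace.single i (1 : ℝ))‖ₑ ^ 2 := by
  have h : ‖L‖ₑ ≤ ∑ i, ‖L (EuclideanSpace.single i (1 : ℝ))‖ₑ := by
    simp only [← ofReal_norm]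
    rw [← ENNReal.ofReal_sum_of_nonneg fun i _ => norm_nonneg _]
    exact ENNReal.ofReal_le_ofReal (norm_le_sum_single L)
  refine (pow_le_pow_left' h 2).trans ((ENNReal_sq_sum_le _ _).trans (le_of_eq ?_))
  simp

set_option maxHeartbeats 400000 in
/-- Smooth functions that approximate an `H²` function at finitely many points and have controlled
derivatives in `L²`. -/
lemma exists_smooth_approx (hO : IsConvexPolyhedralDomain O) {f : Pt d → ℝ}
    (hf : IsInitialDatum O f) : ∃ B : ℝ≥0∞, B < ∞ ∧ ∀ δ : ℝ, 0 < δ →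
      ∃ w : Pt d → ℝ, ContDiff ℝ 2 w ∧ (∀ x ∈ closure O, |w x - f x| ≤ δ) ∧
        ∫⁻ x in O, ‖fderiv ℝ w x‖ₑ ^ 2 ≤ B ∧ ∫⁻ x in O, ‖fderiv ℝ (fderiv ℝ w) x‖ₑ ^ 2 ≤ B := by
  obtain ⟨hfc, -, Df, DDf, hDf, hDDf⟩ := hf
  obtain ⟨c, R, hR, hball⟩ := exists_ball_subset hO
  have hcO : c ∈ O := hball (Metric.mem_ball_self hR)
  -- These bounds do not depend on `δ`: `2 ^ d` bounds the Jacobian factor for all `s ≥ 1 / 2`, and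
  -- each factor `d` comes from estimating an operator norm by its values on the coordinate vectors.
  set B1 : ℝ≥0∞ := d * ∑ i, 2 ^ d * ∫⁻ x in O, ‖Df i x‖ₑ ^ 2 with hB1
  set B2 : ℝ≥0∞ := d * ∑ j, d * ∑ i, 2 ^ d * ∫⁻ x in O, ‖DDf i j x‖ₑ ^ 2 with hB2
  have h1 : B1 < ∞ := ENNReal.mul_lt_top (ENNReal.natCast_lt_top _) (ENNReal.sum_lt_top.2
    fun i _ => ENNReal.mul_lt_top (ENNReal.pow_lt_top (by norm_num))
      (lintegral_sq_lt_top (hDf i).2))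
  have h2 : B2 < ∞ := ENNReal.mul_lt_top (ENNReal.natCast_lt_top _) (ENNReal.sum_lt_top.2
    fun j _ => ENNReal.mul_lt_top (ENNReal.natCast_lt_top _) (ENNReal.sum_lt_top.2
    fun i _ => ENNReal.mul_lt_top (ENNReal.pow_lt_top (by norm_num))
      (lintegral_sq_lt_top (hDDf i j).2)))
  refine ⟨max B1 B2, max_lt h1 h2, fun δ hδ => ?_⟩
  obtain ⟨s, hs2, hs1, η, r, hr, hs⟩ := exists_moll_close hO hfc hδ hR hball
  have hfi := Mesh.integrableOn_of_continuousOn hO hfc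
  have hfin : IsFiniteMeasure ((volume : Measure (Pt d)).restrict O) :=
    ⟨by rw [Measure.restrict_apply_univ]
        exact (measure_mono subset_closure).trans_lt (Mesh.isCompact_closure hO).measure_lt_top⟩
  have hDfi : ∀ i, IntegrableOn (Df i) O := fun i => (hDf i).2.integrable (by norm_num)
  have hs0 : 0 < s := by linarith
  set U := moll η O f with hU
  have hUc : ContDiff ℝ (⊤ : ℕ∞) U := contDiff_moll η hO.1.measurableSet hfi
  have hUic : ∀ i, ContDiff ℝ (⊤ : ℕ∞) (moll η O (Df i)) :=
    fun i => contDiff_moll η hO.1.measurableSet (hDfi i)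
  have hT : ∀ x, HasFDerivAt (fun x : Pt d => c + s • (x - c))
      (s • ContinuousLinearMap.id ℝ (Pt d)) x := fun x =>
    (((hasFDerivAt_id x).sub_const c).const_smul s).const_add c
  have hw1 : ∀ x, fderiv ℝ (fun x => U (c + s • (x - c))) x = s • fderiv ℝ U (c + s • (x - c)) := by
    intro x
    have := ((hUc.differentiable (by simp)) (c + s • (x - c))).hasFDerivAt.comp x (hT x)
    simp only [Function.comp_def] at this
    rw [this.fderiv]
    ext v; simp
  have hUc2 : ContDiff ℝ 2 U := contDiff_infty.1 hUc 2
  have hU1 : ContDiff ℝ 1 (fderiv ℝ U) := hUc2.fderiv_right (by norm_num)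
  have hw2 : ∀ x, fderiv ℝ (fderiv ℝ (fun x => U (c + s • (x - c)))) x
      = s • s • fderiv ℝ (fderiv ℝ U) (c + s • (x - c)) := by
    intro x
    rw [funext hw1]
    have := (((hU1.differentiable one_ne_zero) (c + s • (x - c))).hasFDerivAt.comp x
      (hT x)).const_smul s
    simp only [Function.comp_def] at this
    refine this.fderiv.trans ?_
    ext v; simp
  have hd1 : ∀ z ∈ {z | Metric.closedBall z η.rOut ⊆ O}, ∀ i,
      fderiv ℝ U z (EuclideanSpace.single i (1 : ℝ)) = moll η O (Df i) z := fun z hz i =>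
    fderiv_moll_of_hasWeakPartial η hO.1.measurableSet hfi (hDf i).1 hz
  have hd2 : ∀ x ∈ closure O, ∀ i j,
      fderiv ℝ (fderiv ℝ U) (c + s • (x - c)) (EuclideanSpace.single j (1 : ℝ))
        (EuclideanSpace.single i (1 : ℝ)) = moll η O (DDf i j) (c + s • (x - c)) := by
    intro x hx i j
    -- The formula for the first derivatives is differentiated again, so it is needed in a
    -- neighbourhood. This is why the bump radius was taken strictly smaller than `r`.
    have hnear : ∀ᶠ z in nhds (c + s • (x - c)), Metric.closedBall z η.rOut ⊆ O := by
      filter_upwards [Metric.ball_mem_nhds (c + s • (x - c)) (sub_pos.2 hr)] with z hz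
      refine (fun y hy => (hs x hx).1 ?_)
      rw [Metric.mem_ball] at hz ⊢
      rw [Metric.mem_closedBall] at hy
      linarith [dist_triangle y z (c + s • (x - c))]
    have e1 : (fun z => fderiv ℝ U z (EuclideanSpace.single i (1 : ℝ)))
        =ᶠ[nhds (c + s • (x - c))] moll η O (Df i) := by
      filter_upwards [hnear] with z hz using hd1 z hz i
    rw [← fderiv_moll_of_hasWeakPartial η hO.1.measurableSet (hDfi i) (hDDf i j).1
      hnear.self_of_nhds, ← e1.fderiv_eq]
    rw [fderiv_clm_apply ((hU1.differentiable one_ne_zero) _) (differentiableAt_const _)]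
    simp
  have hscale : ENNReal.ofReal ((s ^ d)⁻¹) ≤ 2 ^ d := by
    have : (s ^ d)⁻¹ ≤ 2 ^ d := by
      rw [← inv_pow]
      refine pow_le_pow_left₀ (by positivity) ?_ d
      rw [inv_le_comm₀ hs0 (by norm_num)]; linarith
    calc _ ≤ ENNReal.ofReal (2 ^ d) := ENNReal.ofReal_le_ofReal this
      _ = 2 ^ d := by rw [ENNReal.ofReal_pow (by norm_num)]; norm_num
  have hint : ∀ g : Pt d → ℝ, AEStronglyMeasurable g (volume.restrict O) →
      ∫⁻ x in O, ‖moll η O g (c + s • (x - c))‖ₑ ^ 2 ≤ 2 ^ d * ∫⁻ x in O, ‖g x‖ₑ ^ 2 := by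
    intro g hg
    refine (setLIntegral_comp_contract_le hO hcO hs0 hs1.le (fun z => ‖moll η O g z‖ₑ ^ 2)).trans ?_
    exact mul_le_mul' hscale ((setLIntegral_le_lintegral _ _).trans (lintegral_moll_sq_le η hg))
  have hmoll_meas : ∀ i, Measurable fun x => ‖moll η O (Df i) (c + s • (x - c))‖ₑ ^ 2 := fun i =>
    (((hUic i).continuous.comp (continuous_const.add
      ((continuous_id.sub continuous_const).const_smul s))).measurable.enorm.pow_const 2)
  have hmeas2 : ∀ i j, Measurable fun x =>
      ‖fderiv ℝ (fderiv ℝ U) (c + s • (x - c)) (EuclideanSpace.single j (1 : ℝ))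
        (EuclideanSpace.single i (1 : ℝ))‖ₑ ^ 2 := fun i j => by
    have h1 : Continuous fun x => fderiv ℝ (fderiv ℝ U) (c + s • (x - c)) :=
      (hU1.continuous_fderiv one_ne_zero).comp (continuous_const.add
        ((continuous_id.sub continuous_const).const_smul s))
    exact (((h1.clm_apply continuous_const).clm_apply
      continuous_const).measurable.enorm.pow_const 2)
  refine ⟨fun x => U (c + s • (x - c)), ?_, fun x hx => (hs x hx).2, ?_, ?_⟩
  · exact hUc2.comp
      (contDiff_const.add ((contDiff_id.sub contDiff_const).const_smul s))
  · refine le_trans ?_ (le_max_left _ _)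
    calc ∫⁻ x in O, ‖fderiv ℝ (fun x => U (c + s • (x - c))) x‖ₑ ^ 2
        ≤ ∫⁻ x in O, d * ∑ i, ‖moll η O (Df i) (c + s • (x - c))‖ₑ ^ 2 := by
          refine setLIntegral_mono' hO.1.measurableSet fun x hx => ?_
          rw [hw1]
          have h3 := enorm_smul_sq_le hs0.le hs1.le (fderiv ℝ U (c + s • (x - c)))
          refine (pow_le_pow_left' h3 2).trans ?_
          refine (enorm_sq_le_sum_single _).trans (le_of_eq ?_)
          congr 1
          exact Finset.sum_congr rfl fun i _ => by
            rw [hd1 _ ((Metric.closedBall_subset_ball hr).trans (hs x (subset_closure hx)).1)]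
      _ = d * ∑ i, ∫⁻ x in O, ‖moll η O (Df i) (c + s • (x - c))‖ₑ ^ 2 := by
          rw [lintegral_const_mul _ (Finset.measurable_fun_sum _ fun i _ => hmoll_meas i),
            lintegral_finsetSum _ fun i _ => hmoll_meas i]
      _ ≤ B1 := by
          rw [hB1]
          gcongr with i _
          exact hint _ (hDf i).2.1
  · refine le_trans ?_ (le_max_right _ _)
    calc ∫⁻ x in O, ‖fderiv ℝ (fderiv ℝ (fun x => U (c + s • (x - c)))) x‖ₑ ^ 2
        ≤ ∫⁻ x in O, d * ∑ j, d * ∑ i,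
            ‖fderiv ℝ (fderiv ℝ U) (c + s • (x - c)) (EuclideanSpace.single j (1 : ℝ))
              (EuclideanSpace.single i (1 : ℝ))‖ₑ ^ 2 := by
          refine lintegral_mono fun x => ?_
          rw [hw2]
          have h3 := enorm_smul_sq_le hs0.le hs1.le (fderiv ℝ (fderiv ℝ U) (c + s • (x - c)))
          have h4 := enorm_smul_sq_le hs0.le hs1.le (s • fderiv ℝ (fderiv ℝ U) (c + s • (x - c)))
          refine (pow_le_pow_left' (h4.trans h3) 2).trans ?_
          refine (enorm_sq_le_sum_single _).trans ?_
          gcongr with j _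
          exact enorm_sq_le_sum_single _
      _ = d * ∑ j, d * ∑ i, ∫⁻ x in O,
            ‖fderiv ℝ (fderiv ℝ U) (c + s • (x - c)) (EuclideanSpace.single j (1 : ℝ))
              (EuclideanSpace.single i (1 : ℝ))‖ₑ ^ 2 := by
          rw [lintegral_const_mul _ (Finset.measurable_fun_sum _ fun j _ =>
            (Finset.measurable_fun_sum _ fun i _ => hmeas2 i j).const_mul _),
            lintegral_finsetSum _ fun j _ =>
            (Finset.measurable_fun_sum _ fun i _ => hmeas2 i j).const_mul _]
          congr 1
          refine Finset.sum_congr rfl fun j _ => ?_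
          rw [lintegral_const_mul _ (Finset.measurable_fun_sum _ fun i _ => hmeas2 i j),
            lintegral_finsetSum _ fun i _ => hmeas2 i j]
      _ ≤ B2 := by
          rw [hB2]
          gcongr with j _ i _
          refine le_trans (le_of_eq ?_) (hint _ (hDDf i j).2.1)
          refine setLIntegral_congr_fun hO.1.measurableSet fun x hx => ?_
          simp only [hd2 x (subset_closure hx) i j]

end Approximation

end SAV

/-! ### The `L²` mass of a function close to the boundary. -/

namespace SAV

section Layer

variable {d : ℕ} {O : Set (Pt d)}

lemma enorm_sq_eq_ofReal (a : ℝ) : ‖a‖ₑ ^ 2 = ENNReal.ofReal (a ^ 2) := by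
  rw [Real.enorm_eq_ofReal_abs, ← ENNReal.ofReal_pow (abs_nonneg _), sq_abs]

lemma hasDerivAt_contract {F : Type*} [NormedAddCommGroup F] [NormedSpace ℝ F] {v : Pt d → F}
    (hv : Differentiable ℝ v) (c e : Pt d) (t : ℝ) :
    HasDerivAt (fun t : ℝ => v (c + t • e)) (fderiv ℝ v (c + t • e) e) t := by
  have h1 : HasDerivAt (fun t : ℝ => c + t • e) e t := by
    simpa using ((hasDerivAt_id t).smul_const e).const_add c
  exact (hv (c + t • e)).hasFDerivAt.comp_hasDerivAt t h1

/-- Comparison of the values of a function at a point and at a contracted point. -/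
lemma enorm_sq_le_contract {v : Pt d → ℝ} (hv : ContDiff ℝ 1 v) (c x : Pt d) {s D : ℝ}
    (hs1 : s ≤ 1) (hD : ‖x - c‖ ≤ D) :
    ‖v x‖ₑ ^ 2 ≤ ‖v (c + s • (x - c))‖ₑ ^ 2 + ENNReal.ofReal D *
      ∫⁻ t in Set.Ioc s 1, (‖v (c + t • (x - c))‖ₑ ^ 2 + ‖fderiv ℝ v (c + t • (x - c))‖ₑ ^ 2) := by
  have hD0 : 0 ≤ D := (norm_nonneg _).trans hD
  have hvd : Differentiable ℝ v := hv.differentiable one_ne_zero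
  have hcv : Continuous fun t : ℝ => v (c + t • (x - c)) :=
    hv.continuous.comp (continuous_const.add (continuous_id.smul continuous_const))
  have hcd : Continuous fun t : ℝ => fderiv ℝ v (c + t • (x - c)) :=
    (hv.continuous_fderiv one_ne_zero).comp
      (continuous_const.add (continuous_id.smul continuous_const))
  -- The fundamental theorem of calculus is applied to the square along the ray from `c`, so that
  -- the comparison has coefficient exactly one in front of the contracted value.
  have hder : ∀ t ∈ Set.uIcc s 1, HasDerivAt (fun t : ℝ => v (c + t • (x - c)) ^ 2)
      (2 * v (c + t • (x - c)) * fderiv ℝ v (c + t • (x - c)) (x - c)) t := by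
    intro t _
    have := (hasDerivAt_contract hvd c (x - c) t).fun_pow 2
    refine this.congr_deriv ?_
    simp
  have hcont : Continuous fun t : ℝ =>
      2 * v (c + t • (x - c)) * fderiv ℝ v (c + t • (x - c)) (x - c) :=
    (continuous_const.mul hcv).mul (hcd.clm_apply continuous_const)
  have hFTC := intervalIntegral.integral_eq_sub_of_hasDerivAt hder (hcont.intervalIntegrable _ _)
  have e1 : c + (1 : ℝ) • (x - c) = x := by simp
  rw [e1, intervalIntegral.integral_of_le hs1] at hFTC
  have hg : Continuous fun t : ℝ =>
      D * (v (c + t • (x - c)) ^ 2 + ‖fderiv ℝ v (c + t • (x - c))‖ ^ 2) :=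
    continuous_const.mul ((hcv.pow 2).add (hcd.norm.pow 2))
  have hbound : ∫ t in Set.Ioc s 1, 2 * v (c + t • (x - c)) * fderiv ℝ v (c + t • (x - c)) (x - c)
      ≤ ∫ t in Set.Ioc s 1, D * (v (c + t • (x - c)) ^ 2 + ‖fderiv ℝ v (c + t • (x - c))‖ ^ 2) := by
    refine setIntegral_mono (hcont.integrableOn_Ioc) (hg.integrableOn_Ioc) fun t => ?_
    have h1 : |fderiv ℝ v (c + t • (x - c)) (x - c)| ≤ ‖fderiv ℝ v (c + t • (x - c))‖ * D :=
      ((fderiv ℝ v (c + t • (x - c))).le_opNorm _).trans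
        (mul_le_mul_of_nonneg_left hD (norm_nonneg _))
    have h2 : v (c + t • (x - c)) * fderiv ℝ v (c + t • (x - c)) (x - c)
        ≤ |v (c + t • (x - c))| * (‖fderiv ℝ v (c + t • (x - c))‖ * D) := by
      refine (le_abs_self _).trans ?_
      rw [abs_mul]
      exact mul_le_mul_of_nonneg_left h1 (abs_nonneg _)
    have h3 := sq_nonneg (|v (c + t • (x - c))| - ‖fderiv ℝ v (c + t • (x - c))‖)
    have h4 := sq_abs (v (c + t • (x - c)))
    nlinarith
  have hreal : v x ^ 2 ≤ v (c + s • (x - c)) ^ 2 + ∫ t in Set.Ioc s 1,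
      D * (v (c + t • (x - c)) ^ 2 + ‖fderiv ℝ v (c + t • (x - c))‖ ^ 2) := by linarith
  rw [enorm_sq_eq_ofReal, enorm_sq_eq_ofReal]
  refine (ENNReal.ofReal_le_ofReal hreal).trans ?_
  rw [ENNReal.ofReal_add (sq_nonneg _) (integral_nonneg fun t => by positivity)]
  refine add_le_add le_rfl (le_of_eq ?_)
  rw [ofReal_integral_eq_lintegral_ofReal hg.integrableOn_Ioc
    (Filter.Eventually.of_forall fun t => by positivity), ← lintegral_const_mul']
  · refine lintegral_congr fun t => ?_
    rw [ENNReal.ofReal_mul hD0, ENNReal.ofReal_add (sq_nonneg _) (sq_nonneg _),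
      enorm_sq_eq_ofReal, ENNReal.ofReal_pow (norm_nonneg _), ofReal_norm]
  · exact ENNReal.ofReal_ne_top

/-- The part of a convex domain outside of a contracted copy has small `L²` weight. -/
lemma lintegral_diff_contract_le (hO : IsConvexPolyhedralDomain O) {v : Pt d → ℝ}
    (hv : ContDiff ℝ 1 v) {c : Pt d} (hc : c ∈ O) {s : ℝ} (hs : 1 / 2 ≤ s) (hs1 : s < 1) :
    ∫⁻ x in {x ∈ O | c + s⁻¹ • (x - c) ∉ O}, ‖v x‖ₑ ^ 2
      ≤ ENNReal.ofReal ((2 : ℝ) ^ d * (d + Metric.diam (closure O)) * (1 - s)) *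
        ((∫⁻ x in O, ‖v x‖ₑ ^ 2) + ∫⁻ x in O, ‖fderiv ℝ v x‖ₑ ^ 2) := by
  have hs0 : 0 < s := by linarith
  set D := Metric.diam (closure O) with hD
  have hD0 : 0 ≤ D := Metric.diam_nonneg
  have hvm : Measurable fun x => ‖v x‖ₑ ^ 2 := hv.continuous.measurable.enorm.pow_const 2
  have hdm : Measurable fun x => ‖fderiv ℝ v x‖ₑ ^ 2 :=
    (hv.continuous_fderiv one_ne_zero).measurable.enorm.pow_const 2
  set A := ∫⁻ x in O, ‖v x‖ₑ ^ 2 with hA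
  set A' := ∫⁻ x in O, ‖fderiv ℝ v x‖ₑ ^ 2 with hA'
  set Os := {x : Pt d | c + s⁻¹ • (x - c) ∈ O} with hOs
  have hOsm : MeasurableSet Os :=
    (hO.1.preimage (continuous_const.add
      ((continuous_id.sub continuous_const).const_smul s⁻¹))).measurableSet
  have hOsub : Os ⊆ O := by
    intro x hx
    have := hO.2.2.1 hc hx (by linarith : 0 ≤ 1 - s) hs0.le (by ring)
    convert this using 1
    rw [smul_add, smul_smul, mul_inv_cancel₀ hs0.ne']
    module
  have hAfin : A < ∞ := by
    have h1 : IntegrableOn (fun x => v x ^ 2) O :=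
      Mesh.integrableOn_of_continuousOn hO (hv.continuous.pow 2).continuousOn
    have h2 := h1.2
    rw [hasFiniteIntegral_iff_enorm] at h2
    refine lt_of_le_of_lt (le_of_eq ?_) h2
    exact lintegral_congr fun x => by rw [enorm_pow]
  set As := ∫⁻ x in Os, ‖v x‖ₑ ^ 2 with hAs
  have hAsA : As ≤ A := lintegral_mono_set hOsub
  have hsplit : A = As + ∫⁻ x in {x ∈ O | c + s⁻¹ • (x - c) ∉ O}, ‖v x‖ₑ ^ 2 := by
    have h := lintegral_inter_add_sdiff (μ := (volume : Measure (Pt d))) (fun x => ‖v x‖ₑ ^ 2) O hOsm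
    rw [Set.inter_eq_right.2 hOsub] at h
    exact h.symm
  have hcontr : ∫⁻ x in O, ‖v (c + s • (x - c))‖ₑ ^ 2 = ENNReal.ofReal ((s ^ d)⁻¹) * As := by
    rw [hAs, ← lintegral_indicator hO.1.measurableSet, ← lintegral_indicator hOsm,
      ← lintegral_comp_contract c hs0]
    refine lintegral_congr fun x => ?_
    have e : c + s⁻¹ • (c + s • (x - c) - c) = x := by
      rw [add_sub_cancel_left, smul_smul, inv_mul_cancel₀ hs0.ne']; simp
    have : c + s • (x - c) ∈ Os ↔ x ∈ O := by
      rw [hOs]; simp only [Set.mem_ofPred_eq, e]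
    by_cases hx : x ∈ O
    · simp [hx, this.2 hx]
    · rw [Set.indicator_of_notMem hx, Set.indicator_of_notMem fun h => hx (this.1 h)]
  -- The ray comparison is integrated over `O`. The contracted value becomes an integral over the
  -- contracted copy `Os`; the ray integral has length `1 - s`, and Tonelli with a change of
  -- variables for each `t` bounds it.
  have hmain : A ≤ ENNReal.ofReal ((s ^ d)⁻¹) * As
      + ENNReal.ofReal (2 ^ d * D * (1 - s)) * (A + A') := by
    have hcm : ∀ t : ℝ, Measurable fun x : Pt d => c + t • (x - c) := fun t =>
      (continuous_const.add ((continuous_id.sub continuous_const).const_smul t)).measurable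
    have hpair : Measurable fun p : Pt d × ℝ =>
        ‖v (c + p.2 • (p.1 - c))‖ₑ ^ 2 + ‖fderiv ℝ v (c + p.2 • (p.1 - c))‖ₑ ^ 2 := by
      have : Measurable fun p : Pt d × ℝ => c + p.2 • (p.1 - c) :=
        (continuous_const.add (continuous_snd.smul (continuous_fst.sub continuous_const))).measurable
      exact (hvm.comp this).add (hdm.comp this)
    calc A ≤ ∫⁻ x in O, (‖v (c + s • (x - c))‖ₑ ^ 2 + ENNReal.ofReal D *
          ∫⁻ t in Set.Ioc s 1, (‖v (c + t • (x - c))‖ₑ ^ 2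
            + ‖fderiv ℝ v (c + t • (x - c))‖ₑ ^ 2)) := by
          refine setLIntegral_mono' hO.1.measurableSet fun x hx => ?_
          refine enorm_sq_le_contract hv c x hs1.le ?_
          rw [← dist_eq_norm]
          exact Metric.dist_le_diam_of_mem (isBounded_closure hO) (subset_closure hx)
            (subset_closure hc)
      _ = ENNReal.ofReal ((s ^ d)⁻¹) * As + ENNReal.ofReal D * ∫⁻ x in O,
          ∫⁻ t in Set.Ioc s 1, (‖v (c + t • (x - c))‖ₑ ^ 2
            + ‖fderiv ℝ v (c + t • (x - c))‖ₑ ^ 2) := by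
          have hm0 : Measurable fun x => ‖v (c + s • (x - c))‖ₑ ^ 2 := hvm.comp (hcm s)
          rw [lintegral_add_left hm0, hcontr, lintegral_const_mul' _ _ ENNReal.ofReal_ne_top]
      _ = ENNReal.ofReal ((s ^ d)⁻¹) * As + ENNReal.ofReal D * ∫⁻ t in Set.Ioc s 1,
          ∫⁻ x in O, (‖v (c + t • (x - c))‖ₑ ^ 2 + ‖fderiv ℝ v (c + t • (x - c))‖ₑ ^ 2) := by
          rw [lintegral_lintegral_swap]
          exact hpair.aemeasurable
      _ ≤ ENNReal.ofReal ((s ^ d)⁻¹) * As + ENNReal.ofReal D * ∫⁻ t in Set.Ioc s 1,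
          (2 ^ d * (A + A')) := by
          refine add_le_add le_rfl (mul_le_mul' le_rfl ?_)
          refine setLIntegral_mono' measurableSet_Ioc fun t ht => ?_
          have ht0 : 0 < t := hs0.trans ht.1
          refine (setLIntegral_comp_contract_le hO hc ht0 ht.2
            (fun z => ‖v z‖ₑ ^ 2 + ‖fderiv ℝ v z‖ₑ ^ 2)).trans ?_
          rw [lintegral_add_left hvm]
          refine mul_le_mul' ?_ le_rfl
          have : (t ^ d)⁻¹ ≤ 2 ^ d := by
            rw [← inv_pow]
            refine pow_le_pow_left₀ (by positivity) ?_ d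
            rw [inv_le_comm₀ ht0 (by norm_num)]; linarith [ht.1]
          calc _ ≤ ENNReal.ofReal (2 ^ d) := ENNReal.ofReal_le_ofReal this
            _ = 2 ^ d := by rw [ENNReal.ofReal_pow (by norm_num)]; norm_num
      _ = _ := by
          rw [setLIntegral_const, Real.volume_Ioc, ENNReal.ofReal_mul (by positivity),
            ENNReal.ofReal_mul (by positivity), ENNReal.ofReal_pow (by norm_num)]
          norm_num
          ring
  -- By Bernoulli's inequality the Jacobian exceeds one by a multiple of `1 - s` only. Then the
  -- integral over the contracted copy, which is finite, cancels and only the outer part is left.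
  have hcoef : ENNReal.ofReal ((s ^ d)⁻¹) ≤ 1 + ENNReal.ofReal (2 ^ d * d * (1 - s)) := by
    rw [← ENNReal.ofReal_one, ← ENNReal.ofReal_add zero_le_one
      (mul_nonneg (by positivity) (by linarith))]
    refine ENNReal.ofReal_le_ofReal ?_
    have h1 : 1 - d * (1 - s) ≤ s ^ d := by
      have := one_add_mul_le_pow (show (-2 : ℝ) ≤ s - 1 by linarith) d
      rw [add_sub_cancel] at this
      linarith
    have h2 : (s ^ d)⁻¹ ≤ 2 ^ d := by
      rw [← inv_pow]
      refine pow_le_pow_left₀ (by positivity) ?_ d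
      rw [inv_le_comm₀ hs0 (by norm_num)]; linarith
    have h3 : 0 < s ^ d := by positivity
    have h4 : (s ^ d)⁻¹ - 1 = (1 - s ^ d) * (s ^ d)⁻¹ := by field_simp
    have h5 : (1 - s ^ d) * (s ^ d)⁻¹ ≤ d * (1 - s) * 2 ^ d :=
      mul_le_mul (by linarith) h2 (by positivity) (mul_nonneg (by positivity) (by linarith))
    linarith
  have hfinal : As + ∫⁻ x in {x ∈ O | c + s⁻¹ • (x - c) ∉ O}, ‖v x‖ₑ ^ 2
      ≤ As + (ENNReal.ofReal (2 ^ d * d * (1 - s)) * (A + A')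
        + ENNReal.ofReal (2 ^ d * D * (1 - s)) * (A + A')) := by
    rw [← hsplit]
    calc A ≤ _ := hmain
      _ ≤ (1 + ENNReal.ofReal (2 ^ d * d * (1 - s))) * As
          + ENNReal.ofReal (2 ^ d * D * (1 - s)) * (A + A') := by gcongr
      _ = As + (ENNReal.ofReal (2 ^ d * d * (1 - s)) * As
        + ENNReal.ofReal (2 ^ d * D * (1 - s)) * (A + A')) := by ring
      _ ≤ _ := by
        gcongr
        exact hAsA.trans le_self_add
  have h := (ENNReal.add_le_add_iff_left (hAsA.trans_lt hAfin).ne).1 hfinal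
  refine h.trans (le_of_eq ?_)
  rw [← add_mul, ← ENNReal.ofReal_add (mul_nonneg (by positivity) (by linarith))
    (mul_nonneg (by positivity) (by linarith))]
  congr 1
  ring_nf

/-- A function in `H¹` has small `L²` weight close to the boundary. -/
lemma lintegral_layer_le (hO : IsConvexPolyhedralDomain O) : ∃ C : ℝ, 0 ≤ C ∧
    ∀ v : Pt d → ℝ, ContDiff ℝ 1 v → ∀ h : ℝ, 0 < h →
      ∫⁻ x in {x ∈ O | ∃ y ∈ frontier O, dist x y ≤ h}, ‖v x‖ₑ ^ 2
        ≤ ENNReal.ofReal (C * h) * ((∫⁻ x in O, ‖v x‖ₑ ^ 2) + ∫⁻ x in O, ‖fderiv ℝ v x‖ₑ ^ 2) := by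
  obtain ⟨c, R, hR, hball⟩ := exists_ball_subset hO
  have hcO : c ∈ O := hball (Metric.mem_ball_self hR)
  set D := Metric.diam (closure O) with hD
  have hD0 : 0 ≤ D := Metric.diam_nonneg
  set C := max ((2 : ℝ) ^ d * (d + D) * (2 / R)) (4 / R) with hC
  have hC0 : 0 ≤ C := le_trans (by positivity) (le_max_right _ _)
  refine ⟨C, hC0, fun v hv h hh => ?_⟩
  -- For small `h` take `s = 1 - 2 h / R`: around each point of the contracted copy a ball of radius
  -- `2 h` lies in `O`, so the layer is disjoint from that copy. For large `h` the constant `4 / R`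
  -- makes the claim trivial.
  rcases le_or_gt h (R / 4) with hhR | hhR
  · have hs : 1 / 2 ≤ 1 - 2 * h / R := by
      have : 2 * h / R ≤ 1 / 2 := by rw [div_le_iff₀ hR]; linarith
      linarith
    have hs1 : 1 - 2 * h / R < 1 := by
      have : 0 < 2 * h / R := by positivity
      linarith
    refine (lintegral_mono_set ?_).trans ((lintegral_diff_contract_le hO hv hcO hs hs1).trans ?_)
    · rintro x ⟨hx, y, hy, hxy⟩
      refine ⟨hx, fun hxO => ?_⟩
      have hsub := ball_contract_subset hO hball (s := 1 - 2 * h / R) (by linarith) hs1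
        (subset_closure hxO)
      have e : c + (1 - 2 * h / R) • (c + (1 - 2 * h / R)⁻¹ • (x - c) - c) = x := by
        rw [add_sub_cancel_left, smul_smul, mul_inv_cancel₀ (by linarith)]; simp
      rw [e] at hsub
      have hyO : y ∈ O := hsub (by
        rw [Metric.mem_ball, dist_comm]
        have : (1 - (1 - 2 * h / R)) * R = 2 * h := by field_simp; ring
        rw [this]; linarith)
      rw [hO.1.frontier_eq] at hy
      exact hy.2 hyO
    · refine mul_le_mul' (ENNReal.ofReal_le_ofReal ?_) le_rfl
      have e : (2 : ℝ) ^ d * (d + D) * (1 - (1 - 2 * h / R)) = (2 : ℝ) ^ d * (d + D) * (2 / R) * h := by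
        ring
      rw [← hD, e]
      exact mul_le_mul_of_nonneg_right (le_max_left _ _) hh.le
  · have h1 : 1 ≤ C * h := by
      have h2 : 4 / R * h ≤ C * h := mul_le_mul_of_nonneg_right (le_max_right _ _) hh.le
      have h3 : 1 ≤ 4 / R * h := by
        rw [div_mul_eq_mul_div, le_div_iff₀ hR]; linarith
      linarith
    calc ∫⁻ x in {x ∈ O | ∃ y ∈ frontier O, dist x y ≤ h}, ‖v x‖ₑ ^ 2
        ≤ ∫⁻ x in O, ‖v x‖ₑ ^ 2 := lintegral_mono_set fun x hx => hx.1
      _ ≤ 1 * ((∫⁻ x in O, ‖v x‖ₑ ^ 2) + ∫⁻ x in O, ‖fderiv ℝ v x‖ₑ ^ 2) := by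
        rw [one_mul]; exact le_self_add
      _ ≤ _ := by
        gcongr
        rw [← ENNReal.ofReal_one]
        exact ENNReal.ofReal_le_ofReal h1

end Layer

end SAV

/-! ### Averaged Taylor expansion in dimension at most three. -/

namespace SAV

section Taylor

variable {d : ℕ}

/-- Taylor's formula with integral remainder around `z`. -/
lemma enorm_taylor_le {w : Pt d → ℝ} (hw : ContDiff ℝ 2 w) (x z : Pt d) {h : ℝ}
    (hxz : dist z x ≤ h) :
    ‖w x - w z - fderiv ℝ w z (x - z)‖ₑ ≤ ENNReal.ofReal (h ^ 2) *
      ∫⁻ t in Set.Ioc (0 : ℝ) 1, ENNReal.ofReal t *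
        ‖fderiv ℝ (fderiv ℝ w) (x + t • (z - x))‖ₑ := by
  have hw1 : ContDiff ℝ 1 (fderiv ℝ w) := hw.fderiv_right (by norm_num)
  have hwd : Differentiable ℝ w := hw.differentiable (by norm_num)
  have hwd1 : Differentiable ℝ (fderiv ℝ w) := hw1.differentiable one_ne_zero
  -- An antiderivative of the remainder. The expansion is around `z` but parametrized from `x`, so
  -- the second derivative carries the weight `t`, which vanishes where the segments from all `z`
  -- meet.
  have hder : ∀ t ∈ Set.uIcc (0 : ℝ) 1, HasDerivAt
      (fun t : ℝ => t * fderiv ℝ w (x + t • (z - x)) (z - x) - w (x + t • (z - x)))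
      (t * fderiv ℝ (fderiv ℝ w) (x + t • (z - x)) (z - x) (z - x)) t := by
    intro t _
    have h1 := hasDerivAt_contract hwd x (z - x) t
    have h2 := (hasDerivAt_contract hwd1 x (z - x) t).clm_apply (hasDerivAt_const t (z - x))
    have h3 := ((hasDerivAt_id t).mul h2).sub h1
    refine h3.congr_deriv ?_
    simp
  have hcont : Continuous fun t : ℝ =>
      t * fderiv ℝ (fderiv ℝ w) (x + t • (z - x)) (z - x) (z - x) := by
    have h1 : Continuous fun t : ℝ => fderiv ℝ (fderiv ℝ w) (x + t • (z - x)) :=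
      (hw1.continuous_fderiv one_ne_zero).comp
        (continuous_const.add (continuous_id.smul continuous_const))
    exact continuous_id.mul ((h1.clm_apply continuous_const).clm_apply continuous_const)
  have hFTC := intervalIntegral.integral_eq_sub_of_hasDerivAt hder (hcont.intervalIntegrable _ _)
  have e : w x - w z - fderiv ℝ w z (x - z)
      = ∫ t in Set.Ioc (0 : ℝ) 1, t * fderiv ℝ (fderiv ℝ w) (x + t • (z - x)) (z - x) (z - x) := by
    rw [intervalIntegral.integral_of_le zero_le_one] at hFTC
    rw [hFTC]
    have : fderiv ℝ w z (x - z) = - fderiv ℝ w z (z - x) := by rw [← map_neg]; simp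
    rw [this]
    simp; ring
  rw [e]
  refine (enorm_integral_le_lintegral_enorm _).trans ?_
  rw [← lintegral_const_mul' _ _ ENNReal.ofReal_ne_top]
  refine setLIntegral_mono' measurableSet_Ioc fun t ht => ?_
  rw [← ofReal_norm, ← ofReal_norm, ← ENNReal.ofReal_mul ht.1.le, ← ENNReal.ofReal_mul (sq_nonneg _)]
  refine ENNReal.ofReal_le_ofReal ?_
  have hh : ‖z - x‖ ≤ h := by rwa [← dist_eq_norm]
  rw [norm_mul, Real.norm_of_nonneg ht.1.le]
  calc t * ‖fderiv ℝ (fderiv ℝ w) (x + t • (z - x)) (z - x) (z - x)‖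
      ≤ t * (‖fderiv ℝ (fderiv ℝ w) (x + t • (z - x))‖ * h * h) := by
        refine mul_le_mul_of_nonneg_left ?_ ht.1.le
        refine (ContinuousLinearMap.le_opNorm _ _).trans ?_
        have h0 : 0 ≤ h := (norm_nonneg _).trans hh
        refine mul_le_mul ((ContinuousLinearMap.le_opNorm _ _).trans ?_) hh (norm_nonneg _)
          (by positivity)
        exact mul_le_mul_of_nonneg_left hh (norm_nonneg _)
    _ = _ := by ring

lemma setLIntegral_comp_contract_convex_le {K : Set (Pt d)} (hK : Convex ℝ K)
    (hKm : MeasurableSet K) {c : Pt d} (hc : c ∈ K)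
    {s : ℝ} (hs : 0 < s) (hs1 : s ≤ 1) (F : Pt d → ℝ≥0∞) :
    ∫⁻ x in K, F (c + s • (x - c)) ≤ ENNReal.ofReal ((s ^ d)⁻¹) * ∫⁻ x in K, F x := by
  rw [← lintegral_indicator hKm, ← lintegral_indicator hKm, ← lintegral_comp_contract c hs]
  refine lintegral_mono fun x => ?_
  by_cases hx : x ∈ K
  · have : c + s • (x - c) ∈ K := by
      have := hK hc hx (by linarith : 0 ≤ 1 - s) hs.le (by ring)
      convert this using 1
      rw [sub_smul, one_smul, smul_sub]; abel
    simp [hx, this]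
  · simp [hx]

lemma lintegral_rpow_neg_half :
    ∫⁻ t in Set.Ioc (0 : ℝ) 1, ENNReal.ofReal (t ^ (-(1 / 2) : ℝ)) = 2 := by
  have hi : IntegrableOn (fun t : ℝ => t ^ (-(1 / 2) : ℝ)) (Set.Ioc 0 1) := by
    have := intervalIntegral.intervalIntegrable_rpow' (a := 0) (b := 1)
      (show (-1 : ℝ) < -(1 / 2) by norm_num)
    rwa [intervalIntegrable_iff_integrableOn_Ioc_of_le zero_le_one] at this
  rw [← ofReal_integral_eq_lintegral_ofReal hi]
  · rw [← intervalIntegral.integral_of_le zero_le_one,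
      integral_rpow (Or.inl (by norm_num))]
    norm_num
  · rw [Filter.EventuallyLE, ae_restrict_iff' measurableSet_Ioc]
    exact Filter.Eventually.of_forall fun t ht => Real.rpow_nonneg ht.1.le _

/-- The mean of the Taylor remainders over a convex set. -/
lemma sq_lintegral_remainder_le (hd : d ≤ 3) {H : Pt d → ℝ≥0∞} (hH : Measurable H)
    {K : Set (Pt d)} (hK : Convex ℝ K) (hKm : MeasurableSet K) {x : Pt d} (hx : x ∈ K) :
    (∫⁻ z in K, ∫⁻ t in Set.Ioc (0 : ℝ) 1, ENNReal.ofReal t * H (x + t • (z - x))) ^ 2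
      ≤ 4 * volume K * ∫⁻ z in K, H z ^ 2 := by
  set b : ℝ≥0∞ := volume K * ∫⁻ z in K, H z ^ 2 with hb
  have hT : Measurable fun p : Pt d × ℝ => x + p.2 • (p.1 - x) :=
    (continuous_const.add (continuous_snd.smul (continuous_fst.sub continuous_const))).measurable
  have hTt : ∀ t : ℝ, Measurable fun z : Pt d => x + t • (z - x) := fun t =>
    (continuous_const.add ((continuous_id.sub continuous_const).const_smul t)).measurable
  have key : ∀ t ∈ Set.Ioc (0 : ℝ) 1, ∫⁻ z in K, ENNReal.ofReal t * H (x + t • (z - x))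
      ≤ ENNReal.ofReal (t ^ (-(1 / 2) : ℝ)) * b ^ (1 / 2 : ℝ) := by
    intro t ht
    have h1 : (∫⁻ z in K, H (x + t • (z - x))) ^ 2 ≤ ENNReal.ofReal ((t ^ d)⁻¹) * b := by
      have h2 := sq_lintegral_mul_le (volume.restrict K) (w := fun _ => 1)
        (f := fun z => H (x + t • (z - x))) aemeasurable_const (hH.comp (hTt t)).aemeasurable
      simp only [one_mul, one_pow, lintegral_one, Measure.restrict_apply_univ] at h2
      refine h2.trans ?_
      calc _ ≤ volume K * (ENNReal.ofReal ((t ^ d)⁻¹) * ∫⁻ z in K, H z ^ 2) := by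
            gcongr
            exact setLIntegral_comp_contract_convex_le hK hKm hx ht.1 ht.2 (fun z => H z ^ 2)
        _ = _ := by rw [hb]; ring
    have h3 : (ENNReal.ofReal t * ∫⁻ z in K, H (x + t • (z - x))) ^ 2
        ≤ ENNReal.ofReal (t ^ (-1 : ℝ)) * b := by
      rw [mul_pow, ← ENNReal.ofReal_pow ht.1.le]
      refine (mul_le_mul' le_rfl h1).trans ?_
      rw [← mul_assoc, ← ENNReal.ofReal_mul (by positivity)]
      gcongr
      rw [Real.rpow_neg_one]
      -- This is where `d ≤ 3` enters: the weight `t ^ 2` against the Jacobian `t ^ (-d)` leaves at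
      -- most `t⁻¹`, and its square root is integrable at zero.
      have h4 : t ^ 3 ≤ t ^ d := pow_le_pow_of_le_one ht.1.le ht.2 hd
      have h5 : 0 < t ^ d := pow_pos ht.1 d
      rw [← div_eq_mul_inv, div_le_iff₀ h5, inv_mul_eq_div, le_div_iff₀ ht.1]
      calc t ^ 2 * t = t ^ 3 := by ring
        _ ≤ _ := h4
    rw [lintegral_const_mul' _ _ ENNReal.ofReal_ne_top]
    generalize ENNReal.ofReal t * ∫⁻ z in K, H (x + t • (z - x)) = X at h3 ⊢
    have h6 := ENNReal.rpow_le_rpow h3 (z := 1 / 2) (by norm_num)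
    have h7 : (X ^ 2) ^ (1 / 2 : ℝ) = X := by
      rw [← ENNReal.rpow_natCast, ← ENNReal.rpow_mul]; norm_num
    rw [h7, ENNReal.mul_rpow_of_nonneg _ _ (by norm_num),
      ENNReal.ofReal_rpow_of_pos (Real.rpow_pos_of_pos ht.1 _), ← Real.rpow_mul ht.1.le] at h6
    norm_num at h6 ⊢
    exact h6
  have hswap : ∫⁻ z in K, ∫⁻ t in Set.Ioc (0 : ℝ) 1, ENNReal.ofReal t * H (x + t • (z - x))
      = ∫⁻ t in Set.Ioc (0 : ℝ) 1, ∫⁻ z in K, ENNReal.ofReal t * H (x + t • (z - x)) := by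
    rw [lintegral_lintegral_swap]
    exact ((measurable_snd.ennreal_ofReal).mul (hH.comp hT)).aemeasurable
  rw [hswap]
  calc _ ≤ (∫⁻ t in Set.Ioc (0 : ℝ) 1, ENNReal.ofReal (t ^ (-(1 / 2) : ℝ)) * b ^ (1 / 2 : ℝ)) ^ 2 :=
        pow_le_pow_left' (setLIntegral_mono' measurableSet_Ioc key) 2
    _ = (2 * b ^ (1 / 2 : ℝ)) ^ 2 := by
        rw [lintegral_mul_const _ (by fun_prop), lintegral_rpow_neg_half]
    _ = 4 * b := by
        rw [mul_pow, ← ENNReal.rpow_natCast (b ^ (1 / 2 : ℝ)), ← ENNReal.rpow_mul]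
        norm_num
    _ = _ := by rw [hb]; ring

/-- Point differences of a `C²` function on a convex set of diameter `h`, in dimension at most
three. -/
lemma volume_mul_enorm_sub_sq_le (hd : d ≤ 3) {w : Pt d → ℝ} (hw : ContDiff ℝ 2 w)
    {K : Set (Pt d)} (hK : Convex ℝ K) (hKm : MeasurableSet K) (hKfin : volume K ≠ ∞) {h : ℝ}
    (hdiam : ∀ x ∈ K, ∀ y ∈ K, dist x y ≤ h) {x y : Pt d} (hx : x ∈ K) (hy : y ∈ K) :
    volume K * ‖w x - w y‖ₑ ^ 2 ≤ ENNReal.ofReal (3 * h ^ 2) * (∫⁻ z in K, ‖fderiv ℝ w z‖ₑ ^ 2)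
      + ENNReal.ofReal (24 * h ^ 4) * ∫⁻ z in K, ‖fderiv ℝ (fderiv ℝ w) z‖ₑ ^ 2 := by
  rcases eq_or_ne (volume K) 0 with h0 | h0
  · simp [h0]
  have hh : 0 ≤ h := dist_nonneg.trans (hdiam x hx y hy)
  have hw1 : ContDiff ℝ 1 (fderiv ℝ w) := hw.fderiv_right (by norm_num)
  have hm1 : Measurable fun z => ‖fderiv ℝ w z‖ₑ := hw1.continuous.measurable.enorm
  have hm2 : Measurable fun z => ‖fderiv ℝ (fderiv ℝ w) z‖ₑ :=
    (hw1.continuous_fderiv one_ne_zero).measurable.enorm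
  set I1 := ∫⁻ z in K, ‖fderiv ℝ w z‖ₑ ^ 2 with hI1
  set I2 := ∫⁻ z in K, ‖fderiv ℝ (fderiv ℝ w) z‖ₑ ^ 2 with hI2
  set S : Pt d → ℝ≥0∞ := fun x => ∫⁻ z in K, ∫⁻ t in Set.Ioc (0 : ℝ) 1,
    ENNReal.ofReal t * ‖fderiv ℝ (fderiv ℝ w) (x + t • (z - x))‖ₑ with hS
  have hSx : ∀ x ∈ K, S x ^ 2 ≤ 4 * volume K * I2 := fun x hx =>
    sq_lintegral_remainder_le hd hm2 hK hKm hx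
  have hG : (∫⁻ z in K, ‖fderiv ℝ w z‖ₑ) ^ 2 ≤ volume K * I1 := by
    have := sq_lintegral_mul_le (volume.restrict K) (w := fun _ => 1)
      (f := fun z => ‖fderiv ℝ w z‖ₑ) aemeasurable_const hm1.aemeasurable
    simpa using this
  have hinner : ∀ x : Pt d, Measurable fun z => ∫⁻ t in Set.Ioc (0 : ℝ) 1,
      ENNReal.ofReal t * ‖fderiv ℝ (fderiv ℝ w) (x + t • (z - x))‖ₑ := by
    intro x
    refine Measurable.lintegral_prod_right' (f := fun p : Pt d × ℝ => ENNReal.ofReal p.2 *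
      ‖fderiv ℝ (fderiv ℝ w) (x + p.2 • (p.1 - x))‖ₑ) ?_
    exact (measurable_snd.ennreal_ofReal).mul (hm2.comp (continuous_const.add
      (continuous_snd.smul (continuous_fst.sub continuous_const))).measurable)
  -- The difference is averaged over the expansion point `z`: two Taylor remainders plus the
  -- gradient at `z` applied to `x - y`. No pointwise bound on a derivative is needed.
  have hmean : volume K * ‖w x - w y‖ₑ
      ≤ ENNReal.ofReal (h ^ 2) * S x + ENNReal.ofReal (h ^ 2) * S y
        + ENNReal.ofReal h * ∫⁻ z in K, ‖fderiv ℝ w z‖ₑ := by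
    calc volume K * ‖w x - w y‖ₑ = ∫⁻ _z in K, ‖w x - w y‖ₑ := by
          rw [setLIntegral_const, mul_comm]
      _ ≤ ∫⁻ z in K, (ENNReal.ofReal (h ^ 2) * (∫⁻ t in Set.Ioc (0 : ℝ) 1,
            ENNReal.ofReal t * ‖fderiv ℝ (fderiv ℝ w) (x + t • (z - x))‖ₑ)
          + ENNReal.ofReal (h ^ 2) * (∫⁻ t in Set.Ioc (0 : ℝ) 1,
            ENNReal.ofReal t * ‖fderiv ℝ (fderiv ℝ w) (y + t • (z - y))‖ₑ)
          + ENNReal.ofReal h * ‖fderiv ℝ w z‖ₑ) := by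
          refine setLIntegral_mono' hKm fun z hz => ?_
          have e : w x - w y = (w x - w z - fderiv ℝ w z (x - z))
              + (-(w y - w z - fderiv ℝ w z (y - z))) + fderiv ℝ w z (x - y) := by
            have : fderiv ℝ w z (x - y) = fderiv ℝ w z (x - z) - fderiv ℝ w z (y - z) := by
              rw [← map_sub]; congr 1; abel
            rw [this]; ring
          rw [e]
          refine (enorm_add_le _ _).trans (add_le_add ((enorm_add_le _ _).trans
            (add_le_add ?_ ?_)) ?_)
          · exact enorm_taylor_le hw x z (hdiam z hz x hx)
          · rw [enorm_neg]
            exact enorm_taylor_le hw y z (hdiam z hz y hy)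
          · rw [← ofReal_norm, ← ofReal_norm, ← ENNReal.ofReal_mul hh]
            refine ENNReal.ofReal_le_ofReal ((ContinuousLinearMap.le_opNorm _ _).trans ?_)
            rw [mul_comm]
            refine mul_le_mul_of_nonneg_right ?_ (norm_nonneg _)
            rw [← dist_eq_norm]
            exact hdiam x hx y hy
      _ = _ := by
          rw [lintegral_add_left, lintegral_add_left, lintegral_const_mul', lintegral_const_mul',
            lintegral_const_mul']
          · exact ENNReal.ofReal_ne_top
          · exact ENNReal.ofReal_ne_top
          · exact ENNReal.ofReal_ne_top
          · exact (hinner x).const_mul _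
          · exact ((hinner x).const_mul _).add ((hinner y).const_mul _)
  have h3 : ∀ a b c : ℝ≥0∞, (a + b + c) ^ 2 ≤ 3 * (a ^ 2 + b ^ 2 + c ^ 2) := by
    intro a b c
    have := ENNReal_sq_sum_le Finset.univ ![a, b, c]
    simpa [Fin.sum_univ_three] using this
  have hsq : volume K * (volume K * ‖w x - w y‖ₑ ^ 2)
      ≤ volume K * (ENNReal.ofReal (3 * h ^ 2) * I1 + ENNReal.ofReal (24 * h ^ 4) * I2) := by
    have hp : ENNReal.ofReal (h ^ 2) ^ 2 = ENNReal.ofReal (h ^ 4) := by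
      rw [← ENNReal.ofReal_pow (by positivity)]; congr 1; ring
    have hp1 : ENNReal.ofReal h ^ 2 = ENNReal.ofReal (h ^ 2) := by
      rw [← ENNReal.ofReal_pow hh]
    calc volume K * (volume K * ‖w x - w y‖ₑ ^ 2) = (volume K * ‖w x - w y‖ₑ) ^ 2 := by ring
      _ ≤ _ := pow_le_pow_left' hmean 2
      _ ≤ _ := h3 _ _ _
      _ ≤ 3 * (ENNReal.ofReal (h ^ 4) * (4 * volume K * I2)
          + ENNReal.ofReal (h ^ 4) * (4 * volume K * I2)
          + ENNReal.ofReal (h ^ 2) * (volume K * I1)) := by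
          rw [mul_pow, mul_pow, mul_pow, hp, hp1]
          gcongr
          · exact hSx x hx
          · exact hSx y hy
      _ = _ := by
          rw [ENNReal.ofReal_mul (by norm_num), ENNReal.ofReal_mul (by norm_num)]
          norm_num
          ring
  exact (ENNReal.mul_le_mul_iff_right h0 hKfin).1 hsq

end Taylor

end SAV

/-! ### Elementwise stability of nodal interpolation. -/

namespace SAV

lemma contDiff_two_fderiv {d : ℕ} {w : Pt d → ℝ} (hw : ContDiff ℝ 2 w) :
    ContDiff ℝ 1 (fderiv ℝ w) := hw.fderiv_right (by norm_num)

/-- Squared `L²` norm of the differential over a simplex. -/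
noncomputable def gradSq {d : ℕ} {F : Type*} [NormedAddCommGroup F] [NormedSpace ℝ F]
    (v : Pt d → F) (t : Finset (Pt d)) : ℝ :=
  (∫⁻ z in convexHull ℝ (t : Set (Pt d)), ‖fderiv ℝ v z‖ₑ ^ 2).toReal

lemma gradSq_nonneg {d : ℕ} {F : Type*} [NormedAddCommGroup F] [NormedSpace ℝ F]
    (v : Pt d → F) (t : Finset (Pt d)) : 0 ≤ gradSq v t := ENNReal.toReal_nonneg

lemma lintegral_gradSq_lt_top {d : ℕ} {F : Type*} [NormedAddCommGroup F] [NormedSpace ℝ F]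
    {v : Pt d → F} (hv : ContDiff ℝ 1 v) (t : Finset (Pt d)) :
    ∫⁻ z in convexHull ℝ (t : Set (Pt d)), ‖fderiv ℝ v z‖ₑ ^ 2 < ∞ := by
  have hc := Mesh.isCompact_simplex t
  have h := ((hv.continuous_fderiv one_ne_zero).norm.pow 2).continuousOn.integrableOn_compact
    (μ := volume) hc
  have := h.2
  rw [hasFiniteIntegral_iff_enorm] at this
  refine lt_of_eq_of_lt (lintegral_congr fun z => ?_) this
  rw [← ofReal_norm, ← ofReal_norm, ← ENNReal.ofReal_pow (norm_nonneg _), Pi.pow_apply,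
    norm_pow, norm_norm]

namespace Mesh

variable {d : ℕ} {O : Set (Pt d)} (M : Mesh O)

/-- The function `hat v` equals one at `v` but vanishes on every face without the vertex `v`. -/
lemma mem_of_mem_convexHull {s : Finset (Pt d)} (hs : s ∈ M.cplx.faces) {v : Pt d}
    (hv : v ∈ M.nodes) (h : v ∈ convexHull ℝ (s : Set (Pt d))) : v ∈ s := by
  classical
  by_contra hvs
  have h1 := (M.hat_face hs h).1 v hvs
  rw [M.hat_node hv] at h1
  simp at h1

lemma dist_le_of_element {κ h : ℝ} (hq : M.IsQuasiuniform κ h) {t : Finset (Pt d)}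
    (ht : t ∈ M.elements) {x y : Pt d} (hx : x ∈ convexHull ℝ (t : Set (Pt d)))
    (hy : y ∈ convexHull ℝ (t : Set (Pt d))) : dist x y ≤ h :=
  (Metric.dist_le_diam_of_mem (isCompact_simplex t).isBounded hx hy).trans (hq t ht).1

lemma vol_pos_le {κ h : ℝ} (hκ : 0 < κ) (hh : 0 < h) (hq : M.IsQuasiuniform κ h)
    {t : Finset (Pt d)} (ht : t ∈ M.elements) :
    (κ * h / 2) ^ d * (volume : Measure (Pt d)).real (Metric.ball 0 1) ≤ vol t := by
  obtain ⟨c, hc⟩ := (hq t ht).2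
  have h1 : (volume : Measure (Pt d)).real (Metric.ball c (κ * h / 2))
      = (κ * h / 2) ^ d * (volume : Measure (Pt d)).real (Metric.ball 0 1) := by
    rw [measureReal_def, Measure.addHaar_ball_of_pos _ _ (by positivity), ENNReal.toReal_mul,
      ENNReal.toReal_ofReal (by positivity), finrank_euclideanSpace_fin]
    rfl
  rw [← h1]
  exact measureReal_mono hc (isCompact_simplex t).measure_lt_top.ne

lemma vol_pos {κ h : ℝ} (hκ : 0 < κ) (hh : 0 < h) (hq : M.IsQuasiuniform κ h)
    {t : Finset (Pt d)} (ht : t ∈ M.elements) : 0 < vol t := by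
  refine lt_of_lt_of_le ?_ (M.vol_pos_le hκ hh hq ht)
  have : 0 < (volume : Measure (Pt d)).real (Metric.ball 0 1) :=
    ENNReal.toReal_pos (Metric.measure_ball_pos _ _ one_pos).ne' measure_ball_lt_top.ne
  positivity

/-- A ball of diameter `κ h` fits into the bounded domain. The bound is used to absorb surplus
powers of `h`. -/
lemma mesh_size_le (hd : 1 ≤ d) (hO : IsConvexPolyhedralDomain O) {κ h : ℝ} (hκ : 0 < κ)
    (hh : 0 < h) (hq : M.IsQuasiuniform κ h) : h ≤ 2 * Metric.diam (closure O) / κ := by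
  obtain ⟨x, hx⟩ := hO.2.1
  obtain ⟨t, ht, -⟩ := M.exists_element_of_mem (subset_closure hx)
  obtain ⟨c, hc⟩ := (hq t ht).2
  set e : Pt d := EuclideanSpace.single ⟨0, hd⟩ (κ * h / 4) with he
  have hne : ‖e‖ = κ * h / 4 := by
    rw [he, PiLp.norm_single, Real.norm_of_nonneg (by positivity)]
  have hp : 0 < κ * h := by positivity
  have h1 : c + e ∈ Metric.ball c (κ * h / 2) := by
    rw [Metric.mem_ball, dist_eq_norm, add_sub_cancel_left, hne]; linarith
  have h2 : c - e ∈ Metric.ball c (κ * h / 2) := by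
    rw [Metric.mem_ball, dist_eq_norm, sub_sub_cancel_left, norm_neg, hne]; linarith
  have hsub := M.convexHull_subset_closure (M.element_face ht)
  have h3 := Metric.dist_le_diam_of_mem (isBounded_closure hO) (hsub (hc h1)) (hsub (hc h2))
  have h4 : dist (c + e) (c - e) = κ * h / 2 := by
    have : c + e - (c - e) = (2 : ℝ) • e := by module
    rw [dist_eq_norm, this, norm_smul, hne]; norm_num; ring
  rw [h4] at h3
  rw [le_div_iff₀ hκ]
  nlinarith

/-- An inverse estimate. Faces of every dimension inherit it from the ball of radius `κ h / 2` in an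
element that contains them. -/
lemma norm_tangentialGrad_le {κ h : ℝ} (hκ : 0 < κ) (hh : 0 < h) (hq : M.IsQuasiuniform κ h)
    {s : Finset (Pt d)} (hs : s ∈ M.cplx.faces) {u : Pt d → ℝ} (hu : M.MemU u) {a : ℝ}
    (ha : ∀ x ∈ s, ∀ y ∈ s, |u x - u y| ≤ a) : ‖tangentialGrad s u‖ * (κ * h) ≤ a := by
  obtain ⟨t, ht, hst⟩ := M.exists_element_superset hs
  obtain ⟨c, hc⟩ := (hq t ht).2
  have hp : 0 < κ * h := by positivity
  have := AffOn.norm_tangentialGrad_le hst (M.cplx.nonempty_of_mem_faces hs) (hu.affOn hs)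
    (fun a => (M.exists_affine_interp ht a).imp fun A hA => hA.1) (half_pos hp) hc ha
  convert this using 2
  ring

/-- Sums of integrals over elements are integrals over their union. -/
lemma sum_gradSq_le (hO : IsConvexPolyhedralDomain O) {F : Type*} [NormedAddCommGroup F]
    [NormedSpace ℝ F] {v : Pt d → F} (hv : ContDiff ℝ 1 v) {T : Finset (Finset (Pt d))}
    (hT : T ⊆ M.elements) {S : Set (Pt d)}
    (hS : ∀ t ∈ T, convexHull ℝ (t : Set (Pt d)) ∩ O ⊆ S) {B : ℝ≥0∞} (hB : B ≠ ∞)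
    (h : ∫⁻ x in S, ‖fderiv ℝ v x‖ₑ ^ 2 ≤ B) : ∑ t ∈ T, gradSq v t ≤ B.toReal := by
  have hd : ((T : Finset (Finset (Pt d))) : Set (Finset (Pt d))).Pairwise
      (Function.onFun (AEDisjoint (volume : Measure (Pt d)))
        fun t : Finset (Pt d) => convexHull ℝ (t : Set (Pt d))) := by
    intro a ha b hb hab
    exact M.volume_inter_elements (hT ha) (hT hb) hab
  have h1 := lintegral_biUnion_finset₀ hd (fun t _ => (measurableSet_simplex t).nullMeasurableSet)
    (fun x => ‖fderiv ℝ v x‖ₑ ^ 2)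
  have hm : MeasurableSet (⋃ t ∈ T, convexHull ℝ (t : Set (Pt d))) :=
    T.measurableSet_biUnion fun t _ => measurableSet_simplex t
  have hsub : (⋃ t ∈ T, convexHull ℝ (t : Set (Pt d))) ⊆ closure O :=
    Set.iUnion₂_subset fun t ht => M.convexHull_subset_closure (M.element_face (hT ht))
  have h2 : (volume : Measure (Pt d)).restrict (⋃ t ∈ T, convexHull ℝ (t : Set (Pt d)))
      = volume.restrict ((⋃ t ∈ T, convexHull ℝ (t : Set (Pt d))) ∩ O) := by
    rw [← Measure.restrict_restrict hm, restrict_closure hO, Measure.restrict_restrict hm,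
      Set.inter_eq_left.2 hsub]
  simp only [gradSq]
  rw [← ENNReal.toReal_sum fun t _ => (lintegral_gradSq_lt_top hv t).ne, ← h1, h2]
  refine ENNReal.toReal_mono hB (le_trans (lintegral_mono_set ?_) h)
  rw [Set.iUnion₂_inter]
  exact Set.iUnion₂_subset hS

/-- Gradients of interpolants in terms of a smooth approximation. -/
lemma norm_tangentialGrad_interp_sq_le (hd : d ≤ 3) {κ h δ : ℝ} (hκ : 0 < κ) (hh : 0 < h)
    (hq : M.IsQuasiuniform κ h) {f w : Pt d → ℝ} (hw : ContDiff ℝ 2 w)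
    (hwf : ∀ x ∈ closure O, |w x - f x| ≤ δ) {s t : Finset (Pt d)}
    (hs : s ∈ M.cplx.faces) (ht : t ∈ M.elements) (hst : s ⊆ t) :
    vol t * (‖tangentialGrad s (M.interp f)‖ ^ 2 * (κ * h) ^ 2)
      ≤ 6 * h ^ 2 * gradSq w t + 48 * h ^ 4 * gradSq (fderiv ℝ w) t + 8 * δ ^ 2 * vol t := by
  set J := 6 * h ^ 2 * gradSq w t + 48 * h ^ 4 * gradSq (fderiv ℝ w) t + 8 * δ ^ 2 * vol t with hJ
  have hv := M.vol_pos hκ hh hq ht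
  have hg1 := gradSq_nonneg w t
  have hg2 := gradSq_nonneg (fderiv ℝ w) t
  have hJ0 : 0 ≤ J := by positivity
  -- At the vertices the interpolant has the values of `f`, which are `δ`-close to those of `w`. The
  -- Taylor average for `w` runs over the whole element `t`, also when `s` is one of its boundary
  -- faces.
  have hosc : ∀ x ∈ s, ∀ y ∈ s, |M.interp f x - M.interp f y| ≤ √(J / vol t) := by
    intro x hx y hy
    rw [M.interp_node f (M.subset_nodes hs hx), M.interp_node f (M.subset_nodes hs hy)]
    refine Real.abs_le_sqrt ?_
    rw [le_div_iff₀ hv]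
    have hxt := subset_convexHull ℝ (t : Set (Pt d)) (hst hx)
    have hyt := subset_convexHull ℝ (t : Set (Pt d)) (hst hy)
    have hsub := M.convexHull_subset_closure (M.element_face ht)
    have h1 := volume_mul_enorm_sub_sq_le hd hw (convex_convexHull ℝ (t : Set (Pt d)))
      (measurableSet_simplex t) (isCompact_simplex t).measure_lt_top.ne
      (fun x hx y hy => M.dist_le_of_element hq ht hx hy) hxt hyt
    have hf1 := (lintegral_gradSq_lt_top (hw.of_le (by norm_num)) t).ne
    have hf2 := (lintegral_gradSq_lt_top (contDiff_two_fderiv hw) t).ne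
    have h2 := ENNReal.toReal_mono (ENNReal.add_ne_top.2
      ⟨ENNReal.mul_ne_top ENNReal.ofReal_ne_top hf1,
        ENNReal.mul_ne_top ENNReal.ofReal_ne_top hf2⟩) h1
    rw [ENNReal.toReal_add (ENNReal.mul_ne_top ENNReal.ofReal_ne_top hf1)
      (ENNReal.mul_ne_top ENNReal.ofReal_ne_top hf2), ENNReal.toReal_mul, ENNReal.toReal_mul,
      ENNReal.toReal_mul, enorm_sq_eq_ofReal, ENNReal.toReal_ofReal (by positivity),
      ENNReal.toReal_ofReal (by positivity), ENNReal.toReal_ofReal (by positivity)] at h2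
    change vol t * (w x - w y) ^ 2 ≤ 3 * h ^ 2 * gradSq w t
      + 24 * h ^ 4 * gradSq (fderiv ℝ w) t at h2
    have ax := abs_le.1 (hwf x (hsub hxt))
    have ay := abs_le.1 (hwf y (hsub hyt))
    have h3 : (f x - f y) ^ 2 ≤ 2 * (w x - w y) ^ 2 + 8 * δ ^ 2 := by
      have : ((w x - f x) - (w y - f y)) ^ 2 ≤ (2 * δ) ^ 2 := by
        rw [sq_le_sq, abs_le]
        rw [abs_of_nonneg (by linarith [ax.1, ax.2] : 0 ≤ 2 * δ)]
        constructor <;> linarith [ax.1, ax.2, ay.1, ay.2]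
      nlinarith [sq_nonneg ((w x - w y) + ((w x - f x) - (w y - f y)))]
    rw [hJ]
    nlinarith
  have h4 := M.norm_tangentialGrad_le hκ hh hq hs (M.memU_interp f) hosc
  have h5 := pow_le_pow_left₀ (by positivity) h4 2
  rw [Real.sq_sqrt (by positivity), mul_pow, le_div_iff₀ hv] at h5
  linarith

end Mesh
end SAV

/-! ### Dirichlet energies of the interpolated initial datum. -/

namespace SAV
namespace Mesh

variable {d : ℕ} {O : Set (Pt d)} (M : Mesh O)

lemma dirichlet_self (hO : IsConvexPolyhedralDomain O) {u : Pt d → ℝ} (hu : M.MemU u) :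
    dirichlet O u u = ∑ t ∈ M.elements, vol t * ‖tangentialGrad t u‖ ^ 2 := by
  rw [M.dirichlet_eq hO hu hu]
  exact Finset.sum_congr rfl fun t _ => by rw [real_inner_self_eq_norm_sq]

lemma dirichletBdry_self (u : Pt d → ℝ) :
    M.dirichletBdry u u = ∑ s ∈ M.bdryElements, area O s * ‖tangentialGrad s u‖ ^ 2 := by
  rw [M.dirichletBdry_eq]
  exact Finset.sum_congr rfl fun t _ => by rw [real_inner_self_eq_norm_sq]

/-- Elements overlap in null sets, so the elementwise bounds add up to integrals over `O`. The term
with `δ` loses two powers of `h`, which is harmless because `δ` may be chosen after the mesh. -/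
lemma dirichlet_interp_le (hO : IsConvexPolyhedralDomain O) (hd : d ≤ 3) {κ h δ : ℝ} (hκ : 0 < κ)
    (hh : 0 < h) (hq : M.IsQuasiuniform κ h) {f w : Pt d → ℝ} (hw : ContDiff ℝ 2 w)
    (hwf : ∀ x ∈ closure O, |w x - f x| ≤ δ) {B : ℝ≥0∞} (hB : B ≠ ∞)
    (h1 : ∫⁻ x in O, ‖fderiv ℝ w x‖ₑ ^ 2 ≤ B)
    (h2 : ∫⁻ x in O, ‖fderiv ℝ (fderiv ℝ w) x‖ₑ ^ 2 ≤ B) :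
    dirichlet O (M.interp f) (M.interp f) * (κ * h) ^ 2
      ≤ (6 * h ^ 2 + 48 * h ^ 4) * B.toReal + 8 * δ ^ 2 * (volume : Measure (Pt d)).real O := by
  rw [M.dirichlet_self hO (M.memU_interp f), Finset.sum_mul]
  have hsub : ∀ t ∈ M.elements, convexHull ℝ (t : Set (Pt d)) ∩ O ⊆ O :=
    fun t _ => Set.inter_subset_right
  have e1 := M.sum_gradSq_le hO (hw.of_le (by norm_num : (1 : WithTop ℕ∞) ≤ 2)) subset_rfl hsub hB h1
  have e2 := M.sum_gradSq_le hO (contDiff_two_fderiv hw) subset_rfl hsub hB h2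
  calc _ ≤ ∑ t ∈ M.elements, (6 * h ^ 2 * gradSq w t + 48 * h ^ 4 * gradSq (fderiv ℝ w) t
        + 8 * δ ^ 2 * vol t) := by
        refine Finset.sum_le_sum fun t ht => ?_
        rw [mul_assoc]
        exact M.norm_tangentialGrad_interp_sq_le hd hκ hh hq hw hwf (M.element_face ht) ht subset_rfl
    _ = 6 * h ^ 2 * (∑ t ∈ M.elements, gradSq w t)
        + 48 * h ^ 4 * (∑ t ∈ M.elements, gradSq (fderiv ℝ w) t)
        + 8 * δ ^ 2 * (volume : Measure (Pt d)).real O := by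
        rw [Finset.sum_add_distrib, Finset.sum_add_distrib, ← Finset.mul_sum, ← Finset.mul_sum,
          ← Finset.mul_sum, M.sum_vol hO]
    _ ≤ _ := by
        have := mul_le_mul_of_nonneg_left e1 (by positivity : 0 ≤ 6 * h ^ 2)
        have := mul_le_mul_of_nonneg_left e2 (by positivity : 0 ≤ 48 * h ^ 4)
        linarith

/-- The area of a boundary element is controlled by the volume of a neighbouring element. -/
lemma area_le_vol (hd : 1 ≤ d) {κ : ℝ} (hκ : 0 < κ) : ∃ c : ℝ, 0 ≤ c ∧
    ∀ (O : Set (Pt d)) (M : Mesh O) (h : ℝ), 0 < h → M.IsQuasiuniform κ h →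
      ∀ s ∈ M.bdryElements, ∀ t ∈ M.elements, s ⊆ t → h * area O s ≤ c * vol t := by
  set b := (volume : Measure (Pt d)).real (Metric.ball 0 1) with hb
  have hb0 : 0 < b :=
    ENNReal.toReal_pos (Metric.measure_ball_pos _ _ one_pos).ne' measure_ball_lt_top.ne
  refine ⟨(simplexConst (d - 1)).toReal / ((κ / 2) ^ d * b), by positivity, ?_⟩
  intro O M h hh hq s hs t ht hst
  have h1 := M.area_le hd hs hh.le fun x hx y hy => M.dist_le_of_element hq ht
    (subset_convexHull ℝ _ (hst hx)) (subset_convexHull ℝ _ (hst hy))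
  have h2 := M.vol_pos_le hκ hh hq ht
  have h3 : h * h ^ (d - 1) = h ^ d := by rw [← pow_succ']; congr 1; omega
  rw [div_mul_eq_mul_div, le_div_iff₀ (by positivity)]
  calc h * area O s * ((κ / 2) ^ d * b)
      ≤ h * ((simplexConst (d - 1)).toReal * h ^ (d - 1)) * ((κ / 2) ^ d * b) := by gcongr
    _ = (simplexConst (d - 1)).toReal * ((κ * h / 2) ^ d * b) := by
        rw [mul_div_right_comm κ h 2, mul_pow, ← h3]; ring
    _ ≤ _ := by gcongr

/-- The element behind a boundary element. -/
lemma exists_elementOf (hM : M.IsBdryCompatible) : ∃ K : Finset (Pt d) → Finset (Pt d),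
    (∀ s ∈ M.bdryElements, K s ∈ M.elements ∧ s ⊆ K s) ∧ Set.InjOn K M.bdryElements := by
  choose! K hK using fun s hs => (hM.2 s hs).exists
  have hmem : ∀ s ∈ M.bdryElements, s ⊆ K s := fun s hs x hx =>
    M.mem_of_mem_convexHull (M.element_face (hK s hs).1)
      (M.subset_nodes (M.bdryElement_face hs) hx)
      (((hK s hs).2 ▸ subset_convexHull ℝ (s : Set (Pt d)) hx :
        x ∈ convexHull ℝ (K s : Set (Pt d)) ∩ frontier O).1)
  refine ⟨K, fun s hs => ⟨(hK s hs).1, hmem s hs⟩, fun s hs s' hs' h => ?_⟩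
  -- A boundary element is the intersection of `Γ` with the element behind it, so that element
  -- determines its hull, and the hull determines the vertices. Injectivity ensures that no element
  -- is counted twice in the boundary sums.
  have hconv : convexHull ℝ (s : Set (Pt d)) = convexHull ℝ (s' : Set (Pt d)) := by
    rw [(hK s hs).2, (hK s' hs').2, h]
  refine Finset.Subset.antisymm (fun x hx => ?_) fun x hx => ?_
  · exact M.mem_of_mem_convexHull (M.bdryElement_face hs')
      (M.subset_nodes (M.bdryElement_face hs) hx) (hconv ▸ subset_convexHull ℝ _ hx)
  · exact M.mem_of_mem_convexHull (M.bdryElement_face hs)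
      (M.subset_nodes (M.bdryElement_face hs') hx) (hconv ▸ subset_convexHull ℝ _ hx)

/-- A discrete trace estimate. Passing from the area of a face to the volume of the element behind
it costs one power of `h`. These elements lie in the boundary layer of width `h`, so the gradient of
`w` is needed only there; the bound `B'` will be of order `h` and restores the lost power. -/
lemma dirichletBdry_interp_le (hO : IsConvexPolyhedralDomain O) (hd1 : 1 ≤ d) (hd : d ≤ 3)
    {κ h δ c : ℝ} (hκ : 0 < κ) (hh : 0 < h) (hq : M.IsQuasiuniform κ h) (hM : M.IsBdryCompatible)
    (hc0 : 0 ≤ c) (hc : ∀ s ∈ M.bdryElements, ∀ t ∈ M.elements, s ⊆ t → h * area O s ≤ c * vol t)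
    {f w : Pt d → ℝ} (hw : ContDiff ℝ 2 w)
    (hwf : ∀ x ∈ closure O, |w x - f x| ≤ δ) {B B' : ℝ≥0∞} (hB : B ≠ ∞) (hB' : B' ≠ ∞)
    (h1 : ∫⁻ x in {x ∈ O | ∃ y ∈ frontier O, dist x y ≤ h}, ‖fderiv ℝ w x‖ₑ ^ 2 ≤ B')
    (h2 : ∫⁻ x in O, ‖fderiv ℝ (fderiv ℝ w) x‖ₑ ^ 2 ≤ B) :
    dirichletBdry M (M.interp f) (M.interp f) * (κ * h) ^ 2 * h
      ≤ c * (6 * h ^ 2 * B'.toReal + 48 * h ^ 4 * B.toReal)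
        + 8 * δ ^ 2 * (surf O).real Set.univ * h := by
  classical
  obtain ⟨K, hK, hinj⟩ := M.exists_elementOf hM
  set T := M.bdryElements.image K with hT
  have hTsub : T ⊆ M.elements := by
    intro t ht
    obtain ⟨s, hs, rfl⟩ := Finset.mem_image.1 ht
    exact (hK s hs).1
  have hlayer : ∀ t ∈ T, convexHull ℝ (t : Set (Pt d)) ∩ O
      ⊆ {x ∈ O | ∃ y ∈ frontier O, dist x y ≤ h} := by
    intro t ht x hx
    obtain ⟨s, hs, rfl⟩ := Finset.mem_image.1 ht
    refine ⟨hx.2, ?_⟩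
    obtain ⟨v, hv⟩ := M.cplx.nonempty_of_mem_faces (M.bdryElement_face hs)
    exact ⟨v, (M.mem_bdryElements.1 hs).2.2 (subset_convexHull ℝ _ hv),
      M.dist_le_of_element hq (hK s hs).1 hx.1 (subset_convexHull ℝ _ ((hK s hs).2 hv))⟩
  have e1 := M.sum_gradSq_le hO (hw.of_le (by norm_num : (1 : WithTop ℕ∞) ≤ 2)) hTsub hlayer hB' h1
  have e2 := M.sum_gradSq_le hO (contDiff_two_fderiv hw) hTsub (S := O)
    (fun t _ => Set.inter_subset_right) hB h2
  rw [hT, Finset.sum_image hinj] at e1 e2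
  rw [M.dirichletBdry_self, Finset.sum_mul, Finset.sum_mul]
  calc _ ≤ ∑ s ∈ M.bdryElements, (c * (6 * h ^ 2 * gradSq w (K s)
        + 48 * h ^ 4 * gradSq (fderiv ℝ w) (K s)) + 8 * δ ^ 2 * area O s * h) := by
        refine Finset.sum_le_sum fun s hs => ?_
        obtain ⟨hKs, hsK⟩ := hK s hs
        have hg := M.norm_tangentialGrad_interp_sq_le hd hκ hh hq hw hwf
          (M.bdryElement_face hs) hKs hsK
        have hv := M.vol_pos hκ hh hq hKs
        have ha := hc s hs _ hKs hsK
        have ha0 : 0 ≤ area O s := area_nonneg s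
        set q := ‖tangentialGrad s (M.interp f)‖ ^ 2 * (κ * h) ^ 2
        set p := 6 * h ^ 2 * gradSq w (K s) + 48 * h ^ 4 * gradSq (fderiv ℝ w) (K s) with hp
        have hp0 : 0 ≤ p := by
          have := gradSq_nonneg w (K s)
          have := gradSq_nonneg (fderiv ℝ w) (K s)
          positivity
        have hq' : q ≤ p / vol (K s) + 8 * δ ^ 2 := by
          rw [div_add' _ _ _ hv.ne', le_div_iff₀ hv]; linarith
        calc area O s * ‖tangentialGrad s (M.interp f)‖ ^ 2 * (κ * h) ^ 2 * h
            = (h * area O s) * q := by ring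
          _ ≤ (h * area O s) * (p / vol (K s) + 8 * δ ^ 2) := by gcongr
          _ = (h * area O s) * (p / vol (K s)) + 8 * δ ^ 2 * area O s * h := by ring
          _ ≤ (c * vol (K s)) * (p / vol (K s)) + 8 * δ ^ 2 * area O s * h := by gcongr
          _ = _ := by field_simp
    _ = c * (6 * h ^ 2 * (∑ s ∈ M.bdryElements, gradSq w (K s))
        + 48 * h ^ 4 * (∑ s ∈ M.bdryElements, gradSq (fderiv ℝ w) (K s)))
        + 8 * δ ^ 2 * (surf O).real Set.univ * h := by
        rw [Finset.sum_add_distrib, ← Finset.mul_sum, Finset.sum_add_distrib, ← Finset.mul_sum,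
          ← Finset.mul_sum, ← Finset.sum_mul, ← Finset.mul_sum, M.sum_area hd1 hM]
    _ ≤ _ := by gcongr

end Mesh

/-- The layer estimate for the differential. -/
lemma lintegral_layer_fderiv_le {d : ℕ} {O : Set (Pt d)} (hO : IsConvexPolyhedralDomain O) :
    ∃ C : ℝ, 0 ≤ C ∧ ∀ w : Pt d → ℝ, ContDiff ℝ 2 w → ∀ h : ℝ, 0 < h → ∀ B : ℝ≥0∞,
      ∫⁻ x in O, ‖fderiv ℝ w x‖ₑ ^ 2 ≤ B → ∫⁻ x in O, ‖fderiv ℝ (fderiv ℝ w) x‖ₑ ^ 2 ≤ B →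
      ∫⁻ x in {x ∈ O | ∃ y ∈ frontier O, dist x y ≤ h}, ‖fderiv ℝ w x‖ₑ ^ 2
        ≤ ENNReal.ofReal (C * h) * B := by
  obtain ⟨C, hC, hl⟩ := lintegral_layer_le hO
  refine ⟨d * (d * (C * 2)), by positivity, fun w hw h hh B h1 h2 => ?_⟩
  have hw1 := contDiff_two_fderiv hw
  set e : Fin d → Pt d := fun i => EuclideanSpace.single i (1 : ℝ) with he
  have hne : ∀ i, ‖e i‖ₑ = 1 := fun i => by
    -- The scalar layer estimate is applied to each partial derivative of `w`; unit coordinate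
    -- vectors keep its `L²` norms below those of the full differentials.
    rw [← ofReal_norm, he, PiLp.norm_single]; simp
  have hvi : ∀ i, ContDiff ℝ 1 fun x => fderiv ℝ w x (e i) := fun i =>
    hw1.clm_apply contDiff_const
  have hb1 : ∀ i, ∫⁻ x in O, ‖fderiv ℝ w x (e i)‖ₑ ^ 2 ≤ B := fun i => by
    refine (lintegral_mono fun x => pow_le_pow_left' ?_ 2).trans h1
    have := (fderiv ℝ w x).le_opENorm (e i)
    rwa [hne, mul_one] at this
  have hb2 : ∀ i, ∫⁻ x in O, ‖fderiv ℝ (fun x => fderiv ℝ w x (e i)) x‖ₑ ^ 2 ≤ B := fun i => by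
    refine (lintegral_mono fun x => pow_le_pow_left' ?_ 2).trans h2
    have hfd : fderiv ℝ (fun x => fderiv ℝ w x (e i)) x
        = (ContinuousLinearMap.apply ℝ ℝ (e i)).comp (fderiv ℝ (fderiv ℝ w) x) := by
      have := ((ContinuousLinearMap.apply ℝ ℝ (e i)).hasFDerivAt.comp x
        ((hw1.differentiable one_ne_zero) x).hasFDerivAt).fderiv
      exact this
    rw [hfd, ← ofReal_norm, ← ofReal_norm]
    refine ENNReal.ofReal_le_ofReal ?_
    refine ContinuousLinearMap.opNorm_le_bound _ (norm_nonneg _) fun y => ?_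
    have h3 := (fderiv ℝ (fderiv ℝ w) x y).le_opNorm (e i)
    have h4 : ‖e i‖ = 1 := by rw [he, PiLp.norm_single]; simp
    rw [h4, mul_one] at h3
    exact h3.trans ((fderiv ℝ (fderiv ℝ w) x).le_opNorm y)
  calc _ ≤ ∫⁻ x in {x ∈ O | ∃ y ∈ frontier O, dist x y ≤ h},
        d * ∑ i, ‖fderiv ℝ w x (e i)‖ₑ ^ 2 := lintegral_mono fun x => enorm_sq_le_sum_single _
    _ = d * ∑ i, ∫⁻ x in {x ∈ O | ∃ y ∈ frontier O, dist x y ≤ h}, ‖fderiv ℝ w x (e i)‖ₑ ^ 2 := by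
        rw [lintegral_const_mul' _ _ (ENNReal.natCast_ne_top _), lintegral_finsetSum]
        exact fun i _ => (hvi i).continuous.measurable.enorm.pow_const 2
    _ ≤ d * ∑ _i : Fin d, ENNReal.ofReal (C * h) * (B + B) := by
        gcongr with i
        exact (hl _ (hvi i) h hh).trans (by gcongr; exacts [hb1 i, hb2 i])
    _ = _ := by
        rw [Finset.sum_const, Finset.card_univ, Fintype.card_fin, nsmul_eq_mul,
          ← two_mul, ← ENNReal.ofReal_natCast d, ← ENNReal.ofReal_ofNat 2]
        simp only [← mul_assoc]
        rw [← ENNReal.ofReal_mul (by positivity), ← ENNReal.ofReal_mul (by positivity),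
          ← ENNReal.ofReal_mul (by positivity)]
        congr 2; ring

/-- The Dirichlet energies of the interpolated initial datum are bounded. -/
lemma exists_initial_dirichlet_le {d : ℕ} {O : Set (Pt d)} (hO : IsConvexPolyhedralDomain O)
    (hd1 : 1 ≤ d) (hd : d ≤ 3) {f : Pt d → ℝ} (hf : IsInitialDatum O f) {κ : ℝ} (hκ : 0 < κ) :
    ∃ C : ℝ, ∀ h : ℝ, 0 < h → ∀ M : Mesh O, M.IsQuasiuniform κ h → M.IsBdryCompatible →
      dirichlet O (M.interp f) (M.interp f) ≤ C ∧ M.dirichletBdry (M.interp f) (M.interp f) ≤ C := by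
  obtain ⟨B, hB, happ⟩ := exists_smooth_approx hO hf
  obtain ⟨CL, hCL, hlay⟩ := lintegral_layer_fderiv_le hO
  obtain ⟨c, hc0, hc⟩ := Mesh.area_le_vol hd1 hκ
  set H := 2 * Metric.diam (closure O) / κ with hH
  set b := B.toReal
  have hb0 : 0 ≤ b := ENNReal.toReal_nonneg
  refine ⟨max ((6 + 48 * H ^ 2) * b / κ ^ 2 + 1) (c * (6 * CL + 48 * H) * b / κ ^ 2 + 1), ?_⟩
  intro h hh M hq hM
  have hhH : h ≤ H := M.mesh_size_le hd1 hO hκ hh hq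
  set V := (volume : Measure (Pt d)).real O
  set S := (surf O).real Set.univ
  have hV : 0 ≤ V := measureReal_nonneg
  have hS : 0 ≤ S := measureReal_nonneg
  -- The accuracy depends on `h`, which is allowed since `B` does not depend on `δ`. With this value
  -- the approximation errors are at most `(κ * h) ^ 2`, which is the summand 1 in the constants.
  set δ := √((κ * h) ^ 2 / (8 * (V + S + 1))) with hδ
  have hδ2 : δ ^ 2 = (κ * h) ^ 2 / (8 * (V + S + 1)) := Real.sq_sqrt (by positivity)
  have hδ0 : 0 < δ := Real.sqrt_pos.2 (by positivity)
  obtain ⟨w, hw, hwf, h1, h2⟩ := happ δ hδ0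
  have hκh : 0 < (κ * h) ^ 2 := by positivity
  have hsm : ∀ A, 0 ≤ A → A ≤ V + S → 8 * δ ^ 2 * A ≤ (κ * h) ^ 2 := fun A hA hAV => by
    rw [hδ2, ← mul_div_assoc, div_mul_eq_mul_div, div_le_iff₀ (by positivity)]
    nlinarith
  constructor
  · have := M.dirichlet_interp_le hO hd hκ hh hq hw hwf hB.ne h1 h2
    have h3 := hsm V hV (by linarith)
    refine le_trans ?_ (le_max_left _ _)
    refine le_of_mul_le_mul_right ?_ hκh
    refine this.trans ?_
    have e : ((6 + 48 * H ^ 2) * b / κ ^ 2 + 1) * (κ * h) ^ 2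
        = (6 * h ^ 2 + 48 * h ^ 2 * H ^ 2) * b + (κ * h) ^ 2 := by field_simp
    rw [e]
    have h4 : h ^ 4 ≤ h ^ 2 * H ^ 2 := by
      calc h ^ 4 = h ^ 2 * h ^ 2 := by ring
        _ ≤ _ := by gcongr
    nlinarith
  · have hl := hlay w hw h hh B h1 h2
    have := M.dirichletBdry_interp_le hO hd1 hd hκ hh hq hM hc0 (hc O M h hh hq) hw hwf hB.ne
      (ENNReal.mul_ne_top ENNReal.ofReal_ne_top hB.ne) hl h2
    rw [ENNReal.toReal_mul, ENNReal.toReal_ofReal (by positivity)] at this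
    have h3 := hsm S hS (by linarith)
    refine le_trans ?_ (le_max_right _ _)
    refine le_of_mul_le_mul_right ?_ (mul_pos hκh hh)
    rw [← mul_assoc]
    refine this.trans ?_
    have e : (c * (6 * CL + 48 * H) * b / κ ^ 2 + 1) * ((κ * h) ^ 2 * h)
        = c * (6 * h ^ 2 * (CL * h * b) + 48 * (h ^ 3 * H) * b) + (κ * h) ^ 2 * h := by
      field_simp
    rw [e]
    have h4 : h ^ 4 ≤ h ^ 3 * H := by
      calc h ^ 4 = h ^ 3 * h := by ring
        _ ≤ _ := by gcongr
    have h5 : 48 * h ^ 4 * b ≤ 48 * (h ^ 3 * H) * b := by gcongr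
    have h6 := mul_le_mul_of_nonneg_right h3 hh.le
    have h7 := mul_le_mul_of_nonneg_left h5 hc0
    change c * (6 * h ^ 2 * (CL * h * b) + 48 * h ^ 4 * b) + 8 * δ ^ 2 * S * h ≤ _
    linarith

end SAV

/-! ### Regularity of the noise modes. -/

namespace SAV

variable {d : ℕ} {O : Set (Pt d)}

/-- Almost everywhere bounds on a convex domain hold everywhere for continuous functions. -/
lemma abs_le_of_ae (hO : IsConvexPolyhedralDomain O) {f : Pt d → ℝ}
    (hf : ContinuousOn f (closure O)) {b : ℝ} (h : ∀ᵐ x ∂(volume.restrict O), |f x| ≤ b) :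
    ∀ x ∈ closure O, |f x| ≤ b := by
  -- The inequality is rewritten as an equality of continuous functions, which extends from almost
  -- everywhere to the closure of the interior.
  have h1 : (fun x => max |f x| b) =ᵐ[volume.restrict (closure O)] fun _ => b := by
    rw [← Mesh.restrict_closure hO]
    filter_upwards [h] with x hx using max_eq_right hx
  have h2 := Measure.eqOn_of_ae_eq h1 (hf.abs.sup continuousOn_const) continuousOn_const
    (closure_mono (interior_maximal subset_closure hO.1))
  exact fun x hx => max_eq_right_iff.1 (h2 hx)

/-- A continuous function in `W^{2,∞}` is bounded and Lipschitz continuous. -/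
lemma abs_le_w2InfNorm (hO : IsConvexPolyhedralDomain O) {f : Pt d → ℝ}
    (hf : ContinuousOn f (closure O)) (hfin : w2InfNorm O f ≠ ∞) :
    (∀ x ∈ closure O, |f x| ≤ (w2InfNorm O f).toReal) ∧
      ∀ x ∈ closure O, ∀ y ∈ closure O, |f x - f y| ≤ (w2InfNorm O f).toReal * dist x y := by
  -- Weak derivatives whose norms come within `ε` of the infimum avoid an appeal to their
  -- uniqueness; `ε` is removed at the end.
  have key : ∀ ε : ℝ, 0 < ε → (∀ x ∈ closure O, |f x| ≤ (w2InfNorm O f).toReal + ε) ∧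
      ∀ x ∈ closure O, ∀ y ∈ closure O,
        |f x - f y| ≤ ((w2InfNorm O f).toReal + ε) * dist x y := by
    intro ε hε
    have hlt : w2InfNorm O f < ENNReal.ofReal ((w2InfNorm O f).toReal + ε) := by
      rw [ENNReal.lt_ofReal_iff_toReal_lt hfin]
      linarith
    conv_lhs at hlt => rw [w2InfNorm]
    simp only [iInf_lt_iff] at hlt
    obtain ⟨Df, DDf, ⟨hDf, -⟩, hlt⟩ := hlt
    set S := ∑ i, eLpNorm (Df i) ∞ (volume.restrict O) with hS
    have hle : eLpNorm f ∞ (volume.restrict O) + S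
        ≤ ENNReal.ofReal ((w2InfNorm O f).toReal + ε) := le_self_add.trans hlt.le
    have hnn : 0 ≤ (w2InfNorm O f).toReal + ε := add_nonneg ENNReal.toReal_nonneg hε.le
    have h1 := le_self_add.trans hle
    have h2 := le_add_self.trans hle
    have hbd : ∀ g : Pt d → ℝ, eLpNorm g ∞ (volume.restrict O) ≠ ∞ →
        ∀ᵐ x ∂(volume.restrict O), |g x| ≤ (eLpNorm g ∞ (volume.restrict O)).toReal := by
      intro g hg
      rw [eLpNorm_exponent_top] at hg ⊢
      filter_upwards [ae_le_eLpNormEssSup (f := g) (μ := volume.restrict O)] with x hx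
      have := ENNReal.toReal_mono hg hx
      rwa [toReal_enorm] at this
    have hSi : ∀ i, eLpNorm (Df i) ∞ (volume.restrict O) ≠ ∞ := fun i =>
      ne_top_of_le_ne_top ENNReal.ofReal_ne_top
        ((Finset.single_le_sum (fun _ _ => zero_le) (Finset.mem_univ i)).trans h2)
    constructor
    · refine abs_le_of_ae hO hf ?_
      filter_upwards [hbd f (ne_top_of_le_ne_top ENNReal.ofReal_ne_top h1)] with x hx
      exact hx.trans (ENNReal.toReal_le_of_le_ofReal hnn h1)
    · intro x hx y hy
      refine (abs_sub_le_of_hasWeakPartial hO hf hDf (fun i => ENNReal.toReal_nonneg)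
        (fun i => hbd _ (hSi i)) hx hy).trans ?_
      refine mul_le_mul_of_nonneg_right ?_ dist_nonneg
      rw [← ENNReal.toReal_sum fun i _ => hSi i]
      exact ENNReal.toReal_le_of_le_ofReal hnn h2
  constructor
  · exact fun x hx => le_of_forall_pos_le_add fun ε hε => (key ε hε).1 x hx
  · intro x hx y hy
    refine le_of_forall_pos_le_add fun δ hδ => ?_
    have h1 : (0 : ℝ) < dist x y + 1 := by positivity
    have := (key (δ / (dist x y + 1)) (by positivity)).2 x hx y hy
    refine this.trans ?_
    rw [add_mul]
    gcongr
    rw [div_mul_eq_mul_div, div_le_iff₀ h1]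
    nlinarith

/-- The sum of the squared noise amplitudes over finitely many modes. -/
lemma IsColored.sum_le {C : ℝ} {e : HilbertBasis ℤ ℝ (Lp ℝ 2 (volume.restrict O))}
    {g : ℤ → Pt d → ℝ} {lam : ℤ → ℝ} (h : IsColored O C e g lam) :
    (∀ k, lam k ≠ 0 → w2InfNorm O (g k) ≠ ∞) ∧
      ∀ Z : Finset ℤ, ∑ k ∈ Z, lam k ^ 2 * (w2InfNorm O (g k)).toReal ^ 2 ≤ max C 0 := by
  have hfin : ∀ k, ENNReal.ofReal (lam k ^ 2) * w2InfNorm O (g k) ^ 2 ≠ ∞ := fun k =>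
    ne_top_of_le_ne_top ENNReal.ofReal_ne_top ((ENNReal.le_tsum k).trans h.color)
  constructor
  · intro k hk htop
    refine hfin k ?_
    rw [htop, ENNReal.top_pow two_ne_zero, ENNReal.mul_top]
    simpa using hk
  · intro Z
    have h1 := (ENNReal.sum_le_tsum Z).trans h.color
    have h2 := ENNReal.toReal_mono ENNReal.ofReal_ne_top h1
    rw [ENNReal.toReal_sum fun k _ => hfin k, ENNReal.toReal_ofReal'] at h2
    refine le_trans (le_of_eq (Finset.sum_congr rfl fun k _ => ?_)) h2
    rw [ENNReal.toReal_mul, ENNReal.toReal_pow, ENNReal.toReal_ofReal (sq_nonneg _)]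

/-- Gradients and nodal values of a noise mode. -/
lemma exists_mode_bound {ϱ : ℝ → ℝ} (hϱ : IsNoiseCoefficient ϱ) {κ : ℝ} (hκ : 0 < κ) :
    ∃ K : ℝ, 0 ≤ K ∧ ∀ (O : Set (Pt d)) (M : Mesh O) (h : ℝ), 0 < h → M.IsQuasiuniform κ h →
      ∀ (f g : Pt d → ℝ) (γ : ℝ), M.MemU f → (∀ x ∈ closure O, |g x| ≤ γ) →
      (∀ x ∈ closure O, ∀ y ∈ closure O, |g x - g y| ≤ γ * dist x y) →
      (∀ v ∈ M.nodes, (ϱ (f v) * g v) ^ 2 ≤ K * γ ^ 2) ∧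
      ∀ s ∈ M.cplx.faces, ‖tangentialGrad s (M.interp fun v => ϱ (f v) * g v)‖ ^ 2
        ≤ K * γ ^ 2 * (1 + ‖tangentialGrad s f‖ ^ 2) := by
  obtain ⟨⟨B, hB⟩, L, hL⟩ := hϱ
  have hB0 : 0 ≤ B := (abs_nonneg _).trans (hB 0)
  refine ⟨B ^ 2 + 2 * (B ^ 2 + (L : ℝ) ^ 2) / κ ^ 2, by positivity, ?_⟩
  intro O M h hh hq f g γ hf hg hg'
  constructor
  · intro v hv
    have h1 := hg v (M.mem_closure_of_mem_nodes hv)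
    have h2 : (ϱ (f v) * g v) ^ 2 ≤ B ^ 2 * γ ^ 2 := by
      rw [mul_pow]
      exact mul_le_mul (sq_le_sq' (abs_le.1 (hB _)).1 (abs_le.1 (hB _)).2)
        (sq_le_sq' (abs_le.1 h1).1 (abs_le.1 h1).2) (sq_nonneg _) (sq_nonneg _)
    refine h2.trans ?_
    gcongr
    have : 0 ≤ 2 * (B ^ 2 + (L : ℝ) ^ 2) / κ ^ 2 := by positivity
    linarith
  · intro s hs
    set p := ‖tangentialGrad s f‖ with hp
    have hsn := M.subset_nodes hs
    obtain ⟨v₀, hv₀⟩ := M.cplx.nonempty_of_mem_faces hs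
    have hγ : 0 ≤ γ := (abs_nonneg _).trans (hg v₀ (M.mem_closure_of_mem_nodes (hsn hv₀)))
    -- A product rule for differences: `ϱ` and `g` are Lipschitz and `f` varies on the face by at
    -- most `p * h`. The factor `h` then cancels against the inverse estimate, so the gradient bound
    -- is independent of the mesh size.
    have hosc : ∀ x ∈ s, ∀ y ∈ s, |M.interp (fun v => ϱ (f v) * g v) x
        - M.interp (fun v => ϱ (f v) * g v) y| ≤ γ * h * (L * p + B) := by
      intro x hx y hy
      rw [M.interp_node _ (hsn hx), M.interp_node _ (hsn hy)]
      have hxc := M.mem_closure_of_mem_nodes (hsn hx)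
      have hyc := M.mem_closure_of_mem_nodes (hsn hy)
      have hxs := subset_convexHull ℝ (s : Set (Pt d)) hx
      have hys := subset_convexHull ℝ (s : Set (Pt d)) hy
      obtain ⟨t, ht, hst⟩ := M.exists_element_superset hs
      have hdist : dist x y ≤ h := M.dist_le_of_element hq ht
        (subset_convexHull ℝ _ (hst hx)) (subset_convexHull ℝ _ (hst hy))
      have hfd : |f x - f y| ≤ p * h := by
        rw [(hf.affOn hs).tangentialGrad_spec.2 y hys x hxs]
        refine (abs_real_inner_le_norm _ _).trans ?_
        rw [← dist_eq_norm]
        gcongr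
      have hϱd : |ϱ (f x) - ϱ (f y)| ≤ L * (p * h) := by
        have := hL.dist_le_mul (f x) (f y)
        rw [Real.dist_eq, Real.dist_eq] at this
        exact this.trans (by gcongr)
      calc |ϱ (f x) * g x - ϱ (f y) * g y|
          = |(ϱ (f x) - ϱ (f y)) * g x + ϱ (f y) * (g x - g y)| := by ring_nf
        _ ≤ |ϱ (f x) - ϱ (f y)| * |g x| + |ϱ (f y)| * |g x - g y| := by
            rw [← abs_mul, ← abs_mul]; exact abs_add_le _ _
        _ ≤ (L * (p * h)) * γ + B * (γ * h) := by
            gcongr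
            · exact hg x hxc
            · exact hB _
            · exact (hg' x hxc y hyc).trans (by gcongr)
        _ = _ := by ring
    have h1 := M.norm_tangentialGrad_le hκ hh hq hs (M.memU_interp _) hosc
    set u := ‖tangentialGrad s (M.interp fun v => ϱ (f v) * g v)‖
    have h2 : u * κ ≤ γ * (L * p + B) := by
      refine le_of_mul_le_mul_right ?_ hh
      linarith
    have h3 : u ^ 2 * κ ^ 2 ≤ γ ^ 2 * (2 * (B ^ 2 + (L : ℝ) ^ 2) * (1 + p ^ 2)) := by
      have h4 := pow_le_pow_left₀ (by positivity) h2 2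
      rw [mul_pow, mul_pow] at h4
      refine h4.trans ?_
      gcongr
      nlinarith [sq_nonneg (L * p - B), sq_nonneg (B * p), sq_nonneg (L : ℝ)]
    have h5 : u ^ 2 ≤ 2 * (B ^ 2 + (L : ℝ) ^ 2) / κ ^ 2 * γ ^ 2 * (1 + p ^ 2) := by
      rw [div_mul_eq_mul_div, div_mul_eq_mul_div, le_div_iff₀ (by positivity)]
      linarith
    refine h5.trans ?_
    gcongr
    exact le_add_of_nonneg_left (sq_nonneg _)

end SAV

/-! ### Khinchine's inequality for even moments. -/

namespace SAV

/-- Independent symmetric random variables with bounded moments. -/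
structure IsSymmFamily {Ω : Type*} [MeasurableSpace Ω] (P : Measure Ω) (Cmom : ℕ → ℝ)
    (b : ℤ → Ω → ℝ) : Prop where
  meas : ∀ k, Measurable (b k)
  indep : iIndepFun b P
  symm : ∀ k, IdentDistrib (b k) (fun ω => -b k ω) P P
  mom : ∀ k, ∀ q : ℕ, 2 ≤ q → Integrable (fun ω => |b k ω| ^ q) P ∧
    ∫ ω, |b k ω| ^ q ∂P ≤ Cmom q

/-- Constants in Khinchine's inequality. -/
noncomputable def khinConst (Cmom : ℕ → ℝ) : ℕ → ℝ
  | 0 => 1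
  | j + 1 => 4 ^ (j + 1) * (1 + ∑ i ∈ Finset.range (j + 2), |Cmom (2 * i)|) * khinConst Cmom j

lemma one_le_khinConst (Cmom : ℕ → ℝ) (j : ℕ) : 1 ≤ khinConst Cmom j := by
  induction j with
  | zero => exact le_rfl
  | succ j ih =>
    rw [khinConst]
    have h1 : (1 : ℝ) ≤ 4 ^ (j + 1) := one_le_pow₀ (by norm_num)
    have h2 : (1 : ℝ) ≤ 1 + ∑ i ∈ Finset.range (j + 2), |Cmom (2 * i)| :=
      le_add_of_nonneg_right (Finset.sum_nonneg fun _ _ => abs_nonneg _)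
    exact one_le_mul_of_one_le_of_one_le (one_le_mul_of_one_le_of_one_le h1 h2) ih

lemma khinConst_mono (Cmom : ℕ → ℝ) : Monotone (khinConst Cmom) := by
  refine monotone_nat_of_le_succ fun j => ?_
  conv_rhs => rw [khinConst]
  have h1 : (1 : ℝ) ≤ 4 ^ (j + 1) := one_le_pow₀ (by norm_num)
  have h2 : (1 : ℝ) ≤ 1 + ∑ i ∈ Finset.range (j + 2), |Cmom (2 * i)| :=
    le_add_of_nonneg_right (Finset.sum_nonneg fun _ _ => abs_nonneg _)
  exact le_mul_of_one_le_left (zero_le_one.trans (one_le_khinConst Cmom j))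
    (one_le_mul_of_one_le_of_one_le h1 h2)

/-- The recursion of `khinConst` is made for this: the power of 4 dominates the binomial
coefficient, the sum dominates the moment, and monotonicity handles `j - i`, which is smaller than
`j`. -/
lemma choose_mul_khinConst_le (Cmom : ℕ → ℝ) {i j : ℕ} (hi : 1 ≤ i) (hij : i ≤ j) :
    ((2 * j).choose (2 * i) : ℝ) * khinConst Cmom (j - i) * |Cmom (2 * i)|
      ≤ khinConst Cmom j := by
  obtain ⟨m, rfl⟩ : ∃ m, j = m + 1 := ⟨j - 1, by omega⟩
  rw [khinConst]
  have h1 : (((2 * (m + 1)).choose (2 * i) : ℕ) : ℝ) ≤ 4 ^ (m + 1) := by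
    have := Nat.choose_le_two_pow (2 * (m + 1)) (2 * i)
    rw [pow_mul] at this
    exact_mod_cast this
  have h2 : |Cmom (2 * i)| ≤ 1 + ∑ i ∈ Finset.range (m + 2), |Cmom (2 * i)| := by
    have := Finset.single_le_sum (f := fun i => |Cmom (2 * i)|) (fun _ _ => abs_nonneg _)
      (Finset.mem_range.2 (by omega : i < m + 2))
    linarith
  have h3 := khinConst_mono Cmom (by omega : m + 1 - i ≤ m)
  have h4 := one_le_khinConst Cmom (m + 1 - i)
  calc _ = ((2 * (m + 1)).choose (2 * i) : ℝ) * |Cmom (2 * i)| * khinConst Cmom (m + 1 - i) := by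
        ring
    _ ≤ _ := by gcongr

namespace IsSymmFamily

variable {Ω : Type*} [MeasurableSpace Ω] {P : Measure Ω} {Cmom : ℕ → ℝ}
  {b : ℤ → Ω → ℝ}

/-- Moments are assumed from order two on only, hence the domination by `1 + |b| ^ (q + 2)`. -/
lemma integrable_pow [IsProbabilityMeasure P] (h : IsSymmFamily P Cmom b) (k : ℤ) (q : ℕ) :
    Integrable (fun ω => b k ω ^ q) P := by
  have h1 : Integrable (fun ω => 1 + |b k ω| ^ (q + 2)) P :=
    (integrable_const _).add (h.mom k (q + 2) (by omega)).1
  refine h1.mono' ((h.meas k).pow_const q).aestronglyMeasurable (ae_of_all _ fun ω => ?_)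
  rw [norm_pow, Real.norm_eq_abs]
  rcases le_total |b k ω| 1 with h2 | h2
  · have := pow_le_one₀ (n := q) (abs_nonneg (b k ω)) h2
    have : 0 ≤ |b k ω| ^ (q + 2) := by positivity
    linarith
  · have := pow_le_pow_right₀ h2 (by omega : q ≤ q + 2)
    linarith

lemma integral_odd (h : IsSymmFamily P Cmom b) (k : ℤ) {q : ℕ} (hq : Odd q) :
    ∫ ω, b k ω ^ q ∂P = 0 := by
  have h1 := ((h.symm k).comp (measurable_id.pow_const q)).integral_eq
  have h2 : ∫ ω, b k ω ^ q ∂P = ∫ ω, (-b k ω) ^ q ∂P := h1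
  simp only [hq.neg_pow, integral_neg] at h2
  linarith

lemma integral_even_le (h : IsSymmFamily P Cmom b) (k : ℤ) {i : ℕ} (hi : 1 ≤ i) :
    ∫ ω, b k ω ^ (2 * i) ∂P ≤ |Cmom (2 * i)| := by
  refine le_trans (le_of_eq ?_) ((h.mom k (2 * i) (by omega)).2.trans (le_abs_self _))
  refine integral_congr_ae (ae_of_all _ fun ω => ?_)
  simp only [pow_mul, sq_abs]

lemma indepFun_sum [IsProbabilityMeasure P] (h : IsSymmFamily P Cmom b) (Z : Finset ℤ) (a : ℤ → ℝ) {k : ℤ} (hk : k ∉ Z) :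
    IndepFun (fun ω => ∑ i ∈ Z, a i * b i ω) (b k) P := by
  have h1 : iIndepFun (fun i ω => (if i = k then 1 else a i) * b i ω) P :=
    h.indep.comp (fun i x => (if i = k then 1 else a i) * x)
      fun i => measurable_const.mul measurable_id
  have h2 := h1.indepFun_finsetSum_of_notMem (fun i => measurable_const.mul (h.meas i)) hk
  have e1 : (∑ j ∈ Z, fun ω => (if j = k then 1 else a j) * b j ω)
      = fun ω => ∑ i ∈ Z, a i * b i ω := by
    ext ω
    rw [Finset.sum_apply]
    refine Finset.sum_congr rfl fun i hi => ?_
    rw [if_neg (ne_of_mem_of_not_mem hi hk)]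
  rw [e1] at h2
  simpa using h2

lemma integrable_sum_pow [IsProbabilityMeasure P] (h : IsSymmFamily P Cmom b) (a : ℤ → ℝ) (Z : Finset ℤ) :
    ∀ q : ℕ, Integrable (fun ω => (∑ k ∈ Z, a k * b k ω) ^ q) P := by
  classical
  induction Z using Finset.induction_on with
  | empty => exact fun q => by simp
  | insert k Z hk ih =>
    intro q
    have e : (fun ω => (∑ i ∈ insert k Z, a i * b i ω) ^ q) = fun ω => ∑ m ∈ Finset.range (q + 1),
        (b k ω ^ m * (∑ i ∈ Z, a i * b i ω) ^ (q - m)) * (a k ^ m * (q.choose m : ℝ)) := by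
      ext ω
      rw [Finset.sum_insert hk, add_pow]
      exact Finset.sum_congr rfl fun m _ => by ring
    rw [e]
    refine integrable_finsetSum _ fun m _ => Integrable.mul_const ?_ _
    have hi : IndepFun (fun ω => b k ω ^ m) (fun ω => (∑ i ∈ Z, a i * b i ω) ^ (q - m)) P :=
      (h.indepFun_sum Z a hk).symm.comp (measurable_id.pow_const m) (measurable_id.pow_const (q - m))
    exact hi.integrable_mul (h.integrable_pow k m) (ih (q - m))

/-- Khinchine's inequality for even moments. -/
lemma integral_sum_pow_le [IsProbabilityMeasure P] (h : IsSymmFamily P Cmom b) (a : ℤ → ℝ) (Z : Finset ℤ) :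
    ∀ j : ℕ, ∫ ω, (∑ k ∈ Z, a k * b k ω) ^ (2 * j) ∂P
      ≤ khinConst Cmom j * (∑ k ∈ Z, a k ^ 2) ^ j := by
  classical
  induction Z using Finset.induction_on with
  | empty =>
    intro j
    rcases Nat.eq_zero_or_pos j with rfl | hj
    · simp [khinConst]
    · simp [hj.ne']
  | insert k Z hk ih =>
    intro j
    set S : Ω → ℝ := fun ω => ∑ i ∈ Z, a i * b i ω with hS
    set σ := ∑ i ∈ Z, a i ^ 2 with hσ
    have hσ0 : 0 ≤ σ := Finset.sum_nonneg fun _ _ => sq_nonneg _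
    have hi : ∀ m n : ℕ, IndepFun (fun ω => b k ω ^ m) (fun ω => S ω ^ n) P := fun m n =>
      (h.indepFun_sum Z a hk).symm.comp (measurable_id.pow_const m) (measurable_id.pow_const n)
    have hint := h.integrable_sum_pow a Z
    have e : ∀ ω, (∑ i ∈ insert k Z, a i * b i ω) ^ (2 * j) = ∑ m ∈ Finset.range (2 * j + 1),
        (b k ω ^ m * S ω ^ (2 * j - m)) * (a k ^ m * ((2 * j).choose m : ℝ)) := by
      intro ω
      rw [Finset.sum_insert hk, add_pow]
      exact Finset.sum_congr rfl fun m _ => by ring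
    simp only [e]
    have hint2 : ∀ m, Integrable (fun ω => b k ω ^ m * S ω ^ (2 * j - m)) P := fun m =>
      (hi m _).integrable_mul (h.integrable_pow k m) (hint _)
    rw [integral_finsetSum _ fun m _ => (hint2 m).mul_const _]
    have e2 : ∀ m, ∫ ω, (b k ω ^ m * S ω ^ (2 * j - m)) * (a k ^ m * ((2 * j).choose m : ℝ)) ∂P
        = (∫ ω, b k ω ^ m ∂P) * (∫ ω, S ω ^ (2 * j - m) ∂P)
          * (a k ^ m * ((2 * j).choose m : ℝ)) := by
      intro m
      rw [integral_mul_const]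
      congr 1
      exact (hi m (2 * j - m)).integral_fun_mul_eq_mul_integral
        ((h.meas k).pow_const m).aestronglyMeasurable (hint _).aestronglyMeasurable
    simp only [e2]
    -- only the even powers contribute
    have e3 : ∑ m ∈ Finset.range (2 * j + 1), (∫ ω, b k ω ^ m ∂P) * (∫ ω, S ω ^ (2 * j - m) ∂P)
          * (a k ^ m * ((2 * j).choose m : ℝ))
        = ∑ i ∈ Finset.range (j + 1), (∫ ω, b k ω ^ (2 * i) ∂P)
          * (∫ ω, S ω ^ (2 * j - 2 * i) ∂P) * (a k ^ (2 * i) * ((2 * j).choose (2 * i) : ℝ)) := by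
      symm
      rw [← Finset.sum_image (s := Finset.range (j + 1)) (g := fun i => 2 * i)
        (f := fun m => (∫ ω, b k ω ^ m ∂P) * (∫ ω, S ω ^ (2 * j - m) ∂P)
          * (a k ^ m * ((2 * j).choose m : ℝ))) (fun x _ y _ hxy => by simpa using hxy)]
      refine Finset.sum_subset (fun m hm => ?_) fun m hm hm' => ?_
      · obtain ⟨i, hi, rfl⟩ := Finset.mem_image.1 hm
        have := Finset.mem_range.1 hi
        exact Finset.mem_range.2 (by omega)
      · have hodd : Odd m := by
          rw [← Nat.not_even_iff_odd]
          rintro ⟨i, hi⟩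
          refine hm' (Finset.mem_image.2 ⟨i, Finset.mem_range.2 ?_, by omega⟩)
          have := Finset.mem_range.1 hm
          omega
        simp [h.integral_odd k hodd]
    rw [e3, Finset.sum_insert hk]
    -- The target is expanded as well, and the sums are compared term by term. The term `i = 0` is
    -- the induction hypothesis; in the others the binomial coefficient of the target is only used
    -- to be at least one.
    have e4 : khinConst Cmom j * (a k ^ 2 + σ) ^ j = ∑ i ∈ Finset.range (j + 1),
        khinConst Cmom j * ((a k ^ 2) ^ i * σ ^ (j - i) * (j.choose i : ℝ)) := by
      rw [add_pow, Finset.mul_sum]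
    rw [e4]
    refine Finset.sum_le_sum fun i hi => ?_
    have hij : i ≤ j := by have := Finset.mem_range.1 hi; omega
    have hSi := ih (j - i)
    rw [show 2 * (j - i) = 2 * j - 2 * i by omega] at hSi
    change ∫ ω, S ω ^ (2 * j - 2 * i) ∂P ≤ _ at hSi
    rcases Nat.eq_zero_or_pos i with rfl | hi0
    · simpa using hSi
    have hb := h.integral_even_le k hi0
    have hb0 : 0 ≤ ∫ ω, b k ω ^ (2 * i) ∂P :=
      integral_nonneg fun ω => by rw [pow_mul]; positivity
    have hS0 : 0 ≤ ∫ ω, S ω ^ (2 * j - 2 * i) ∂P := integral_nonneg fun ω => by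
      rw [show 2 * j - 2 * i = 2 * (j - i) by omega, pow_mul]; positivity
    have hch : (1 : ℝ) ≤ (j.choose i : ℝ) := by
      exact_mod_cast Nat.choose_pos hij
    calc _ ≤ |Cmom (2 * i)| * (khinConst Cmom (j - i) * σ ^ (j - i))
          * (a k ^ (2 * i) * ((2 * j).choose (2 * i) : ℝ)) := by
          gcongr
          exact mul_nonneg (by rw [pow_mul]; positivity) (Nat.cast_nonneg _)
      _ = (((2 * j).choose (2 * i) : ℝ) * khinConst Cmom (j - i) * |Cmom (2 * i)|)
          * (((a k ^ 2) ^ i * σ ^ (j - i)) * 1) := by rw [pow_mul]; ring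
      _ ≤ khinConst Cmom j * ((a k ^ 2) ^ i * σ ^ (j - i) * (j.choose i : ℝ)) := by
          have := zero_le_one.trans (one_le_khinConst Cmom j)
          gcongr
          exact choose_mul_khinConst_le Cmom hi0 hij

end IsSymmFamily
end SAV

/-! ### Freezing the past, and moments of one random step. -/

namespace SAV

section Freezing

variable {Ω : Type*} [MeasurableSpace Ω] {P : Measure Ω} [IsProbabilityMeasure P]
  {E : Type*} [MeasurableSpace E]

/-- Integration of a function of two independent random elements. -/
lemma lintegral_indepFun {E' : Type*} [MeasurableSpace E'] {X : Ω → E} {B : Ω → E'}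
    (hX : Measurable X) (hB : Measurable B) (h : IndepFun X B P) {Φ : E → E' → ℝ≥0∞}
    (hΦ : Measurable (Function.uncurry Φ)) :
    ∫⁻ ω, Φ (X ω) (B ω) ∂P = ∫⁻ ω, ∫⁻ ω', Φ (X ω) (B ω') ∂P ∂P := by
  have h1 := (indepFun_iff_map_prod_eq_prod_map_map hX.aemeasurable hB.aemeasurable).1 h
  have : IsProbabilityMeasure (P.map B) := Measure.isProbabilityMeasure_map hB.aemeasurable
  calc ∫⁻ ω, Φ (X ω) (B ω) ∂P = ∫⁻ p, Function.uncurry Φ p ∂(P.map fun ω => (X ω, B ω)) :=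
        (lintegral_map hΦ (hX.prodMk hB)).symm
    _ = ∫⁻ x, ∫⁻ y, Φ x y ∂(P.map B) ∂(P.map X) := by
        rw [h1, lintegral_prod _ hΦ.aemeasurable]; rfl
    _ = ∫⁻ ω, ∫⁻ y, Φ (X ω) y ∂(P.map B) ∂P :=
        lintegral_map (Measurable.lintegral_prod_right' hΦ) hX
    _ = _ := by
        refine lintegral_congr fun ω => ?_
        exact lintegral_map (f := Φ (X ω)) (hΦ.comp (measurable_const.prodMk measurable_id)) hB

end Freezing

/-- A nonnegative function of a parameter and of the noise, with moment bounds in terms of a size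
that depends on the parameter only. -/
structure IsForm {Ω : Type*} [MeasurableSpace Ω] (P : Measure Ω) {E : Type*} [MeasurableSpace E]
    (B : Ω → ℤ → ℝ) (K : ℕ → ℝ) (z : E → (ℤ → ℝ) → ℝ) (s : E → ℝ) : Prop where
  meas : Measurable (Function.uncurry z)
  nonneg : ∀ c b, 0 ≤ z c b
  size_nonneg : ∀ c, 0 ≤ s c
  bound : ∀ c, ∀ j : ℕ, 1 ≤ j →
    ∫⁻ ω, ENNReal.ofReal (z c (B ω) ^ j) ∂P ≤ ENNReal.ofReal (K j * s c ^ j)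

section Forms

variable {Ω : Type*} [MeasurableSpace Ω] {P : Measure Ω}
  {E : Type*} [MeasurableSpace E] {B : Ω → ℤ → ℝ} {K : ℕ → ℝ}

lemma IsForm.zero : IsForm P B K (fun (_ : E) _ => 0) fun _ => 0 where
  meas := measurable_const
  nonneg _ _ := le_rfl
  size_nonneg _ := le_rfl
  bound c j hj := by simp [show j ≠ 0 by omega]

lemma IsForm.const_mul {z : E → (ℤ → ℝ) → ℝ} {s : E → ℝ} (h : IsForm P B K z s) {w : ℝ}
    (hw : 0 ≤ w) : IsForm P B K (fun c b => w * z c b) fun c => w * s c where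
  meas := h.meas.const_mul w
  nonneg c b := mul_nonneg hw (h.nonneg c b)
  size_nonneg c := mul_nonneg hw (h.size_nonneg c)
  bound c j hj := by
    have e : ∀ ω, ENNReal.ofReal ((w * z c (B ω)) ^ j)
        = ENNReal.ofReal (w ^ j) * ENNReal.ofReal (z c (B ω) ^ j) := fun ω => by
      rw [mul_pow, ENNReal.ofReal_mul (by positivity)]
    simp only [e]
    rw [lintegral_const_mul' _ _ ENNReal.ofReal_ne_top,
      show K j * (w * s c) ^ j = w ^ j * (K j * s c ^ j) by ring,
      ENNReal.ofReal_mul (by positivity)]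
    gcongr
    exact h.bound c j hj

/-- Minkowski's inequality in `L^j`. As the bound is homogeneous of degree `j` in the size, the
sizes add up while `K` stays the same. Sums over nodes and faces thus cost no constant that depends
on the mesh. -/
lemma IsForm.add {z z' : E → (ℤ → ℝ) → ℝ} {s s' : E → ℝ} (hB : Measurable B)
    (hK : ∀ j, 0 ≤ K j) (h : IsForm P B K z s) (h' : IsForm P B K z' s') :
    IsForm P B K (fun c b => z c b + z' c b) fun c => s c + s' c where
  meas := h.meas.add h'.meas
  nonneg c b := add_nonneg (h.nonneg c b) (h'.nonneg c b)
  size_nonneg c := add_nonneg (h.size_nonneg c) (h'.size_nonneg c)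
  bound c j hj := by
    have hj0 : (0 : ℝ) < j := by exact_mod_cast hj
    have hm : ∀ {y : E → (ℤ → ℝ) → ℝ}, Measurable (Function.uncurry y) →
        Measurable fun ω => ENNReal.ofReal (y c (B ω)) := fun hy =>
      (hy.comp (measurable_const.prodMk hB)).ennreal_ofReal
    have hb : ∀ {y : E → (ℤ → ℝ) → ℝ} {t : E → ℝ}, IsForm P B K y t →
        (∫⁻ ω, ENNReal.ofReal (y c (B ω)) ^ (j : ℝ) ∂P) ^ (1 / (j : ℝ))
          ≤ ENNReal.ofReal (K j) ^ (1 / (j : ℝ)) * ENNReal.ofReal (t c) := by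
      intro y t hy
      have h1 := hy.bound c j hj
      have e : ∀ ω, ENNReal.ofReal (y c (B ω)) ^ (j : ℝ) = ENNReal.ofReal (y c (B ω) ^ j) :=
        fun ω => by rw [ENNReal.rpow_natCast, ENNReal.ofReal_pow (hy.nonneg _ _)]
      simp only [e]
      refine (ENNReal.rpow_le_rpow h1 (by positivity)).trans (le_of_eq ?_)
      rw [ENNReal.ofReal_mul (hK j), ENNReal.mul_rpow_of_nonneg _ _ (by positivity),
        ENNReal.ofReal_pow (hy.size_nonneg c), ← ENNReal.rpow_natCast (ENNReal.ofReal (t c)),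
        ← ENNReal.rpow_mul, mul_one_div_cancel hj0.ne', ENNReal.rpow_one]
    have h1 := ENNReal.lintegral_Lp_add_le (μ := P) (hm h.meas).aemeasurable
      (hm h'.meas).aemeasurable (p := j) (by exact_mod_cast hj)
    have h2 := h1.trans (add_le_add (hb h) (hb h'))
    rw [← mul_add, ← ENNReal.ofReal_add (h.size_nonneg c) (h'.size_nonneg c)] at h2
    have h3 := ENNReal.rpow_le_rpow h2 (z := j) hj0.le
    rw [← ENNReal.rpow_mul, one_div_mul_cancel hj0.ne', ENNReal.rpow_one,
      ENNReal.mul_rpow_of_nonneg _ _ hj0.le, ← ENNReal.rpow_mul, one_div_mul_cancel hj0.ne',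
      ENNReal.rpow_one, ENNReal.rpow_natCast,
      ← ENNReal.ofReal_pow (add_nonneg (h.size_nonneg c) (h'.size_nonneg c)),
      ← ENNReal.ofReal_mul (hK j)] at h3
    refine le_trans (le_of_eq (lintegral_congr fun ω => ?_)) h3
    rw [Pi.add_apply, ENNReal.rpow_natCast, ← ENNReal.ofReal_add (h.nonneg _ _) (h'.nonneg _ _),
      ENNReal.ofReal_pow (add_nonneg (h.nonneg _ _) (h'.nonneg _ _))]

lemma IsForm.sum {ι : Type*} (hB : Measurable B) (hK : ∀ j, 0 ≤ K j) (I : Finset ι)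
    {z : ι → E → (ℤ → ℝ) → ℝ} {s : ι → E → ℝ} (h : ∀ i ∈ I, IsForm P B K (z i) (s i)) :
    IsForm P B K (fun c b => ∑ i ∈ I, z i c b) fun c => ∑ i ∈ I, s i c := by
  classical
  induction I using Finset.induction_on with
  | empty => simpa using IsForm.zero
  | insert i I hi ih =>
    simp only [Finset.sum_insert hi]
    exact (h i (Finset.mem_insert_self _ _)).add hB hK
      (ih fun j hj => h j (Finset.mem_insert_of_mem hj))

variable [IsProbabilityMeasure P] {Cmom : ℕ → ℝ} {b : ℤ → Ω → ℝ} {τ : ℝ} {lam : ℤ → ℝ}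

/-- The moment bound for linear forms in the noise. -/
lemma lintegral_linear_pow_le (h : IsSymmFamily P Cmom b) (hτ : 0 ≤ τ) (a : ℤ → ℝ) (Z : Finset ℤ)
    (j : ℕ) :
    ∫⁻ ω, ENNReal.ofReal ((∑ k ∈ Z, (√τ * lam k * b k ω) * a k) ^ (2 * j)) ∂P
      ≤ ENNReal.ofReal (khinConst Cmom j * (τ * ∑ k ∈ Z, lam k ^ 2 * a k ^ 2) ^ j) := by
  have e : ∀ ω, ∑ k ∈ Z, (√τ * lam k * b k ω) * a k
      = ∑ k ∈ Z, (√τ * (lam k * a k)) * b k ω := fun ω =>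
    Finset.sum_congr rfl fun k _ => by ring
  simp only [e]
  rw [← ofReal_integral_eq_lintegral_ofReal (h.integrable_sum_pow _ Z _)
    (ae_of_all _ fun ω => Even.pow_nonneg ⟨j, by ring⟩ _)]
  refine ENNReal.ofReal_le_ofReal ((h.integral_sum_pow_le _ Z j).trans (le_of_eq ?_))
  rw [Finset.mul_sum]
  congr 2
  refine Finset.sum_congr rfl fun k _ => ?_
  rw [mul_pow, Real.sq_sqrt hτ, mul_pow]

lemma measurable_linear (Z : Finset ℤ) {a : ℤ → E → ℝ} (ha : ∀ k ∈ Z, Measurable (a k)) :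
    Measurable (Function.uncurry fun (c : E) (b : ℤ → ℝ) => ∑ k ∈ Z, b k * a k c) := by
  refine Finset.measurable_sum _ fun k hk => ?_
  exact ((measurable_pi_apply k).comp measurable_snd).mul ((ha k hk).comp measurable_fst)

/-- Squares of linear forms. -/
lemma IsForm.sq (h : IsSymmFamily P Cmom b) (hτ : 0 ≤ τ) (Z : Finset ℤ) {a : ℤ → E → ℝ}
    (ha : ∀ k ∈ Z, Measurable (a k)) :
    IsForm P (fun ω k => √τ * lam k * b k ω) (fun j => khinConst Cmom (2 * j))
      (fun c b => (∑ k ∈ Z, b k * a k c) ^ 2) fun c => τ * ∑ k ∈ Z, lam k ^ 2 * a k c ^ 2 where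
  meas := (measurable_linear Z ha).pow_const 2
  nonneg _ _ := sq_nonneg _
  size_nonneg c := by positivity
  bound c j hj := by
    simp only [← pow_mul]
    refine (lintegral_linear_pow_le h hτ (fun k => a k c) Z j).trans (ENNReal.ofReal_le_ofReal ?_)
    gcongr
    -- The constant with index `j` would do; `2 * j` is taken so that squares and fourth powers
    -- share one family of constants.
    exact khinConst_mono Cmom (by omega)

/-- Fourth powers of linear forms. -/
lemma IsForm.fourth (h : IsSymmFamily P Cmom b) (hτ : 0 < τ) (Z : Finset ℤ) {a : ℤ → E → ℝ}
    (ha : ∀ k ∈ Z, Measurable (a k)) :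
    IsForm P (fun ω k => √τ * lam k * b k ω) (fun j => khinConst Cmom (2 * j))
      (fun c b => τ⁻¹ * (∑ k ∈ Z, b k * a k c) ^ 4)
      fun c => τ * (∑ k ∈ Z, lam k ^ 2 * a k c ^ 2) ^ 2 := by
  have h1 : IsForm P (fun ω k => √τ * lam k * b k ω) (fun j => khinConst Cmom (2 * j))
      (fun c b => (∑ k ∈ Z, b k * a k c) ^ 4)
      fun c => (τ * ∑ k ∈ Z, lam k ^ 2 * a k c ^ 2) ^ 2 :=
    { meas := (measurable_linear Z ha).pow_const 4
      nonneg := fun _ _ => by positivity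
      size_nonneg := fun c => by positivity
      bound := fun c j hj => by
        simp only [← pow_mul]
        have := lintegral_linear_pow_le (lam := lam) h hτ.le (fun k => a k c) Z (2 * j)
        rw [show 2 * (2 * j) = 4 * j by ring] at this
        exact this }
  -- A fourth power of the noise is of order `τ ^ 2`, so dividing by `τ` leaves a form of size of
  -- order `τ`.
  have h2 := h1.const_mul (inv_nonneg.2 hτ.le)
  convert h2 using 2 with c
  field_simp

end Forms

/-- The terms of order zero and one are kept exactly, so that a centred part of `x` drops out in the
mean. Any higher term is dominated by the quadratic one if `|x| ≤ U` and by `x ^ q` otherwise. -/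
lemma add_pow_even_le {q : ℕ} (hq : Even q) (h2 : 2 ≤ q) {U x : ℝ} (hU : 0 ≤ U) :
    (U + x) ^ q ≤ U ^ q + q * U ^ (q - 1) * x + 2 ^ q * (U ^ (q - 2) * x ^ 2 + x ^ q) := by
  have key : ∀ i, 2 ≤ i → i ≤ q → x ^ i * U ^ (q - i) ≤ U ^ (q - 2) * x ^ 2 + x ^ q := by
    intro i hi hiq
    have hxq : x ^ q = |x| ^ q := (hq.pow_abs x).symm
    have hx2 : x ^ 2 = |x| ^ 2 := (sq_abs x).symm
    have h3 : x ^ i * U ^ (q - i) ≤ |x| ^ i * U ^ (q - i) := by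
      exact mul_le_mul_of_nonneg_right ((le_abs_self _).trans (abs_pow x i).le) (by positivity)
    refine h3.trans ?_
    have hx0 := abs_nonneg x
    rcases le_total |x| U with h | h
    · have : |x| ^ i * U ^ (q - i) ≤ U ^ (q - 2) * x ^ 2 := by
        calc |x| ^ i * U ^ (q - i) = |x| ^ 2 * (|x| ^ (i - 2) * U ^ (q - i)) := by
              rw [← mul_assoc, ← pow_add]; congr 2; omega
          _ ≤ |x| ^ 2 * (U ^ (i - 2) * U ^ (q - i)) := by gcongr
          _ = _ := by rw [← pow_add, hx2, mul_comm]; congr 2; omega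
      have h4 : 0 ≤ x ^ q := by rw [hxq]; positivity
      linarith
    · have : |x| ^ i * U ^ (q - i) ≤ x ^ q := by
        calc |x| ^ i * U ^ (q - i) ≤ |x| ^ i * |x| ^ (q - i) := by gcongr
          _ = _ := by rw [← pow_add, hxq]; congr 1; omega
      have h4 : 0 ≤ U ^ (q - 2) * x ^ 2 := by positivity
      linarith
  obtain ⟨m, rfl⟩ : ∃ m, q = m + 2 := ⟨q - 2, by omega⟩
  rw [add_comm U x, add_pow, Finset.sum_range_succ', Finset.sum_range_succ']
  have h5 : ∑ k ∈ Finset.range (m + 1), x ^ (k + 1 + 1) * U ^ (m + 2 - (k + 1 + 1))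
        * ((m + 2).choose (k + 1 + 1) : ℝ)
      ≤ 2 ^ (m + 2) * (U ^ (m + 2 - 2) * x ^ 2 + x ^ (m + 2)) := by
    have hR : 0 ≤ U ^ (m + 2 - 2) * x ^ 2 + x ^ (m + 2) := by
      have := hq.pow_nonneg x
      positivity
    calc _ ≤ ∑ k ∈ Finset.range (m + 1), (U ^ (m + 2 - 2) * x ^ 2 + x ^ (m + 2))
          * ((m + 2).choose (k + 1 + 1) : ℝ) := by
          refine Finset.sum_le_sum fun k hk => ?_
          have := Finset.mem_range.1 hk
          gcongr
          exact key _ (by omega) (by omega)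
      _ = (U ^ (m + 2 - 2) * x ^ 2 + x ^ (m + 2))
          * ∑ k ∈ Finset.range (m + 1), ((m + 2).choose (k + 1 + 1) : ℝ) := by
          rw [Finset.mul_sum]
      _ ≤ (U ^ (m + 2 - 2) * x ^ 2 + x ^ (m + 2)) * 2 ^ (m + 2) := by
          gcongr
          have h6 := Nat.sum_range_choose (m + 2)
          rw [Finset.sum_range_succ', Finset.sum_range_succ'] at h6
          have h7 : ∑ k ∈ Finset.range (m + 1), (m + 2).choose (k + 1 + 1) ≤ 2 ^ (m + 2) := by
            omega
          exact_mod_cast h7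
      _ = _ := mul_comm _ _
  simp only [zero_add, pow_one, pow_zero, Nat.choose_one_right, Nat.choose_zero_right,
    Nat.cast_one, mul_one, Nat.sub_zero, one_mul]
  have e : x * U ^ (m + 2 - 1) * ((m + 2 : ℕ) : ℝ) = ((m + 2 : ℕ) : ℝ) * U ^ (m + 2 - 1) * x := by
    ring
  linarith

lemma add_three_pow_le {q : ℕ} (hq : Even q) (x y z : ℝ) :
    (x + y + z) ^ q ≤ 3 ^ q * (x ^ q + y ^ q + z ^ q) := by
  rw [← hq.pow_abs (x + y + z), ← hq.pow_abs x, ← hq.pow_abs y, ← hq.pow_abs z]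
  set M := max (max |x| |y|) |z| with hM
  have h1 : |x + y + z| ≤ 3 * M := by
    have hx : |x| ≤ M := (le_max_left _ _).trans (le_max_left _ _)
    have hy : |y| ≤ M := (le_max_right _ _).trans (le_max_left _ _)
    have hz : |z| ≤ M := le_max_right _ _
    linarith [abs_add_three x y z]
  have h2 : M ^ q ≤ |x| ^ q + |y| ^ q + |z| ^ q := by
    have := pow_nonneg (abs_nonneg x) q
    have := pow_nonneg (abs_nonneg y) q
    have := pow_nonneg (abs_nonneg z) q
    rcases max_choice (max |x| |y|) |z| with h | h
    · rcases max_choice |x| |y| with h' | h' <;> rw [hM, h, h'] <;> linarith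
    · rw [hM, h]; linarith
  calc |x + y + z| ^ q ≤ (3 * M) ^ q := pow_le_pow_left₀ (abs_nonneg _) h1 q
    _ = 3 ^ q * M ^ q := mul_pow _ _ _
    _ ≤ _ := by gcongr

/-- The growth rate of the `q`-th moment in one time step. -/
noncomputable def growthRate (Cmom : ℕ → ℝ) (κ : ℝ) (q : ℕ) : ℝ :=
  q * (κ + khinConst Cmom 2 * κ)
    + 2 ^ q * (3 ^ 2 * (κ ^ 2 + khinConst Cmom 1 * κ + khinConst Cmom 4 * κ ^ 2)
      + 3 ^ q * (κ ^ q + khinConst Cmom (q / 2) * κ ^ (q / 2) + khinConst Cmom (2 * q) * κ ^ q))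

lemma growthRate_nonneg (Cmom : ℕ → ℝ) {κ : ℝ} (hκ : 0 ≤ κ) (q : ℕ) :
    0 ≤ growthRate Cmom κ q := by
  have h : ∀ j, 0 ≤ khinConst Cmom j := fun j => zero_le_one.trans (one_le_khinConst Cmom j)
  have h1 := h 1
  have h2 := h 2
  have h3 := h 4
  have h4 := h (q / 2)
  have h5 := h (2 * q)
  rw [growthRate]
  positivity

section Step

variable {Ω : Type*} [MeasurableSpace Ω] {P : Measure Ω}
  {Cmom : ℕ → ℝ} {b : ℤ → Ω → ℝ} {τ : ℝ} {lam : ℤ → ℝ}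

lemma integral_le_of_lintegral_ofReal_le {f : Ω → ℝ} (hf : Measurable f) (h0 : ∀ ω, 0 ≤ f ω)
    {a : ℝ} (ha : 0 ≤ a) (h : ∫⁻ ω, ENNReal.ofReal (f ω) ∂P ≤ ENNReal.ofReal a) :
    Integrable f P ∧ ∫ ω, f ω ∂P ≤ a := by
  have hi : Integrable f P := by
    refine ⟨hf.aestronglyMeasurable, ?_⟩
    rw [hasFiniteIntegral_iff_ofReal (ae_of_all _ h0)]
    exact h.trans_lt ENNReal.ofReal_lt_top
  refine ⟨hi, ?_⟩
  rw [← ofReal_integral_eq_lintegral_ofReal hi (ae_of_all _ h0)] at h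
  exact (ENNReal.ofReal_le_ofReal_iff ha).1 h

variable [IsProbabilityMeasure P]

lemma integral_const_add_add (a : ℝ) {f g : Ω → ℝ} (hf : Integrable f P) (hg : Integrable g P) :
    Integrable (fun ω => a + f ω + g ω) P ∧
      ∫ ω, (a + f ω + g ω) ∂P = a + (∫ ω, f ω ∂P) + ∫ ω, g ω ∂P := by
  have h1 : Integrable (fun ω => a + f ω) P := (integrable_const a).add hf
  refine ⟨h1.add hg, ?_⟩
  rw [integral_add h1 hg, integral_add (integrable_const a) hf]
  simp

/-- One step with frozen coefficients. -/
lemma lintegral_frozen_step_le (h : IsSymmFamily P Cmom b) (hτ : 0 < τ) (hτ1 : τ < 1)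
    (Z : Finset ℤ) {κ U s : ℝ} (hκ : 0 ≤ κ) (hU : 0 ≤ U) (l : ℤ → ℝ)
    (hl : ∑ k ∈ Z, lam k ^ 2 * l k ^ 2 ≤ κ * U ^ 2) {z : Ω → ℝ} (hz : Measurable z)
    (hz0 : ∀ ω, 0 ≤ z ω) (hs0 : 0 ≤ s) (hs : s ≤ κ * τ * U)
    (hzb : ∀ j, 1 ≤ j → ∫⁻ ω, ENNReal.ofReal (z ω ^ j) ∂P
      ≤ ENNReal.ofReal (khinConst Cmom (2 * j) * s ^ j))
    {q : ℕ} (hq : Even q) (hq2 : 2 ≤ q) :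
    ∫⁻ ω, ENNReal.ofReal
        ((U * (1 + κ * τ) + ∑ k ∈ Z, (√τ * lam k * b k ω) * l k + z ω) ^ q) ∂P
      ≤ ENNReal.ofReal (1 + growthRate Cmom κ q * τ) * ENNReal.ofReal (U ^ q) := by
  have hk0 : ∀ j, 0 ≤ khinConst Cmom j := fun j => zero_le_one.trans (one_le_khinConst Cmom j)
  obtain ⟨q', rfl⟩ : ∃ q', q = 2 * q' := ⟨q / 2, by obtain ⟨r, hr⟩ := hq; omega⟩
  have hq'1 : 1 ≤ q' := by omega
  set y : Ω → ℝ := fun ω => ∑ k ∈ Z, (√τ * lam k * b k ω) * l k with hy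
  have hyeq : ∀ ω, y ω = ∑ k ∈ Z, (√τ * lam k * l k) * b k ω := fun ω =>
    Finset.sum_congr rfl fun k _ => by ring
  have hym : Measurable y := Finset.measurable_sum _ fun k _ =>
    ((h.meas k).const_mul _).mul_const _
  -- moments of the linear part
  have hyb : ∀ j, Integrable (fun ω => y ω ^ (2 * j)) P ∧
      ∫ ω, y ω ^ (2 * j) ∂P ≤ khinConst Cmom j * (κ * τ * U ^ 2) ^ j := fun j => by
    refine integral_le_of_lintegral_ofReal_le (hym.pow_const _)
      (fun ω => by rw [pow_mul]; positivity) (mul_nonneg (hk0 j) (by positivity)) ?_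
    refine (lintegral_linear_pow_le h hτ.le l Z j).trans (ENNReal.ofReal_le_ofReal ?_)
    have : τ * ∑ k ∈ Z, lam k ^ 2 * l k ^ 2 ≤ κ * τ * U ^ 2 := by nlinarith
    have := hk0 j
    gcongr
  -- The linear part is of size `√τ`. Its vanishing mean removes it at first order, so that it
  -- contributes to the moment only through powers of order at least `τ`.
  have hy1 : Integrable y P ∧ ∫ ω, y ω ∂P = 0 := by
    have hi : ∀ k, Integrable (b k) P := fun k => by simpa using h.integrable_pow k 1
    simp only [funext hyeq]
    refine ⟨integrable_finsetSum _ fun k _ => (hi k).const_mul _, ?_⟩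
    rw [integral_finsetSum _ fun k _ => (hi k).const_mul _]
    refine Finset.sum_eq_zero fun k _ => ?_
    rw [integral_const_mul]
    have := h.integral_odd k (q := 1) odd_one
    simp only [pow_one] at this
    rw [this, mul_zero]
  have hzj : ∀ j, 1 ≤ j → Integrable (fun ω => z ω ^ j) P ∧
      ∫ ω, z ω ^ j ∂P ≤ khinConst Cmom (2 * j) * (κ * τ * U) ^ j := fun j hj => by
    refine integral_le_of_lintegral_ofReal_le (hz.pow_const _)
      (fun ω => pow_nonneg (hz0 ω) j) (mul_nonneg (hk0 _) (by positivity)) ?_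
    refine (hzb j hj).trans (ENNReal.ofReal_le_ofReal ?_)
    have := hk0 (2 * j)
    gcongr
  have hz1 : Integrable z P ∧ ∫ ω, z ω ∂P ≤ khinConst Cmom 2 * (κ * τ * U) := by
    simpa using hzj 1 le_rfl
  -- the pointwise bound
  set R : Ω → ℝ := fun ω => U ^ (2 * q') + (2 * q' : ℕ) * U ^ (2 * q' - 1) * (κ * τ * U + y ω + z ω)
    + 2 ^ (2 * q') * (U ^ (2 * q' - 2) * (3 ^ 2 * ((κ * τ * U) ^ 2 + y ω ^ 2 + z ω ^ 2))
      + 3 ^ (2 * q') * ((κ * τ * U) ^ (2 * q') + y ω ^ (2 * q') + z ω ^ (2 * q'))) with hR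
  have hpt : ∀ ω, (U * (1 + κ * τ) + y ω + z ω) ^ (2 * q') ≤ R ω := fun ω => by
    have e : U * (1 + κ * τ) + y ω + z ω = U + (κ * τ * U + y ω + z ω) := by ring
    rw [e]
    refine (add_pow_even_le hq hq2 hU).trans ?_
    have h1 := add_three_pow_le even_two (κ * τ * U) (y ω) (z ω)
    have h2 := add_three_pow_le hq (κ * τ * U) (y ω) (z ω)
    simp only [hR]
    gcongr
  have hy2 : Integrable (fun ω => y ω ^ 2) P ∧
      ∫ ω, y ω ^ 2 ∂P ≤ khinConst Cmom 1 * (κ * τ * U ^ 2) := by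
    simpa using hyb 1
  have hz2 := hzj 2 (by norm_num)
  have hyq := hyb q'
  have hzq := hzj (2 * q') (by omega)
  obtain ⟨hA, hA'⟩ := integral_const_add_add (κ * τ * U) hy1.1 hz1.1
  obtain ⟨hB, hB'⟩ := integral_const_add_add ((κ * τ * U) ^ 2) hy2.1 hz2.1
  obtain ⟨hC, hC'⟩ := integral_const_add_add ((κ * τ * U) ^ (2 * q')) hyq.1 hzq.1
  have hBC : Integrable (fun ω => 3 ^ (2 * q')
      * ((κ * τ * U) ^ (2 * q') + y ω ^ (2 * q') + z ω ^ (2 * q'))) P := hC.const_mul _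
  have hB3 : Integrable (fun ω => U ^ (2 * q' - 2)
      * (3 ^ 2 * ((κ * τ * U) ^ 2 + y ω ^ 2 + z ω ^ 2))) P := (hB.const_mul _).const_mul _
  have hR' := integral_const_add_add (U ^ (2 * q'))
    (hA.const_mul ((2 * q' : ℕ) * U ^ (2 * q' - 1))) ((hB3.add hBC).const_mul (2 ^ (2 * q')))
  have hRi : Integrable R P := hR'.1
  have hIA : ∫ ω, (κ * τ * U + y ω + z ω) ∂P ≤ κ * τ * U + khinConst Cmom 2 * (κ * τ * U) := by
    rw [hA', hy1.2]
    linarith [hz1.2]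
  have hIB : ∫ ω, ((κ * τ * U) ^ 2 + y ω ^ 2 + z ω ^ 2) ∂P
      ≤ (κ * τ * U) ^ 2 + khinConst Cmom 1 * (κ * τ * U ^ 2)
        + khinConst Cmom 4 * (κ * τ * U) ^ 2 := by
    rw [hB']
    linarith [hy2.2, hz2.2]
  have hIC : ∫ ω, ((κ * τ * U) ^ (2 * q') + y ω ^ (2 * q') + z ω ^ (2 * q')) ∂P
      ≤ (κ * τ * U) ^ (2 * q') + khinConst Cmom q' * (κ * τ * U ^ 2) ^ q'
        + khinConst Cmom (2 * (2 * q')) * (κ * τ * U) ^ (2 * q') := by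
    rw [hC']
    linarith [hyq.2, hzq.2]
  have hIR : ∫ ω, R ω ∂P ≤ (1 + growthRate Cmom κ (2 * q') * τ) * U ^ (2 * q') := by
    have e : ∫ ω, R ω ∂P = U ^ (2 * q')
        + (2 * q' : ℕ) * U ^ (2 * q' - 1) * (∫ ω, (κ * τ * U + y ω + z ω) ∂P)
        + 2 ^ (2 * q') * (U ^ (2 * q' - 2)
            * (3 ^ 2 * ∫ ω, ((κ * τ * U) ^ 2 + y ω ^ 2 + z ω ^ 2) ∂P)
          + 3 ^ (2 * q')
            * ∫ ω, ((κ * τ * U) ^ (2 * q') + y ω ^ (2 * q') + z ω ^ (2 * q')) ∂P) := by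
      refine hR'.2.trans ?_
      rw [integral_const_mul, integral_const_mul, integral_add' hB3 hBC, integral_const_mul,
        integral_const_mul, integral_const_mul]
    rw [e]
    -- Since `τ < 1`, every positive power of `τ` is at most `τ`; all contributions are collected
    -- into one factor `1 + growthRate * τ`.
    have hτ2 : τ ^ 2 ≤ τ := by nlinarith
    have hτq : τ ^ (2 * q') ≤ τ := by
      calc τ ^ (2 * q') ≤ τ ^ 1 := pow_le_pow_of_le_one hτ.le hτ1.le (by omega)
        _ = τ := pow_one τ
    have hτq' : τ ^ q' ≤ τ := by
      calc τ ^ q' ≤ τ ^ 1 := pow_le_pow_of_le_one hτ.le hτ1.le hq'1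
        _ = τ := pow_one τ
    have k1 := hk0 1
    have k2 := hk0 2
    have k4 := hk0 4
    have kq := hk0 q'
    have kqq := hk0 (2 * (2 * q'))
    have hB4 : (κ * τ * U) ^ 2 + khinConst Cmom 1 * (κ * τ * U ^ 2)
        + khinConst Cmom 4 * (κ * τ * U) ^ 2
        ≤ (κ ^ 2 + khinConst Cmom 1 * κ + khinConst Cmom 4 * κ ^ 2) * τ * U ^ 2 := by
      have h1 : (κ * τ * U) ^ 2 ≤ κ ^ 2 * τ * U ^ 2 := by
        rw [mul_pow, mul_pow]; gcongr
      have h2 := mul_le_mul_of_nonneg_left h1 k4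
      linarith
    have hC4 : (κ * τ * U) ^ (2 * q') + khinConst Cmom q' * (κ * τ * U ^ 2) ^ q'
        + khinConst Cmom (2 * (2 * q')) * (κ * τ * U) ^ (2 * q')
        ≤ (κ ^ (2 * q') + khinConst Cmom q' * κ ^ q' + khinConst Cmom (2 * (2 * q')) * κ ^ (2 * q'))
          * τ * U ^ (2 * q') := by
      have h1 : (κ * τ * U) ^ (2 * q') ≤ κ ^ (2 * q') * τ * U ^ (2 * q') := by
        rw [mul_pow, mul_pow]; gcongr
      have h2 := mul_le_mul_of_nonneg_left h1 kqq
      have h3 : (κ * τ * U ^ 2) ^ q' ≤ κ ^ q' * τ * U ^ (2 * q') := by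
        rw [mul_pow, mul_pow, ← pow_mul]; gcongr
      have h4 := mul_le_mul_of_nonneg_left h3 kq
      linarith
    have eU1 : U ^ (2 * q' - 1) * U = U ^ (2 * q') := by
      rw [← pow_succ]; congr 1; omega
    have eU2 : U ^ (2 * q' - 2) * U ^ 2 = U ^ (2 * q') := by
      rw [← pow_add]; congr 1; omega
    have ed : 2 * q' / 2 = q' := by omega
    calc _ ≤ U ^ (2 * q') + (2 * q' : ℕ) * U ^ (2 * q' - 1)
            * (κ * τ * U + khinConst Cmom 2 * (κ * τ * U))
          + 2 ^ (2 * q') * (U ^ (2 * q' - 2)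
            * (3 ^ 2 * ((κ ^ 2 + khinConst Cmom 1 * κ + khinConst Cmom 4 * κ ^ 2) * τ * U ^ 2))
          + 3 ^ (2 * q') * ((κ ^ (2 * q') + khinConst Cmom q' * κ ^ q'
            + khinConst Cmom (2 * (2 * q')) * κ ^ (2 * q')) * τ * U ^ (2 * q'))) := by
          gcongr
          · exact hIB.trans hB4
          · exact hIC.trans hC4
      _ = U ^ (2 * q') + (2 * q' : ℕ) * (κ * τ + khinConst Cmom 2 * (κ * τ))
            * (U ^ (2 * q' - 1) * U)
          + 2 ^ (2 * q') * ((U ^ (2 * q' - 2) * U ^ 2)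
            * (3 ^ 2 * ((κ ^ 2 + khinConst Cmom 1 * κ + khinConst Cmom 4 * κ ^ 2) * τ))
          + 3 ^ (2 * q') * ((κ ^ (2 * q') + khinConst Cmom q' * κ ^ q'
            + khinConst Cmom (2 * (2 * q')) * κ ^ (2 * q')) * τ * U ^ (2 * q'))) := by ring
      _ = _ := by rw [eU1, eU2, growthRate, ed]; ring
  have hR0 : 0 ≤ᵐ[P] R := ae_of_all _ fun ω => (hq.pow_nonneg _).trans (hpt ω)
  calc _ ≤ ∫⁻ ω, ENNReal.ofReal (R ω) ∂P :=
        lintegral_mono fun ω => ENNReal.ofReal_le_ofReal (hpt ω)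
    _ = ENNReal.ofReal (∫ ω, R ω ∂P) := (ofReal_integral_eq_lintegral_ofReal hRi hR0).symm
    _ ≤ _ := by
        rw [← ENNReal.ofReal_mul (by have := growthRate_nonneg Cmom hκ (2 * q'); positivity)]
        exact ENNReal.ofReal_le_ofReal hIR

/-- One step with coefficients independent of the noise. -/
lemma lintegral_step_le {E : Type*} [MeasurableSpace E] {X : Ω → E} {B : Ω → ℤ → ℝ}
    (hX : Measurable X) (hB : Measurable B) (hind : IndepFun X B P)
    (h : IsSymmFamily P Cmom b) {Z : Finset ℤ}
    (hBb : ∀ᵐ ω ∂P, ∀ k, B ω k = √τ * lam k * b k ω) (hτ : 0 < τ) (hτ1 : τ < 1)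
    {κ : ℝ} (hκ : 0 ≤ κ) {U : E → ℝ} (hUm : Measurable U) (hU : ∀ c, 0 ≤ U c) {l : ℤ → E → ℝ}
    (hlm : ∀ k ∈ Z, Measurable (l k))
    (hl : ∀ c, ∑ k ∈ Z, lam k ^ 2 * l k c ^ 2 ≤ κ * U c ^ 2)
    {z : E → (ℤ → ℝ) → ℝ} {s : E → ℝ} (hs : ∀ c, s c ≤ κ * τ * U c)
    (hz : IsForm P (fun ω k => √τ * lam k * b k ω) (fun j => khinConst Cmom (2 * j)) z s)
    {q : ℕ} (hq : Even q) (hq2 : 2 ≤ q) {A : Set E} (hA : MeasurableSet A) :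
    ∫⁻ ω in X ⁻¹' A, ENNReal.ofReal ((U (X ω) * (1 + κ * τ) + ∑ k ∈ Z, B ω k * l k (X ω)
        + z (X ω) (B ω)) ^ q) ∂P
      ≤ ENNReal.ofReal (1 + growthRate Cmom κ q * τ)
        * ∫⁻ ω in X ⁻¹' A, ENNReal.ofReal (U (X ω) ^ q) ∂P := by
  -- The indicator of the past event is part of the function of the parameter, so the localization
  -- survives the passage to the product law.
  set Φ : E → (ℤ → ℝ) → ℝ≥0∞ := fun c β =>
    A.indicator (fun _ => 1) c * ENNReal.ofReal ((U c * (1 + κ * τ) + ∑ k ∈ Z, β k * l k c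
      + z c β) ^ q) with hΦ
  have hΦm : Measurable (Function.uncurry Φ) := by
    refine Measurable.mul ((measurable_const.indicator hA).comp measurable_fst) ?_
    refine (Measurable.pow_const ?_ q).ennreal_ofReal
    exact (((hUm.comp measurable_fst).mul_const _).add (measurable_linear Z hlm)).add hz.meas
  have hind1 : ∀ (f : Ω → ℝ≥0∞), ∫⁻ ω in X ⁻¹' A, f ω ∂P
      = ∫⁻ ω, A.indicator (fun _ => 1) (X ω) * f ω ∂P := fun f => by
    rw [← lintegral_indicator (hX hA)]
    refine lintegral_congr fun ω => ?_
    by_cases hω : X ω ∈ A <;> simp [Set.indicator, hω]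
  rw [hind1, hind1]
  have h1 := lintegral_indepFun hX hB hind hΦm
  refine le_trans (le_of_eq h1) ?_
  rw [← lintegral_const_mul' _ _ ENNReal.ofReal_ne_top]
  refine lintegral_mono fun ω => ?_
  set c := X ω
  simp only [hΦ]
  have hne : A.indicator (fun _ => (1 : ℝ≥0∞)) c ≠ ∞ := by
    by_cases hc : c ∈ A <;> simp [Set.indicator, hc]
  rw [lintegral_const_mul' _ _ hne, mul_left_comm]
  refine mul_le_mul_right ?_ _
  have h2 := lintegral_frozen_step_le h hτ hτ1 Z hκ (hU c) (fun k => l k c) (hl c)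
    (z := fun ω => z c (fun k => √τ * lam k * b k ω))
    (hz.meas.comp (measurable_const.prodMk (measurable_pi_lambda _ fun k => (h.meas k).const_mul _)))
    (fun ω => hz.nonneg _ _) (hz.size_nonneg c) (hs c) (fun j hj => hz.bound c j hj) hq hq2
  refine le_trans (le_of_eq (lintegral_congr_ae ?_)) h2
  filter_upwards [hBb] with ω' hω'
  have : B ω' = fun k => √τ * lam k * b k ω' := funext hω'
  simp only [this]

end Step
end SAV

/-! ### A weak maximal inequality and moments of the maximum. -/

namespace SAV

section Maximal

variable {Ω : Type*} [mΩ : MeasurableSpace Ω] {P : Measure Ω}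

/-- A weak maximal inequality for sequences that grow at most by a factor in each step. -/
lemma mul_measure_exists_le (𝓕 : Filtration ℕ mΩ) {N : ℕ} {W : ℕ → Ω → ℝ≥0∞}
    (hW : ∀ n ≤ N, Measurable[𝓕 n] (W n)) {a : ℝ≥0∞} (ha : 1 ≤ a)
    (hstep : ∀ n < N, ∀ A, MeasurableSet[𝓕 n] A →
      ∫⁻ ω in A, W (n + 1) ω ∂P ≤ a * ∫⁻ ω in A, W n ω ∂P) (t : ℝ≥0∞) :
    t * P {ω | ∃ n ≤ N, t ≤ W n ω} ≤ a ^ N * ∫⁻ ω, W 0 ω ∂P := by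
  set B : ℕ → Set Ω := fun n => {ω | ∀ i ≤ n, W i ω < t} with hB
  have hBm : ∀ n ≤ N, MeasurableSet[𝓕 n] (B n) := by
    intro n hn
    have e : B n = ⋂ i ∈ Finset.range (n + 1), {ω | W i ω < t} := by
      ext ω
      simp [hB]
    rw [e]
    refine Finset.measurableSet_biInter _ fun i hi => ?_
    have hin : i ≤ n := Nat.lt_succ_iff.1 (Finset.mem_range.1 hi)
    exact 𝓕.mono hin _ (measurableSet_lt (hW i (hin.trans hn)) measurable_const)
  have hgm : ∀ n ≤ N, MeasurableSet {ω | t ≤ W n ω} := fun n hn =>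
    𝓕.le n _ (measurableSet_le measurable_const (hW n hn))
  have hsplit : ∀ n ≤ N, ∀ A, MeasurableSet A →
      (∫⁻ ω in A ∩ {ω | W n ω < t}, W n ω ∂P) + t * P (A ∩ {ω | t ≤ W n ω})
        ≤ ∫⁻ ω in A, W n ω ∂P := by
    intro n hn A hA
    have e1 : A ∩ {ω | W n ω < t} = A \ {ω | t ≤ W n ω} := by
      ext ω; simp
    rw [e1, add_comm, ← lintegral_inter_add_sdiff (W n) A (hgm n hn)]
    gcongr
    calc t * P (A ∩ {ω | t ≤ W n ω}) = ∫⁻ _ω in A ∩ {ω | t ≤ W n ω}, t ∂P := by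
          rw [setLIntegral_const]
      _ ≤ _ := setLIntegral_mono' (hA.inter (hgm n hn)) fun ω hω => hω.2
  -- The left side is a lower bound for the mean of the sequence stopped when it first reaches `t`.
  -- The assumption `1 ≤ a` allows the part already stopped to be multiplied by `a` as well.
  have key : ∀ n ≤ N, (∫⁻ ω in B n, W n ω ∂P) + t * P (B n)ᶜ ≤ a ^ n * ∫⁻ ω, W 0 ω ∂P := by
    intro n
    induction n with
    | zero =>
      intro _
      have := hsplit 0 (Nat.zero_le _) Set.univ MeasurableSet.univ
      have e2 : B 0 = Set.univ ∩ {ω | W 0 ω < t} := by ext ω; simp [hB]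
      have e3 : (B 0)ᶜ = Set.univ ∩ {ω | t ≤ W 0 ω} := by ext ω; simp [hB]
      rw [e3, e2]
      simpa using this
    | succ n ih =>
      intro hn
      have hBn := 𝓕.le n _ (hBm n (by omega))
      have h1 := hsplit (n + 1) hn (B n) hBn
      have e2 : B (n + 1) = B n ∩ {ω | W (n + 1) ω < t} := by
        ext ω
        simp only [hB, Set.mem_inter_iff, Set.mem_ofPred_eq]
        constructor
        · exact fun h => ⟨fun i hi => h i (by omega), h _ le_rfl⟩
        · rintro ⟨h, h'⟩ i hi
          rcases Nat.lt_or_ge n i with h2 | h2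
          · rwa [show i = n + 1 by omega]
          · exact h i h2
      have e3 : (B (n + 1))ᶜ ⊆ (B n)ᶜ ∪ (B n ∩ {ω | t ≤ W (n + 1) ω}) := by
        intro ω hω
        rw [e2] at hω
        by_cases h3 : ω ∈ B n
        · refine Or.inr ⟨h3, ?_⟩
          rw [Set.mem_ofPred_eq]
          exact not_lt.1 fun h4 => hω ⟨h3, h4⟩
        · exact Or.inl h3
      calc (∫⁻ ω in B (n + 1), W (n + 1) ω ∂P) + t * P (B (n + 1))ᶜ
          ≤ (∫⁻ ω in B n ∩ {ω | W (n + 1) ω < t}, W (n + 1) ω ∂P)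
            + t * (P (B n)ᶜ + P (B n ∩ {ω | t ≤ W (n + 1) ω})) := by
            rw [e2] at e3 ⊢
            gcongr
            exact (measure_mono e3).trans (measure_union_le _ _)
        _ = ((∫⁻ ω in B n ∩ {ω | W (n + 1) ω < t}, W (n + 1) ω ∂P)
            + t * P (B n ∩ {ω | t ≤ W (n + 1) ω})) + t * P (B n)ᶜ := by ring
        _ ≤ a * (∫⁻ ω in B n, W n ω ∂P) + a * (t * P (B n)ᶜ) := by
            exact add_le_add (h1.trans (hstep n (by omega) _ (hBm n (by omega))))
              (le_mul_of_one_le_left zero_le ha)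
        _ = a * ((∫⁻ ω in B n, W n ω ∂P) + t * P (B n)ᶜ) := by ring
        _ ≤ a * (a ^ n * ∫⁻ ω, W 0 ω ∂P) := by gcongr; exact ih (by omega)
        _ = _ := by rw [pow_succ]; ring
  have e4 : {ω | ∃ n ≤ N, t ≤ W n ω} = (B N)ᶜ := by
    ext ω
    simp [hB]
  rw [e4]
  exact le_add_self.trans (key N le_rfl)

/-- Layer cake formula: levels up to 1 contribute at most 1, and the tail `K / t ^ 2` integrates to
`K`. -/
lemma lintegral_le_of_weak_bound [IsProbabilityMeasure P] {f : Ω → ℝ} (hf : Measurable f)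
    (h0 : ∀ ω, 0 ≤ f ω) {K : ℝ} (hK : 0 ≤ K)
    (h : ∀ t : ℝ, 1 < t → P {ω | t ≤ f ω} ≤ ENNReal.ofReal (K * t ^ (-2 : ℝ))) :
    ∫⁻ ω, ENNReal.ofReal (f ω) ∂P ≤ ENNReal.ofReal (1 + K) := by
  rw [lintegral_eq_lintegral_meas_le P (ae_of_all _ h0) hf.aemeasurable,
    ← Set.Ioc_union_Ioi_eq_Ioi zero_le_one,
    lintegral_union measurableSet_Ioi Set.Ioc_disjoint_Ioi_same, ENNReal.ofReal_add zero_le_one hK]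
  have hint : IntegrableOn (fun t : ℝ => K * t ^ (-2 : ℝ)) (Set.Ioi 1) :=
    (integrableOn_Ioi_rpow_of_lt (by norm_num) zero_lt_one).const_mul K
  refine add_le_add ?_ ?_
  · refine (lintegral_mono fun t => prob_le_one).trans ?_
    simp
  · calc _ ≤ ∫⁻ t in Set.Ioi (1 : ℝ), ENNReal.ofReal (K * t ^ (-2 : ℝ)) :=
          setLIntegral_mono' measurableSet_Ioi fun t ht => h t ht
      _ = ENNReal.ofReal (∫ t in Set.Ioi (1 : ℝ), K * t ^ (-2 : ℝ)) := by
          refine (ofReal_integral_eq_lintegral_ofReal hint ?_).symm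
          rw [Filter.EventuallyLE, ae_restrict_iff' measurableSet_Ioi]
          refine ae_of_all _ fun t ht => ?_
          have ht0 : (0 : ℝ) < t := zero_lt_one.trans ht
          exact mul_nonneg hK (Real.rpow_nonneg ht0.le _)
      _ = _ := by
          rw [integral_const_mul, integral_Ioi_rpow_of_lt (by norm_num) zero_lt_one]
          norm_num

/-- Moments of the maximum of a sequence that grows at most by a factor `1 + ρ τ` in each step. -/
lemma lintegral_iSup_rpow_le [IsProbabilityMeasure P] (𝓕 : Filtration ℕ mΩ) {N : ℕ}
    {V : ℕ → Ω → ℝ} (hV : ∀ n ≤ N, Measurable[𝓕 n] (V n)) (hV1 : ∀ n ω, 1 ≤ V n ω) {ρ τ : ℝ}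
    (hρ : 0 ≤ ρ) (hτ : 0 ≤ τ) {q : ℕ}
    (hstep : ∀ n < N, ∀ A, MeasurableSet[𝓕 n] A →
      ∫⁻ ω in A, ENNReal.ofReal (V (n + 1) ω ^ (2 * q)) ∂P
        ≤ ENNReal.ofReal (1 + ρ * τ) * ∫⁻ ω in A, ENNReal.ofReal (V n ω ^ (2 * q)) ∂P)
    {C₀ : ℝ} (h0 : ∀ ω, V 0 ω ≤ C₀) {p : ℝ} (hpq : p ≤ q) :
    ∫⁻ ω, ⨆ m ∈ Finset.range (N + 1), ENNReal.ofReal (V m ω ^ p) ∂P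
      ≤ ENNReal.ofReal (1 + Real.exp (ρ * (τ * N)) * C₀ ^ (2 * q)) := by
  have hC₀ : 0 ≤ C₀ := by
    obtain ⟨ω⟩ := nonempty_of_isProbabilityMeasure P
    exact zero_le_one.trans ((hV1 0 ω).trans (h0 ω))
  have hne : (Finset.range (N + 1)).Nonempty := ⟨0, by simp⟩
  set f : Ω → ℝ := fun ω => (Finset.range (N + 1)).sup' hne fun m => V m ω ^ q with hf
  have hVm : ∀ n ≤ N, Measurable (V n) := fun n hn => (hV n hn).mono (𝓕.le n) le_rfl
  have hfm : Measurable f := by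
    have : f = (Finset.range (N + 1)).sup' hne fun m ω => V m ω ^ q := by
      ext ω; rw [Finset.sup'_apply]
    rw [this]
    refine Finset.measurable_sup' hne fun m hm => (hVm m ?_).pow_const q
    exact Nat.lt_succ_iff.1 (Finset.mem_range.1 hm)
  have hf0 : ∀ ω, 0 ≤ f ω := fun ω =>
    (pow_nonneg (zero_le_one.trans (hV1 0 ω)) q).trans
      (Finset.le_sup' (fun m => V m ω ^ q) (by simp : (0 : ℕ) ∈ Finset.range (N + 1)))
  have hle : ∀ ω, ⨆ m ∈ Finset.range (N + 1), ENNReal.ofReal (V m ω ^ p)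
      ≤ ENNReal.ofReal (f ω) := by
    intro ω
    refine iSup₂_le fun m hm => ENNReal.ofReal_le_ofReal ?_
    refine le_trans ?_ (Finset.le_sup' (fun m => V m ω ^ q) hm)
    rw [← Real.rpow_natCast]
    exact Real.rpow_le_rpow_of_exponent_le (hV1 m ω) hpq
  refine (lintegral_mono hle).trans (lintegral_le_of_weak_bound hfm hf0 (by positivity) ?_)
  intro t ht
  have ht0 : 0 < t := zero_lt_one.trans ht
  -- The weak inequality is used for the exponent `2 * q`, twice what is needed. The tail of the
  -- maximum of `V ^ q` then decays like `t ^ (-2)`, which is integrable.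
  have h1 := mul_measure_exists_le (P := P) 𝓕
    (W := fun n ω => ENNReal.ofReal (V n ω ^ (2 * q)))
    (fun n hn => ((hV n hn).pow_const _).ennreal_ofReal)
    (a := ENNReal.ofReal (1 + ρ * τ))
    (by rw [ENNReal.one_le_ofReal]; nlinarith [mul_nonneg hρ hτ]) hstep (ENNReal.ofReal (t ^ 2))
  have h2 : {ω | t ≤ f ω}
      ⊆ {ω | ∃ n ≤ N, ENNReal.ofReal (t ^ 2) ≤ ENNReal.ofReal (V n ω ^ (2 * q))} := by
    intro ω hω
    obtain ⟨m, hm, hm'⟩ := Finset.exists_mem_eq_sup' hne fun m => V m ω ^ q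
    refine ⟨m, Nat.lt_succ_iff.1 (Finset.mem_range.1 hm), ENNReal.ofReal_le_ofReal ?_⟩
    have h3 : t ≤ V m ω ^ q := by rw [← hm']; exact hω
    calc t ^ 2 ≤ (V m ω ^ q) ^ 2 := by gcongr
      _ = _ := by rw [← pow_mul, mul_comm]
  have h3 : ∫⁻ ω, ENNReal.ofReal (V 0 ω ^ (2 * q)) ∂P ≤ ENNReal.ofReal (C₀ ^ (2 * q)) := by
    calc _ ≤ ∫⁻ _ω, ENNReal.ofReal (C₀ ^ (2 * q)) ∂P :=
          lintegral_mono fun ω => ENNReal.ofReal_le_ofReal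
            (pow_le_pow_left₀ (zero_le_one.trans (hV1 0 ω)) (h0 ω) _)
      _ = _ := by simp
  have h4 : ENNReal.ofReal (1 + ρ * τ) ^ N ≤ ENNReal.ofReal (Real.exp (ρ * (τ * N))) := by
    rw [← ENNReal.ofReal_pow (by positivity)]
    refine ENNReal.ofReal_le_ofReal ?_
    calc (1 + ρ * τ) ^ N ≤ Real.exp (ρ * τ) ^ N := by
          gcongr
          rw [add_comm]; exact Real.add_one_le_exp _
      _ = _ := by rw [← Real.exp_nat_mul]; congr 1; ring
  have h5 : ENNReal.ofReal (t ^ 2) * P {ω | t ≤ f ω}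
      ≤ ENNReal.ofReal (Real.exp (ρ * (τ * N)) * C₀ ^ (2 * q)) := by
    rw [ENNReal.ofReal_mul (Real.exp_nonneg _)]
    exact (mul_le_mul' le_rfl (measure_mono h2)).trans (h1.trans (mul_le_mul' h4 h3))
  have ht2 : ENNReal.ofReal (t ^ 2) ≠ 0 := by
    rw [Ne, ENNReal.ofReal_eq_zero, not_le]; positivity
  have h6 : P {ω | t ≤ f ω} = ENNReal.ofReal ((t ^ 2)⁻¹)
      * (ENNReal.ofReal (t ^ 2) * P {ω | t ≤ f ω}) := by
    rw [← mul_assoc, ← ENNReal.ofReal_mul (by positivity), inv_mul_cancel₀ (by positivity),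
      ENNReal.ofReal_one, one_mul]
  rw [h6]
  refine (mul_le_mul' le_rfl h5).trans (le_of_eq ?_)
  rw [← ENNReal.ofReal_mul (by positivity), Real.rpow_neg ht0.le, mul_comm]
  norm_num

end Maximal
end SAV

/-! ### Algebra of one component, either the domain or its boundary. -/

namespace SAV

lemma tangentialGrad_sub {d : ℕ} {s : Finset (Pt d)} {u v : Pt d → ℝ} (hu : AffOn s u)
    (hv : AffOn s v) :
    tangentialGrad s (fun x => u x - v x) = tangentialGrad s u - tangentialGrad s v := by
  have h := tangentialGrad_add hu (hv.smul (-1))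
  rw [tangentialGrad_smul (-1) hv] at h
  have e : (fun x => u x - v x) = fun x => u x + -1 * v x := by ext x; ring
  rw [e, h]
  module

/-- A discretized domain: weighted nodes for lumped integrals, weighted faces for the Dirichlet
form. -/
structure Comp (d : ℕ) where
  nodes : Finset (Pt d)
  mass : Pt d → ℝ
  faces : Finset (Finset (Pt d))
  wt : Finset (Pt d) → ℝ
  mass_nonneg : ∀ v, 0 ≤ mass v
  wt_nonneg : ∀ s, 0 ≤ wt s

namespace Comp

variable {d : ℕ} (c : Comp d)

/-- The lumped integral. -/
noncomputable def lump (a : Pt d → ℝ) : ℝ := ∑ v ∈ c.nodes, a v * c.mass v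

/-- The Dirichlet form. -/
noncomputable def dir (u v : Pt d → ℝ) : ℝ :=
  ∑ s ∈ c.faces, c.wt s * inner ℝ (tangentialGrad s u) (tangentialGrad s v)

/-- Affine on every face. -/
def Aff (u : Pt d → ℝ) : Prop := ∀ s ∈ c.faces, AffOn s u

lemma lump_nonneg {a : Pt d → ℝ} (h : ∀ v, 0 ≤ a v) : 0 ≤ c.lump a :=
  Finset.sum_nonneg fun v _ => mul_nonneg (h v) (c.mass_nonneg v)

lemma lump_mono {a b : Pt d → ℝ} (h : ∀ v ∈ c.nodes, a v ≤ b v) : c.lump a ≤ c.lump b :=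
  Finset.sum_le_sum fun v hv => mul_le_mul_of_nonneg_right (h v hv) (c.mass_nonneg v)

lemma lump_add (a b : Pt d → ℝ) : c.lump (fun x => a x + b x) = c.lump a + c.lump b := by
  simp only [lump, add_mul, Finset.sum_add_distrib]

lemma lump_const_mul (w : ℝ) (a : Pt d → ℝ) : c.lump (fun x => w * a x) = w * c.lump a := by
  simp only [lump, Finset.mul_sum, mul_assoc]

/-- Cauchy–Schwarz in the form that needs only a pointwise bound of `r ^ 2` by a product; this suits
the growth conditions of the potentials. -/
lemma lump_sq_le {r f g : Pt d → ℝ} (hf : ∀ v, 0 ≤ f v) (hg : ∀ v, 0 ≤ g v)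
    (h : ∀ v ∈ c.nodes, r v ^ 2 ≤ f v * g v) : c.lump r ^ 2 ≤ c.lump f * c.lump g := by
  refine Finset.sum_sq_le_sum_mul_sum_of_sq_le_mul c.nodes
    (fun v _ => mul_nonneg (hf v) (c.mass_nonneg v))
    (fun v _ => mul_nonneg (hg v) (c.mass_nonneg v)) fun v hv => ?_
  have := mul_le_mul_of_nonneg_right (h v hv) (sq_nonneg (c.mass v))
  linarith

lemma dir_self_nonneg (u : Pt d → ℝ) : 0 ≤ c.dir u u :=
  Finset.sum_nonneg fun s _ => mul_nonneg (c.wt_nonneg s) real_inner_self_nonneg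

lemma dir_sq_le (u v : Pt d → ℝ) : c.dir u v ^ 2 ≤ c.dir u u * c.dir v v := by
  refine Finset.sum_sq_le_sum_mul_sum_of_sq_le_mul c.faces
    (fun s _ => mul_nonneg (c.wt_nonneg s) real_inner_self_nonneg)
    (fun s _ => mul_nonneg (c.wt_nonneg s) real_inner_self_nonneg) fun s _ => ?_
  have := mul_le_mul_of_nonneg_right
    (real_inner_mul_inner_self_le (tangentialGrad s u) (tangentialGrad s v)) (sq_nonneg (c.wt s))
  nlinarith

variable {c} {u v w : Pt d → ℝ}

/-- The implicit treatment of the gradient yields the extra square of the increment, the numerical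
dissipation that absorbs noise terms. -/
lemma dir_increment (hu : c.Aff u) (hv : c.Aff v) :
    c.dir u (fun x => u x - v x) = (c.dir u u - c.dir v v
      + c.dir (fun x => u x - v x) fun x => u x - v x) / 2 := by
  simp only [dir]
  rw [← Finset.sum_sub_distrib, ← Finset.sum_add_distrib, Finset.sum_div]
  refine Finset.sum_congr rfl fun s hs => ?_
  rw [tangentialGrad_sub (hu s hs) (hv s hs)]
  simp only [inner_sub_left, inner_sub_right]
  rw [real_inner_comm (tangentialGrad s u) (tangentialGrad s v)]
  ring

/-- Young's inequality for the Dirichlet form, around an old value. -/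
lemma dir_le (hu : c.Aff u) (hv : c.Aff v) (w : Pt d → ℝ) :
    c.dir u w ≤ c.dir v w + c.dir (fun x => u x - v x) (fun x => u x - v x) / 8
      + 2 * c.dir w w := by
  simp only [dir]
  rw [Finset.sum_div, Finset.mul_sum, ← Finset.sum_add_distrib, ← Finset.sum_add_distrib]
  refine Finset.sum_le_sum fun s hs => ?_
  rw [tangentialGrad_sub (hu s hs) (hv s hs)]
  set a := tangentialGrad s u
  set b := tangentialGrad s v
  set e := tangentialGrad s w
  have h : inner ℝ a e ≤ inner ℝ b e + inner ℝ (a - b) (a - b) / 8 + 2 * inner ℝ e e := by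
    have h1 : 0 ≤ inner ℝ ((a - b) - (4 : ℝ) • e) ((a - b) - (4 : ℝ) • e) := real_inner_self_nonneg
    rw [real_inner_sub_sub_self, inner_smul_right, inner_smul_right, inner_smul_left] at h1
    have h2 : inner ℝ (a - b) e = inner ℝ a e - inner ℝ b e := inner_sub_left a b e
    simp only [conj_trivial] at h1
    linarith
  have := mul_le_mul_of_nonneg_left h (c.wt_nonneg s)
  linarith

/-- For the coupling of `∇μ` and `∇φ` that appears when the evolution equation is tested with `φ`:
the new value is split into old value and increment, and the square of `∇μ` is absorbed by the
physical dissipation. -/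
lemma neg_dir_le (hu : c.Aff u) (hv : c.Aff v) (w : Pt d → ℝ) :
    -c.dir w u ≤ c.dir w w + c.dir v v / 2
      + c.dir (fun x => u x - v x) (fun x => u x - v x) / 2 := by
  simp only [dir]
  rw [Finset.sum_div, Finset.sum_div, ← Finset.sum_neg_distrib, ← Finset.sum_add_distrib,
    ← Finset.sum_add_distrib]
  refine Finset.sum_le_sum fun s hs => ?_
  rw [tangentialGrad_sub (hu s hs) (hv s hs)]
  set a := tangentialGrad s u
  set b := tangentialGrad s v
  set e := tangentialGrad s w
  have h : -inner ℝ e a ≤ inner ℝ e e + inner ℝ b b / 2 + inner ℝ (a - b) (a - b) / 2 := by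
    have h1 : 0 ≤ inner ℝ (e + b) (e + b) := real_inner_self_nonneg
    have h2 : 0 ≤ inner ℝ (e + (a - b)) (e + (a - b)) := real_inner_self_nonneg
    rw [real_inner_add_add_self] at h1 h2
    rw [inner_sub_right e a b] at h2
    linarith
  have := mul_le_mul_of_nonneg_left h (c.wt_nonneg s)
  linarith

lemma lump_increment (c : Comp d) (u v : Pt d → ℝ) :
    c.lump (fun x => (u x - v x) * u x) = (c.lump (fun x => u x ^ 2) - c.lump (fun x => v x ^ 2)
      + c.lump fun x => (u x - v x) ^ 2) / 2 := by
  simp only [lump]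
  rw [← Finset.sum_sub_distrib, ← Finset.sum_add_distrib, Finset.sum_div]
  exact Finset.sum_congr rfl fun s hs => by ring

lemma lump_mul_le (c : Comp d) (u v w : Pt d → ℝ) :
    c.lump (fun x => w x * u x) ≤ c.lump (fun x => w x * v x)
      + c.lump (fun x => (u x - v x) ^ 2) / 4 + c.lump fun x => w x ^ 2 := by
  simp only [lump]
  rw [Finset.sum_div, ← Finset.sum_add_distrib, ← Finset.sum_add_distrib]
  refine Finset.sum_le_sum fun s _ => ?_
  have h : w s * u s ≤ w s * v s + (u s - v s) ^ 2 / 4 + w s ^ 2 := by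
    nlinarith [sq_nonneg ((u s - v s) / 2 - w s)]
  have := mul_le_mul_of_nonneg_right h (c.mass_nonneg s)
  linarith

lemma neg_lump_mul_le (c : Comp d) (u v w : Pt d → ℝ) :
    -c.lump (fun x => w x * u x) ≤ 5 / 2 * c.lump (fun x => w x ^ 2)
      + c.lump (fun x => v x ^ 2) / 2 + c.lump (fun x => (u x - v x) ^ 2) / 8 := by
  simp only [lump]
  rw [Finset.sum_div, Finset.sum_div, Finset.mul_sum, ← Finset.sum_neg_distrib,
    ← Finset.sum_add_distrib, ← Finset.sum_add_distrib]
  refine Finset.sum_le_sum fun s _ => ?_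
  have h : -(w s * u s) ≤ 5 / 2 * w s ^ 2 + v s ^ 2 / 2 + (u s - v s) ^ 2 / 8 := by
    nlinarith [sq_nonneg (w s + v s), sq_nonneg ((u s - v s) / 4 + w s)]
  have := mul_le_mul_of_nonneg_right h (c.mass_nonneg s)
  linarith

end Comp

/-! ### Potentials -/

namespace Comp

variable {d : ℕ} (c : Comp d) (F : ℝ → ℝ)

/-- The discrete energy. -/
noncomputable def energy (f : Pt d → ℝ) : ℝ := c.lump fun x => F (f x)

/-- The linear functional of the scalar auxiliary variable equation. -/
noncomputable def lin (f X η : Pt d → ℝ) : ℝ :=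
  1 / (2 * √(c.energy F f)) * c.lump (fun x => deriv F (f x) * η x)
    - 1 / (8 * c.energy F f ^ (3 / 2 : ℝ)) * c.lump (fun x => deriv F (f x) * X x)
        * c.lump (fun x => deriv F (f x) * η x)
    + 1 / (4 * √(c.energy F f)) * c.lump (fun x => deriv (deriv F) (f x) * X x * η x)

/-- The normalized first variation of the energy. -/
noncomputable def slope (f X : Pt d → ℝ) : ℝ :=
  c.lump (fun x => deriv F (f x) * X x) / √(c.energy F f)

end Comp

/-- The growth conditions are turned into bounds by `F` itself. After Cauchy–Schwarz the discrete
energy appears with exactly the power that the scheme divides by, so that power cancels. -/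
lemma IsPotential.bounds {F : ℝ → ℝ} (hF : IsPotential F) : ∃ K : ℝ, 0 < K ∧
    (∀ z, 0 < F z) ∧ (∀ z, deriv F z ^ 2 ≤ K * F z * (1 + z ^ 2)) ∧
    (∀ z, (1 + z ^ 2) ^ 2 ≤ K * F z) ∧ (∀ z, deriv (deriv F) z ^ 2 ≤ K * F z) ∧
    ∀ z, F z ≤ K * (1 + z ^ 4) := by
  obtain ⟨-, ⟨γ, hγ, hFγ⟩, ⟨a, ha, hFa⟩, ⟨C, hC⟩, -⟩ := hF
  have hC0 : 0 ≤ C := by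
    have := (abs_nonneg _).trans (hC 0).2.1
    simpa using this
  have hpos : ∀ z, 0 < F z := fun z => hγ.trans_le (hFγ z)
  have h4 : ∀ z : ℝ, |z| ^ 4 = z ^ 4 := fun z => (by decide : Even 4).pow_abs z
  have hq : ∀ z, (1 + z ^ 2) ^ 2 ≤ 2 / a * F z := fun z => by
    have h1 := hFa z
    rw [h4] at h1
    rw [div_mul_eq_mul_div, le_div_iff₀ ha]
    nlinarith [sq_nonneg (1 - z ^ 2), mul_nonneg ha.le (sq_nonneg (1 - z ^ 2))]
  refine ⟨2 * C ^ 2 / a + 2 / a + C, by positivity, hpos, fun z => ?_, fun z => ?_, fun z => ?_,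
    fun z => ?_⟩
  · have h1 := (hC z).2.1
    have h2 : deriv F z ^ 2 ≤ (C * (1 + |z| ^ 3)) ^ 2 := by
      rw [← sq_abs]; gcongr
    have h3 : (1 + |z| ^ 3) ^ 2 ≤ 2 * (1 + z ^ 4) * (1 + z ^ 2) := by
      have e2 : |z| ^ 2 = z ^ 2 := sq_abs z
      have := abs_nonneg z
      rw [← h4, ← e2]
      nlinarith [sq_nonneg (1 - |z| ^ 3), sq_nonneg |z|, pow_nonneg this 4]
    have h5 : 2 * (1 + z ^ 4) ≤ 2 / a * F z := by
      have h1 := hFa z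
      rw [h4] at h1
      rw [div_mul_eq_mul_div, le_div_iff₀ ha]
      linarith
    calc deriv F z ^ 2 ≤ C ^ 2 * (1 + |z| ^ 3) ^ 2 := by rw [← mul_pow]; exact h2
      _ ≤ C ^ 2 * (2 * (1 + z ^ 4) * (1 + z ^ 2)) := by gcongr
      _ ≤ C ^ 2 * (2 / a * F z * (1 + z ^ 2)) := by gcongr
      _ = 2 * C ^ 2 / a * F z * (1 + z ^ 2) := by ring
      _ ≤ _ := by
        have := (hpos z).le
        gcongr
        have : 0 ≤ 2 / a := by positivity
        linarith
  · refine (hq z).trans ?_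
    have := (hpos z).le
    gcongr
    have : 0 ≤ 2 * C ^ 2 / a := by positivity
    linarith
  · have h1 := (hC z).2.2
    have h2 : deriv (deriv F) z ^ 2 ≤ (C * (1 + |z| ^ 2)) ^ 2 := by
      rw [← sq_abs (deriv (deriv F) z)]; gcongr
    rw [sq_abs] at h2
    calc deriv (deriv F) z ^ 2 ≤ C ^ 2 * (1 + z ^ 2) ^ 2 := by rw [← mul_pow]; exact h2
      _ ≤ C ^ 2 * (2 / a * F z) := by gcongr; exact hq z
      _ = 2 * C ^ 2 / a * F z := by ring
      _ ≤ _ := by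
        have := (hpos z).le
        gcongr
        have : 0 ≤ 2 / a := by positivity
        linarith
  · have h1 := (hC z).1
    rw [h4] at h1
    refine h1.trans ?_
    gcongr
    have : 0 ≤ 2 * C ^ 2 / a := by positivity
    have : 0 ≤ 2 / a := by positivity
    linarith

namespace Comp

variable {d : ℕ} (c : Comp d) {F : ℝ → ℝ}

lemma energy_nonneg (hF : ∀ z, 0 < F z) (f : Pt d → ℝ) : 0 ≤ c.energy F f :=
  c.lump_nonneg fun v => (hF (f v)).le

/-- First variation of the energy in a bounded direction. -/
lemma slope_sq_le {K : ℝ} (hK : 0 < K) (hF : ∀ z, 0 < F z)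
    (h1 : ∀ z, deriv F z ^ 2 ≤ K * F z * (1 + z ^ 2)) (f : Pt d → ℝ) {u : Pt d → ℝ} {a : ℝ}
    (ha : 0 ≤ a) (hu : ∀ v ∈ c.nodes, u v ^ 2 ≤ a) :
    c.slope F f u ^ 2 ≤ K * a * (c.lump (fun _ => 1) + c.lump fun x => f x ^ 2) := by
  have hE := c.energy_nonneg hF f
  have h2 : c.lump (fun x => deriv F (f x) * u x) ^ 2
      ≤ c.lump (fun x => F (f x)) * c.lump (fun x => K * a * (1 + f x ^ 2)) := by
    refine c.lump_sq_le (fun v => (hF _).le) (fun v => by positivity) fun v hv => ?_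
    rw [mul_pow]
    have h3 := h1 (f v)
    have h4 := hu v hv
    have h5 := (hF (f v)).le
    calc _ ≤ (K * F (f v) * (1 + f v ^ 2)) * a := by gcongr
      _ = _ := by ring
  rw [c.lump_const_mul, c.lump_add] at h2
  rw [slope, div_pow, Real.sq_sqrt hE]
  have h6 : 0 ≤ c.lump (fun _ => 1) := c.lump_nonneg fun _ => zero_le_one
  have h7 : 0 ≤ c.lump fun x => f x ^ 2 := c.lump_nonneg fun _ => sq_nonneg _
  refine div_le_of_le_mul₀ hE (by positivity) ?_
  rw [mul_comm]
  exact h2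

/-- The second order part of the scalar auxiliary variable equation. -/
lemma lin_self {K : ℝ} (hK : 0 < K) (hF : ∀ z, 0 < F z)
    (h1 : ∀ z, deriv F z ^ 2 ≤ K * F z * (1 + z ^ 2)) (h2 : ∀ z, (1 + z ^ 2) ^ 2 ≤ K * F z)
    (h3 : ∀ z, deriv (deriv F) z ^ 2 ≤ K * F z) (f X : Pt d → ℝ) :
    ∃ S : ℝ, c.lin F f X X = c.slope F f X / 2 + S ∧
      S ^ 2 ≤ (K ^ 3 + K) * c.lump fun x => X x ^ 4 := by
  set E := c.energy F f with hE
  set L := c.lump (fun x => deriv F (f x) * X x) with hL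
  set Q := c.lump (fun x => deriv (deriv F) (f x) * X x * X x) with hQ
  set X4 := c.lump (fun x => X x ^ 4) with hX4
  have hE0 : 0 ≤ E := c.energy_nonneg hF f
  have hX0 : 0 ≤ X4 := c.lump_nonneg fun v => by positivity
  have hQ2 : Q ^ 2 ≤ K * E * X4 := by
    have : Q ^ 2 ≤ c.lump (fun x => K * F (f x)) * X4 := by
      refine c.lump_sq_le (fun v => mul_nonneg hK.le (hF _).le) (fun v => by positivity)
        fun v _ => ?_
      have := mul_le_mul_of_nonneg_right (h3 (f v)) (by positivity : 0 ≤ X v ^ 4)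
      linarith
    rwa [c.lump_const_mul] at this
  -- Two applications of Cauchy–Schwarz: first against `F`, which leaves `(1 + f ^ 2) * X ^ 2`, then
  -- once more against `F`. The resulting `E ^ 3` matches the square of the denominator `E ^ (3 /
  -- 2)`.
  have hL4 : L ^ 4 ≤ K ^ 3 * E ^ 3 * X4 := by
    set M := c.lump (fun x => (1 + f x ^ 2) * X x ^ 2) with hM
    have e1 : L ^ 2 ≤ E * (K * M) := by
      have : L ^ 2 ≤ c.lump (fun x => F (f x)) * c.lump (fun x => K * ((1 + f x ^ 2) * X x ^ 2)) := by
        refine c.lump_sq_le (fun v => (hF _).le) (fun v => by positivity) fun v _ => ?_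
        have := mul_le_mul_of_nonneg_right (h1 (f v)) (sq_nonneg (X v))
        linarith
      rwa [c.lump_const_mul] at this
    have e2 : M ^ 2 ≤ K * E * X4 := by
      have : M ^ 2 ≤ c.lump (fun x => K * F (f x)) * X4 := by
        refine c.lump_sq_le (fun v => mul_nonneg hK.le (hF _).le) (fun v => by positivity)
          fun v _ => ?_
        have := mul_le_mul_of_nonneg_right (h2 (f v)) (by positivity : 0 ≤ X v ^ 4)
        linarith
      rwa [c.lump_const_mul] at this
    calc L ^ 4 = (L ^ 2) ^ 2 := by ring
      _ ≤ (E * (K * M)) ^ 2 := by gcongr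
      _ = E ^ 2 * K ^ 2 * M ^ 2 := by ring
      _ ≤ E ^ 2 * K ^ 2 * (K * E * X4) := by gcongr
      _ = _ := by ring
  refine ⟨-(1 / (8 * E ^ (3 / 2 : ℝ)) * L * L) + 1 / (4 * √E) * Q, ?_, ?_⟩
  · rw [lin, slope]
    change 1 / (2 * √E) * L - 1 / (8 * E ^ (3 / 2 : ℝ)) * L * L + 1 / (4 * √E) * Q = L / √E / 2 + _
    ring
  · have hsq : √E ^ 2 = E := Real.sq_sqrt hE0
    have hp : (E ^ (3 / 2 : ℝ)) ^ 2 = E ^ 3 := by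
      rw [← Real.rpow_natCast, ← Real.rpow_mul hE0, ← Real.rpow_natCast]
      norm_num
    have a1 : (1 / (8 * E ^ (3 / 2 : ℝ)) * L * L) ^ 2 ≤ K ^ 3 / 64 * X4 := by
      have : (1 / (8 * E ^ (3 / 2 : ℝ)) * L * L) ^ 2 = L ^ 4 / (64 * E ^ 3) := by
        rw [← hp]; ring
      rw [this]
      refine div_le_of_le_mul₀ (by positivity) (by positivity) ?_
      linarith
    have a2 : (1 / (4 * √E) * Q) ^ 2 ≤ K / 16 * X4 := by
      have : (1 / (4 * √E) * Q) ^ 2 = Q ^ 2 / (16 * √E ^ 2) := by ring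
      rw [this, hsq]
      refine div_le_of_le_mul₀ (by positivity) (by positivity) ?_
      linarith
    have hK3 : 0 ≤ K ^ 3 * X4 := by positivity
    have hK1 : 0 ≤ K * X4 := by positivity
    nlinarith [sq_nonneg (1 / (8 * E ^ (3 / 2 : ℝ)) * L * L + 1 / (4 * √E) * Q)]

/-- The energy of a component. -/
noncomputable def ham (f : Pt d → ℝ) (r : ℝ) : ℝ :=
  c.dir f f / 2 + r ^ 2 + c.lump (fun x => f x ^ 2) / 8

/-- The martingale part of the energy increment. -/
noncomputable def ell (F : ℝ → ℝ) (f : Pt d → ℝ) (r : ℝ) (X : Pt d → ℝ) : ℝ :=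
  c.dir f X + r * c.slope F f X + c.lump (fun x => X x * f x) / 4

/-- The remainder in the energy increment. -/
noncomputable def rem (F : ℝ → ℝ) (K τ : ℝ) (f X : Pt d → ℝ) : ℝ :=
  2 * c.dir X X + c.lump (fun x => X x ^ 2) + c.slope F f X ^ 2
    + 5 * (K ^ 3 + K) * (τ⁻¹ * c.lump fun x => X x ^ 4)

lemma ham_nonneg (f : Pt d → ℝ) (r : ℝ) : 0 ≤ c.ham f r := by
  have := c.dir_self_nonneg f
  have : 0 ≤ c.lump fun x => f x ^ 2 := c.lump_nonneg fun _ => sq_nonneg _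
  rw [ham]
  positivity

/-- The contribution of one component to the energy inequality. -/
lemma ham_le {K : ℝ} (hK : 0 < K) (hF : ∀ z, 0 < F z)
    (h1 : ∀ z, deriv F z ^ 2 ≤ K * F z * (1 + z ^ 2)) (h2 : ∀ z, (1 + z ^ 2) ^ 2 ≤ K * F z)
    (h3 : ∀ z, deriv (deriv F) z ^ 2 ≤ K * F z) {τ : ℝ} (hτ : 0 < τ) (hτ1 : τ < 1)
    {f f' : Pt d → ℝ} (X : Pt d → ℝ) (hf : c.Aff f) (hf' : c.Aff f') (r r' : ℝ) :
    c.ham f r + 3 / 8 * c.dir (fun x => f x - f' x) (fun x => f x - f' x) + (r - r') ^ 2 / 2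
        + c.lump (fun x => (f x - f' x) ^ 2) / 16
      ≤ c.ham f' r' + τ * r' ^ 2 + c.ell F f' r' X + c.rem F K τ f' X
        + (c.dir f (fun x => f x - f' x) + 2 * r * (r - r') - c.dir f X - 2 * r * c.lin F f' X X)
        + (c.lump (fun x => (f x - f' x) * f x) - c.lump (fun x => X x * f x)) / 4 := by
  obtain ⟨S, hS, hS2⟩ := c.lin_self hK hF h1 h2 h3 f' X
  rw [hS, c.lump_increment, dir_increment hf hf', ham, ham, ell, rem]
  have a1 := dir_le hf hf' X
  have a2 := c.lump_mul_le f f' X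
  set H := c.slope F f' X
  set X4 := c.lump fun x => X x ^ 4
  have hS2' : S ^ 2 ≤ τ⁻¹ * S ^ 2 :=
    le_mul_of_one_le_left (sq_nonneg S) (one_le_inv₀ hτ |>.2 hτ1.le)
  have hS4 : τ⁻¹ * S ^ 2 ≤ (K ^ 3 + K) * (τ⁻¹ * X4) := by
    have := mul_le_mul_of_nonneg_left hS2 (inv_nonneg.2 hτ.le)
    linarith
  -- The term `r' S` is not centred, as `S` is of second order in the noise. Weighting Young's
  -- inequality by `τ` costs a growth term of order `τ` and `τ⁻¹ * S ^ 2`, which is again of order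
  -- `τ`.
  have a3 : 2 * r' * S ≤ τ * r' ^ 2 + τ⁻¹ * S ^ 2 := by
    have h := mul_nonneg hτ.le (sq_nonneg (r' - τ⁻¹ * S))
    have e : τ * (r' - τ⁻¹ * S) ^ 2 = τ * r' ^ 2 - 2 * r' * S + τ⁻¹ * S ^ 2 := by
      field_simp
      ring
    linarith
  -- Replacing the implicit `r` by `r'` is paid for by half of the numerical dissipation `(r - r') ^
  -- 2`.
  have a4 : 2 * (r - r') * (H / 2 + S) ≤ (r - r') ^ 2 / 2 + H ^ 2 + 4 * S ^ 2 := by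
    nlinarith [sq_nonneg ((r - r') - 2 * (H / 2 + S)), sq_nonneg (H / 2 - S)]
  have hX2 : 0 ≤ c.lump fun x => X x ^ 2 := c.lump_nonneg fun _ => sq_nonneg _
  nlinarith

end Comp
end SAV

/-! ### The pathwise energy inequality and its dependence on the noise. -/

namespace SAV
namespace Mesh

variable {d : ℕ} {O : Set (Pt d)} (M : Mesh O)

/-- The triangulation of the domain as a discretized domain. -/
noncomputable def bulk : Comp d where
  nodes := M.nodes
  mass := M.mass
  faces := M.elements
  wt := vol
  mass_nonneg := M.mass_nonneg
  wt_nonneg := vol_nonneg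

/-- The triangulation of the boundary as a discretized domain. -/
noncomputable def bdry : Comp d where
  nodes := M.bdryNodes
  mass := M.massBdry
  faces := M.bdryElements
  wt := area O
  mass_nonneg := M.massBdry_nonneg
  wt_nonneg := area_nonneg

variable {M}

lemma MemU.aff_bulk {u : Pt d → ℝ} (hu : M.MemU u) : M.bulk.Aff u := fun _ hs =>
  hu.affOn (M.element_face hs)

lemma MemU.aff_bdry {u : Pt d → ℝ} (hu : M.MemU u) : M.bdry.Aff u := fun _ hs =>
  hu.affOn (M.bdryElement_face hs)

variable (M)

/-- The total energy. -/
noncomputable def totalEnergy (f : Pt d → ℝ) (r s : ℝ) : ℝ :=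
  M.bulk.ham f r + M.bdry.ham f s + 1

/-- The numerical and physical dissipation in one step. -/
noncomputable def dissipation (τ : ℝ) (δ μ θ : Pt d → ℝ) (a b : ℝ) : ℝ :=
  (M.bulk.dir δ δ + M.bdry.dir δ δ + M.bulk.lump (fun x => δ x ^ 2)
    + M.bdry.lump (fun x => δ x ^ 2) + a ^ 2 + b ^ 2 + τ * M.bulk.dir μ μ
    + τ * M.bdry.lump (fun x => θ x ^ 2)) / 32

/-- The pathwise energy inequality. -/
lemma SchemeStep.energy_le (hO : IsConvexPolyhedralDomain O) (hd : 1 ≤ d)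
    (hM : M.IsBdryCompatible) {F G : ℝ → ℝ} {τ : ℝ} {φ' φ μ θ X : Pt d → ℝ} {r' s' r s : ℝ}
    (h : M.SchemeStep F G τ φ' r' s' X φ μ θ r s) (hφ' : M.MemU φ') (hφ : M.MemU φ)
    (hμ : M.MemU μ) (hθ : M.MemUBdry θ) (hX : M.MemU X) (hτ : 0 < τ) (hτ1 : τ < 1)
    {K : ℝ} (hK : 0 < K) (hF : ∀ z, 0 < F z)
    (hF1 : ∀ z, deriv F z ^ 2 ≤ K * F z * (1 + z ^ 2)) (hF2 : ∀ z, (1 + z ^ 2) ^ 2 ≤ K * F z)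
    (hF3 : ∀ z, deriv (deriv F) z ^ 2 ≤ K * F z) (hG : ∀ z, 0 < G z)
    (hG1 : ∀ z, deriv G z ^ 2 ≤ K * G z * (1 + z ^ 2)) (hG2 : ∀ z, (1 + z ^ 2) ^ 2 ≤ K * G z)
    (hG3 : ∀ z, deriv (deriv G) z ^ 2 ≤ K * G z) :
    M.totalEnergy φ r s + M.dissipation τ (fun x => φ x - φ' x) μ θ (r - r') (s - s')
      ≤ (1 + τ) * M.totalEnergy φ' r' s' + (M.bulk.ell F φ' r' X + M.bdry.ell G φ' s' X)
        + (M.bulk.rem F K τ φ' X + M.bdry.rem G K τ φ' X) := by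
  set δ : Pt d → ℝ := fun x => φ x - φ' x with hδ
  have hδU : M.MemU δ := hφ.sub hφ'
  have i1 : ∀ a, M.intI a = M.bulk.lump a := fun a => M.intI_eq hO a
  have i2 : ∀ a, M.intIBdry a = M.bdry.lump a := fun a => M.intIBdry_eq hO hd hM a
  have d1 : ∀ {u v}, M.MemU u → M.MemU v → dirichlet O u v = M.bulk.dir u v :=
    fun hu hv => M.dirichlet_eq hO hu hv
  have d2 : ∀ u v, M.dirichletBdry u v = M.bdry.dir u v := fun u v => M.dirichletBdry_eq u v
  have en1 : M.energy F φ' = M.bulk.energy F φ' := i1 _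
  have en2 : M.energyBdry G φ' = M.bdry.energy G φ' := i2 _
  have cm : ∀ (c : Comp d) (a b : Pt d → ℝ), c.lump (fun x => a x * b x)
      = c.lump fun x => b x * a x := fun c a b => by
    congr 1; ext x; ring
  -- The potentials as test functions give the physical dissipation, `φ` gives the `L²` norms. In
  -- the potential equation, `δ` gives the energy increment and `X` the work of the noise.
  have e1 := h.eq_phi μ hμ
  have e2 := h.eq_phi φ hφ
  have e3 := h.eq_phi_bdry θ hθ
  have e4 := h.eq_phi_bdry φ hφ.memUBdry
  have e5 := h.eq_pot δ hδU
  have e6 := h.eq_pot X hX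
  have e7 := h.eq_r
  have e8 := h.eq_s
  simp only [i1, i2, d1 hμ hμ, d1 hμ hφ, d1 hφ hδU, d1 hφ hX, d2, en1, en2] at e1 e2 e3 e4 e5 e6 e7 e8
  -- The structure of the scheme is used here: the nonlinear terms tested with `δ` are `2 r` and `2
  -- s` times the right-hand sides of the updates of the scalar variables.
  have p5 : M.bulk.lump (fun x => μ x * δ x) + M.bdry.lump (fun x => θ x * δ x)
      = M.bulk.dir φ δ + M.bdry.dir φ δ + 2 * r * (r - r') + 2 * s * (s - s') := by
    rw [e7, e8, e5]
    ring
  have p6 : M.bulk.lump (fun x => μ x * X x) + M.bdry.lump (fun x => θ x * X x)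
      = M.bulk.dir φ X + M.bdry.dir φ X + 2 * r * M.bulk.lin F φ' X X
        + 2 * s * M.bdry.lin G φ' X X := by
    rw [e6, Comp.lin, Comp.lin]
    ring
  have q1 := M.bulk.ham_le hK hF hF1 hF2 hF3 hτ hτ1 X hφ.aff_bulk hφ'.aff_bulk r r'
  have q2 := M.bdry.ham_le hK hG hG1 hG2 hG3 hτ hτ1 X hφ.aff_bdry hφ'.aff_bdry s s'
  -- The tests with `φ` leave mixed terms with `μ` and `θ`. With weight 1/4 they take at most 1/4 of
  -- the `μ`-dissipation, 5/8 of the `θ`-dissipation, and 1/32 of the available 1/16 for the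
  -- boundary increment; the remaining 1/32 explains the normalization in `dissipation`.
  have y1 := Comp.neg_dir_le hφ.aff_bulk hφ'.aff_bulk μ
  have y2 := M.bdry.neg_lump_mul_le φ φ' θ
  have f1 : M.bulk.lump (fun x => δ x * μ x) = M.bulk.lump fun x => μ x * δ x := cm _ _ _
  have f2 : M.bulk.lump (fun x => X x * μ x) = M.bulk.lump fun x => μ x * X x := cm _ _ _
  have f3 : M.bdry.lump (fun x => δ x * θ x) = M.bdry.lump fun x => θ x * δ x := cm _ _ _
  have f4 : M.bdry.lump (fun x => X x * θ x) = M.bdry.lump fun x => θ x * X x := cm _ _ _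
  have f5 : M.bdry.lump (fun x => θ x * θ x) = M.bdry.lump fun x => θ x ^ 2 := by
    congr 1; ext x; ring
  change M.bulk.lump (fun x => δ x * μ x) + _ = _ at e1
  change M.bulk.lump (fun x => δ x * φ x) + _ = _ at e2
  change M.bdry.lump (fun x => δ x * θ x) + _ = _ at e3
  change M.bdry.lump (fun x => δ x * φ x) + _ = _ at e4
  rw [f1, f2] at e1
  rw [f3, f4, f5] at e3
  change _ + 3 / 8 * M.bulk.dir δ δ + _ + M.bulk.lump (fun x => δ x ^ 2) / 16
    ≤ _ + (M.bulk.dir φ δ + _ - _ - _) + (M.bulk.lump (fun x => δ x * φ x) - _) / 4 at q1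
  change _ + 3 / 8 * M.bdry.dir δ δ + _ + M.bdry.lump (fun x => δ x ^ 2) / 16
    ≤ _ + (M.bdry.dir φ δ + _ - _ - _) + (M.bdry.lump (fun x => δ x * φ x) - _) / 4 at q2
  change _ ≤ _ + M.bulk.dir δ δ / 2 at y1
  change _ ≤ _ + _ + M.bdry.lump (fun x => δ x ^ 2) / 8 at y2
  have n1 := M.bulk.dir_self_nonneg δ
  have n2 := M.bdry.dir_self_nonneg δ
  have n3 := M.bulk.dir_self_nonneg μ
  have n4 := M.bulk.dir_self_nonneg φ'
  have n5 := M.bdry.dir_self_nonneg φ'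
  have n6 : 0 ≤ M.bdry.lump fun x => θ x ^ 2 := M.bdry.lump_nonneg fun _ => sq_nonneg _
  have n7 : 0 ≤ M.bdry.lump fun x => δ x ^ 2 := M.bdry.lump_nonneg fun _ => sq_nonneg _
  have n8 : 0 ≤ M.bulk.lump fun x => δ x ^ 2 := M.bulk.lump_nonneg fun _ => sq_nonneg _
  have n9 : 0 ≤ M.bulk.lump fun x => φ' x ^ 2 := M.bulk.lump_nonneg fun _ => sq_nonneg _
  have y1' := mul_le_mul_of_nonneg_left y1 hτ.le
  have y2' := mul_le_mul_of_nonneg_left y2 hτ.le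
  have t1 : τ * M.bulk.dir δ δ ≤ M.bulk.dir δ δ := mul_le_of_le_one_left n1 hτ1.le
  have t2 : τ * M.bdry.lump (fun x => δ x ^ 2) ≤ M.bdry.lump fun x => δ x ^ 2 :=
    mul_le_of_le_one_left n7 hτ1.le
  have t3 := mul_nonneg hτ.le n3
  have t4 := mul_nonneg hτ.le n4
  have t5 := mul_nonneg hτ.le n5
  have t6 := mul_nonneg hτ.le n6
  have t9 := mul_nonneg hτ.le n9
  have expand : (1 + τ) * M.totalEnergy φ' r' s' = M.totalEnergy φ' r' s'
      + (τ * M.bulk.dir φ' φ' / 2 + τ * r' ^ 2 + τ * M.bulk.lump (fun x => φ' x ^ 2) / 8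
        + (τ * M.bdry.dir φ' φ' / 2 + τ * s' ^ 2 + τ * M.bdry.lump (fun x => φ' x ^ 2) / 8) + τ) := by
    rw [totalEnergy, Comp.ham, Comp.ham]; ring
  rw [expand, totalEnergy, totalEnergy, dissipation]
  have sr := sq_nonneg (r - r')
  have ss := sq_nonneg (s - s')
  linarith

end Mesh

namespace Comp

variable {d : ℕ} (c : Comp d) (F : ℝ → ℝ) (f : Pt d → ℝ) (Z : Finset ℤ) (β : ℤ → ℝ)
  (u : ℤ → Pt d → ℝ)

lemma lump_sum_mul (a : Pt d → ℝ) : c.lump (fun x => a x * ∑ k ∈ Z, β k * u k x)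
    = ∑ k ∈ Z, β k * c.lump fun x => a x * u k x := by
  simp only [lump, Finset.mul_sum, Finset.sum_mul]
  rw [Finset.sum_comm]
  exact Finset.sum_congr rfl fun k _ => Finset.sum_congr rfl fun v _ => by ring

lemma slope_sum : c.slope F f (fun x => ∑ k ∈ Z, β k * u k x)
    = ∑ k ∈ Z, β k * c.slope F f (u k) := by
  simp only [slope]
  rw [c.lump_sum_mul Z β u, Finset.sum_div]
  exact Finset.sum_congr rfl fun k _ => by rw [mul_div_assoc]

variable {c u Z}

lemma dir_sum (hu : ∀ k ∈ Z, c.Aff (u k)) : c.dir f (fun x => ∑ k ∈ Z, β k * u k x)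
    = ∑ k ∈ Z, β k * c.dir f (u k) := by
  simp only [dir, Finset.mul_sum]
  rw [Finset.sum_comm]
  refine Finset.sum_congr rfl fun s hs => ?_
  rw [(affOn_sum Z β u fun k hk => hu k hk s hs).2, inner_sum, Finset.mul_sum]
  refine Finset.sum_congr rfl fun k _ => ?_
  rw [inner_smul_right]; ring

/-- Linearity in the direction: the martingale part is a linear form in the noise coefficients, with
factors determined by the past. -/
lemma ell_sum (hu : ∀ k ∈ Z, c.Aff (u k)) (r : ℝ) :
    c.ell F f r (fun x => ∑ k ∈ Z, β k * u k x) = ∑ k ∈ Z, β k * c.ell F f r (u k) := by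
  have cm : ∀ w : Pt d → ℝ, c.lump (fun x => w x * f x) = c.lump fun x => f x * w x := fun w => by
    congr 1; ext x; ring
  simp only [ell, cm]
  rw [dir_sum f β hu, slope_sum, lump_sum_mul, Finset.mul_sum, Finset.sum_div,
    ← Finset.sum_add_distrib, ← Finset.sum_add_distrib]
  exact Finset.sum_congr rfl fun k _ => by ring

/-- Coordinates turn the Dirichlet energy of the noise into a weighted sum of squares of scalar
linear forms, to which `IsForm.sq` applies. -/
lemma dir_sum_self (hu : ∀ k ∈ Z, c.Aff (u k)) :
    c.dir (fun x => ∑ k ∈ Z, β k * u k x) (fun x => ∑ k ∈ Z, β k * u k x)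
      = ∑ s ∈ c.faces, c.wt s * ∑ j, (∑ k ∈ Z, β k * tangentialGrad s (u k) j) ^ 2 := by
  simp only [dir]
  refine Finset.sum_congr rfl fun s hs => ?_
  rw [(affOn_sum Z β u fun k hk => hu k hk s hs).2, real_inner_self_eq_norm_sq,
    EuclideanSpace.real_norm_sq_eq]
  simp

end Comp
end SAV

/-! ### Sizes of the martingale part and of the remainder. -/

namespace SAV
namespace Comp

variable {d : ℕ} (c : Comp d) (F : ℝ → ℝ)

/-- The variance proxy of the remainder of the energy increment. -/
noncomputable def remSize (K τ : ℝ) (lam : ℤ → ℝ) (Z : Finset ℤ) (f : Pt d → ℝ)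
    (u : ℤ → Pt d → ℝ) : ℝ :=
  2 * (∑ s ∈ c.faces, c.wt s * ∑ j, τ * ∑ k ∈ Z, lam k ^ 2 * tangentialGrad s (u k) j ^ 2)
    + (∑ v ∈ c.nodes, c.mass v * (τ * ∑ k ∈ Z, lam k ^ 2 * u k v ^ 2))
    + τ * (∑ k ∈ Z, lam k ^ 2 * c.slope F f (u k) ^ 2)
    + 5 * (K ^ 3 + K) * ∑ v ∈ c.nodes, c.mass v * (τ * (∑ k ∈ Z, lam k ^ 2 * u k v ^ 2) ^ 2)

/-- The remainder is a combination, with nonnegative weights that do not depend on the noise, of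
squares and of `τ⁻¹` times fourth powers of linear forms; sizes add by Minkowski's inequality. -/
lemma isForm_rem {Ω : Type*} [MeasurableSpace Ω] {P : Measure Ω} [IsProbabilityMeasure P]
    {E : Type*} [MeasurableSpace E] {Cmom : ℕ → ℝ} {b : ℤ → Ω → ℝ} {τ : ℝ} {lam : ℤ → ℝ}
    (h : IsSymmFamily P Cmom b) (hτ : 0 < τ) {K : ℝ} (hK : 0 < K) {Z : Finset ℤ}
    {f : E → Pt d → ℝ} {u : ℤ → E → Pt d → ℝ} (hu : ∀ k ∈ Z, ∀ e, c.Aff (u k e))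
    (hum : ∀ k ∈ Z, ∀ v ∈ c.nodes, Measurable fun e => u k e v)
    (hugm : ∀ k ∈ Z, ∀ s ∈ c.faces, Measurable fun e => tangentialGrad s (u k e))
    (hsm : ∀ k ∈ Z, Measurable fun e => c.slope F (f e) (u k e)) :
    IsForm P (fun ω k => √τ * lam k * b k ω) (fun j => khinConst Cmom (2 * j))
      (fun e β => c.rem F K τ (f e) fun x => ∑ k ∈ Z, β k * u k e x)
      (fun e => c.remSize F K τ lam Z (f e) fun k => u k e) := by
  have hB : Measurable fun (ω : Ω) (k : ℤ) => √τ * lam k * b k ω :=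
    measurable_pi_lambda _ fun k => (h.meas k).const_mul _
  have hK0 : ∀ j, 0 ≤ khinConst Cmom (2 * j) := fun j => zero_le_one.trans (one_le_khinConst _ _)
  have e1 : ∀ (e : E) (β : ℤ → ℝ), c.rem F K τ (f e) (fun x => ∑ k ∈ Z, β k * u k e x)
      = 2 * (∑ s ∈ c.faces, c.wt s * ∑ j, (∑ k ∈ Z, β k * tangentialGrad s (u k e) j) ^ 2)
        + (∑ v ∈ c.nodes, c.mass v * (∑ k ∈ Z, β k * u k e v) ^ 2)
        + (∑ k ∈ Z, β k * c.slope F (f e) (u k e)) ^ 2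
        + 5 * (K ^ 3 + K)
          * ∑ v ∈ c.nodes, c.mass v * (τ⁻¹ * (∑ k ∈ Z, β k * u k e v) ^ 4) := by
    intro e β
    rw [rem, dir_sum_self β fun k hk => hu k hk e, slope_sum]
    simp only [lump]
    rw [Finset.mul_sum c.nodes _ τ⁻¹]
    congr 1
    · congr 2
      exact Finset.sum_congr rfl fun v _ => mul_comm _ _
    · congr 1
      exact Finset.sum_congr rfl fun v _ => by ring
  simp only [e1, remSize]
  have g1 : ∀ s ∈ c.faces, ∀ j : Fin d, IsForm P (fun ω k => √τ * lam k * b k ω)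
      (fun j => khinConst Cmom (2 * j))
      (fun (e : E) β => (∑ k ∈ Z, β k * tangentialGrad s (u k e) j) ^ 2)
      (fun e => τ * ∑ k ∈ Z, lam k ^ 2 * tangentialGrad s (u k e) j ^ 2) := fun s hs j =>
    IsForm.sq h hτ.le Z fun k hk => by
      have h1 := hugm k hk s hs
      exact (EuclideanSpace.proj (𝕜 := ℝ) j).continuous.measurable.comp h1
  have g2 : ∀ v ∈ c.nodes, IsForm P (fun ω k => √τ * lam k * b k ω)
      (fun j => khinConst Cmom (2 * j)) (fun (e : E) β => (∑ k ∈ Z, β k * u k e v) ^ 2)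
      (fun e => τ * ∑ k ∈ Z, lam k ^ 2 * u k e v ^ 2) := fun v hv =>
    IsForm.sq h hτ.le Z fun k hk => hum k hk v hv
  have g3 : IsForm P (fun ω k => √τ * lam k * b k ω) (fun j => khinConst Cmom (2 * j))
      (fun (e : E) β => (∑ k ∈ Z, β k * c.slope F (f e) (u k e)) ^ 2)
      (fun e => τ * ∑ k ∈ Z, lam k ^ 2 * c.slope F (f e) (u k e) ^ 2) :=
    IsForm.sq h hτ.le Z fun k hk => hsm k hk
  have g4 : ∀ v ∈ c.nodes, IsForm P (fun ω k => √τ * lam k * b k ω)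
      (fun j => khinConst Cmom (2 * j)) (fun (e : E) β => τ⁻¹ * (∑ k ∈ Z, β k * u k e v) ^ 4)
      (fun e => τ * (∑ k ∈ Z, lam k ^ 2 * u k e v ^ 2) ^ 2) := fun v hv =>
    IsForm.fourth h hτ Z fun k hk => hum k hk v hv
  refine IsForm.add hB hK0 (IsForm.add hB hK0 (IsForm.add hB hK0 ?_ ?_) g3) ?_
  · exact (IsForm.sum hB hK0 _ fun s hs => (IsForm.sum hB hK0 _ fun j _ => g1 s hs j).const_mul
      (c.wt_nonneg s)).const_mul zero_le_two
  · exact IsForm.sum hB hK0 _ fun v hv => (g2 v hv).const_mul (c.mass_nonneg v)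
  · exact (IsForm.sum hB hK0 _ fun v hv => (g4 v hv).const_mul (c.mass_nonneg v)).const_mul
      (by positivity)

/-- Bounds for a noise mode of amplitude `γ` at the state `f`. -/
structure IsMode (f u : Pt d → ℝ) (K₂ γ : ℝ) : Prop where
  val : ∀ v ∈ c.nodes, u v ^ 2 ≤ K₂ * γ ^ 2
  grad : ∀ s ∈ c.faces, ‖tangentialGrad s u‖ ^ 2
    ≤ K₂ * γ ^ 2 * (1 + ‖tangentialGrad s f‖ ^ 2)

variable {c F} {K : ℝ} {f : Pt d → ℝ} {u : Pt d → ℝ} {K₂ γ W : ℝ}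

lemma IsMode.dir_le (hu : c.IsMode f u K₂ γ) (hK₂ : 0 ≤ K₂) (hW : ∑ s ∈ c.faces, c.wt s ≤ W) :
    c.dir u u ≤ K₂ * γ ^ 2 * (W + c.dir f f) := by
  simp only [dir, real_inner_self_eq_norm_sq]
  calc _ ≤ ∑ s ∈ c.faces, c.wt s * (K₂ * γ ^ 2 * (1 + ‖tangentialGrad s f‖ ^ 2)) :=
        Finset.sum_le_sum fun s hs => mul_le_mul_of_nonneg_left (hu.grad s hs) (c.wt_nonneg s)
    _ = K₂ * γ ^ 2 * (∑ s ∈ c.faces, c.wt s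
          + ∑ s ∈ c.faces, c.wt s * ‖tangentialGrad s f‖ ^ 2) := by
        rw [← Finset.sum_add_distrib, Finset.mul_sum]
        exact Finset.sum_congr rfl fun s _ => by ring
    _ ≤ _ := by gcongr

lemma IsMode.lump_sq_le (hu : c.IsMode f u K₂ γ) (hK₂ : 0 ≤ K₂)
    (hW : c.lump (fun _ => 1) ≤ W) : c.lump (fun x => u x ^ 2) ≤ K₂ * γ ^ 2 * W := by
  calc _ ≤ c.lump fun _ => K₂ * γ ^ 2 * 1 := c.lump_mono fun v hv => by
        rw [mul_one]; exact hu.val v hv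
    _ = K₂ * γ ^ 2 * c.lump fun _ => 1 := c.lump_const_mul _ _
    _ ≤ _ := by gcongr

lemma dir_le_ham (c : Comp d) (f : Pt d → ℝ) (r : ℝ) : c.dir f f ≤ 2 * c.ham f r := by
  have : 0 ≤ c.lump fun x => f x ^ 2 := c.lump_nonneg fun _ => sq_nonneg _
  rw [ham]
  nlinarith [sq_nonneg r]

lemma lump_le_ham (c : Comp d) (f : Pt d → ℝ) (r : ℝ) :
    c.lump (fun x => f x ^ 2) ≤ 8 * c.ham f r := by
  have := c.dir_self_nonneg f
  rw [ham]
  nlinarith [sq_nonneg r]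

lemma sq_le_ham (c : Comp d) (f : Pt d → ℝ) (r : ℝ) : r ^ 2 ≤ c.ham f r := by
  have := c.dir_self_nonneg f
  have : 0 ≤ c.lump fun x => f x ^ 2 := c.lump_nonneg fun _ => sq_nonneg _
  rw [ham]
  linarith

/-- The martingale part of the energy increment in the direction of a mode. -/
lemma IsMode.ell_sq_le (hu : c.IsMode f u K₂ γ) (hK₂ : 0 ≤ K₂) (hK : 0 < K)
    (hF : ∀ z, 0 < F z) (hF1 : ∀ z, deriv F z ^ 2 ≤ K * F z * (1 + z ^ 2)) (hW0 : 0 ≤ W)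
    (hW1 : c.lump (fun _ => 1) ≤ W) (hW2 : ∑ s ∈ c.faces, c.wt s ≤ W) {r V : ℝ}
    (hV1 : 1 ≤ V) (hV : c.ham f r ≤ V) :
    c.ell F f r u ^ 2 ≤ 3 * (2 * K₂ * (W + 2) + K * K₂ * (W + 8) + K₂ * W) * γ ^ 2 * V ^ 2 := by
  have d1 := c.dir_sq_le f u
  have d2 := hu.dir_le hK₂ hW2
  have d3 := (c.dir_le_ham f r).trans (mul_le_mul_of_nonneg_left hV zero_le_two)
  have d4 := (c.lump_le_ham f r).trans (mul_le_mul_of_nonneg_left hV (by norm_num : (0 : ℝ) ≤ 8))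
  have d5 := (c.sq_le_ham f r).trans hV
  have d6 := hu.lump_sq_le hK₂ hW1
  have d7 := c.slope_sq_le hK hF hF1 f (by positivity) hu.val
  have n1 := c.dir_self_nonneg f
  have n2 : 0 ≤ c.lump fun x => f x ^ 2 := c.lump_nonneg fun _ => sq_nonneg _
  have n3 : 0 ≤ c.lump fun x => u x ^ 2 := c.lump_nonneg fun _ => sq_nonneg _
  have d8 : c.lump (fun x => u x * f x) ^ 2
      ≤ c.lump (fun x => u x ^ 2) * c.lump (fun x => f x ^ 2) :=
    c.lump_sq_le (fun _ => sq_nonneg _) (fun _ => sq_nonneg _) fun v _ => (mul_pow _ _ _).le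
  -- Constants are absorbed into multiples of `V`. This is what the summand 1 in `totalEnergy` is
  -- for: the bounds become homogeneous in the energy.
  have hWV : W ≤ W * V := le_mul_of_one_le_right hW0 hV1
  have b1 : c.dir f u ^ 2 ≤ 2 * K₂ * (W + 2) * γ ^ 2 * V ^ 2 := by
    calc _ ≤ c.dir f f * c.dir u u := d1
      _ ≤ (2 * V) * (K₂ * γ ^ 2 * (W * V + 2 * V)) := by
          refine mul_le_mul d3 (d2.trans ?_) (c.dir_self_nonneg u) (by positivity)
          gcongr
      _ = _ := by ring
  have b2 : (r * c.slope F f u) ^ 2 ≤ K * K₂ * (W + 8) * γ ^ 2 * V ^ 2 := by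
    calc _ = r ^ 2 * c.slope F f u ^ 2 := mul_pow _ _ _
      _ ≤ V * (K * (K₂ * γ ^ 2) * (W * V + 8 * V)) := by
          refine mul_le_mul d5 (d7.trans ?_) (sq_nonneg _) (by positivity)
          gcongr
          exact hW1.trans hWV
      _ = _ := by ring
  have b3 : (c.lump (fun x => u x * f x) / 4) ^ 2 ≤ K₂ * W * γ ^ 2 * V ^ 2 := by
    have : c.lump (fun x => u x * f x) ^ 2 ≤ (K₂ * γ ^ 2 * W) * (8 * V) :=
      d8.trans (mul_le_mul d6 d4 n2 (by positivity))
    have h2 : (K₂ * γ ^ 2 * W) * V ≤ (K₂ * γ ^ 2 * W) * V ^ 2 := by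
      gcongr
      nlinarith
    nlinarith
  rw [ell]
  nlinarith [sq_nonneg (c.dir f u - r * c.slope F f u),
    sq_nonneg (c.dir f u - c.lump (fun x => u x * f x) / 4),
    sq_nonneg (r * c.slope F f u - c.lump (fun x => u x * f x) / 4)]

/-- The remainder of the energy increment. -/
lemma remSize_le {u : ℤ → Pt d → ℝ} {γ lam : ℤ → ℝ} {Z : Finset ℤ}
    (hu : ∀ k ∈ Z, c.IsMode f (u k) K₂ (γ k)) (hK₂ : 0 ≤ K₂) (hK : 0 < K)
    (hF : ∀ z, 0 < F z) (hF1 : ∀ z, deriv F z ^ 2 ≤ K * F z * (1 + z ^ 2)) (hW0 : 0 ≤ W)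
    (hW1 : c.lump (fun _ => 1) ≤ W) (hW2 : ∑ s ∈ c.faces, c.wt s ≤ W) {r V τ Γ : ℝ}
    (hV1 : 1 ≤ V) (hV : c.ham f r ≤ V) (hτ : 0 ≤ τ)
    (hΓ : ∑ k ∈ Z, lam k ^ 2 * γ k ^ 2 ≤ Γ) :
    c.remSize F K τ lam Z f u ≤ τ * ((2 * K₂ * Γ * (W + 2) + K₂ * Γ * W + K * K₂ * Γ * (W + 8)
      + 5 * (K ^ 3 + K) * W * (K₂ * Γ) ^ 2) * V) := by
  have d3 := (c.dir_le_ham f r).trans (mul_le_mul_of_nonneg_left hV zero_le_two)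
  have d4 := (c.lump_le_ham f r).trans (mul_le_mul_of_nonneg_left hV (by norm_num : (0 : ℝ) ≤ 8))
  have hWV : W ≤ W * V := le_mul_of_one_le_right hW0 hV1
  have hV0 : 0 ≤ V := zero_le_one.trans hV1
  have hΓ0 : 0 ≤ Γ := le_trans (Finset.sum_nonneg fun k _ => by positivity) hΓ
  have hsum : ∀ (a : ℤ → ℝ) (B : ℝ), 0 ≤ B → (∀ k ∈ Z, a k ≤ B * γ k ^ 2) →
      ∑ k ∈ Z, lam k ^ 2 * a k ≤ B * Γ := fun a B hB ha => by
    calc _ ≤ ∑ k ∈ Z, lam k ^ 2 * (B * γ k ^ 2) :=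
          Finset.sum_le_sum fun k hk => mul_le_mul_of_nonneg_left (ha k hk) (sq_nonneg _)
      _ = B * ∑ k ∈ Z, lam k ^ 2 * γ k ^ 2 := by
          rw [Finset.mul_sum]; exact Finset.sum_congr rfl fun k _ => by ring
      _ ≤ _ := by gcongr
  have m0 : ∑ v ∈ c.nodes, c.mass v ≤ W := by
    have : c.lump (fun _ => 1) = ∑ v ∈ c.nodes, c.mass v := by simp [lump]
    rwa [← this]
  have hval : ∀ v ∈ c.nodes, ∑ k ∈ Z, lam k ^ 2 * u k v ^ 2 ≤ K₂ * Γ := fun v hv =>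
    hsum _ K₂ hK₂ fun k hk => (hu k hk).val v hv
  have t1 : ∑ s ∈ c.faces, c.wt s * ∑ j, τ * ∑ k ∈ Z, lam k ^ 2 * tangentialGrad s (u k) j ^ 2
      ≤ τ * (K₂ * Γ * (W + 2) * V) := by
    -- The coordinates recombine to the Dirichlet energies of the single modes.
    have e : ∑ s ∈ c.faces, c.wt s * ∑ j, τ * ∑ k ∈ Z, lam k ^ 2 * tangentialGrad s (u k) j ^ 2
        = τ * ∑ k ∈ Z, lam k ^ 2 * c.dir (u k) (u k) := by
      simp only [dir, real_inner_self_eq_norm_sq, EuclideanSpace.real_norm_sq_eq, Finset.mul_sum]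
      rw [Finset.sum_comm (s := Z)]
      refine Finset.sum_congr rfl fun s _ => ?_
      rw [Finset.sum_comm]
      refine Finset.sum_congr rfl fun k _ => Finset.sum_congr rfl fun j _ => by ring
    rw [e]
    gcongr
    have := hsum (fun k => c.dir (u k) (u k)) (K₂ * (W * V + 2 * V)) (by positivity) fun k hk => by
      refine ((hu k hk).dir_le hK₂ hW2).trans ?_
      calc _ ≤ K₂ * γ k ^ 2 * (W * V + 2 * V) := by gcongr
        _ = _ := by ring
    refine this.trans (le_of_eq (by ring))
  have t2 : ∑ v ∈ c.nodes, c.mass v * (τ * ∑ k ∈ Z, lam k ^ 2 * u k v ^ 2)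
      ≤ τ * (K₂ * Γ * W * V) := by
    calc _ ≤ ∑ v ∈ c.nodes, c.mass v * (τ * (K₂ * Γ)) := by
          refine Finset.sum_le_sum fun v hv => ?_
          have := c.mass_nonneg v
          have := hval v hv
          gcongr
      _ = (τ * (K₂ * Γ)) * ∑ v ∈ c.nodes, c.mass v := by rw [← Finset.sum_mul, mul_comm]
      _ ≤ (τ * (K₂ * Γ)) * (W * V) := by gcongr; exact m0.trans hWV
      _ = _ := by ring
  have t3 : τ * ∑ k ∈ Z, lam k ^ 2 * c.slope F f (u k) ^ 2 ≤ τ * (K * K₂ * Γ * (W + 8) * V) := by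
    gcongr
    have := hsum (fun k => c.slope F f (u k) ^ 2) (K * K₂ * (W * V + 8 * V)) (by positivity)
      fun k hk => by
        refine (c.slope_sq_le hK hF hF1 f (by positivity) (hu k hk).val).trans ?_
        calc _ ≤ K * (K₂ * γ k ^ 2) * (W * V + 8 * V) := by
              gcongr
              exact hW1.trans hWV
          _ = _ := by ring
    refine this.trans (le_of_eq (by ring))
  have t4 : ∑ v ∈ c.nodes, c.mass v * (τ * (∑ k ∈ Z, lam k ^ 2 * u k v ^ 2) ^ 2)
      ≤ τ * (W * (K₂ * Γ) ^ 2 * V) := by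
    calc _ ≤ ∑ v ∈ c.nodes, c.mass v * (τ * (K₂ * Γ) ^ 2) := by
          refine Finset.sum_le_sum fun v hv => ?_
          have := c.mass_nonneg v
          have := hval v hv
          have : 0 ≤ ∑ k ∈ Z, lam k ^ 2 * u k v ^ 2 := by positivity
          gcongr
      _ = (τ * (K₂ * Γ) ^ 2) * ∑ v ∈ c.nodes, c.mass v := by rw [← Finset.sum_mul, mul_comm]
      _ ≤ (τ * (K₂ * Γ) ^ 2) * (W * V) := by gcongr; exact m0.trans hWV
      _ = _ := by ring
  have t5 := mul_le_mul_of_nonneg_left t4 (by positivity : 0 ≤ 5 * (K ^ 3 + K))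
  rw [remSize]
  linarith

end Comp
end SAV

/-! ### The one-step moment estimate for the scheme. -/

namespace SAV

/-- The rate in the moment estimate, from the constants in the bounds for the noise modes. -/
noncomputable def noiseRate (K K₂ W Γ : ℝ) : ℝ :=
  1 + 4 * (3 * (2 * K₂ * (W + 2) + K * K₂ * (W + 8) + K₂ * W)) * Γ
    + 2 * (2 * K₂ * Γ * (W + 2) + K₂ * Γ * W + K * K₂ * Γ * (W + 8)
      + 5 * (K ^ 3 + K) * W * (K₂ * Γ) ^ 2)

namespace Mesh

variable {d : ℕ} {O : Set (Pt d)} (M : Mesh O)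

section Measurability

variable {E : Type*} [MeasurableSpace E] {f : E → Pt d → ℝ}

/-- The gradient is defined by a choice, so measurability cannot be read off. It follows by writing
the gradient as a combination of the fixed gradients of the nodal basis with the nodal values as
coefficients. -/
lemma measurable_tangentialGrad (hf : ∀ e, M.MemU (f e))
    (hm : ∀ v ∈ M.nodes, Measurable fun e => f e v) {s : Finset (Pt d)} (hs : s ∈ M.cplx.faces) :
    Measurable fun e => tangentialGrad s (f e) := by
  have e1 : ∀ e, tangentialGrad s (f e) = ∑ v ∈ M.nodes, f e v • tangentialGrad s (M.hat v) := by
    intro e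
    have h1 : ∀ v ∈ M.nodes, AffOn s (M.hat v) := fun v hv => (M.memU_hat hv).affOn hs
    rw [← (affOn_sum M.nodes (fun v => f e v) M.hat h1).2]
    refine AffOn.tangentialGrad_congr ((hf e).affOn hs) (affOn_sum M.nodes _ M.hat h1).1
      fun x hx => ?_
    exact (M.interp_node (f e) (M.subset_nodes hs hx)).symm
  simp only [e1]
  exact Finset.measurable_sum _ fun v hv => (hm v hv).smul_const _

lemma measurable_dir (c : Comp d) (h : ∀ s ∈ c.faces, Measurable fun e => tangentialGrad s (f e)) :
    Measurable fun e => c.dir (f e) (f e) :=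
  Finset.measurable_sum _ fun s hs => ((h s hs).inner (h s hs)).const_mul _

lemma measurable_lump (c : Comp d) {a : E → Pt d → ℝ}
    (h : ∀ v ∈ c.nodes, Measurable fun e => a e v) : Measurable fun e => c.lump (a e) :=
  Finset.measurable_sum _ fun v hv => (h v hv).mul_const _

lemma measurable_ham (c : Comp d) (hn : ∀ v ∈ c.nodes, Measurable fun e => f e v)
    (h : ∀ s ∈ c.faces, Measurable fun e => tangentialGrad s (f e)) {r : E → ℝ}
    (hr : Measurable r) : Measurable fun e => c.ham (f e) (r e) :=
  (((measurable_dir c h).div_const _).add (hr.pow_const 2)).add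
    ((measurable_lump c fun v hv => (hn v hv).pow_const 2).div_const _)

lemma measurable_slope (c : Comp d) {F : ℝ → ℝ} (hF : Measurable F)
    (hn : ∀ v ∈ c.nodes, Measurable fun e => f e v) {u : E → Pt d → ℝ}
    (hu : ∀ v ∈ c.nodes, Measurable fun e => u e v) :
    Measurable fun e => c.slope F (f e) (u e) :=
  (measurable_lump c fun v hv => ((measurable_deriv F).comp (hn v hv)).mul (hu v hv)).div
    (measurable_lump c fun v hv => hF.comp (hn v hv)).sqrt

lemma measurable_ell (c : Comp d) {F : ℝ → ℝ} (hF : Measurable F)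
    (hn : ∀ v ∈ c.nodes, Measurable fun e => f e v)
    (h : ∀ s ∈ c.faces, Measurable fun e => tangentialGrad s (f e)) {u : E → Pt d → ℝ}
    (hu : ∀ v ∈ c.nodes, Measurable fun e => u e v)
    (hu' : ∀ s ∈ c.faces, Measurable fun e => tangentialGrad s (u e)) {r : E → ℝ}
    (hr : Measurable r) : Measurable fun e => c.ell F (f e) (r e) (u e) :=
  ((Finset.measurable_sum _ fun s hs => ((h s hs).inner (hu' s hs)).const_mul _).add
    (hr.mul (measurable_slope c hF hn hu))).add
    ((measurable_lump c fun v hv => (hu v hv).mul (hn v hv)).div_const _)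

end Measurability

lemma bdryNodes_subset : M.bdryNodes ⊆ M.nodes := fun _ hv => (M.mem_bdryNodes.1 hv).1

/-- The moment estimate for one step of the scheme. -/
lemma moment_step_le {Ω : Type*} [MeasurableSpace Ω] {P : Measure Ω} [IsProbabilityMeasure P]
    {E : Type*} [mE : MeasurableSpace E] {X : Ω → E} {B : Ω → ℤ → ℝ}
    (hX : Measurable X) (hB : Measurable B) (hind : IndepFun X B P) {Cmom : ℕ → ℝ}
    {b : ℤ → Ω → ℝ} (h : IsSymmFamily P Cmom b) {τ : ℝ} {lam : ℤ → ℝ} {Z : Finset ℤ}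
    (hBb : ∀ᵐ ω ∂P, ∀ k, B ω k = √τ * lam k * b k ω) (hτ : 0 < τ) (hτ1 : τ < 1)
    {F G ϱ : ℝ → ℝ} (hFm : Measurable F) (hGm : Measurable G) (hϱ : Measurable ϱ)
    {K K₂ W Γ : ℝ} (hK : 0 < K) (hK₂ : 0 ≤ K₂) (hW : 0 ≤ W)
    (hF : ∀ z, 0 < F z) (hF1 : ∀ z, deriv F z ^ 2 ≤ K * F z * (1 + z ^ 2))
    (hG : ∀ z, 0 < G z) (hG1 : ∀ z, deriv G z ^ 2 ≤ K * G z * (1 + z ^ 2))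
    (hW1 : M.bulk.lump (fun _ => 1) ≤ W) (hW2 : ∑ s ∈ M.bulk.faces, M.bulk.wt s ≤ W)
    (hW3 : M.bdry.lump (fun _ => 1) ≤ W) (hW4 : ∑ s ∈ M.bdry.faces, M.bdry.wt s ≤ W)
    {g : ℤ → Pt d → ℝ} {γ : ℤ → ℝ} (hΓ : ∑ k ∈ Z, lam k ^ 2 * γ k ^ 2 ≤ Γ)
    {f : E → Pt d → ℝ} (hf : ∀ e, M.MemU (f e))
    (hm : ∀ v ∈ M.nodes, Measurable fun e => f e v) {r s : E → ℝ} (hr : Measurable r)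
    (hs : Measurable s) {U : E → ℝ} (hU : Measurable U) (hU1 : ∀ e, 1 ≤ U e)
    (hUV : ∀ e, M.totalEnergy (f e) (r e) (s e) ≤ U e)
    (hmode : ∀ k ∈ Z, ∀ e,
      M.bulk.IsMode (f e) (M.interp fun v => ϱ (f e v) * g k v) K₂ (γ k) ∧
      M.bdry.IsMode (f e) (M.interp fun v => ϱ (f e v) * g k v) K₂ (γ k))
    {q : ℕ} (hq : Even q) (hq2 : 2 ≤ q) {A : Set E} (hA : MeasurableSet A) :
    ∫⁻ ω in X ⁻¹' A, ENNReal.ofReal ((U (X ω) * (1 + noiseRate K K₂ W Γ * τ)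
        + ∑ k ∈ Z, B ω k * (M.bulk.ell F (f (X ω)) (r (X ω))
              (M.interp fun v => ϱ (f (X ω) v) * g k v)
            + M.bdry.ell G (f (X ω)) (s (X ω)) (M.interp fun v => ϱ (f (X ω) v) * g k v))
        + (M.bulk.rem F K τ (f (X ω))
              (fun x => ∑ k ∈ Z, B ω k * M.interp (fun v => ϱ (f (X ω) v) * g k v) x)
            + M.bdry.rem G K τ (f (X ω))
              (fun x => ∑ k ∈ Z, B ω k * M.interp (fun v => ϱ (f (X ω) v) * g k v) x))) ^ q) ∂P
      ≤ ENNReal.ofReal (1 + growthRate Cmom (noiseRate K K₂ W Γ) q * τ)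
        * ∫⁻ ω in X ⁻¹' A, ENNReal.ofReal (U (X ω) ^ q) ∂P := by
  set u : ℤ → E → Pt d → ℝ := fun k e => M.interp fun v => ϱ (f e v) * g k v with hu
  have huU : ∀ k e, M.MemU (u k e) := fun k e => M.memU_interp _
  have hum : ∀ k, ∀ v ∈ M.nodes, Measurable fun e => u k e v := fun k v hv => by
    simp only [hu, M.interp_node _ hv]
    exact (hϱ.comp (hm v hv)).mul_const _
  have hgm : ∀ s ∈ M.cplx.faces, Measurable fun e => tangentialGrad s (f e) := fun s hs =>
    M.measurable_tangentialGrad hf hm hs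
  have hugm : ∀ k, ∀ s ∈ M.cplx.faces, Measurable fun e => tangentialGrad s (u k e) :=
    fun k s hs => M.measurable_tangentialGrad (huU k) (hum k) hs
  have hn' : ∀ v ∈ M.bdry.nodes, v ∈ M.nodes := M.bdryNodes_subset
  have hΓ0 : 0 ≤ Γ := le_trans (Finset.sum_nonneg fun k _ => by positivity) hΓ
  have hVb : ∀ e, M.bulk.ham (f e) (r e) ≤ U e := fun e => by
    have := M.bdry.ham_nonneg (f e) (s e)
    have := hUV e
    rw [totalEnergy] at this
    linarith
  have hVΓ : ∀ e, M.bdry.ham (f e) (s e) ≤ U e := fun e => by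
    have := M.bulk.ham_nonneg (f e) (r e)
    have := hUV e
    rw [totalEnergy] at this
    linarith
  set c₁ := 3 * (2 * K₂ * (W + 2) + K * K₂ * (W + 8) + K₂ * W) with hc₁
  set c₂ := 2 * K₂ * Γ * (W + 2) + K₂ * Γ * W + K * K₂ * Γ * (W + 8)
      + 5 * (K ^ 3 + K) * W * (K₂ * Γ) ^ 2 with hc₂
  have hc₁0 : 0 ≤ c₁ := by positivity
  have hc₂0 : 0 ≤ c₂ := by positivity
  have hrate : noiseRate K K₂ W Γ = 1 + 4 * c₁ * Γ + 2 * c₂ := rfl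
  have hform := (M.bulk.isForm_rem F h hτ hK (Z := Z) (f := f) (lam := lam)
    (fun k _ e => (huU k e).aff_bulk) (fun k _ => hum k)
    (fun k _ s hs => hugm k s (M.element_face hs))
    (fun k _ => measurable_slope M.bulk hFm hm (hum k))).add
    (measurable_pi_lambda _ fun k => (h.meas k).const_mul _)
    (fun j => zero_le_one.trans (one_le_khinConst _ _))
    (M.bdry.isForm_rem G h hτ hK (Z := Z) (f := f) (lam := lam)
    (fun k _ e => (huU k e).aff_bdry) (fun k _ v hv => hum k v (hn' v hv))
    (fun k _ s hs => hugm k s (M.bdryElement_face hs))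
    (fun k _ => measurable_slope M.bdry hGm (fun v hv => hm v (hn' v hv))
      fun v hv => hum k v (hn' v hv)))
  refine lintegral_step_le hX hB hind h hBb hτ hτ1 (κ := noiseRate K K₂ W Γ) ?_ hU
    (fun e => zero_le_one.trans (hU1 e))
    (l := fun k e => M.bulk.ell F (f e) (r e) (u k e) + M.bdry.ell G (f e) (s e) (u k e))
    ?_ ?_ ?_ hform hq hq2 hA
  · rw [hrate]; positivity
  · intro k _
    exact (measurable_ell M.bulk hFm hm (fun s hs => hgm s (M.element_face hs)) (hum k)
      (fun s hs => hugm k s (M.element_face hs)) hr).add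
      (measurable_ell M.bdry hGm (fun v hv => hm v (hn' v hv))
      (fun s hs => hgm s (M.bdryElement_face hs)) (fun v hv => hum k v (hn' v hv))
      (fun s hs => hugm k s (M.bdryElement_face hs)) hs)
  · intro e
    have hb : ∀ k ∈ Z, (M.bulk.ell F (f e) (r e) (u k e) + M.bdry.ell G (f e) (s e) (u k e)) ^ 2
        ≤ 4 * c₁ * γ k ^ 2 * U e ^ 2 := fun k hk => by
      have h1 := (hmode k hk e).1.ell_sq_le hK₂ hK hF hF1 hW hW1 hW2 (hU1 e) (hVb e)
      have h2 := (hmode k hk e).2.ell_sq_le hK₂ hK hG hG1 hW hW3 hW4 (hU1 e) (hVΓ e)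
      nlinarith [sq_nonneg (M.bulk.ell F (f e) (r e) (u k e) - M.bdry.ell G (f e) (s e) (u k e))]
    calc _ ≤ ∑ k ∈ Z, lam k ^ 2 * (4 * c₁ * γ k ^ 2 * U e ^ 2) :=
          Finset.sum_le_sum fun k hk => mul_le_mul_of_nonneg_left (hb k hk) (sq_nonneg _)
      _ = 4 * c₁ * (∑ k ∈ Z, lam k ^ 2 * γ k ^ 2) * U e ^ 2 := by
          rw [Finset.mul_sum, Finset.sum_mul]
          exact Finset.sum_congr rfl fun k _ => by ring
      _ ≤ 4 * c₁ * Γ * U e ^ 2 := by gcongr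
      _ ≤ _ := by rw [hrate]; gcongr; linarith
  · intro e
    have h1 := Comp.remSize_le (lam := lam) (fun k hk => (hmode k hk e).1) hK₂ hK hF hF1 hW
      hW1 hW2 (hU1 e) (hVb e) hτ.le hΓ
    have h2 := Comp.remSize_le (lam := lam) (fun k hk => (hmode k hk e).2) hK₂ hK hG hG1 hW
      hW3 hW4 (hU1 e) (hVΓ e) hτ.le hΓ
    have hU0 := zero_le_one.trans (hU1 e)
    calc _ ≤ τ * (c₂ * U e) + τ * (c₂ * U e) := add_le_add h1 h2
      _ = (2 * c₂) * τ * U e := by ring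
      _ ≤ _ := by
          rw [hrate]
          gcongr
          have : 0 ≤ 4 * c₁ * Γ := by positivity
          linarith

end Mesh
end SAV

/-! ### Fourier coefficients of the noise; initial energy; comparison of norms. -/

namespace SAV

section Noise

variable {d : ℕ} {O : Set (Pt d)} {Ω : Type*} [mΩ : MeasurableSpace Ω] {P : Measure Ω}
  {e : HilbertBasis ℤ ℝ (Lp ℝ 2 (volume.restrict O))} {lam : ℤ → ℝ} {Cmom : ℕ → ℝ} {τ : ℝ} {N : ℕ}
  {𝓕 : Filtration ℕ mΩ} {ξ : ℕ → Ω → Lp ℝ 2 (volume.restrict O)}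

/-- The Fourier coefficients of a noise increment. -/
lemma IsNoise.exists_family (h : IsNoise P e lam Cmom τ N 𝓕 ξ) {n : ℕ} (hn1 : 1 ≤ n)
    (hn : n ≤ N) : ∃ b : ℤ → Ω → ℝ, IsSymmFamily P Cmom b ∧
      ∀ᵐ ω ∂P, ∀ k, inner ℝ (ξ n ω) (e k) = √τ * lam k * b k ω := by
  obtain ⟨b, hbm, hbi, hb, hsum⟩ := h.expansion
  refine ⟨b n, ⟨hbm n, ?_, fun k => (hb n hn1 hn k).1, fun k => (hb n hn1 hn k).2.2.2⟩, ?_⟩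
  · exact hbi.precomp (g := fun k : ℤ => ((⟨n, hn1, hn⟩ : {n : ℕ // 1 ≤ n ∧ n ≤ N}), k))
      fun k k' hk => (Prod.ext_iff.1 hk).2
  · filter_upwards [hsum n hn1 hn] with ω hω k
    have h1 := (innerSL ℝ (e k)).hasSum hω
    have h2 : HasSum (fun j => innerSL ℝ (e k) ((√τ * lam j * b n j ω) • e j))
        (innerSL ℝ (e k) ((√τ * lam k * b n k ω) • e k)) := by
      refine hasSum_single k fun j hj => ?_
      rw [innerSL_apply_apply, inner_smul_right, e.orthonormal.2 hj.symm, mul_zero]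
    have h3 := h1.unique h2
    rw [innerSL_apply_apply, innerSL_apply_apply, inner_smul_right, real_inner_self_eq_norm_sq,
      e.orthonormal.1 k] at h3
    rw [real_inner_comm, h3]
    ring

lemma IsNoise.measurable_coeff (h : IsNoise P e lam Cmom τ N 𝓕 ξ) {n : ℕ} (hn1 : 1 ≤ n)
    (hn : n ≤ N) : Measurable fun ω (k : ℤ) => inner ℝ (ξ n ω) (e k) := by
  refine measurable_pi_lambda _ fun k => ?_
  have h1 := (h.adapted n hn1 hn).mono (𝓕.le n)
  exact ((continuous_id.inner continuous_const).comp_stronglyMeasurable h1).measurable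

/-- The past is represented by the identity map into `Ω` with the σ-algebra `𝓕 n`; every quantity
known at step `n` is a measurable function of it. The coefficients depend continuously on `ξ (n +
1)` and so inherit its independence. -/
lemma IsNoise.indepFun_coeff (h : IsNoise P e lam Cmom τ N 𝓕 ξ) {n : ℕ} (hn : n + 1 ≤ N) :
    @IndepFun Ω Ω (ℤ → ℝ) mΩ (𝓕 n) MeasurableSpace.pi id
      (fun ω k => inner ℝ (ξ (n + 1) ω) (e k)) P := by
  have h1 := h.indep (n + 1) (by omega) hn n (by omega)
  refine (@IndepFun_iff_Indep Ω Ω (ℤ → ℝ) mΩ (𝓕 n) MeasurableSpace.pi id _ P).2 ?_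
  have h2 : MeasurableSpace.comap (fun ω (k : ℤ) => inner ℝ (ξ (n + 1) ω) (e k)) MeasurableSpace.pi
      ≤ MeasurableSpace.comap (ξ (n + 1)) (borel _) := by
    let _ : MeasurableSpace (Lp ℝ 2 (volume.restrict O)) := borel _
    have : BorelSpace (Lp ℝ 2 (volume.restrict O)) := ⟨rfl⟩
    have h3 : Measurable fun (f : Lp ℝ 2 (volume.restrict O)) (k : ℤ) => (inner ℝ f (e k) : ℝ) :=
      measurable_pi_lambda _ fun k => (continuous_id.inner continuous_const).measurable
    rw [show (fun ω (k : ℤ) => (inner ℝ (ξ (n + 1) ω) (e k) : ℝ))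
      = (fun (f : Lp ℝ 2 (volume.restrict O)) (k : ℤ) => (inner ℝ f (e k) : ℝ)) ∘ ξ (n + 1) from rfl,
      ← MeasurableSpace.comap_comp]
    exact MeasurableSpace.comap_mono h3.comap_le
  rw [MeasurableSpace.comap_id]
  exact (indep_of_indep_of_le_left h1 h2).symm

/-- Regularity of `g k` is available for active modes only, so modes whose coefficient vanishes have
to be removed before any estimate. -/
lemma Mesh.noiseOp_eq (M : Mesh O) (ϱ : ℝ → ℝ) (g : ℤ → Pt d → ℝ) (Z : Finset ℤ)
    (ζ : Pt d → ℝ) (f : Lp ℝ 2 (volume.restrict O)) (p : ℤ → Prop) [DecidablePred p]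
    (hp : ∀ k, ¬ p k → inner ℝ f (e k) = 0) :
    M.noiseOp ϱ e g Z ζ f = fun x => ∑ k ∈ Z.filter p, inner ℝ f (e k)
      * M.interp (fun v => ϱ (ζ v) * g k v) x := by
  have h1 : ∀ (k : ℤ) (x : Pt d), M.interp (fun y => ϱ (ζ y) * inner ℝ f (e k) * g k y) x
      = inner ℝ f (e k) * M.interp (fun v => ϱ (ζ v) * g k v) x := fun k x => by
    simp only [Mesh.interp, Finset.mul_sum]
    exact Finset.sum_congr rfl fun v _ => by ring
  ext x
  simp only [Mesh.noiseOp, h1]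
  rw [Finset.sum_filter]
  refine Finset.sum_congr rfl fun k _ => ?_
  split_ifs with h2
  · rfl
  · rw [hp k h2, zero_mul]

end Noise

namespace Mesh

variable {d : ℕ} {O : Set (Pt d)} (M : Mesh O)

lemma lump_bulk_one (hO : IsConvexPolyhedralDomain O) :
    M.bulk.lump (fun _ => 1) = (volume : Measure (Pt d)).real O := by
  rw [← M.sum_mass hO]
  simp only [Comp.lump, one_mul]
  rfl

lemma lump_bdry_one (hO : IsConvexPolyhedralDomain O) (hd : 1 ≤ d) (hM : M.IsBdryCompatible) :
    M.bdry.lump (fun _ => 1) = (surf O).real Set.univ := by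
  rw [← M.sum_massBdry hO hd hM]
  simp only [Comp.lump, one_mul]
  rfl

/-- The energy of the initial datum is bounded. -/
lemma exists_initial_energy_le (hO : IsConvexPolyhedralDomain O) (hd1 : 1 ≤ d) (hd : d ≤ 3)
    {f : Pt d → ℝ} (hf : IsInitialDatum O f) {κ : ℝ} (hκ : 0 < κ) {F G : ℝ → ℝ} {K : ℝ}
    (hK : 0 < K) (hF0 : ∀ z, 0 < F z) (hG0 : ∀ z, 0 < G z) (hF : ∀ z, F z ≤ K * (1 + z ^ 4))
    (hG : ∀ z, G z ≤ K * (1 + z ^ 4)) :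
    ∃ C : ℝ, ∀ h : ℝ, 0 < h → ∀ M : Mesh O, M.IsQuasiuniform κ h → M.IsBdryCompatible →
      ∀ φ, M.MemU φ → Set.EqOn φ (M.interp f) (closure O) →
        M.totalEnergy φ √(M.energy F φ) √(M.energyBdry G φ) ≤ C := by
  obtain ⟨C, hC⟩ := exists_initial_dirichlet_le hO hd1 hd hf hκ
  obtain ⟨b, hb⟩ := (isCompact_closure hO).exists_bound_of_continuousOn hf.1
  set V := (volume : Measure (Pt d)).real O
  set S := (surf O).real Set.univ
  refine ⟨C / 2 + K * (1 + b ^ 4) * V + b ^ 2 * V / 8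
    + (C / 2 + K * (1 + b ^ 4) * S + b ^ 2 * S / 8) + 1, ?_⟩
  intro h hh M hq hM φ hφ heq
  obtain ⟨c1, c2⟩ := hC h hh M hq hM
  have hI := M.memU_interp f
  have hval : ∀ v ∈ M.nodes, |φ v| ≤ b := fun v hv => by
    have hvc := M.mem_closure_of_mem_nodes hv
    rw [heq hvc, M.interp_node f hv]
    exact hb v hvc
  have hgrad : ∀ s ∈ M.cplx.faces, tangentialGrad s φ = tangentialGrad s (M.interp f) :=
    fun s hs => AffOn.tangentialGrad_congr (hφ.affOn hs) (hI.affOn hs) fun x hx =>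
      heq (M.mem_closure_of_mem_nodes (M.subset_nodes hs hx))
  have d1 : M.bulk.dir φ φ ≤ C := by
    refine le_trans (le_of_eq ?_) c1
    rw [M.dirichlet_eq hO hI hI]
    exact Finset.sum_congr rfl fun s hs => by rw [hgrad s (M.element_face hs)]; rfl
  have d2 : M.bdry.dir φ φ ≤ C := by
    refine le_trans (le_of_eq ?_) c2
    rw [M.dirichletBdry_eq]
    exact Finset.sum_congr rfl fun s hs => by rw [hgrad s (M.bdryElement_face hs)]; rfl
  have key : ∀ (c : Comp d) (H : ℝ → ℝ), (∀ v ∈ c.nodes, v ∈ M.nodes) → (∀ z, 0 < H z) →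
      (∀ z, H z ≤ K * (1 + z ^ 4)) → c.dir φ φ ≤ C → c.ham φ √(c.energy H φ)
        ≤ C / 2 + K * (1 + b ^ 4) * c.lump (fun _ => 1) + b ^ 2 * c.lump (fun _ => 1) / 8 := by
    intro c H hn hH0 hH hdir
    have h1 : c.energy H φ ≤ K * (1 + b ^ 4) * c.lump fun _ => 1 := by
      rw [← c.lump_const_mul]
      refine c.lump_mono fun v hv => (hH _).trans ?_
      rw [mul_one]
      have : φ v ^ 4 ≤ b ^ 4 := by
        rw [← (by decide : Even 4).pow_abs (φ v)]
        exact pow_le_pow_left₀ (abs_nonneg _) (hval v (hn v hv)) 4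
      gcongr
    have h2 : c.lump (fun x => φ x ^ 2) ≤ b ^ 2 * c.lump fun _ => 1 := by
      rw [← c.lump_const_mul]
      refine c.lump_mono fun v hv => ?_
      rw [mul_one, ← sq_abs]
      exact pow_le_pow_left₀ (abs_nonneg _) (hval v (hn v hv)) 2
    rw [Comp.ham, Real.sq_sqrt (c.energy_nonneg hH0 φ)]
    linarith
  have k1 := key M.bulk F (fun _ h => h) hF0 hF d1
  have k2 := key M.bdry G M.bdryNodes_subset hG0 hG d2
  rw [M.lump_bulk_one hO] at k1
  rw [M.lump_bdry_one hO hd1 hM] at k2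
  have e1 : M.energy F φ = M.bulk.energy F φ := M.intI_eq hO _
  have e2 : M.energyBdry G φ = M.bdry.energy G φ := M.intIBdry_eq hO hd1 hM _
  rw [totalEnergy, e1, e2]
  linarith

lemma dissipation_nonneg {τ : ℝ} (hτ : 0 ≤ τ) (δ μ θ : Pt d → ℝ) (a b : ℝ) :
    0 ≤ M.dissipation τ δ μ θ a b := by
  have n1 := M.bulk.dir_self_nonneg δ
  have n2 := M.bdry.dir_self_nonneg δ
  have n3 := M.bulk.dir_self_nonneg μ
  have n6 : 0 ≤ M.bdry.lump fun x => θ x ^ 2 := M.bdry.lump_nonneg fun _ => sq_nonneg _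
  have n7 : 0 ≤ M.bdry.lump fun x => δ x ^ 2 := M.bdry.lump_nonneg fun _ => sq_nonneg _
  have n8 : 0 ≤ M.bulk.lump fun x => δ x ^ 2 := M.bulk.lump_nonneg fun _ => sq_nonneg _
  rw [dissipation]
  positivity

lemma one_le_totalEnergy (f : Pt d → ℝ) (r s : ℝ) : 1 ≤ M.totalEnergy f r s := by
  have := M.bulk.ham_nonneg f r
  have := M.bdry.ham_nonneg f s
  rw [totalEnergy]
  linarith

variable {M}

lemma MemU.normH1_sq_le (hO : IsConvexPolyhedralDomain O) {u : Pt d → ℝ} (hu : M.MemU u) :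
    normH1 O u ^ 2 ≤ M.bulk.lump (fun x => u x ^ 2) + M.bulk.dir u u := by
  have h1 : dirichlet O u u = M.bulk.dir u u := M.dirichlet_eq hO hu hu
  have h2 : 0 ≤ ∫ x in O, u x ^ 2 := integral_nonneg fun _ => sq_nonneg _
  have h3 := M.bulk.dir_self_nonneg u
  have h4 : M.intI (fun x => u x ^ 2) = M.bulk.lump (fun x => u x ^ 2) := M.intI_eq hO _
  rw [normH1, h1, Real.sq_sqrt (by positivity), ← h4]
  gcongr
  exact hu.integral_sq_le hO

lemma MemU.normH1Bdry_sq_le (hO : IsConvexPolyhedralDomain O) (hd : 1 ≤ d)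
    (hM : M.IsBdryCompatible) {u : Pt d → ℝ} (hu : M.MemU u) :
    M.normH1Bdry u ^ 2 ≤ M.bdry.lump (fun x => u x ^ 2) + M.bdry.dir u u := by
  have h1 : M.dirichletBdry u u = M.bdry.dir u u := M.dirichletBdry_eq u u
  have h2 : 0 ≤ ∫ x, u x ^ 2 ∂(surf O) := integral_nonneg fun _ => sq_nonneg _
  have h3 := M.bdry.dir_self_nonneg u
  have h4 : M.intIBdry (fun x => u x ^ 2) = M.bdry.lump (fun x => u x ^ 2) :=
    M.intIBdry_eq hO hd hM _
  rw [normH1Bdry, h1, Real.sq_sqrt (by positivity), ← h4]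
  gcongr
  exact M.integral_surf_sq_le hO hd hM hu.memUBdry

end Mesh
end SAV

/-! ### Growth of the energy with accumulated dissipation. -/

namespace SAV
namespace Mesh

variable {d : ℕ} {O : Set (Pt d)} (M : Mesh O)

/-- The energy after `n` steps together with the dissipation accumulated so far. -/
noncomputable def pathEnergy (τ : ℝ) (φ μ θ : ℕ → Pt d → ℝ) (r s : ℕ → ℝ) (n : ℕ) : ℝ :=
  M.totalEnergy (φ n) (r n) (s n) + ∑ j ∈ Finset.range n,
    M.dissipation τ (fun x => φ (j + 1) x - φ j x) (μ (j + 1)) (θ (j + 1)) (r (j + 1) - r j)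
      (s (j + 1) - s j)

variable {τ : ℝ}

lemma totalEnergy_le_pathEnergy (hτ : 0 ≤ τ) (φ μ θ : ℕ → Pt d → ℝ) (r s : ℕ → ℝ) (n : ℕ) :
    M.totalEnergy (φ n) (r n) (s n) ≤ M.pathEnergy τ φ μ θ r s n :=
  le_add_of_nonneg_right (Finset.sum_nonneg fun _ _ => M.dissipation_nonneg hτ _ _ _ _ _)

lemma one_le_pathEnergy (hτ : 0 ≤ τ) (φ μ θ : ℕ → Pt d → ℝ) (r s : ℕ → ℝ) (n : ℕ) : 1 ≤ M.pathEnergy τ φ μ θ r s n :=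
  (M.one_le_totalEnergy _ _ _).trans (M.totalEnergy_le_pathEnergy hτ φ μ θ r s n)

lemma sum_dissipation_le_pathEnergy (φ μ θ : ℕ → Pt d → ℝ) (r s : ℕ → ℝ) (n : ℕ) : ∑ j ∈ Finset.range n,
    M.dissipation τ (fun x => φ (j + 1) x - φ j x) (μ (j + 1)) (θ (j + 1)) (r (j + 1) - r j)
      (s (j + 1) - s j) ≤ M.pathEnergy τ φ μ θ r s n :=
  le_add_of_nonneg_left (zero_le_one.trans (M.one_le_totalEnergy _ _ _))

lemma measurable_totalEnergy {E : Type*} [MeasurableSpace E] {f : E → Pt d → ℝ} {r s : E → ℝ}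
    (hf : ∀ e, M.MemU (f e)) (hm : ∀ v ∈ M.nodes, Measurable fun e => f e v) (hr : Measurable r)
    (hs : Measurable s) : Measurable fun e => M.totalEnergy (f e) (r e) (s e) :=
  ((measurable_ham M.bulk hm (fun _ ht => M.measurable_tangentialGrad hf hm (M.element_face ht))
    hr).add (measurable_ham M.bdry (fun v hv => hm v (M.bdryNodes_subset hv))
    (fun _ ht => M.measurable_tangentialGrad hf hm (M.bdryElement_face ht)) hs)).add_const 1

lemma measurable_dissipation {E : Type*} [MeasurableSpace E] (τ : ℝ) {f g l : E → Pt d → ℝ}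
    {r s : E → ℝ} (hf : ∀ e, M.MemU (f e)) (hfm : ∀ v ∈ M.nodes, Measurable fun e => f e v)
    (hg : ∀ e, M.MemU (g e)) (hgm : ∀ v ∈ M.nodes, Measurable fun e => g e v)
    (hlm : ∀ v ∈ M.bdryNodes, Measurable fun e => l e v) (hr : Measurable r)
    (hs : Measurable s) :
    Measurable fun e => M.dissipation τ (f e) (g e) (l e) (r e) (s e) := by
  have h1 := measurable_dir M.bulk
    fun t ht => M.measurable_tangentialGrad hf hfm (M.element_face ht)
  have h2 := measurable_dir M.bdry
    fun t ht => M.measurable_tangentialGrad hf hfm (M.bdryElement_face ht)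
  have h3 := measurable_dir M.bulk
    fun t ht => M.measurable_tangentialGrad hg hgm (M.element_face ht)
  have h4 := measurable_lump M.bulk (a := fun e x => f e x ^ 2) fun v hv => (hfm v hv).pow_const 2
  have h5 := measurable_lump M.bdry (a := fun e x => f e x ^ 2)
    fun v hv => (hfm v (M.bdryNodes_subset hv)).pow_const 2
  have h6 := measurable_lump M.bdry (a := fun e x => l e x ^ 2) fun v hv => (hlm v hv).pow_const 2
  exact (((((((h1.add h2).add h4).add h5).add (hr.pow_const 2)).add (hs.pow_const 2)).add
    (h3.const_mul τ)).add (h6.const_mul τ)).div_const 32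

lemma isMode {ϱ : ℝ → ℝ} {f g : Pt d → ℝ} {K γ : ℝ}
    (h1 : ∀ v ∈ M.nodes, (ϱ (f v) * g v) ^ 2 ≤ K * γ ^ 2)
    (h2 : ∀ s ∈ M.cplx.faces, ‖tangentialGrad s (M.interp fun v => ϱ (f v) * g v)‖ ^ 2
        ≤ K * γ ^ 2 * (1 + ‖tangentialGrad s f‖ ^ 2)) :
    M.bulk.IsMode f (M.interp fun v => ϱ (f v) * g v) K γ ∧
      M.bdry.IsMode f (M.interp fun v => ϱ (f v) * g v) K γ := by
  have h3 : ∀ v ∈ M.nodes, M.interp (fun v => ϱ (f v) * g v) v ^ 2 ≤ K * γ ^ 2 := fun v hv => by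
    rw [M.interp_node _ hv]
    exact h1 v hv
  exact ⟨⟨h3, fun s hs => h2 s (M.element_face hs)⟩,
    ⟨fun v hv => h3 v (M.bdryNodes_subset hv), fun s hs => h2 s (M.bdryElement_face hs)⟩⟩

end Mesh

section Solution

variable {d : ℕ} {O : Set (Pt d)} {M : Mesh O} {Ω : Type*} [mΩ : MeasurableSpace Ω]
  {P : Measure Ω} {F G ϱ : ℝ → ℝ} {φ₀ : Pt d → ℝ}
  {e : HilbertBasis ℤ ℝ (Lp ℝ 2 (volume.restrict O))} {g : ℤ → Pt d → ℝ} {Z : Finset ℤ}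
  {τ : ℝ} {N : ℕ} {𝓕 : Filtration ℕ mΩ} {ξ : ℕ → Ω → Lp ℝ 2 (volume.restrict O)}
  {φ μ θ : ℕ → Ω → Pt d → ℝ} {r s : ℕ → Ω → ℝ}

lemma IsDiscreteSolution.measurable_pathEnergy
    (h : IsDiscreteSolution M P F G ϱ φ₀ e g Z τ N 𝓕 ξ φ μ θ r s) {n : ℕ} (hn : n ≤ N) :
    Measurable[𝓕 n] fun ω => M.pathEnergy τ (fun j => φ j ω) (fun j => μ j ω) (fun j => θ j ω)
      (fun j => r j ω) (fun j => s j ω) n := by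
  have hφ : ∀ j ≤ n, ∀ v ∈ M.nodes, Measurable[𝓕 n] fun ω => φ j ω v := fun j hj v hv =>
    (h.meas_phi j (hj.trans hn) v (M.mem_closure_of_mem_nodes hv)).mono (𝓕.mono hj) le_rfl
  have hμ : ∀ j, 1 ≤ j → j ≤ n → ∀ v ∈ M.nodes, Measurable[𝓕 n] fun ω => μ j ω v :=
    fun j h1 hj v hv =>
    (h.meas_mu j h1 (hj.trans hn) v (M.mem_closure_of_mem_nodes hv)).mono (𝓕.mono hj) le_rfl
  have hθ : ∀ j, 1 ≤ j → j ≤ n → ∀ v ∈ M.bdryNodes, Measurable[𝓕 n] fun ω => θ j ω v :=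
    fun j h1 hj v hv =>
    (h.meas_theta j h1 (hj.trans hn) v (M.mem_bdryNodes.1 hv).2).mono (𝓕.mono hj) le_rfl
  have hr : ∀ j ≤ n, Measurable[𝓕 n] (r j) := fun j hj =>
    (h.meas_r j (hj.trans hn)).mono (𝓕.mono hj) le_rfl
  have hs : ∀ j ≤ n, Measurable[𝓕 n] (s j) := fun j hj =>
    (h.meas_s j (hj.trans hn)).mono (𝓕.mono hj) le_rfl
  refine @Measurable.add _ _ _ _ (𝓕 n) _ _ _ (@Mesh.measurable_totalEnergy _ _ M Ω (𝓕 n) _ _ _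
    (h.mem_phi n hn) (hφ n le_rfl) (hr n le_rfl) (hs n le_rfl)) ?_
  refine @Finset.measurable_sum _ _ _ _ _ _ (𝓕 n) _ _ fun j hj => ?_
  have hj' : j + 1 ≤ n := Finset.mem_range.1 hj
  have h0 : j ≤ n := by omega
  have hrd : Measurable[𝓕 n] fun ω => r (j + 1) ω - r j ω :=
    (hr _ hj').sub (hr _ h0)
  have hsd : Measurable[𝓕 n] fun ω => s (j + 1) ω - s j ω :=
    (hs _ hj').sub (hs _ h0)
  exact @Mesh.measurable_dissipation _ _ M Ω (𝓕 n) τ _ _ _ _ _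
    (fun ω => (h.mem_phi _ (hj'.trans hn) ω).sub (h.mem_phi _ (h0.trans hn) ω))
    (fun v hv => (hφ _ hj' v hv).sub (hφ _ h0 v hv))
    (h.mem_mu _ (by omega) (hj'.trans hn)) (hμ _ (by omega) hj') (hθ _ (by omega) hj')
    hrd hsd

/-- The `q`-th moment of the energy, localized to an event of the past, grows at most by a factor
`1 + ρ τ` in each step. -/
lemma IsDiscreteSolution.lintegral_pathEnergy_succ_le [IsProbabilityMeasure P]
    (h : IsDiscreteSolution M P F G ϱ φ₀ e g Z τ N 𝓕 ξ φ μ θ r s)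
    (hO : IsConvexPolyhedralDomain O) (hd : 1 ≤ d) (hM : M.IsBdryCompatible)
    {lam : ℤ → ℝ} {Cmom : ℕ → ℝ} (hξ : IsNoise P e lam Cmom τ N 𝓕 ξ)
    (hτ : 0 < τ) (hτ1 : τ < 1) {K K₂ Γ : ℝ} (hK : 0 < K) (hK₂ : 0 ≤ K₂)
    (hFm : Measurable F) (hGm : Measurable G) (hϱ : Measurable ϱ)
    (hF : ∀ z, 0 < F z)
    (hF1 : ∀ z, deriv F z ^ 2 ≤ K * F z * (1 + z ^ 2)) (hF2 : ∀ z, (1 + z ^ 2) ^ 2 ≤ K * F z)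
    (hF3 : ∀ z, deriv (deriv F) z ^ 2 ≤ K * F z) (hG : ∀ z, 0 < G z)
    (hG1 : ∀ z, deriv G z ^ 2 ≤ K * G z * (1 + z ^ 2)) (hG2 : ∀ z, (1 + z ^ 2) ^ 2 ≤ K * G z)
    (hG3 : ∀ z, deriv (deriv G) z ^ 2 ≤ K * G z) {γ : ℤ → ℝ}
    (hΓ : ∀ Z : Finset ℤ, ∑ k ∈ Z, lam k ^ 2 * γ k ^ 2 ≤ Γ)
    (hmode : ∀ k, lam k ≠ 0 → ∀ f, M.MemU f →
      M.bulk.IsMode f (M.interp fun v => ϱ (f v) * g k v) K₂ (γ k) ∧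
      M.bdry.IsMode f (M.interp fun v => ϱ (f v) * g k v) K₂ (γ k))
    {q : ℕ} (hq : Even q) (hq2 : 2 ≤ q) {n : ℕ} (hn : n < N) {A : Set Ω}
    (hA : MeasurableSet[𝓕 n] A) :
    ∫⁻ ω in A, ENNReal.ofReal (M.pathEnergy τ (fun j => φ j ω) (fun j => μ j ω)
        (fun j => θ j ω) (fun j => r j ω) (fun j => s j ω) (n + 1) ^ q) ∂P
      ≤ ENNReal.ofReal (1 + growthRate Cmom (noiseRate K K₂
          ((volume : Measure (Pt d)).real O + (surf O).real Set.univ) Γ) q * τ)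
        * ∫⁻ ω in A, ENNReal.ofReal (M.pathEnergy τ (fun j => φ j ω) (fun j => μ j ω)
          (fun j => θ j ω) (fun j => r j ω) (fun j => s j ω) n ^ q) ∂P := by
  classical
  set U : ℕ → Ω → ℝ := fun m ω => M.pathEnergy τ (fun j => φ j ω) (fun j => μ j ω)
    (fun j => θ j ω) (fun j => r j ω) (fun j => s j ω) m with hU
  set W := (volume : Measure (Pt d)).real O + (surf O).real Set.univ with hW
  set V := (volume : Measure (Pt d)).real O
  set S := (surf O).real Set.univ
  have hV0 : 0 ≤ V := measureReal_nonneg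
  have hS0 : 0 ≤ S := measureReal_nonneg
  have hW0 : 0 ≤ W := add_nonneg hV0 hS0
  have hΓ0 : 0 ≤ Γ := by simpa using hΓ ∅
  have hrate : 1 ≤ noiseRate K K₂ W Γ := by
    rw [noiseRate, add_assoc]
    exact le_add_of_nonneg_right (by positivity)
  obtain ⟨b, hb, hbξ⟩ := hξ.exists_family (n := n + 1) (by omega) hn
  set B : Ω → ℤ → ℝ := fun ω k => inner ℝ (ξ (n + 1) ω) (e k) with hB
  set Z' := Z.filter fun k => lam k ≠ 0 with hZ'
  -- The parameter space of the one-step estimate is `Ω` itself with the σ-algebra `𝓕 n`, so the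
  -- event `A` is a measurable set of parameters.
  have a1 : @Measurable Ω Ω mΩ (𝓕 n) id := measurable_id.mono (𝓕.le n) le_rfl
  have a2 : Measurable B := hξ.measurable_coeff (by omega) hn
  have a3 : @IndepFun Ω Ω (ℤ → ℝ) mΩ (𝓕 n) MeasurableSpace.pi id B P := hξ.indepFun_coeff hn
  have a4 : ∀ v ∈ M.nodes, Measurable[𝓕 n] fun ω => φ n ω v := fun v hv =>
    h.meas_phi n hn.le v (M.mem_closure_of_mem_nodes hv)
  have a5 : Measurable[𝓕 n] (U n) := h.measurable_pathEnergy hn.le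
  have a6 : ∀ ω, 1 ≤ U n ω := fun ω => M.one_le_pathEnergy hτ.le _ _ _ _ _ n
  have a7 : ∀ ω, M.totalEnergy (φ n ω) (r n ω) (s n ω) ≤ U n ω := fun ω =>
    M.totalEnergy_le_pathEnergy hτ.le (fun j => φ j ω) (fun j => μ j ω)
      (fun j => θ j ω) (fun j => r j ω) (fun j => s j ω) n
  have key := @Mesh.moment_step_le d O M Ω mΩ P _ Ω (𝓕 n) id B a1 a2 a3 Cmom b hb τ lam Z' hbξ hτ
    hτ1 F G ϱ hFm hGm hϱ K K₂ W Γ hK hK₂ hW0 hF hF1 hG hG1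
    ((M.lump_bulk_one hO).le.trans (le_add_of_nonneg_right hS0))
    ((M.sum_vol hO).le.trans (le_add_of_nonneg_right hS0))
    ((M.lump_bdry_one hO hd hM).le.trans (le_add_of_nonneg_left hV0))
    ((M.sum_area hd hM).le.trans (le_add_of_nonneg_left hV0)) g γ (hΓ Z') (φ n)
    (h.mem_phi n hn.le) a4 (r n) (s n) (h.meas_r n hn.le) (h.meas_s n hn.le) (U n) a5 a6 a7
    (fun k hk ω => hmode k (Finset.mem_filter.1 hk).2 _ (h.mem_phi n hn.le ω)) q hq hq2 A hA
  rw [Set.preimage_id] at key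
  simp only [id] at key
  refine le_trans (lintegral_mono_ae (ae_restrict_of_ae ?_)) key
  filter_upwards [hbξ, h.step n hn] with ω hω hstep
  have hX : M.noiseOp ϱ e g Z (φ n ω) (ξ (n + 1) ω) = fun x => ∑ k ∈ Z', B ω k
      * M.interp (fun v => ϱ (φ n ω v) * g k v) x := M.noiseOp_eq ϱ g Z (φ n ω) (ξ (n + 1) ω) (e := e) (fun k => lam k ≠ 0) fun k hk => by
    rw [not_not] at hk
    rw [hω k, hk, mul_zero, zero_mul]
  have hXU : M.MemU (M.noiseOp ϱ e g Z (φ n ω) (ξ (n + 1) ω)) := by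
    rw [hX]
    exact M.memU_sum _ _ fun k _ => (M.memU_interp _).smul _
  have h1 := Mesh.SchemeStep.energy_le M hO hd hM hstep (h.mem_phi n hn.le ω) (h.mem_phi (n + 1) hn ω)
    (h.mem_mu (n + 1) (by omega) hn ω) (h.mem_theta (n + 1) (by omega) hn ω) hXU hτ hτ1 hK
    hF hF1 hF2 hF3 hG hG1 hG2 hG3
  have l1 := Comp.ell_sum (c := M.bulk) (F := F) (Z := Z')
    (u := fun k => M.interp fun v => ϱ (φ n ω v) * g k v) (f := φ n ω) (β := B ω)
    (fun k _ => (M.memU_interp _).aff_bulk) (r n ω)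
  have l2 := Comp.ell_sum (c := M.bdry) (F := G) (Z := Z')
    (u := fun k => M.interp fun v => ϱ (φ n ω v) * g k v) (f := φ n ω) (β := B ω)
    (fun k _ => (M.memU_interp _).aff_bdry) (s n ω)
  have l3 := congrArg₂ (· + ·) l1 l2
  simp only [← Finset.sum_add_distrib, ← mul_add] at l3
  rw [hX] at h1
  refine ENNReal.ofReal_le_ofReal (pow_le_pow_left₀
    (zero_le_one.trans (M.one_le_pathEnergy hτ.le _ _ _ _ _ _)) ?_ q)
  have h2 : U (n + 1) ω = M.totalEnergy (φ (n + 1) ω) (r (n + 1) ω) (s (n + 1) ω)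
      + M.dissipation τ (fun x => φ (n + 1) ω x - φ n ω x) (μ (n + 1) ω) (θ (n + 1) ω)
        (r (n + 1) ω - r n ω) (s (n + 1) ω - s n ω)
      + (U n ω - M.totalEnergy (φ n ω) (r n ω) (s n ω)) := by
    simp only [hU, Mesh.pathEnergy, Finset.sum_range_succ]
    ring
  -- The accumulated dissipation is carried along unchanged, and the deterministic growth `τ` is
  -- covered by the summand 1 in `noiseRate`.
  have h3 : (1 + τ) * M.totalEnergy (φ n ω) (r n ω) (s n ω)
      + (U n ω - M.totalEnergy (φ n ω) (r n ω) (s n ω))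
      ≤ U n ω * (1 + noiseRate K K₂ W Γ * τ) := by
    have h4 := a7 ω
    have h5 := a6 ω
    have h6 : τ * M.totalEnergy (φ n ω) (r n ω) (s n ω) ≤ τ * U n ω := by gcongr
    have h7 : τ * U n ω * 1 ≤ τ * U n ω * noiseRate K K₂ W Γ := by gcongr
    linarith
  change U (n + 1) ω ≤ _
  rw [h2, ← l3]
  linarith

/-- The moments of the maximum of the energy are bounded. -/
lemma IsDiscreteSolution.lintegral_iSup_pathEnergy_le [IsProbabilityMeasure P]
    (h : IsDiscreteSolution M P F G ϱ φ₀ e g Z τ N 𝓕 ξ φ μ θ r s) (hτ : 0 < τ) {ρ C₀ : ℝ}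
    (hρ : 0 ≤ ρ) {q : ℕ}
    (hstep : ∀ n < N, ∀ A, MeasurableSet[𝓕 n] A →
      ∫⁻ ω in A, ENNReal.ofReal (M.pathEnergy τ (fun j => φ j ω) (fun j => μ j ω)
        (fun j => θ j ω) (fun j => r j ω) (fun j => s j ω) (n + 1) ^ (2 * q)) ∂P
      ≤ ENNReal.ofReal (1 + ρ * τ)
        * ∫⁻ ω in A, ENNReal.ofReal (M.pathEnergy τ (fun j => φ j ω) (fun j => μ j ω)
          (fun j => θ j ω) (fun j => r j ω) (fun j => s j ω) n ^ (2 * q)) ∂P)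
    (h0 : ∀ u, M.MemU u → Set.EqOn u (M.interp φ₀) (closure O) →
        M.totalEnergy u √(M.energy F u) √(M.energyBdry G u) ≤ C₀) {p : ℝ} (hpq : p ≤ q) :
    ∫⁻ ω, ⨆ m ∈ Finset.range (N + 1), ENNReal.ofReal (M.pathEnergy τ (fun j => φ j ω)
        (fun j => μ j ω) (fun j => θ j ω) (fun j => r j ω) (fun j => s j ω) m ^ p) ∂P
      ≤ ENNReal.ofReal (1 + Real.exp (ρ * (τ * N)) * C₀ ^ (2 * q)) := by
  refine lintegral_iSup_rpow_le 𝓕 (fun n hn => h.measurable_pathEnergy hn)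
    (fun n ω => M.one_le_pathEnergy hτ.le _ _ _ _ _ n) hρ hτ.le hstep (fun ω => ?_) hpq
  have := h0 _ (h.mem_phi 0 (Nat.zero_le _) ω) (h.init_phi ω)
  rw [← h.init_r, ← h.init_s] at this
  simpa [Mesh.pathEnergy] using this

end Solution
end SAV

/-! ### From moments of the energy to the ten quantities. -/

namespace SAV
namespace Mesh

variable {d : ℕ} {O : Set (Pt d)} {M : Mesh O} {τ : ℝ}

lemma MemU.normH1_sq_le_totalEnergy (hO : IsConvexPolyhedralDomain O) {u : Pt d → ℝ}
    (hu : M.MemU u) (r s : ℝ) : normH1 O u ^ 2 ≤ 32 * M.totalEnergy u r s := by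
  have := hu.normH1_sq_le hO
  have := M.bulk.dir_le_ham u r
  have := M.bulk.lump_le_ham u r
  have := M.bulk.ham_nonneg u r
  have := M.bdry.ham_nonneg u s
  rw [totalEnergy]
  linarith

lemma MemU.normH1Bdry_sq_le_totalEnergy (hO : IsConvexPolyhedralDomain O) (hd : 1 ≤ d)
    (hM : M.IsBdryCompatible) {u : Pt d → ℝ} (hu : M.MemU u) (r s : ℝ) :
    M.normH1Bdry u ^ 2 ≤ 32 * M.totalEnergy u r s := by
  have := hu.normH1Bdry_sq_le hO hd hM
  have := M.bdry.dir_le_ham u s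
  have := M.bdry.lump_le_ham u s
  have := M.bulk.ham_nonneg u r
  have := M.bdry.ham_nonneg u s
  rw [totalEnergy]
  linarith

lemma sq_le_totalEnergy (u : Pt d → ℝ) (r s : ℝ) :
    r ^ 2 ≤ 32 * M.totalEnergy u r s ∧ s ^ 2 ≤ 32 * M.totalEnergy u r s := by
  have := M.bulk.sq_le_ham u r
  have := M.bdry.sq_le_ham u s
  have := M.bulk.ham_nonneg u r
  have := M.bdry.ham_nonneg u s
  rw [totalEnergy]
  constructor <;> linarith

/-- The quantities controlled by the dissipation. -/
lemma le_dissipation (hO : IsConvexPolyhedralDomain O) (hd : 1 ≤ d) (hM : M.IsBdryCompatible)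
    (hτ : 0 ≤ τ) {δ μ θ : Pt d → ℝ} (hδ : M.MemU δ) (hμ : M.MemU μ) (hθ : M.MemUBdry θ) (a b : ℝ) :
    normH1 O δ ^ 2 ≤ 32 * M.dissipation τ δ μ θ a b ∧
    M.normH1Bdry δ ^ 2 ≤ 32 * M.dissipation τ δ μ θ a b ∧
    a ^ 2 ≤ 32 * M.dissipation τ δ μ θ a b ∧ b ^ 2 ≤ 32 * M.dissipation τ δ μ θ a b ∧
    τ * dirichlet O μ μ ≤ 32 * M.dissipation τ δ μ θ a b ∧
    τ * (∫ x, θ x ^ 2 ∂(surf O)) ≤ 32 * M.dissipation τ δ μ θ a b := by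
  have h1 := hδ.normH1_sq_le hO
  have h2 := hδ.normH1Bdry_sq_le hO hd hM
  have h3 : dirichlet O μ μ = M.bulk.dir μ μ := M.dirichlet_eq hO hμ hμ
  have h4 : M.intIBdry (fun x => θ x ^ 2) = M.bdry.lump (fun x => θ x ^ 2) :=
    M.intIBdry_eq hO hd hM _
  have h5 := M.integral_surf_sq_le hO hd hM hθ
  rw [h4] at h5
  have h6 := mul_le_mul_of_nonneg_left h5 hτ
  have n1 := M.bulk.dir_self_nonneg δ
  have n2 := M.bdry.dir_self_nonneg δ
  have n3 := mul_nonneg hτ (M.bulk.dir_self_nonneg μ)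
  have n6 : 0 ≤ τ * M.bdry.lump fun x => θ x ^ 2 :=
    mul_nonneg hτ (M.bdry.lump_nonneg fun _ => sq_nonneg _)
  have n7 : 0 ≤ M.bdry.lump fun x => δ x ^ 2 := M.bdry.lump_nonneg fun _ => sq_nonneg _
  have n8 : 0 ≤ M.bulk.lump fun x => δ x ^ 2 := M.bulk.lump_nonneg fun _ => sq_nonneg _
  have n9 := sq_nonneg a
  have n10 := sq_nonneg b
  rw [h3, dissipation]
  refine ⟨?_, ?_, ?_, ?_, ?_, ?_⟩ <;> linarith

end Mesh

section Moments

variable {Ω : Type*} [MeasurableSpace Ω] {P : Measure Ω} {V : ℕ → Ω → ℝ} {c p : ℝ} {N : ℕ}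

lemma ofReal_rpow_le_iSup {V : ℕ → ℝ} (hc : 0 ≤ c) (hp : 0 ≤ p) (hV : ∀ m, 0 ≤ V m) {m : ℕ}
    (hm : m ≤ N) {x : ℝ} (hx0 : 0 ≤ x) (hx : x ≤ c * V m) : ENNReal.ofReal (x ^ p)
      ≤ ENNReal.ofReal (c ^ p) * ⨆ m ∈ Finset.range (N + 1), ENNReal.ofReal (V m ^ p) := by
  refine le_trans ?_ (mul_le_mul_right (le_iSup₂ (f := fun m (_ : m ∈ Finset.range (N + 1)) =>
    ENNReal.ofReal (V m ^ p)) m (Finset.mem_range.2 (Nat.lt_succ_of_le hm))) _)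
  rw [← ENNReal.ofReal_mul (Real.rpow_nonneg hc p), ← Real.mul_rpow hc (hV m)]
  exact ENNReal.ofReal_le_ofReal (Real.rpow_le_rpow hx0 hx hp)

lemma lintegral_rpow_le_iSup (hc : 0 ≤ c) (hp : 0 ≤ p) (hV : ∀ m ω, 0 ≤ V m ω) {x : Ω → ℝ}
    (hx0 : ∀ ω, 0 ≤ x ω) (hx : ∀ ω, x ω ≤ c * V N ω) :
    ∫⁻ ω, ENNReal.ofReal (x ω ^ p) ∂P ≤ ENNReal.ofReal (c ^ p)
      * ∫⁻ ω, ⨆ m ∈ Finset.range (N + 1), ENNReal.ofReal (V m ω ^ p) ∂P := by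
  rw [← lintegral_const_mul' _ _ ENNReal.ofReal_ne_top]
  exact lintegral_mono fun ω =>
    ofReal_rpow_le_iSup hc hp (fun m => hV m ω) le_rfl (hx0 ω) (hx ω)

lemma lintegral_iSup_rpow_two_mul_le (hc : 0 ≤ c) (hp : 0 ≤ p) (hV : ∀ m ω, 0 ≤ V m ω)
    {x : ℕ → Ω → ℝ} (hx0 : ∀ m ω, 0 ≤ x m ω) (hx : ∀ m ≤ N, ∀ ω, x m ω ^ 2 ≤ c * V m ω) :
    ∫⁻ ω, ⨆ m ∈ Finset.range (N + 1), ENNReal.ofReal (x m ω ^ (2 * p)) ∂P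
      ≤ ENNReal.ofReal (c ^ p)
        * ∫⁻ ω, ⨆ m ∈ Finset.range (N + 1), ENNReal.ofReal (V m ω ^ p) ∂P := by
  rw [← lintegral_const_mul' _ _ ENNReal.ofReal_ne_top]
  refine lintegral_mono fun ω => iSup₂_le fun m hm => ?_
  have hm' := Nat.lt_succ_iff.1 (Finset.mem_range.1 hm)
  rw [Real.rpow_mul (hx0 m ω), Real.rpow_two]
  exact ofReal_rpow_le_iSup hc hp (fun m => hV m ω) hm' (sq_nonneg _) (hx m hm' ω)

end Moments

section Solution

variable {d : ℕ} {O : Set (Pt d)} {M : Mesh O} {Ω : Type*} [mΩ : MeasurableSpace Ω]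
  {P : Measure Ω} {F G ϱ : ℝ → ℝ} {φ₀ : Pt d → ℝ}
  {e : HilbertBasis ℤ ℝ (Lp ℝ 2 (volume.restrict O))} {g : ℤ → Pt d → ℝ} {Z : Finset ℤ}
  {τ : ℝ} {N : ℕ} {𝓕 : Filtration ℕ mΩ} {ξ : ℕ → Ω → Lp ℝ 2 (volume.restrict O)}
  {φ μ θ : ℕ → Ω → Pt d → ℝ} {r s : ℕ → Ω → ℝ}

lemma sum_Icc_le_pathEnergy {φ μ θ : ℕ → Pt d → ℝ} {r s : ℕ → ℝ} {x : ℕ → ℝ}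
    (hx : ∀ j < N, x (j + 1) ≤ 32 * M.dissipation τ (fun y => φ (j + 1) y - φ j y) (μ (j + 1))
      (θ (j + 1)) (r (j + 1) - r j) (s (j + 1) - s j)) :
    ∑ n ∈ Finset.Icc 1 N, x n ≤ 32 * M.pathEnergy τ φ μ θ r s N := by
  refine le_trans ?_ (mul_le_mul_of_nonneg_left
    (M.sum_dissipation_le_pathEnergy φ μ θ r s N) (by norm_num))
  rw [← Finset.Ico_add_one_right_eq_Icc, Finset.sum_Ico_eq_sum_range, Finset.mul_sum,
    Nat.add_sub_cancel]
  refine Finset.sum_le_sum fun j hj => ?_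
  rw [add_comm]
  exact hx j (Finset.mem_range.1 hj)

/-- Moments of all the quantities that are controlled by the energy. -/
lemma IsDiscreteSolution.sum_lintegral_le
    (h : IsDiscreteSolution M P F G ϱ φ₀ e g Z τ N 𝓕 ξ φ μ θ r s)
    (hO : IsConvexPolyhedralDomain O) (hd : 1 ≤ d) (hM : M.IsBdryCompatible) (hτ : 0 < τ)
    {p : ℝ} (hp : 0 ≤ p) {D : ℝ} (hD : ∫⁻ ω, ⨆ m ∈ Finset.range (N + 1), ENNReal.ofReal
        (M.pathEnergy τ (fun j => φ j ω) (fun j => μ j ω) (fun j => θ j ω) (fun j => r j ω)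
          (fun j => s j ω) m ^ p) ∂P ≤ ENNReal.ofReal D) :
    (∫⁻ ω, ⨆ m ∈ Finset.range (N + 1), ENNReal.ofReal (normH1 O (φ m ω) ^ (2 * p)) ∂P)
        + (∫⁻ ω, ⨆ m ∈ Finset.range (N + 1), ENNReal.ofReal (M.normH1Bdry (φ m ω) ^ (2 * p)) ∂P)
        + (∫⁻ ω, ⨆ m ∈ Finset.range (N + 1), ENNReal.ofReal (|r m ω| ^ (2 * p)) ∂P)
        + (∫⁻ ω, ⨆ m ∈ Finset.range (N + 1), ENNReal.ofReal (|s m ω| ^ (2 * p)) ∂P)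
        + (∫⁻ ω, ENNReal.ofReal
            ((∑ n ∈ Finset.Icc 1 N, normH1 O (φ n ω - φ (n - 1) ω) ^ 2) ^ p) ∂P)
        + (∫⁻ ω, ENNReal.ofReal
            ((∑ n ∈ Finset.Icc 1 N, M.normH1Bdry (φ n ω - φ (n - 1) ω) ^ 2) ^ p) ∂P)
        + (∫⁻ ω, ENNReal.ofReal ((∑ n ∈ Finset.Icc 1 N, |r n ω - r (n - 1) ω| ^ 2) ^ p) ∂P)
        + (∫⁻ ω, ENNReal.ofReal ((∑ n ∈ Finset.Icc 1 N, |s n ω - s (n - 1) ω| ^ 2) ^ p) ∂P)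
        + (∫⁻ ω, ENNReal.ofReal ((∑ n ∈ Finset.Icc 1 N, τ * dirichlet O (μ n ω) (μ n ω)) ^ p) ∂P)
        + (∫⁻ ω, ENNReal.ofReal
            ((∑ n ∈ Finset.Icc 1 N, τ * ∫ x, θ n ω x ^ 2 ∂(surf O)) ^ p) ∂P)
      ≤ ENNReal.ofReal (10 * (32 ^ p * D)) := by
  set V : ℕ → Ω → ℝ := fun m ω => M.pathEnergy τ (fun j => φ j ω) (fun j => μ j ω)
    (fun j => θ j ω) (fun j => r j ω) (fun j => s j ω) m with hV
  have hV0 : ∀ m ω, 0 ≤ V m ω := fun m ω =>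
    zero_le_one.trans (M.one_le_pathEnergy hτ.le _ _ _ _ _ m)
  have hE : ∀ m ω, M.totalEnergy (φ m ω) (r m ω) (s m ω) ≤ V m ω := fun m ω =>
    M.totalEnergy_le_pathEnergy hτ.le (fun j => φ j ω) (fun j => μ j ω) (fun j => θ j ω)
      (fun j => r j ω) (fun j => s j ω) m
  have hE' : ∀ m ω, 32 * M.totalEnergy (φ m ω) (r m ω) (s m ω) ≤ 32 * V m ω := fun m ω =>
    mul_le_mul_of_nonneg_left (hE m ω) (by norm_num)
  have h32 : (0 : ℝ) ≤ 32 := by norm_num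
  have hX : ENNReal.ofReal (32 ^ p) * ∫⁻ ω, ⨆ m ∈ Finset.range (N + 1),
      ENNReal.ofReal (V m ω ^ p) ∂P ≤ ENNReal.ofReal (32 ^ p * D) := by
    rw [ENNReal.ofReal_mul (Real.rpow_nonneg h32 p)]
    gcongr
  have hmax : ∀ x : ℕ → Ω → ℝ, (∀ m ω, 0 ≤ x m ω) →
      (∀ m ≤ N, ∀ ω, x m ω ^ 2 ≤ 32 * M.totalEnergy (φ m ω) (r m ω) (s m ω)) →
      ∫⁻ ω, ⨆ m ∈ Finset.range (N + 1), ENNReal.ofReal (x m ω ^ (2 * p)) ∂P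
        ≤ ENNReal.ofReal (32 ^ p * D) := fun x h0 h1 =>
    (lintegral_iSup_rpow_two_mul_le h32 hp hV0 h0
      fun m hm ω => (h1 m hm ω).trans (hE' m ω)).trans hX
  have hsum : ∀ x : ℕ → Ω → ℝ, (∀ n ω, 1 ≤ n → n ≤ N → 0 ≤ x n ω) →
      (∀ ω, ∀ j < N, x (j + 1) ω ≤ 32 * M.dissipation τ (fun y => φ (j + 1) ω y - φ j ω y)
        (μ (j + 1) ω) (θ (j + 1) ω) (r (j + 1) ω - r j ω) (s (j + 1) ω - s j ω)) →
      ∫⁻ ω, ENNReal.ofReal ((∑ n ∈ Finset.Icc 1 N, x n ω) ^ p) ∂P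
        ≤ ENNReal.ofReal (32 ^ p * D) := fun x h0 h1 =>
    (lintegral_rpow_le_iSup h32 hp hV0 (fun ω => Finset.sum_nonneg fun n hn =>
      h0 n ω (Finset.mem_Icc.1 hn).1 (Finset.mem_Icc.1 hn).2) fun ω =>
      sum_Icc_le_pathEnergy (M := M) (φ := fun j => φ j ω) (μ := fun j => μ j ω)
        (θ := fun j => θ j ω) (r := fun j => r j ω) (s := fun j => s j ω)
        (x := fun n => x n ω) (h1 ω)).trans hX
  have hdis := fun ω (j : ℕ) (hj : j < N) => M.le_dissipation hO hd hM hτ.le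
    ((h.mem_phi (j + 1) hj ω).sub (h.mem_phi j hj.le ω)) (h.mem_mu (j + 1) (by omega) hj ω)
    (h.mem_theta (j + 1) (by omega) hj ω) (r (j + 1) ω - r j ω) (s (j + 1) ω - s j ω)
  have t1 := hmax (fun m ω => normH1 O (φ m ω)) (fun _ _ => Real.sqrt_nonneg _)
    fun m hm ω => (h.mem_phi m hm ω).normH1_sq_le_totalEnergy hO _ _
  have t2 := hmax (fun m ω => M.normH1Bdry (φ m ω)) (fun _ _ => Real.sqrt_nonneg _)
    fun m hm ω => (h.mem_phi m hm ω).normH1Bdry_sq_le_totalEnergy hO hd hM _ _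
  have t3 := hmax (fun m ω => |r m ω|) (fun _ _ => abs_nonneg _)
    fun m hm ω => by rw [sq_abs]; exact (Mesh.sq_le_totalEnergy _ _ _).1
  have t4 := hmax (fun m ω => |s m ω|) (fun _ _ => abs_nonneg _)
    fun m hm ω => by rw [sq_abs]; exact (Mesh.sq_le_totalEnergy _ _ _).2
  have t5 := hsum (fun n ω => normH1 O (φ n ω - φ (n - 1) ω) ^ 2) (fun _ _ _ _ => sq_nonneg _)
    fun ω j hj => (hdis ω j hj).1
  have t6 := hsum (fun n ω => M.normH1Bdry (φ n ω - φ (n - 1) ω) ^ 2)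
    (fun _ _ _ _ => sq_nonneg _) fun ω j hj => (hdis ω j hj).2.1
  have t7 := hsum (fun n ω => |r n ω - r (n - 1) ω| ^ 2) (fun _ _ _ _ => sq_nonneg _)
    fun ω j hj => by rw [sq_abs]; exact (hdis ω j hj).2.2.1
  have t8 := hsum (fun n ω => |s n ω - s (n - 1) ω| ^ 2) (fun _ _ _ _ => sq_nonneg _)
    fun ω j hj => by rw [sq_abs]; exact (hdis ω j hj).2.2.2.1
  have t9 := hsum (fun n ω => τ * dirichlet O (μ n ω) (μ n ω))
    (fun _ _ _ _ => mul_nonneg hτ.le (integral_nonneg fun _ => real_inner_self_nonneg))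
    fun ω j hj => (hdis ω j hj).2.2.2.2.1
  have t10 := hsum (fun n ω => τ * ∫ x, θ n ω x ^ 2 ∂(surf O))
    (fun _ _ _ _ => mul_nonneg hτ.le (integral_nonneg fun _ => sq_nonneg _))
    fun ω j hj => (hdis ω j hj).2.2.2.2.2
  rw [ENNReal.ofReal_mul (by norm_num), show ENNReal.ofReal 10 = 10 by simp]
  refine (add_le_add (add_le_add (add_le_add (add_le_add (add_le_add (add_le_add (add_le_add
    (add_le_add (add_le_add t1 t2) t3) t4) t5) t6) t7) t8) t9) t10).trans (le_of_eq ?_)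
  ring

end Solution
end SAV

/-! ### Choice of the constants and conclusion. -/

theorem lemma6p1 {d : ℕ} (hd : d = 2 ∨ d = 3) (O : Set (SAV.Pt d))
    (hO : SAV.IsConvexPolyhedralDomain O)
    (F G : ℝ → ℝ) (hF : SAV.IsPotential F) (hG : SAV.IsPotential G)
    (ϱ : ℝ → ℝ) (hϱ : SAV.IsNoiseCoefficient ϱ)
    (φ₀ : SAV.Pt d → ℝ) (hφ₀ : SAV.IsInitialDatum O φ₀)
    (T : ℝ) (hT : 0 < T) (κ : ℝ) (hκ : 0 < κ) (Ccol : ℝ) (Cmom : ℕ → ℝ)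
    (p : ℝ) (hp : 1 ≤ p) :
    ∃ C : ℝ, 0 < C ∧
      ∀ (h : ℝ), 0 < h →
      ∀ (M : SAV.Mesh O), M.IsQuasiuniform κ h → M.IsBdryCompatible →
      ∀ (N : ℕ) (τ : ℝ), 0 < N → τ = T / N → τ < 1 →
      ∀ (e : HilbertBasis ℤ ℝ (Lp ℝ 2 (volume.restrict O))) (g : ℤ → SAV.Pt d → ℝ) (lam : ℤ → ℝ),
        SAV.IsColored O Ccol e g lam →
      ∀ (Z : Finset ℤ) (Ω : Type*) [mΩ : MeasurableSpace Ω] (P : Measure Ω) [IsProbabilityMeasure P]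
        (𝓕 : Filtration ℕ mΩ) (ξ : ℕ → Ω → Lp ℝ 2 (volume.restrict O)),
        SAV.IsNoise P e lam Cmom τ N 𝓕 ξ →
      ∀ (φ μ θ : ℕ → Ω → SAV.Pt d → ℝ) (r s : ℕ → Ω → ℝ),
        SAV.IsDiscreteSolution M P F G ϱ φ₀ e g Z τ N 𝓕 ξ φ μ θ r s →
        (∫⁻ ω, ⨆ m ∈ Finset.range (N + 1), ENNReal.ofReal (SAV.normH1 O (φ m ω) ^ (2 * p)) ∂P)
        + (∫⁻ ω, ⨆ m ∈ Finset.range (N + 1), ENNReal.ofReal (M.normH1Bdry (φ m ω) ^ (2 * p)) ∂P)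
        + (∫⁻ ω, ⨆ m ∈ Finset.range (N + 1), ENNReal.ofReal (|r m ω| ^ (2 * p)) ∂P)
        + (∫⁻ ω, ⨆ m ∈ Finset.range (N + 1), ENNReal.ofReal (|s m ω| ^ (2 * p)) ∂P)
        + (∫⁻ ω, ENNReal.ofReal
            ((∑ n ∈ Finset.Icc 1 N, SAV.normH1 O (φ n ω - φ (n - 1) ω) ^ 2) ^ p) ∂P)
        + (∫⁻ ω, ENNReal.ofReal
            ((∑ n ∈ Finset.Icc 1 N, M.normH1Bdry (φ n ω - φ (n - 1) ω) ^ 2) ^ p) ∂P)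
        + (∫⁻ ω, ENNReal.ofReal ((∑ n ∈ Finset.Icc 1 N, |r n ω - r (n - 1) ω| ^ 2) ^ p) ∂P)
        + (∫⁻ ω, ENNReal.ofReal ((∑ n ∈ Finset.Icc 1 N, |s n ω - s (n - 1) ω| ^ 2) ^ p) ∂P)
        + (∫⁻ ω, ENNReal.ofReal ((∑ n ∈ Finset.Icc 1 N, τ * SAV.dirichlet O (μ n ω) (μ n ω)) ^ p) ∂P)
        + (∫⁻ ω, ENNReal.ofReal
            ((∑ n ∈ Finset.Icc 1 N, τ * ∫ x, θ n ω x ^ 2 ∂(SAV.surf O)) ^ p) ∂P)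
        ≤ ENNReal.ofReal C := by
  have hd1 : 1 ≤ d := by omega
  have hd3 : d ≤ 3 := by omega
  obtain ⟨KF, hKF, hF0, hF1, hF2, hF3, hF4⟩ := hF.bounds
  obtain ⟨KG, hKG, hG0, hG1, hG2, hG3, hG4⟩ := hG.bounds
  obtain ⟨K₂, hK₂, hmode⟩ := SAV.exists_mode_bound (d := d) hϱ hκ
  have hK : 0 < KF + KG := add_pos hKF hKG
  have hFK : KF ≤ KF + KG := le_add_of_nonneg_right hKG.le
  have hGK : KG ≤ KF + KG := le_add_of_nonneg_left hKF.le
  have hq4 : ∀ z : ℝ, 0 ≤ 1 + z ^ 4 := fun z => by positivity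
  obtain ⟨C₀, hC₀⟩ := SAV.Mesh.exists_initial_energy_le hO hd1 hd3 hφ₀ hκ hK hF0 hG0
    (fun z => (hF4 z).trans (mul_le_mul_of_nonneg_right hFK (hq4 z)))
    (fun z => (hG4 z).trans (mul_le_mul_of_nonneg_right hGK (hq4 z)))
  -- An integer exponent above `p`; the one-step estimate is then used with the even exponent `2 *
  -- q`.
  set q := ⌈p⌉₊ with hq
  have hq1 : 1 ≤ q := Nat.one_le_ceil_iff.2 (by linarith)
  -- The mesh enters the rate only through total volume and total area, which are those of `O` and
  -- `Γ`.
  set ρ := SAV.growthRate Cmom (SAV.noiseRate (KF + KG) K₂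
    ((volume : Measure (SAV.Pt d)).real O + (SAV.surf O).real Set.univ) (max Ccol 0)) (2 * q)
    with hρ
  have hD : 0 < 1 + Real.exp (ρ * T) * C₀ ^ (2 * q) := by
    have : 0 ≤ C₀ ^ (2 * q) := (even_two_mul q).pow_nonneg _
    positivity
  -- Ten quantities, each at most 32 times the energy before the power `p` is taken; the rest bounds
  -- the moment of the maximal energy, with `τ * N = T` in the exponential.
  refine ⟨10 * (32 ^ p * (1 + Real.exp (ρ * T) * C₀ ^ (2 * q))), by positivity, ?_⟩
  intro h hh M hq' hM N τ hN hτT hτ1 e g lam hcol Z Ω mΩ P _ 𝓕 ξ hξ φ μ θ r s hsol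
  have hN' : (0 : ℝ) < N := by exact_mod_cast hN
  have hτ : 0 < τ := hτT ▸ div_pos hT hN'
  have hτN : τ * N = T := by rw [hτT]; exact div_mul_cancel₀ T hN'.ne'
  obtain ⟨hfin, hsum⟩ := hcol.sum_le
  refine hsol.sum_lintegral_le hO hd1 hM hτ (by linarith) ?_
  rw [← hτN]
  refine hsol.lintegral_iSup_pathEnergy_le hτ (SAV.growthRate_nonneg _ ?_ _) (fun n hn A hA =>
    hsol.lintegral_pathEnergy_succ_le hO hd1 hM hξ hτ hτ1 hK hK₂ hF.1.continuous.measurable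
      hG.1.continuous.measurable hϱ.2.choose_spec.continuous.measurable hF0 ?_ ?_ ?_ hG0 ?_ ?_ ?_
      hsum ?_ (even_two_mul q) (by omega) hn hA) (hC₀ h hh M hq' hM) (Nat.le_ceil p)
  · have : 0 ≤ (volume : Measure (SAV.Pt d)).real O + (SAV.surf O).real Set.univ := by positivity
    rw [SAV.noiseRate]
    positivity
  · intro z
    refine (hF1 z).trans ?_
    have := hF0 z
    gcongr
  · intro z
    exact (hF2 z).trans (mul_le_mul_of_nonneg_right hFK (hF0 z).le)
  · intro z
    exact (hF3 z).trans (mul_le_mul_of_nonneg_right hFK (hF0 z).le)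
  · intro z
    refine (hG1 z).trans ?_
    have := hG0 z
    gcongr
  · intro z
    exact (hG2 z).trans (mul_le_mul_of_nonneg_right hGK (hG0 z).le)
  · intro z
    exact (hG3 z).trans (mul_le_mul_of_nonneg_right hGK (hG0 z).le)
  · intro k hk f hf
    obtain ⟨b1, b2⟩ := SAV.abs_le_w2InfNorm hO (hcol.cont k hk) (hfin k hk)
    obtain ⟨m1, m2⟩ := hmode O M h hh hq' f (g k) _ hf b1 b2
    exact M.isMode m1 m2
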